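/- **Setting.** Let $d\ge 2$, let $E\in\{\mathbb Z,\mathbb R\}$ with Borel $\sigma$-algebra $\mathcal E$ and reference measure $\lambda$ (counting, resp. Lebesgue measure), let $\Omega=E^{\mathbb Z^d}$, and let $\mathcal L\subset\mathbb Z^d$ be a full-rank sublattice. For $x\in\mathcal L$ put $\theta_x y=y+x$ and $(\theta_x\phi)(y)=\phi(y+x)$; $\Theta=\{\theta_x:x\in\mathcal L\}$. Let $\mathcal F$ be the product $\sigma$-algebra on $\Omega$, $\mathcal F^\nabla=\sigma(\phi(y)-\phi(x):x,y\in\mathbb Z^d)$, $\mathcal F^\nabla_\Lambda=\sigma(\phi(y)-\phi(x):x,y\in\Lambda)$, $\mathcal T^\nabla_\Lambda=\sigma(\phi(x):x\notin\Lambda)\cap\mathcal F^\nabla$. Let $\pi_\Lambda$ denote restriction to $\Lambda$, let $d_1$ be the graph distance of the square lattice, $\Pi_n=[0,n)^d\cap\mathbb Z^d$, and write $\Lambda\subset\subset\mathbb Z^d$ if $\Lambda$ is a finite subset. $\mathcal P_{\mathcal L}(\Omega,\mathcal F^\nabla)$ is the set of $\mathcal L$-invariant probability measures on $(\Omega,\mathcal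 F^\nabla)$. **Potentials.** A periodic gradient potential is a family $\Phi=(\Phi_\Lambda)_{\Lambda\subset\subset\mathbb Z^d}$ of $\mathcal F^\nabla_\Lambda$-measurable functions $\Phi_\Lambda:\Omega\to\mathbb R\cup\{\infty\}$ with $\Phi_\Lambda\equiv0$ if $|\Lambda|\le 1$ and $\Phi_{\theta\Lambda}(\phi)=\Phi_\Lambda(\theta\phi)$ for $\theta\in\Theta$. Put $H_{\Lambda,\Delta}=\sum\Phi_\Gamma$ over the finite $\Gamma\subset\Delta$ that intersect $\Lambda$, $H_\Lambda=H_{\Lambda,\mathbb Z^d}$, $H^0_\Lambda=H_{\Lambda,\Lambda}$. An admissible graph is an $\mathcal L$-invariant connected graph $\mathbb A$ of bounded degree on $\mathbb Z^d$. An admissible quasimetric is a $\Theta$-invariant $q:\mathbb Z^d\times\mathbb Z^d\to\mathbb R$ with $q(x,x)=0$, $q(x,y)+q(y,x)>0$ for $x\ne y$, and the triangle inequality. A local Lipschitz constraint is a pair $(\mathbb A,q)$ of such objects such that $p\le q$ for every admissible quasimetric $p$ with $p\le q$ on the edges of $\mathbb A$; and $q_\varepsilon$ is the largest admissible quasimetric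 with $q_\varepsilon\le q-\varepsilon$ on the edges of $\mathbb A$ (it exists for small $\varepsilon>0$). A strong interaction ($\Psi\in\mathcal S_{\mathcal L}$) is a periodic gradient potential $\Psi\ge0$ of finite range ($\Psi_\Lambda\equiv0$ if the $d_1$-diameter of $\Lambda$ exceeds some constant) for which there is a local Lipschitz constraint $(\mathbb A,q)$ with: $\Psi_\Lambda(\phi)=\infty$ if and only if $\Lambda=\{x,y\}\in\mathbb A$ and $\phi(y)-\phi(x)>q(x,y)$ for some $x,y$; if $E=\mathbb Z$, $q$ is integer-valued; if $E=\mathbb R$, for every sufficiently small $\varepsilon>0$ there is $C_\varepsilon<\infty$ with $H^\Psi_{\{x\}}(\phi)\le C_\varepsilon$ for all $x$ and all $\phi\in\Omega$ that satisfy the $q_\varepsilon$-Lipschitz inequality on every edge of $\mathbb A$ containing $x$. A weak interaction ($\Xi\in\mathcal W_{\mathcal L}$) is a periodic gradient potential with $\sup_{x,\phi}\sum_{\Lambda\ni x}|\Xi_\Lambda(\phi)|<\infty$ for which $e^-(\Lambda):=\sup_\phi\sum|\Xi_\Delta(\phi)|$, the sum being over the finite $\Delta$ that intersect both $\Lambda$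 and $\mathbb Z^d\smallsetminus\Lambda$, is amenable: it is finite, $\Theta$-invariant, subadditive over disjoint finite sets, and $e^-(\Lambda_n)=o(|\Lambda_n|)$ along every sequence of finite sets with $|\Lambda_n|\to\infty$ and $|\partial\Lambda_n|/|\Lambda_n|\to0$ (here $\partial\Lambda$ is the set of vertices adjacent to $\Lambda$ in the square lattice). **Specification.** Let $\Phi=\Psi+\Xi$ with $\Psi\in\mathcal S_{\mathcal L}$, $\Xi\in\mathcal W_{\mathcal L}$. Put $Z_\Lambda(\phi)=\int_{E^\Lambda}e^{-H_\Lambda(\psi\phi_{\mathbb Z^d\smallsetminus\Lambda})}d\lambda^\Lambda(\psi)$, where $\psi\phi_{\mathbb Z^d\smallsetminus\Lambda}$ equals $\psi$ on $\Lambda$ and $\phi$ off $\Lambda$. Call $\phi$ admissible if $\Phi_\Lambda(\phi)<\infty$ and $Z_\Lambda(\phi)\in(0,\infty)$ for all $\Lambda\subset\subset\mathbb Z^d$; for such $\phi$, let $\gamma_\Lambda(A,\phi)=Z_\Lambda(\phi)^{-1}\int_{E^\Lambda}1_A(\psi\phi_{\mathbb Z^d\smallsetminus\Lambda})e^{-H_\Lambda(\psi\phi_{\mathbb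 Z^d\smallsetminus\Lambda})}d\lambda^\Lambda(\psi)$. **Minimizers.** For $\mu\in\mathcal P_{\mathcal L}(\Omega,\mathcal F^\nabla)$ let $\mathcal H_\Lambda(\mu|\Phi)$ be the relative entropy on $\mathcal F^\nabla_\Lambda$ of $\mu$ with respect to $e^{-H^0_\Lambda}\lambda^{\Lambda-1}$, where $\lambda^{\Lambda-1}$ is the measure on $\mathcal F^\nabla_\Lambda$ whose image under $\phi\mapsto(\phi(y)-\phi(x))_{y\in\Lambda\smallsetminus\{x\}}$ is $\lambda^{\Lambda\smallsetminus\{x\}}$ (for any fixed $x\in\Lambda$). Here the relative entropy of $\mu$ with respect to $\nu$ is $\int\log\frac{d\mu}{d\nu}\,d\mu$ if $\mu\ll\nu$ and $\infty$ otherwise, with $\infty-\infty=\infty$. Let $\mathcal H(\mu|\Phi)=\lim_n n^{-d}\mathcal H_{\Pi_n}(\mu|\Phi)$. If all $\phi(y)-\phi(x)$ are $\mu$-integrable, the slope $S(\mu)$ is the linear functional $u$ on $\mathbb R^d$ with $u(x)=\int(\phi(x)-\phi(0))\,d\mu$ for $x\in\mathcal L$. Let $\sigma(u)=\inf\{\mathcal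 H(\nu|\Phi):\nu\in\mathcal P_{\mathcal L}(\Omega,\mathcal F^\nabla),\,S(\nu)=u\}$. Call $\mu\in\mathcal P_{\mathcal L}(\Omega,\mathcal F^\nabla)$ a minimizer if it has a slope and $\mathcal H(\mu|\Phi)=\sigma(S(\mu))<\infty$. **Limiting local Gibbs measures.** For $\Lambda\subset\Delta\subset\subset\mathbb Z^d$ and $\phi\in\Omega$, let $\mathcal A_{\Lambda,\Delta,\phi}$ be the set of probability measures $\nu\gamma_\Lambda\pi_\Lambda$ on $E^\Lambda$, with $\nu$ any probability measure on $(\Omega,\mathcal F)$ supported on admissible height functions with $\nu\pi_\Delta=\delta_{\phi_\Delta}$. Let $\mathcal A_{\Lambda,\phi}$ be the intersection over all finite $\Delta\supset\Lambda$ of the closures of $\mathcal A_{\Lambda,\Delta,\phi}$ in the strong topology (the coarsest one making $\rho\mapsto\rho(A)$ continuous for each measurable $A$). Let $\Omega_\gamma$ be the set of admissible $\phi$ with $\mathcal A_{\Lambda,\phi}=\{\gamma_\Lambda(\cdot,\phi)\pi_\Lambda\}$ for all $\Lambda\subset\subset\mathbb Z^d$. A probability measure $\mu$ on $(\Omega,\mathcal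 F^\nabla)$ is an almost Gibbs measure if $\mu(\Omega_\gamma)=1$ and $\mu=\mu\gamma_\Lambda$ on $\mathcal F^\nabla$ for all $\Lambda\subset\subset\mathbb Z^d$; it is then called a Gibbs measure if moreover $\Omega_\gamma$ contains every admissible height function. **Theorem.** Let $\Phi\in\mathcal S_{\mathcal L}+\mathcal W_{\mathcal L}$ and let $\mu\in\mathcal P_{\mathcal L}(\Omega,\mathcal F^\nabla)$ be a minimizer. 1. Let $\Lambda\subset\subset\mathbb Z^d$, and let $\phi\mapsto\mu^\phi$ be the regular conditional probability distribution of $\mu$ on $(\Omega,\mathcal F)$ given the values of the height function off $\Lambda$: each $\mu^\phi$ is a probability measure on $(\Omega,\mathcal F)$ carried by the height functions equal to $\phi$ off $\Lambda$, and for each $A\in\mathcal F^\nabla$, $\phi\mapsto\mu^\phi(A)$ is a version of $\mu(A|\mathcal T^\nabla_\Lambda)$. Such a family exists, and for every such family, $\mu^\phi\pi_\Lambda\in\mathcal A_{\Lambda,\phi}$ for $\mu$-almost every $\phi$. 2. If $\mu(\Omega_\gamma)=1$, then $\mu$ is an almost Gibbs measure. 3. If $\Omega_\gamma$ contains every admissible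 height function, then $\mu$ is a Gibbs measure. -/

import Mathlib

open MeasureTheory Filter Topology
open scoped ENNReal

/-! ### Sites, heights, height functions -/

/-- The vertices of the square lattice `ℤ^d`. -/
abbrev Site (d : ℕ) : Type := Fin d → ℤ

/-- The two cases `E = ℤ` and `E = ℝ` for the space of heights. -/
inductive HeightKind : Type
  | int : HeightKind
  | real : HeightKind

namespace HeightKind

/-- The space `E` of heights. -/
def E : HeightKind → Type
  | .int => ℤ
  | .real => ℝ

instance instAddCommGroup : (k : HeightKind) → AddCommGroup k.E
  | .int => inferInstanceAs (AddCommGroup ℤ)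
  | .real => inferInstanceAs (AddCommGroup ℝ)

/-- The Borel σ-algebra on `E`. -/
instance instMeasurableSpace : (k : HeightKind) → MeasurableSpace k.E
  | .int => inferInstanceAs (MeasurableSpace ℤ)
  | .real => inferInstanceAs (MeasurableSpace ℝ)

/-- The reference measure `λ` on `E`: counting measure on `ℤ`, Lebesgue measure on `ℝ`. -/
noncomputable def ref : (k : HeightKind) → Measure k.E
  | .int => (Measure.count : Measure ℤ)
  | .real => (volume : Measure ℝ)

/-- A height as a real number. -/
noncomputable def val : (k : HeightKind) → k.E → ℝ
  | .int => fun n : ℤ => (n : ℝ)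
  | .real => fun t : ℝ => t

end HeightKind

/-- The set `Ω` of height functions. Its canonical σ-algebra (the product one) is `F`. -/
abbrev HeightFn (d : ℕ) (k : HeightKind) : Type := Site d → k.E

section Lattice

variable {d : ℕ}

/-- The graph distance `d₁` on the square lattice. -/
def dist1 (x y : Site d) : ℕ := ∑ i, (x i - y i).natAbs

/-- The box `Π_n = [0, n)^d`. -/
noncomputable def box (d n : ℕ) : Finset (Site d) := Fintype.piFinset fun _ => Finset.Ico (0 : ℤ) n

/-- The translate `Λ + v`. -/
def translateSet (v : Site d) (Λ : Finset (Site d)) : Finset (Site d) :=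
  Λ.map (addRightEmbedding v)

/-- The vertices adjacent to `Λ` in the square lattice. -/
def outerBoundary (Λ : Finset (Site d)) : Set (Site d) :=
  {x | x ∉ Λ ∧ ∃ y ∈ Λ, dist1 x y = 1}

/-- Van Hove sequences of finite sets of vertices. -/
def IsVanHove (Λ : ℕ → Finset (Site d)) : Prop :=
  Tendsto (fun n => (Λ n).card) atTop atTop ∧
    Tendsto (fun n => ((outerBoundary (Λ n)).ncard : ℝ) / ((Λ n).card : ℝ)) atTop (𝓝 0)

end Lattice

/-! ### σ-algebras, gradient measures, slope -/

section Sigma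

variable (d : ℕ) (k : HeightKind)

/-- `F^∇`, generated by all height differences. -/
@[reducible] def gradSigma : MeasurableSpace (HeightFn d k) :=
  ⨆ (x : Site d) (y : Site d), MeasurableSpace.comap (fun φ : HeightFn d k => φ y - φ x) inferInstance

variable {d}

/-- `F^∇_Λ`, generated by the height differences within `Λ`. -/
@[reducible] def gradSigmaOn (Λ : Set (Site d)) : MeasurableSpace (HeightFn d k) :=
  ⨆ (x ∈ Λ) (y ∈ Λ), MeasurableSpace.comap (fun φ : HeightFn d k => φ y - φ x) inferInstance

/-- `T_Λ`, generated by the heights outside `Λ`. -/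
@[reducible] def extSigma (Λ : Finset (Site d)) : MeasurableSpace (HeightFn d k) :=
  ⨆ (x : Site d) (_ : x ∉ Λ), MeasurableSpace.comap (fun φ : HeightFn d k => φ x) inferInstance

/-- `T^∇_Λ = T_Λ ∩ F^∇`. -/
@[reducible] def extGradSigma (Λ : Finset (Site d)) : MeasurableSpace (HeightFn d k) :=
  extSigma k Λ ⊓ gradSigma d k

variable {k}

/-- `(θ_v φ)(x) = φ(x + v)`. -/
def shift (v : Site d) (φ : HeightFn d k) : HeightFn d k := fun x => φ (x + v)

/-- `φ ↦ ψ φ_{ℤ^d ∖ Λ}`: the function equal to `ψ` on `Λ` and to `φ` off `Λ`. -/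
def patch (Λ : Finset (Site d)) (φ : HeightFn d k) (ψ : Λ → k.E) : HeightFn d k :=
  fun x => if h : x ∈ Λ then ψ ⟨x, h⟩ else φ x

/-- `P_L(Ω, F^∇)`: the `L`-invariant gradient probability measures. -/
structure IsInvariantGradientMeasure (L : AddSubgroup (Site d))
    (μ : Measure[gradSigma d k] (HeightFn d k)) : Prop where
  prob : IsProbabilityMeasure μ
  invariant : ∀ v ∈ L, ∀ A : Set (HeightFn d k), MeasurableSet[gradSigma d k] A →
    μ (shift v ⁻¹' A) = μ A

/-- `μ` has finite slope, and its slope `S(μ)` is the linear functional `u`. -/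
def HasSlope (L : AddSubgroup (Site d)) (μ : Measure[gradSigma d k] (HeightFn d k))
    (u : (Fin d → ℝ) →ₗ[ℝ] ℝ) : Prop :=
  (∀ x y : Site d, Integrable (fun φ : HeightFn d k => k.val (φ y - φ x)) μ) ∧
    ∀ x ∈ L, u (fun i => (x i : ℝ)) = ∫ φ, k.val (φ x - φ 0) ∂μ

/-- `κ` is (a version of) the regular conditional probability distribution `φ ↦ μ^φ` on `(Ω, F)`
of the gradient measure `μ`, given the values of the height function off `Λ`. The law `κ φ` is
carried by the height functions equal to `φ` off `Λ`, and on gradient events it is a version of the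
conditional probability of `μ` given `T^∇_Λ`. For finite `Λ` this determines `κ φ` on all of `F`,
for `μ`-almost every `φ`, since heights are determined by height differences and one value of `φ`
off `Λ`. -/
structure IsCondDistrib (Λ : Finset (Site d)) (μ : Measure[gradSigma d k] (HeightFn d k))
    (κ : HeightFn d k → Measure (HeightFn d k)) : Prop where
  prob : ∀ φ, IsProbabilityMeasure (κ φ)
  proper : ∀ φ, ∀ᵐ ψ ∂(κ φ), ∀ x, x ∉ Λ → ψ x = φ x
  measurable : ∀ A : Set (HeightFn d k), MeasurableSet[gradSigma d k] A →
    Measurable[extGradSigma k Λ] fun φ => κ φ A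
  cond : ∀ A B : Set (HeightFn d k), MeasurableSet[gradSigma d k] A →
    MeasurableSet[extGradSigma k Λ] B → ∫⁻ φ in B, κ φ A ∂μ = μ (A ∩ B)

end Sigma

/-! ### Potentials, Hamiltonians, local Gibbs measures -/

/-- A family of functions indexed by the finite sets of vertices; the value `∞` is `⊤`. -/
abbrev Potential (d : ℕ) (k : HeightKind) : Type := Finset (Site d) → HeightFn d k → EReal

section Potentials

variable {d : ℕ} {k : HeightKind}

/-- `L`-invariant gradient potentials, with values in `ℝ ∪ {∞}`, and with the convention that the
potential functions of singletons and of the empty set vanish. -/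
structure IsPeriodicGradient (L : AddSubgroup (Site d)) (Φ : Potential d k) : Prop where
  ne_bot : ∀ Λ φ, Φ Λ φ ≠ ⊥
  measurable : ∀ Λ : Finset (Site d), Measurable[gradSigmaOn k (Λ : Set (Site d))] (Φ Λ)
  trivial_zero : ∀ Λ, Λ.card ≤ 1 → ∀ φ, Φ Λ φ = 0
  periodic : ∀ v ∈ L, ∀ Λ φ, Φ (translateSet v Λ) φ = Φ Λ (shift v φ)

/-- `H_{Λ,Δ}`, the sum of all `Φ_Γ` with `Γ ⊆ Δ` finite and intersecting `Λ`. -/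
noncomputable def hamiltonianIn (Φ : Potential d k) (Λ : Finset (Site d)) (Δ : Set (Site d))
    (φ : HeightFn d k) : EReal :=
  ∑' Γ : {Γ : Finset (Site d) // (Γ : Set (Site d)) ⊆ Δ ∧ ∃ x ∈ Γ, x ∈ Λ}, Φ Γ.1 φ

/-- The Hamiltonian `H_Λ = H_{Λ, ℤ^d}`. -/
noncomputable def hamiltonian (Φ : Potential d k) (Λ : Finset (Site d)) (φ : HeightFn d k) :
    EReal :=
  hamiltonianIn Φ Λ Set.univ φ

/-- The interior Hamiltonian `H⁰_Λ = H_{Λ, Λ}`. -/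
noncomputable def interiorHamiltonian (Φ : Potential d k) (Λ : Finset (Site d))
    (φ : HeightFn d k) : EReal :=
  hamiltonianIn Φ Λ (Λ : Set (Site d)) φ

/-- The partition function `Z_Λ(φ)`. -/
noncomputable def partitionFn (Φ : Potential d k) (Λ : Finset (Site d)) (φ : HeightFn d k) :
    ℝ≥0∞ :=
  ∫⁻ ψ : Λ → k.E, EReal.exp (-hamiltonian Φ Λ (patch Λ φ ψ)) ∂(Measure.pi fun _ => k.ref)

/-- The local Gibbs measure `γ_Λ(·, φ)` on `(Ω, F)`; it is only used for `φ` admissible. -/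
noncomputable def localGibbs (Φ : Potential d k) (Λ : Finset (Site d)) (φ : HeightFn d k) :
    Measure (HeightFn d k) :=
  (partitionFn Φ Λ φ)⁻¹ •
    (((Measure.pi fun _ : Λ => k.ref).withDensity fun ψ =>
      EReal.exp (-hamiltonian Φ Λ (patch Λ φ ψ))).map (patch Λ φ))

/-- Admissible height functions: those of finite energy for which every local Gibbs measure is
well-defined. -/
def Admissible (Φ : Potential d k) (φ : HeightFn d k) : Prop :=
  (∀ Λ, Φ Λ φ < ⊤) ∧ ∀ Λ, 0 < partitionFn Φ Λ φ ∧ partitionFn Φ Λ φ < ⊤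

/-! ### Local Lipschitz constraints and strong interactions -/

/-- Admissible graphs: `L`-invariant, connected, of bounded degree. -/
structure IsAdmissibleGraph (L : AddSubgroup (Site d)) (A : SimpleGraph (Site d)) : Prop where
  invariant : ∀ v ∈ L, ∀ x y, A.Adj (x + v) (y + v) ↔ A.Adj x y
  connected : A.Connected
  bounded_degree : ∃ D : ℕ, ∀ x, (A.neighborSet x).encard ≤ D

/-- Admissible quasimetrics. -/
structure IsAdmissibleQuasimetric (L : AddSubgroup (Site d)) (q : Site d → Site d → ℝ) :
    Prop where
  self : ∀ x, q x x = 0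
  pos : ∀ x y, x ≠ y → 0 < q x y + q y x
  triangle : ∀ x y z, q x z ≤ q x y + q y z
  invariant : ∀ v ∈ L, ∀ x y, q (x + v) (y + v) = q x y

/-- Local Lipschitz constraints `(A, q)`. -/
structure IsLocalLipschitzConstraint (L : AddSubgroup (Site d)) (A : SimpleGraph (Site d))
    (q : Site d → Site d → ℝ) : Prop where
  graph : IsAdmissibleGraph L A
  quasimetric : IsAdmissibleQuasimetric L q
  maximal : ∀ p : Site d → Site d → ℝ, IsAdmissibleQuasimetric L p →
    (∀ x y, A.Adj x y → p x y ≤ q x y) → ∀ x y, p x y ≤ q x y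

/-- `p = q_ε`: the largest admissible quasimetric that is at most `q - ε` on the edges of `A`. -/
def IsShrunkQuasimetric (L : AddSubgroup (Site d)) (A : SimpleGraph (Site d))
    (q : Site d → Site d → ℝ) (ε : ℝ) (p : Site d → Site d → ℝ) : Prop :=
  IsGreatest {p : Site d → Site d → ℝ | IsAdmissibleQuasimetric L p ∧
    ∀ x y, A.Adj x y → p x y ≤ q x y - ε} p

/-- `φ` is `p`-Lipschitz at `z`, with respect to the edges of `A` that contain `z`. -/
def IsLipschitzAt (A : SimpleGraph (Site d)) (p : Site d → Site d → ℝ) (z : Site d)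
    (φ : HeightFn d k) : Prop :=
  ∀ x y, A.Adj x y → (x = z ∨ y = z) → k.val (φ y - φ x) ≤ p x y

/-- The potential `Ψ` is Lipschitz with constraint `(A, q)`. -/
def IsLipschitzPotential (Ψ : Potential d k) (A : SimpleGraph (Site d))
    (q : Site d → Site d → ℝ) : Prop :=
  ∀ Λ φ, Ψ Λ φ = ⊤ ↔
    ∃ x y, Λ = {x, y} ∧ A.Adj x y ∧ q x y < k.val (φ y - φ x)

/-- For every sufficiently small `ε > 0`, the Hamiltonians of the single vertices `x` are bounded,
uniformly over `x` and over the height functions that are `q_ε`-Lipschitz at `x`. -/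
def IsLocallyBounded (L : AddSubgroup (Site d)) (Ψ : Potential d k) (A : SimpleGraph (Site d))
    (q : Site d → Site d → ℝ) : Prop :=
  ∃ ε₀ : ℝ, 0 < ε₀ ∧ ∀ ε, 0 < ε → ε < ε₀ → ∀ p, IsShrunkQuasimetric L A q ε p →
    ∃ C : ℝ, ∀ (x : Site d) (φ : HeightFn d k), IsLipschitzAt A p x φ →
      hamiltonian Ψ {x} φ ≤ (C : EReal)

/-- Strong interactions `S_L`; if `E = ℤ` then the quasimetric is integral. -/
structure IsStrongInteraction (L : AddSubgroup (Site d)) (Ψ : Potential d k) : Prop where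
  periodicGradient : IsPeriodicGradient L Ψ
  nonneg : ∀ Λ φ, 0 ≤ Ψ Λ φ
  finite_range : ∃ R : ℕ, ∀ Λ : Finset (Site d), (∃ x ∈ Λ, ∃ y ∈ Λ, R < dist1 x y) →
    ∀ φ, Ψ Λ φ = 0
  lipschitz : ∃ (A : SimpleGraph (Site d)) (q : Site d → Site d → ℝ),
    IsLocalLipschitzConstraint L A q ∧ IsLipschitzPotential Ψ A q ∧
    (k = HeightKind.int → ∀ x y, ∃ m : ℤ, q x y = m) ∧
    (k = HeightKind.real → IsLocallyBounded L Ψ A q)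

/-! ### Weak interactions -/

/-- The norm `‖Ξ‖`. -/
noncomputable def potentialNorm (Ξ : Potential d k) : ℝ≥0∞ :=
  ⨆ (x : Site d) (φ : HeightFn d k), ∑' Λ : {Λ : Finset (Site d) // x ∈ Λ}, (Ξ Λ.1 φ).abs

/-- The lower exterior bound `e⁻(Λ)`. -/
noncomputable def lowerExteriorBound (Ξ : Potential d k) (Λ : Finset (Site d)) : ℝ≥0∞ :=
  ⨆ φ : HeightFn d k,
    ∑' Δ : {Δ : Finset (Site d) // (∃ x ∈ Δ, x ∈ Λ) ∧ ∃ x ∈ Δ, x ∉ Λ}, (Ξ Δ.1 φ).abs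

/-- Amenable functions; in particular they take values in `[0, ∞)`. -/
structure IsAmenable (L : AddSubgroup (Site d)) (f : Finset (Site d) → ℝ≥0∞) : Prop where
  finite : ∀ Λ, f Λ < ⊤
  invariant : ∀ v ∈ L, ∀ Λ, f (translateSet v Λ) = f Λ
  subadditive : ∀ Λ Δ, Disjoint Λ Δ → f (Λ ∪ Δ) ≤ f Λ + f Δ
  sublinear : ∀ Λ : ℕ → Finset (Site d), IsVanHove Λ →
    Tendsto (fun n => f (Λ n) / ((Λ n).card : ℝ≥0∞)) atTop (𝓝 0)

/-- Weak interactions `W_L`. -/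
structure IsWeakInteraction (L : AddSubgroup (Site d)) (Ξ : Potential d k) : Prop where
  periodicGradient : IsPeriodicGradient L Ξ
  summable : potentialNorm Ξ < ⊤
  amenable : IsAmenable L (lowerExteriorBound Ξ)

/-- `Φ ∈ S_L + W_L`. -/
def IsStrongPlusWeak (L : AddSubgroup (Site d)) (Φ : Potential d k) : Prop :=
  ∃ Ψ Ξ : Potential d k, IsStrongInteraction L Ψ ∧ IsWeakInteraction L Ξ ∧
    ∀ Λ φ, Φ Λ φ = Ψ Λ φ + Ξ Λ φ

end Potentials

/-! ### Free energy, specific free energy, surface tension, minimizers -/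

open Classical in
/-- The relative entropy `H(μ|ν) = μ(log dμ/dν)` of a probability measure `μ` with respect to a
σ-finite measure `ν`, with the convention `∞ - ∞ = ∞`. -/
noncomputable def relEntropy {X : Type*} [MeasurableSpace X] (μ ν : Measure X) : EReal :=
  if μ ≪ ν ∧ ∫⁻ x, ENNReal.ofReal (llr μ ν x) ∂μ < ⊤ then
    ((∫⁻ x, ENNReal.ofReal (llr μ ν x) ∂μ : ℝ≥0∞) : EReal) -
      ((∫⁻ x, ENNReal.ofReal (-llr μ ν x) ∂μ : ℝ≥0∞) : EReal)
  else ⊤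

section FreeEnergy

variable {d : ℕ} {k : HeightKind}

/-- The coordinates `φ_{Λ'} - φ(o)` with `Λ' = Λ ∖ {o}`. For `o ∈ Λ` they identify `F^∇_Λ` with the
product σ-algebra on `E^{Λ'}`. -/
def gradCoords (Λ : Finset (Site d)) (o : Site d) (φ : HeightFn d k) :
    ↥(Λ.erase o) → k.E :=
  fun y => φ y - φ o

/-- The height function with coordinates `ω` on `Λ' = Λ ∖ {o}` that vanishes elsewhere; it is a
right inverse of `gradCoords Λ o`. -/
def ofGradCoords (Λ : Finset (Site d)) (o : Site d)
    (ω : ↥(Λ.erase o) → k.E) : HeightFn d k :=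
  patch (Λ.erase o) (fun _ => 0) ω

/-- The free energy `H_Λ(μ|Φ)`: the relative entropy of `μ` with respect to the measure
`e^{-H⁰_Λ} λ^{Λ-1}` on `F^∇_Λ`. Measures on `F^∇_Λ` are written as measures on `E^{Λ'}`, where
`Λ' = Λ ∖ {o}` for a reference vertex `o ∈ Λ`; so `λ^{Λ-1}` is the product measure `λ^{Λ'}`. -/
noncomputable def freeEnergy (Φ : Potential d k) (Λ : Finset (Site d)) (o : Site d)
    (μ : Measure[gradSigma d k] (HeightFn d k)) : EReal :=
  relEntropy (@Measure.map _ _ (gradSigma d k) _ (gradCoords Λ o) μ)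
    ((Measure.pi fun _ : ↥(Λ.erase o) => k.ref).withDensity fun ω =>
      EReal.exp (-interiorHamiltonian Φ Λ (ofGradCoords Λ o ω)))

/-- The specific free energy `H(μ|Φ) = lim n^{-d} H_{Π_n}(μ|Φ)` exists and equals `h`. -/
def HasSpecificFreeEnergy (Φ : Potential d k) (μ : Measure[gradSigma d k] (HeightFn d k))
    (h : EReal) : Prop :=
  Tendsto (fun n : ℕ => ((((n : ℝ) ^ d)⁻¹ : ℝ) : EReal) * freeEnergy Φ (box d n) 0 μ)
    atTop (𝓝 h)

/-- The surface tension `σ(u)`: the infimum of `H(ν|Φ)` over the `L`-invariant gradient measures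
`ν` of slope `u`. -/
noncomputable def surfaceTension (L : AddSubgroup (Site d)) (Φ : Potential d k)
    (u : (Fin d → ℝ) →ₗ[ℝ] ℝ) : EReal :=
  sInf {h : EReal | ∃ ν : Measure[gradSigma d k] (HeightFn d k),
    IsInvariantGradientMeasure L ν ∧ HasSlope L ν u ∧ HasSpecificFreeEnergy Φ ν h}

/-- `μ` is a minimizer: `μ ∈ P_L(Ω, F^∇)` and `H(μ|Φ) = σ(S(μ)) < ∞`. -/
def IsMinimizer (L : AddSubgroup (Site d)) (Φ : Potential d k)
    (μ : Measure[gradSigma d k] (HeightFn d k)) : Prop :=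
  IsInvariantGradientMeasure L μ ∧
    ∃ (u : (Fin d → ℝ) →ₗ[ℝ] ℝ) (h : EReal), HasSlope L μ u ∧ HasSpecificFreeEnergy Φ μ h ∧
      h = surfaceTension L Φ u ∧ h < ⊤

end FreeEnergy

/-! ### Limiting local Gibbs measures, quasilocality, Gibbs measures -/

/-- The strong topology on probability measures: the coarsest topology that makes `μ ↦ μ(A)`
continuous for every measurable set `A`. -/
@[reducible] def strongTopology (X : Type*) [MeasurableSpace X] : TopologicalSpace (ProbabilityMeasure X) :=
  TopologicalSpace.induced
    (fun (μ : ProbabilityMeasure X) (A : {A : Set X // MeasurableSet A}) => μ A.1)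
    Pi.topologicalSpace

section Gibbs

variable {d : ℕ} {k : HeightKind}

/-- `A_{Λ,Δ,φ}`: the measures `μ γ_Λ π_Λ`, where `μ` is a probability measure on `(Ω, F)` with
`μ π_Δ = δ_{φ_Δ}`, supported on admissible height functions so that `μ γ_Λ` is defined. -/
def localGibbsMixtures (Φ : Potential d k) (Λ Δ : Finset (Site d)) (φ : HeightFn d k) :
    Set (ProbabilityMeasure (Λ → k.E)) :=
  {ρ | ∃ μ : Measure (HeightFn d k), IsProbabilityMeasure μ ∧
    (∀ᵐ ψ ∂μ, Admissible Φ ψ) ∧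
    μ.map (fun ψ => Δ.restrict ψ) = Measure.dirac (Δ.restrict φ) ∧
    (ρ : Measure (Λ → k.E)) = (μ.bind (localGibbs Φ Λ)).map (fun ψ => Λ.restrict ψ)}

/-- `A_{Λ,φ}`: the intersection over the finite sets `Δ ⊇ Λ` of the closures of `A_{Λ,Δ,φ}`. -/
def limitingLocalGibbs (Φ : Potential d k) (Λ : Finset (Site d)) (φ : HeightFn d k) :
    Set (ProbabilityMeasure (Λ → k.E)) :=
  ⋂ (Δ : Finset (Site d)) (_ : Λ ⊆ Δ),
    closure[strongTopology (Λ → k.E)] (localGibbsMixtures Φ Λ Δ φ)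

/-- `φ ∈ Ω_γ`: `φ` is a point of quasilocality, i.e. an admissible height function with
`A_{Λ,φ} = {γ_Λ(·, φ) π_Λ}` for every finite `Λ`. -/
def IsPointOfQuasilocality (Φ : Potential d k) (φ : HeightFn d k) : Prop :=
  Admissible Φ φ ∧ ∀ Λ : Finset (Site d),
    (fun ρ : ProbabilityMeasure (Λ → k.E) => (ρ : Measure (Λ → k.E))) ''
        limitingLocalGibbs Φ Λ φ =
      {(localGibbs Φ Λ φ).map (fun ψ => Λ.restrict ψ)}

/-- The gradient measure `μ` is almost Gibbs: `μ(Ω_γ) = 1`, and `μ = μ γ_Λ` on `F^∇` for every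
finite `Λ`. -/
def IsAlmostGibbs (Φ : Potential d k) (μ : Measure[gradSigma d k] (HeightFn d k)) : Prop :=
  (∀ᵐ φ ∂μ, IsPointOfQuasilocality Φ φ) ∧
    ∀ (Λ : Finset (Site d)) (A : Set (HeightFn d k)), MeasurableSet[gradSigma d k] A →
      μ A = ∫⁻ φ, localGibbs Φ Λ φ A ∂μ

/-- The specification is quasilocal: every height function for which it is defined, i.e. every
admissible one, is a point of quasilocality. -/
def IsQuasilocal (Φ : Potential d k) : Prop :=
  ∀ φ, Admissible Φ φ → IsPointOfQuasilocality Φ φ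

/-- Gibbs measures are the almost Gibbs measures of a quasilocal specification. -/
def IsGibbs (Φ : Potential d k) (μ : Measure[gradSigma d k] (HeightFn d k)) : Prop :=
  IsQuasilocal Φ ∧ IsAlmostGibbs Φ μ

end Gibbs

/-! ### The group of heights -/

namespace HeightKind

/-! The mechanism is variational. Replacing the heights of the minimizer in many separate regions by
samples of local Gibbs measures lowers the specific free energy by a definite amount per region,
unless the conditional laws are already close to mixtures of local Gibbs measures. Minimality
excludes a gain, up to errors of boundary order, and a pigeonhole argument turns this into a
statement about one fixed region `Λ`.

Preparation. The gradient measure is replaced by the law `lift μ` of the height function pinned at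
`0`, so that all measures live on the product σ-algebra. Finite free energy in boxes forces the
Lipschitz constraint almost surely and makes all finite-dimensional laws absolutely continuous;
hence almost every height function is admissible (`Interaction.Regular`,
`Interaction.Regular.ae_good`). The entropy of the height differences in a block is almost
superadditive: the strong interaction between two blocks is nonnegative, the weak one is at most the
exterior bound of one block, and the relative height of the two blocks costs the logarithm of a
distance (`Interaction.blockEnt_union_ge`). Hence the specific free energy exists whenever the
entropies of the boxes are finite and do not grow faster than the volume
(`Interaction.exists_tendsto_blockEnt`), which is needed for the competitor below.

The competitor. Tile the lattice by boxes of side `m`, a multiple of the index of `L`, and resample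
independently in all tiles the heights on a set `V` that stays away from the boundary of the tile.
If a kernel `R` resamples part of the state and almost preserves the reference measure, then the
chain rule shows that passing from `N` to `R ∘ₘ N` lowers the entropy by the divergence of `N` from
`R ∘ₘ N`, up to the energy error (`ent_resample_le`). So every tile gains at least `g - 4 *
I.extBound (box d m)`, where `g` is the divergence, within one tile, of the minimizer from its
resampled version. Averaging over the shifts in `L` modulo the tiling restores invariance, and by
convexity costs only boundary terms. The corners of the tiles are never resampled, so the slope is
unchanged. Minimality yields `g ≤ 4 * I.extBound (box d m)`, which is `o(m ^ d)`
(`IsMinimizer.klDiv_resample_le`).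

Localization. For large `m` the set `V` contains a number of order `m ^ d` of disjoint translates of
a neighbourhood of `Λ`. Relative entropy is monotone in the block, so if these translates are
revealed one after the other, one of them contributes at most `ε` (`exists_small_increment`).
Shifted back to `Λ`, this gives a measure `P` preserved by the Gibbs kernel of `Λ`, and a large set
`S`, such that given the heights on `S` the conditional law of the heights on `Λ` under the
minimizer is `ε`-close in relative entropy to the one under `P`. The latter is a mixture of local
Gibbs measures (`IsMinimizer.exists_approximation`). Pinsker's inequality makes the two close in
mean on every event (`IsMinimizer.exists_kernel_approximation`).

The limit. Let the sets `S` increase to the complement of `Λ` with summable errors. By Lévy's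
theorem the conditional laws given `S` converge to the conditional law given everything off `Λ`, and
so do the mixtures, almost surely on a countable generating algebra. All mixtures are dominated by a
multiple of one local Gibbs measure, so convergence extends to all events; this is convergence in
the strong topology and puts the conditional law into `limitingLocalGibbs`. At a point of
quasilocality that set has one element, which gives the almost Gibbs property; if all admissible
height functions are such points, then almost every height function is one. -/

instance instStandardBorelSpace : (k : HeightKind) → StandardBorelSpace k.E
  | .int => inferInstanceAs (StandardBorelSpace ℤ)
  | .real => inferInstanceAs (StandardBorelSpace ℝ)

instance instMeasurableAdd₂ : (k : HeightKind) → MeasurableAdd₂ k.E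
  | .int => inferInstanceAs (MeasurableAdd₂ ℤ)
  | .real => inferInstanceAs (MeasurableAdd₂ ℝ)

instance instMeasurableSub₂ : (k : HeightKind) → MeasurableSub₂ k.E
  | .int => inferInstanceAs (MeasurableSub₂ ℤ)
  | .real => inferInstanceAs (MeasurableSub₂ ℝ)

instance instMeasurableNeg : (k : HeightKind) → MeasurableNeg k.E
  | .int => inferInstanceAs (MeasurableNeg ℤ)
  | .real => inferInstanceAs (MeasurableNeg ℝ)

instance instSigmaFiniteRef : (k : HeightKind) → SigmaFinite k.ref
  | .int => inferInstanceAs (SigmaFinite (Measure.count : Measure ℤ))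
  | .real => inferInstanceAs (SigmaFinite (volume : Measure ℝ))

instance instIsAddLeftInvariantRef : (k : HeightKind) → k.ref.IsAddLeftInvariant
  | .int => inferInstanceAs ((Measure.count : Measure ℤ).IsAddLeftInvariant)
  | .real => inferInstanceAs ((volume : Measure ℝ).IsAddLeftInvariant)

theorem val_add : (k : HeightKind) → (a b : k.E) → k.val (a + b) = k.val a + k.val b
  | .int, a, b => Int.cast_add (R := ℝ) a b
  | .real, _, _ => rfl

theorem measurable_val : (k : HeightKind) → Measurable k.val
  | .int => measurable_from_top (α := ℤ)
  | .real => measurable_id (α := ℝ)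

/-- `val` as a homomorphism. -/
noncomputable def valHom (k : HeightKind) : k.E →+ ℝ := AddMonoidHom.mk' k.val k.val_add

theorem val_sub (k : HeightKind) (a b : k.E) : k.val (a - b) = k.val a - k.val b :=
  map_sub k.valHom a b

theorem val_zero (k : HeightKind) : k.val 0 = 0 := map_zero k.valHom

/-- The heights whose absolute value is at most `r`. -/
def ballE (k : HeightKind) (r : ℝ) : Set k.E := {t | |k.val t| ≤ r}

/-- The bound covers both cases: there are `2 * ⌊r⌋ + 1` integers in the ball, and its Lebesgue
measure is `2 * r`. The summand `1` also keeps the logarithm of the bound nonnegative, and this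
logarithm is the price for linking two blocks. -/
theorem ref_ballE_le : (k : HeightKind) → {r : ℝ} → 0 ≤ r →
    k.ref (k.ballE r) ≤ ENNReal.ofReal (2 * r + 1)
  | .int, r, hr => by
    have h : (ballE .int r : Set ℤ) = ((Finset.Icc (-⌊r⌋) ⌊r⌋ : Finset ℤ) : Set ℤ) := by
      ext (n : ℤ)
      suffices |(n : ℝ)| ≤ r ↔ n ∈ Finset.Icc (-⌊r⌋) ⌊r⌋ by
        exact this.trans Finset.mem_coe.symm
      rw [Finset.mem_Icc, abs_le]
      constructor
      · rintro ⟨h1, h2⟩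
        refine ⟨?_, Int.le_floor.2 h2⟩
        have : (-n : ℤ) ≤ ⌊r⌋ := Int.le_floor.2 (by push_cast; linarith)
        linarith
      · rintro ⟨h1, h2⟩
        refine ⟨?_, Int.le_floor.1 h2⟩
        have : ((-n : ℤ) : ℝ) ≤ r := Int.le_floor.1 (by linarith)
        push_cast at this; linarith
    have h2 : (ref .int) (ballE .int r) = (Measure.count : Measure ℤ) (ballE .int r : Set ℤ) := rfl
    rw [h2, h, Measure.count_apply_finset, Int.card_Icc]
    have hf : 0 ≤ ⌊r⌋ := Int.floor_nonneg.2 hr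
    rw [← ENNReal.ofReal_natCast]
    apply ENNReal.ofReal_le_ofReal
    have : (((⌊r⌋ + 1 - -⌊r⌋).toNat : ℤ) : ℝ) = ((⌊r⌋ + 1 - -⌊r⌋ : ℤ) : ℝ) := by
      rw [Int.toNat_of_nonneg (by linarith)]
    have h3 := Int.floor_le r
    push_cast at this
    rw [this]; linarith
  | .real, r, hr => by
    have h : (ballE .real r : Set ℝ) = Set.Icc (-r) r := by
      ext (t : ℝ)
      exact (abs_le : |t| ≤ r ↔ _)
    have h2 : (ref .real) (ballE .real r) = (volume : Measure ℝ) (ballE .real r : Set ℝ) := rfl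
    rw [h2, h, Real.volume_Icc]
    apply ENNReal.ofReal_le_ofReal
    linarith

theorem ref_ball_le (k : HeightKind) (c : k.E) {r : ℝ} (hr : 0 ≤ r) :
    k.ref {t | |k.val (t - c)| ≤ r} ≤ ENNReal.ofReal (2 * r + 1) := by
  have h : {t | |k.val (t - c)| ≤ r} = (fun t => -c + t) ⁻¹' k.ballE r := by
    ext t
    simp [ballE, sub_eq_neg_add]
  rw [h, measure_preimage_add]
  exact k.ref_ballE_le hr

end HeightKind

section Basic

variable {d : ℕ} {k : HeightKind}

instance instIsAddLeftInvariantPiRef (Λ : Finset (Site d)) :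
    (Measure.pi fun _ : Λ => k.ref).IsAddLeftInvariant := inferInstance

/-- Integration of the heights on `S` against the reference measure. -/
noncomputable def refInt (S : Finset (Site d)) (f : HeightFn d k → ℝ≥0∞) (φ : HeightFn d k) :
    ℝ≥0∞ := ∫⁻ ψ, f (patch S φ ψ) ∂(Measure.pi fun _ : S => k.ref)

theorem refInt_eq_lmarginal (S : Finset (Site d)) (f : HeightFn d k → ℝ≥0∞) :
    refInt S f = lmarginal (fun _ => k.ref) S f := rfl

theorem patch_of_mem {S : Finset (Site d)} (φ : HeightFn d k) (ψ : S → k.E) {x : Site d}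
    (h : x ∈ S) : patch S φ ψ x = ψ ⟨x, h⟩ := dif_pos h

theorem patch_of_notMem {S : Finset (Site d)} (φ : HeightFn d k) (ψ : S → k.E) {x : Site d}
    (h : x ∉ S) : patch S φ ψ x = φ x := dif_neg h

theorem measurable_patch (S : Finset (Site d)) :
    Measurable fun p : HeightFn d k × (S → k.E) => patch S p.1 p.2 := by
  refine measurable_pi_lambda _ fun x => ?_
  by_cases h : x ∈ S
  · simp only [patch_of_mem _ _ h]; fun_prop
  · simp only [patch_of_notMem _ _ h]; fun_prop

theorem measurable_patch_right (S : Finset (Site d)) (φ : HeightFn d k) :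
    Measurable fun ψ : S → k.E => patch S φ ψ :=
  (measurable_patch S).comp (measurable_const.prodMk measurable_id)

theorem Measurable.refInt {S : Finset (Site d)} {f : HeightFn d k → ℝ≥0∞} (hf : Measurable f) :
    Measurable (refInt S f) :=
  Measurable.lmarginal (X := fun _ : Site d => k.E) (fun _ => k.ref) hf

theorem refInt_union {S T : Finset (Site d)} {f : HeightFn d k → ℝ≥0∞} (hf : Measurable f)
    (h : Disjoint S T) : refInt (S ∪ T) f = refInt S (refInt T f) :=
  lmarginal_union (X := fun _ : Site d => k.E) (fun _ => k.ref) f hf h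

theorem refInt_union' {S T : Finset (Site d)} {f : HeightFn d k → ℝ≥0∞} (hf : Measurable f)
    (h : Disjoint S T) : refInt (S ∪ T) f = refInt T (refInt S f) :=
  lmarginal_union' (X := fun _ : Site d => k.E) (fun _ => k.ref) f hf h

theorem refInt_congr {S : Finset (Site d)} (f : HeightFn d k → ℝ≥0∞) {φ φ' : HeightFn d k}
    (h : ∀ x ∉ S, φ x = φ' x) : refInt S f φ = refInt S f φ' :=
  lmarginal_congr (X := fun _ : Site d => k.E) (fun _ => k.ref) f h

theorem refInt_mono {S : Finset (Site d)} {f g : HeightFn d k → ℝ≥0∞} {φ : HeightFn d k}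
    (h : ∀ φ', (∀ x ∉ S, φ' x = φ x) → f φ' ≤ g φ') : refInt S f φ ≤ refInt S g φ :=
  lintegral_mono fun _ => h _ fun _ hx => patch_of_notMem _ _ hx

theorem refInt_congr_fun {S : Finset (Site d)} {f g : HeightFn d k → ℝ≥0∞} {φ : HeightFn d k}
    (h : ∀ φ', (∀ x ∉ S, φ' x = φ x) → f φ' = g φ') : refInt S f φ = refInt S g φ :=
  lintegral_congr fun _ => h _ fun _ hx => patch_of_notMem _ _ hx

/-- A factor that does not depend on the heights on `S` may be pulled out. -/
theorem refInt_mul_left {S : Finset (Site d)} {f g : HeightFn d k → ℝ≥0∞} (hg : Measurable g)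
    {φ : HeightFn d k} (h : ∀ φ', (∀ x ∉ S, φ' x = φ x) → f φ' = f φ) :
    refInt S (fun φ' => f φ' * g φ') φ = f φ * refInt S g φ := by
  unfold refInt
  rw [← lintegral_const_mul _ (show Measurable fun ψ => g (patch S φ ψ) from
    hg.comp (measurable_patch_right S φ))]
  refine lintegral_congr fun ψ => ?_
  have := h (patch S φ ψ) fun _ hx => patch_of_notMem _ _ hx
  simp only [this]

theorem refInt_const_mul {S : Finset (Site d)} {g : HeightFn d k → ℝ≥0∞} (hg : Measurable g)
    (c : ℝ≥0∞) (φ : HeightFn d k) :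
    refInt S (fun φ' => c * g φ') φ = c * refInt S g φ :=
  refInt_mul_left (f := fun _ => c) hg fun _ _ => rfl

theorem refInt_empty (f : HeightFn d k → ℝ≥0∞) : refInt ∅ f = f := 
  lmarginal_empty (X := fun _ : Site d => k.E) (fun _ => k.ref) f

/-- The reference measure is invariant under translations of the heights. -/
theorem refInt_comp_add (S : Finset (Site d)) {f : HeightFn d k → ℝ≥0∞}
    (c φ : HeightFn d k) : refInt S (fun φ' => f (φ' + c)) φ = refInt S f (φ + c) := by
  unfold refInt
  have h : ∀ ψ : S → k.E, patch S φ ψ + c = patch S (φ + c) ((fun x : S => c x) + ψ) := by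
    intro ψ
    ext x
    by_cases hx : x ∈ S
    · simp [patch_of_mem _ _ hx, add_comm]
    · simp [patch_of_notMem _ _ hx]
  simp_rw [h]
  exact lintegral_add_left_eq_self (fun ψ => f (patch S (φ + c) ψ)) _

/-- The lattice shift, acting on height functions, and the reference measure. -/
theorem refInt_translateSet (v : Site d) (S : Finset (Site d)) {f : HeightFn d k → ℝ≥0∞}
    (hf : Measurable f) (φ : HeightFn d k) :
    refInt (translateSet v S) f φ = refInt S (fun φ' => f (shift (-v) φ')) (shift v φ) := by
  have h1 : translateSet v S = S.image (fun x => x + v) := by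
    rw [translateSet, Finset.map_eq_image]; rfl
  have h := lmarginal_image (X := fun _ : Site d => k.E) (μ := fun _ : Site d => k.ref) (δ' := Site d)
    (e := fun x => x + v) (add_left_injective v) S (f := fun φ' => f (shift (-v) φ'))
    (by refine hf.comp (measurable_pi_lambda _ fun x => ?_); exact measurable_pi_apply _) φ
  rw [refInt_eq_lmarginal, refInt_eq_lmarginal, h1]
  refine Eq.trans ?_ (h.trans rfl)
  congr 1
  ext φ'
  have : shift (-v) (fun x => φ' (x + v)) = φ' := by ext x; simp [shift]
  exact (congrArg f this).symm

theorem measurable_shift (v : Site d) : Measurable (shift (k := k) v) :=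
  measurable_pi_lambda _ fun _ => measurable_pi_apply _

theorem shift_shift (v w : Site d) (φ : HeightFn d k) : shift v (shift w φ) = shift (v + w) φ := by
  ext x; simp [shift, add_assoc]

theorem shift_zero (φ : HeightFn d k) : shift 0 φ = φ := by
  ext x; simp [shift]

end Basic

/-! ### Relative entropy with respect to finite measures -/

section Entropy

open InformationTheory ProbabilityTheory

variable {X Y : Type*} [MeasurableSpace X] [MeasurableSpace Y]

/-- The integral `∫ log (dM/dν) dM`. It is the relative entropy if `klDiv M ν ≠ ∞`. -/
noncomputable def ent (M ν : Measure X) : ℝ := ∫ x, llr M ν x ∂M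

/-- `klDiv` contains the difference of the total masses, which makes it nonnegative and monotone
under maps for any finite reference measure. `ent` omits it, which suits free energies and changes
of the Hamiltonian. The proof passes between the two by this identity. -/
theorem toReal_klDiv_eq_ent {M ν : Measure X} [IsProbabilityMeasure M] [IsFiniteMeasure ν]
    (h : klDiv M ν ≠ ∞) : (klDiv M ν).toReal = ent M ν + ν.real Set.univ - 1 := by
  obtain ⟨h1, h2⟩ := klDiv_ne_top_iff.1 h
  rw [toReal_klDiv h1 h2, ent]; simp

/-- With `f` the density, `-log f ≤ 1 / f`, and the integral of `1 / f` under `M` is at most the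
total mass of `ν`. So with a finite reference measure only the positive part of `llr` can be
infinite. -/
theorem lintegral_neg_llr_lt_top {M ν : Measure X} [IsFiniteMeasure M] [IsFiniteMeasure ν]
    (h : M ≪ ν) : ∫⁻ x, ENNReal.ofReal (-llr M ν x) ∂M < ∞ := by
  calc ∫⁻ x, ENNReal.ofReal (-llr M ν x) ∂M
      ≤ ∫⁻ x, (M.rnDeriv ν x)⁻¹ ∂M := by
        refine lintegral_mono_ae ?_
        filter_upwards [Measure.rnDeriv_pos h, h.ae_le (Measure.rnDeriv_lt_top M ν)] with x h0 h1
        have hp : 0 < (M.rnDeriv ν x).toReal := ENNReal.toReal_pos h0.ne' h1.ne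
        rw [llr, ← ENNReal.ofReal_toReal (ENNReal.inv_ne_top.2 h0.ne'), ENNReal.toReal_inv]
        apply ENNReal.ofReal_le_ofReal
        have := Real.one_sub_inv_le_log_of_pos hp
        linarith
    _ = ∫⁻ x, M.rnDeriv ν x * (M.rnDeriv ν x)⁻¹ ∂ν :=
        (lintegral_rnDeriv_mul h (by fun_prop)).symm
    _ ≤ ∫⁻ _, 1 ∂ν := lintegral_mono fun x => ENNReal.mul_inv_le_one _
    _ < ∞ := by simp

theorem integrable_llr_of_le {M ν : Measure X} [IsFiniteMeasure M] [IsFiniteMeasure ν]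
    (h : M ≪ ν) {g : X → ℝ} (hg : Integrable g M) (hle : ∀ᵐ x ∂M, llr M ν x ≤ g x) :
    Integrable (llr M ν) M := by
  refine ⟨(measurable_llr M ν).aestronglyMeasurable, ?_⟩
  have h2 : ∫⁻ x, ‖g x‖ₑ ∂M < ∞ := hg.2
  refine lt_of_le_of_lt ?_ (ENNReal.add_lt_top.2 ⟨h2, lintegral_neg_llr_lt_top h⟩)
  rw [← lintegral_add_right _ (by fun_prop)]
  refine lintegral_mono_ae ?_
  filter_upwards [hle] with x hx
  rw [Real.enorm_eq_ofReal_abs, Real.enorm_eq_ofReal_abs]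
  rcases le_total 0 (llr M ν x) with h0 | h0
  · rw [abs_of_nonneg h0]
    refine le_add_right (ENNReal.ofReal_le_ofReal (hx.trans (le_abs_self _)))
  · rw [abs_of_nonpos h0]
    exact le_add_self

/-- The density of `ν` with respect to `ν'` is at most `e ^ c`, and densities multiply, so `llr`
grows by at most `c`. All energy errors enter through this lemma: changing the Hamiltonian by at
most `c` changes the entropy by at most `c`. -/
theorem ent_mono_right {M ν ν' : Measure X} [IsProbabilityMeasure M] [IsFiniteMeasure ν]
    [IsFiniteMeasure ν'] {c : ℝ} (hle : ν ≤ ENNReal.ofReal (Real.exp c) • ν')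
    (h : klDiv M ν ≠ ∞) : klDiv M ν' ≠ ∞ ∧ ent M ν' ≤ ent M ν + c := by
  obtain ⟨h1, h2⟩ := klDiv_ne_top_iff.1 h
  have hac : ν ≪ ν' := (Measure.absolutelyContinuous_of_le hle).trans
    (Measure.AbsolutelyContinuous.rfl.smul_left _)
  have h3 : M ≪ ν' := h1.trans hac
  have hd : ∀ᵐ x ∂ν', ν.rnDeriv ν' x ≤ ENNReal.ofReal (Real.exp c) := by
    refine ae_le_of_forall_setLIntegral_le_of_sigmaFinite (by fun_prop) fun s hs _ => ?_
    rw [setLIntegral_const]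
    exact (Measure.setLIntegral_rnDeriv_le s).trans (hle s)
  have hl : ∀ᵐ x ∂M, llr M ν' x ≤ llr M ν x + c := by
    filter_upwards [h3.ae_le (Measure.rnDeriv_mul_rnDeriv (κ := ν') h1), h3.ae_le hd,
      Measure.rnDeriv_pos h1, h1.ae_le (Measure.rnDeriv_lt_top M ν), Measure.rnDeriv_pos h3]
      with x hx hx2 hx3 hx4 hx5
    have hp : 0 < (M.rnDeriv ν x).toReal := ENNReal.toReal_pos hx3.ne' hx4.ne
    have hx6 : (ν.rnDeriv ν' x).toReal ≤ Real.exp c := by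
      have := ENNReal.toReal_mono ENNReal.ofReal_ne_top hx2
      rwa [ENNReal.toReal_ofReal (Real.exp_pos c).le] at this
    have hx7 : 0 < (ν.rnDeriv ν' x).toReal := by
      refine ENNReal.toReal_pos ?_ (ne_top_of_le_ne_top ENNReal.ofReal_ne_top hx2)
      intro h0
      rw [← hx] at hx5
      simp [h0] at hx5
    rw [llr, llr, ← hx, Pi.mul_apply, ENNReal.toReal_mul, Real.log_mul hp.ne' hx7.ne']
    have := Real.log_le_log hx7 hx6
    rw [Real.log_exp] at this
    linarith
  have hi : Integrable (llr M ν') M := integrable_llr_of_le h3 (h2.add (integrable_const c)) hl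
  refine ⟨klDiv_ne_top h3 hi, ?_⟩
  have := integral_mono_ae hi (h2.add (integrable_const c)) hl
  refine this.trans ?_
  simp only [Pi.add_apply]
  rw [integral_add h2 (integrable_const c)]
  simp [ent]

/-- The data processing inequality; a map preserves total masses, so the correction terms of `klDiv`
cancel. -/
theorem ent_map_le {M ν : Measure X} [IsProbabilityMeasure M] [IsFiniteMeasure ν] {g : X → Y}
    (hg : Measurable g) (h : klDiv M ν ≠ ∞) :
    klDiv (M.map g) (ν.map g) ≠ ∞ ∧ ent (M.map g) (ν.map g) ≤ ent M ν := by
  have h1 := klDiv_map_le M ν hg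
  have h2 := ne_top_of_le_ne_top h h1
  refine ⟨h2, ?_⟩
  have := Measure.isProbabilityMeasure_map (μ := M) hg.aemeasurable
  have h3 := ENNReal.toReal_mono h h1
  rw [toReal_klDiv_eq_ent h, toReal_klDiv_eq_ent h2] at h3
  have h4 : (ν.map g).real Set.univ = ν.real Set.univ := by
    simp [measureReal_def, Measure.map_apply hg MeasurableSet.univ]
  linarith

/-- Data processing along `f` and back along `g`. It suffices that `g` undoes `f` on the two
measures at hand. -/
theorem klDiv_map_eq {M ν : Measure X} [IsFiniteMeasure M] [IsFiniteMeasure ν] {f : X → Y}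
    {g : Y → X} (hf : Measurable f) (hg : Measurable g) (hM : (M.map f).map g = M)
    (hν : (ν.map f).map g = ν) : klDiv (M.map f) (ν.map f) = klDiv M ν := by
  refine le_antisymm (klDiv_map_le _ _ hf) ?_
  conv_lhs => rw [← hM, ← hν]
  exact klDiv_map_le _ _ hg

/-- Chain rule for a kernel `R` that resamples the part of the state not recorded by `z`. -/
theorem klDiv_resample [StandardBorelSpace X] [Nonempty X] {M ν : Measure X} [IsFiniteMeasure M]
    [IsFiniteMeasure ν] {z : X → X} (hz : Measurable z) (R : Kernel X X) [IsMarkovKernel R]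
    (hR : ∀ x, R (z x) = R x) (hRz : ∀ x, ∀ᵐ y ∂(R x), z y = z x) :
    klDiv M (R ∘ₘ ν) = klDiv (M.map z) (ν.map z) + klDiv M (R ∘ₘ M) := by
  have hj : Measurable fun x => (z x, x) := hz.prodMk measurable_id
  -- Since `R x` depends on `x` only through `z x` and does not change `z`, the law of `z` together
  -- with the resampled state is a product of the law of `z` with `R`.
  have key : ∀ N : Measure X, IsFiniteMeasure N →
      (R ∘ₘ N).map (fun x => (z x, x)) = (N.map z) ⊗ₘ R := by
    intro N hN
    refine Measure.ext_of_lintegral _ fun f hf => ?_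
    rw [lintegral_map hf hj, Measure.lintegral_compProd hf,
      Measure.lintegral_bind R.measurable.aemeasurable (by fun_prop), lintegral_map _ hz]
    · refine lintegral_congr fun x => ?_
      rw [hR]
      refine lintegral_congr_ae ?_
      filter_upwards [hRz x] with y hy
      rw [hy]
    · exact hf.lintegral_kernel_prod_right'
  have e : ∀ N N' : Measure X, IsFiniteMeasure N → IsFiniteMeasure N' →
      klDiv (N.map fun x => (z x, x)) (N'.map fun x => (z x, x)) = klDiv N N' := by
    intro N N' hN hN'
    refine klDiv_map_eq hj measurable_snd ?_ ?_ <;>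
    · rw [Measure.map_map measurable_snd hj]
      exact Measure.map_id
  -- Once `M` is disintegrated along `z`, the chain rule compares its conditional law with `R`. The
  -- conditional term is computed under `M` alone, hence it is the divergence of `M` from `R ∘ₘ M`.
  have hM : M.map (fun x => (z x, x)) = (M.map z) ⊗ₘ condDistrib id z M :=
    (compProd_map_condDistrib (X := z) (Y := id) (μ := M) aemeasurable_id).symm
  rw [← e M (R ∘ₘ ν) inferInstance inferInstance, ← e M (R ∘ₘ M) inferInstance inferInstance,
    key ν inferInstance, key M inferInstance, hM]
  exact klDiv_compProd_eq_add _ _ _ _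

theorem ent_smul_right_le {M ν : Measure X} [IsProbabilityMeasure M] [IsFiniteMeasure ν]
    {a : ℝ} (ha : 0 < a) (h : klDiv M ν ≠ ∞) :
    klDiv M (ENNReal.ofReal a • ν) ≠ ∞ ∧ ent M (ENNReal.ofReal a • ν) ≤ ent M ν - Real.log a := by
  have : IsFiniteMeasure (ENNReal.ofReal a • ν) := ν.smul_finite ENNReal.ofReal_ne_top
  have := ent_mono_right (M := M) (ν := ν) (ν' := ENNReal.ofReal a • ν) (c := -Real.log a) ?_ h
  · exact ⟨this.1, by linarith [this.2]⟩
  · rw [smul_smul, ← ENNReal.ofReal_mul (Real.exp_pos _).le, Real.exp_neg, Real.exp_log ha,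
      inv_mul_cancel₀ ha.ne', ENNReal.ofReal_one, one_smul]

/-- Superadditivity of relative entropy with respect to product measures. -/
theorem ent_prod_ge [StandardBorelSpace Y] [Nonempty Y] {M : Measure (X × Y)}
    [IsProbabilityMeasure M] {ν₁ : Measure X} {ν₂ : Measure Y} [IsFiniteMeasure ν₁]
    [IsFiniteMeasure ν₂] (h : klDiv M (ν₁.prod ν₂) ≠ ∞) :
    (klDiv (M.map Prod.fst) ν₁ ≠ ∞ ∧ klDiv (M.map Prod.snd) ν₂ ≠ ∞) ∧
      ent (M.map Prod.fst) ν₁ + ent (M.map Prod.snd) ν₂ ≤ ent M (ν₁.prod ν₂) := by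
  have hν₂ : ν₂ ≠ 0 := by
    rintro rfl
    have h1 := (klDiv_ne_top_iff.1 h).1
    simp only [Measure.prod_zero] at h1
    have := Measure.absolutelyContinuous_zero_iff.1 h1
    exact (IsProbabilityMeasure.ne_zero M) this
  set a : ℝ := ν₂.real Set.univ with ha
  have ha0 : 0 < a := by
    rw [ha, measureReal_def]
    exact ENNReal.toReal_pos (by simpa using hν₂) (measure_ne_top _ _)
  have haE : ENNReal.ofReal a = ν₂ Set.univ := by
    rw [ha, measureReal_def, ENNReal.ofReal_toReal (measure_ne_top _ _)]
  -- The mass of the second factor is moved into the first. The product then has a constant Markov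
  -- kernel as its second factor, so the chain rule applies, and the conditional term controls the
  -- second marginal by projection.
  set p : Measure Y := ENNReal.ofReal a⁻¹ • ν₂ with hp
  have hpprob : IsProbabilityMeasure p := ⟨by
    rw [hp, Measure.smul_apply, ← haE, smul_eq_mul, ← ENNReal.ofReal_mul (inv_nonneg.2 ha0.le),
      inv_mul_cancel₀ ha0.ne', ENNReal.ofReal_one]⟩
  set ν₁' : Measure X := ENNReal.ofReal a • ν₁ with hν₁'
  have : IsFiniteMeasure ν₁' := ν₁.smul_finite ENNReal.ofReal_ne_top
  have hback₁ : ENNReal.ofReal a⁻¹ • ν₁' = ν₁ := by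
    rw [hν₁', smul_smul, ← ENNReal.ofReal_mul (inv_nonneg.2 ha0.le),
      inv_mul_cancel₀ ha0.ne', ENNReal.ofReal_one, one_smul]
  have hback₂ : ENNReal.ofReal a • p = ν₂ := by
    rw [hp, smul_smul, ← ENNReal.ofReal_mul ha0.le,
      mul_inv_cancel₀ ha0.ne', ENNReal.ofReal_one, one_smul]
  have hprod : ν₁.prod ν₂ = ν₁' ⊗ₘ Kernel.const X p := by
    rw [Measure.compProd_const, hν₁', hp, Measure.prod_smul_left, Measure.prod_smul_right,
      smul_smul, ← ENNReal.ofReal_mul ha0.le, mul_inv_cancel₀ ha0.ne', ENNReal.ofReal_one,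
      one_smul]
  have hM : M = M.fst ⊗ₘ M.condKernel := (M.disintegrate M.condKernel).symm
  have hch : klDiv M (ν₁.prod ν₂) = klDiv M.fst ν₁' + klDiv M (M.fst.prod p) := by
    have h0 := klDiv_compProd_eq_add M.fst ν₁' M.condKernel (Kernel.const X p)
    rwa [← hM, ← hprod, Measure.compProd_const] at h0
  have hsnd : klDiv (M.map Prod.snd) p ≤ klDiv M (M.fst.prod p) := by
    have h0 := klDiv_map_le M (M.fst.prod p) measurable_snd
    have h1 : (M.fst.prod p).map Prod.snd = p := by
      simp
    rwa [h1] at h0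
  have hf1 : klDiv M.fst ν₁' ≠ ∞ := fun h0 => h (by rw [hch, h0, top_add])
  have hf2 : klDiv M (M.fst.prod p) ≠ ∞ := fun h0 => h (by rw [hch, h0, add_top])
  have hf3 : klDiv (M.map Prod.snd) p ≠ ∞ := ne_top_of_le_ne_top hf2 hsnd
  have : IsProbabilityMeasure (M.map Prod.snd) :=
    Measure.isProbabilityMeasure_map measurable_snd.aemeasurable
  have g1 := ent_smul_right_le (inv_pos.2 ha0) hf1
  rw [hback₁] at g1
  have g2 := ent_smul_right_le ha0 hf3
  rw [hback₂] at g2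
  refine ⟨⟨g1.1, g2.1⟩, ?_⟩
  have k1 := congrArg ENNReal.toReal hch
  rw [ENNReal.toReal_add hf1 hf2, toReal_klDiv_eq_ent h, toReal_klDiv_eq_ent hf1] at k1
  have k2 := ENNReal.toReal_mono hf2 hsnd
  rw [toReal_klDiv_eq_ent hf3] at k2
  have k3 : (ν₁.prod ν₂).real Set.univ = ν₁'.real Set.univ := by
    rw [hprod, Measure.compProd_const, measureReal_def, measureReal_def, ← Set.univ_prod_univ,
      Measure.prod_prod]
    simp
  have k4 : p.real Set.univ = 1 := by simp
  have g1' := g1.2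
  have g2' := g2.2
  rw [Real.log_inv] at g1'
  have : ent (M.map Prod.fst) ν₁ = ent M.fst ν₁ := rfl
  linarith

/-- The density of `M` vanishes off `G`. This replaces σ-finite reference measures by finite ones,
to which `klDiv` and data processing apply. -/
theorem llr_restrict {M ν : Measure X} [SigmaFinite M] [SigmaFinite ν] {G : Set X}
    (hG : MeasurableSet G) (hMG : ∀ᵐ x ∂M, x ∈ G) (h : M ≪ ν) :
    M ≪ ν.restrict G ∧ llr M (ν.restrict G) =ᵐ[M] llr M ν := by
  have h1 : M ≪ ν.restrict G := by
    have := h.restrict G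
    rwa [Measure.restrict_eq_self_of_ae_mem hMG] at this
  refine ⟨h1, ?_⟩
  have h2 := Measure.rnDeriv_mul_rnDeriv (κ := ν) h1
  filter_upwards [h.ae_le h2, h.ae_le (Measure.rnDeriv_restrict_self ν hG), hMG] with x hx hx2 hx3
  rw [llr, llr, ← hx, Pi.mul_apply, hx2, Set.indicator_of_mem hx3]
  simp

theorem klDiv_restrict_ne_top_iff {M ν : Measure X} [IsProbabilityMeasure M] [SigmaFinite ν]
    {G : Set X} (hG : MeasurableSet G) (hMG : ∀ᵐ x ∂M, x ∈ G) :
    klDiv M (ν.restrict G) ≠ ∞ ↔ klDiv M ν ≠ ∞ := by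
  by_cases h : M ≪ ν
  · obtain ⟨h1, h2⟩ := llr_restrict hG hMG h
    rw [klDiv_ne_top_iff, klDiv_ne_top_iff, integrable_congr h2]
    tauto
  · have h' : ¬ M ≪ ν.restrict G := fun h0 => h (h0.trans Measure.absolutelyContinuous_restrict)
    simp [klDiv_of_not_ac h, klDiv_of_not_ac h']

theorem ent_restrict {M ν : Measure X} [IsProbabilityMeasure M] [SigmaFinite ν] {G : Set X}
    (hG : MeasurableSet G) (hMG : ∀ᵐ x ∂M, x ∈ G) (h : M ≪ ν) :
    ent M (ν.restrict G) = ent M ν :=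
  integral_congr_ae (llr_restrict hG hMG h).2

/-- Relative entropy as an extended real number, computed from a finite restriction of the
reference measure. -/
theorem relEntropy_eq {M ν : Measure X} [IsProbabilityMeasure M] [SigmaFinite ν] {G : Set X}
    (hG : MeasurableSet G) (hMG : ∀ᵐ x ∂M, x ∈ G) [IsFiniteMeasure (ν.restrict G)] :
    (klDiv M (ν.restrict G) = ∞ → relEntropy M ν = ⊤) ∧
      (klDiv M (ν.restrict G) ≠ ∞ → relEntropy M ν = (ent M (ν.restrict G) : ℝ)) := by
  by_cases h : M ≪ ν
  · obtain ⟨h1, h2⟩ := llr_restrict hG hMG h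
    have hneg : ∫⁻ x, ENNReal.ofReal (-llr M ν x) ∂M < ∞ := by
      refine lt_of_eq_of_lt (lintegral_congr_ae ?_) (lintegral_neg_llr_lt_top h1)
      filter_upwards [h2] with x hx
      rw [hx]
    constructor
    · intro h3
      rw [relEntropy, if_neg]
      rintro ⟨-, h4⟩
      refine klDiv_ne_top h1 ?_ h3
      rw [integrable_congr h2]
      refine ⟨(measurable_llr M ν).aestronglyMeasurable, ?_⟩
      refine lt_of_le_of_lt ?_ (ENNReal.add_lt_top.2 ⟨h4, hneg⟩)
      rw [← lintegral_add_right _ (by fun_prop)]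
      refine lintegral_mono fun x => ?_
      rw [Real.enorm_eq_ofReal_abs]
      rcases le_total 0 (llr M ν x) with h0 | h0
      · rw [abs_of_nonneg h0]; exact le_self_add
      · rw [abs_of_nonpos h0]; exact le_add_self
    · intro h3
      have h4 := (klDiv_ne_top_iff.1 h3).2
      have h5 : Integrable (llr M ν) M := by rwa [← integrable_congr h2]
      have hpos : ∫⁻ x, ENNReal.ofReal (llr M ν x) ∂M < ∞ :=
        lt_of_le_of_lt (lintegral_ofReal_le_lintegral_enorm _) h5.2
      rw [relEntropy, if_pos ⟨h, hpos⟩, ent, integral_congr_ae h2,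
        integral_eq_lintegral_pos_part_sub_lintegral_neg_part h5]
      rw [EReal.coe_sub, EReal.coe_ennreal_toReal hpos.ne, EReal.coe_ennreal_toReal hneg.ne]
  · have h' : ¬ M ≪ ν.restrict G := fun h0 => h (h0.trans Measure.absolutelyContinuous_restrict)
    constructor
    · intro _
      rw [relEntropy, if_neg (by tauto)]
    · intro h3
      exact absurd (klDiv_of_not_ac h') h3

/-- Convexity in the first argument: Jensen's inequality for `klFun`, applied pointwise to the
densities with respect to `ν`. -/
theorem klDiv_average_le {ι : Type*} (s : Finset ι) (hs : s.Nonempty) (M : ι → Measure X)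
    (ν : Measure X) [∀ i, IsFiniteMeasure (M i)] [IsFiniteMeasure ν] :
    klDiv ((s.card : ℝ≥0∞)⁻¹ • ∑ i ∈ s, M i) ν ≤
      (s.card : ℝ≥0∞)⁻¹ * ∑ i ∈ s, klDiv (M i) ν := by
  have hc0 : (s.card : ℝ≥0∞) ≠ 0 := by simpa using hs.ne_empty
  have hct : (s.card : ℝ≥0∞) ≠ ∞ := ENNReal.natCast_ne_top _
  by_cases hac : ∀ i ∈ s, M i ≪ ν
  swap
  · push Not at hac
    obtain ⟨i, hi, hi2⟩ := hac
    have h1 : ∑ i ∈ s, klDiv (M i) ν = ∞ :=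
      ENNReal.sum_eq_top.2 ⟨i, hi, klDiv_of_not_ac hi2⟩
    rw [h1, ENNReal.mul_top (ENNReal.inv_ne_zero.2 hct)]
    exact le_top
  have hM : ∀ i ∈ s, ν.withDensity ((M i).rnDeriv ν) = M i := fun i hi =>
    Measure.withDensity_rnDeriv_eq _ _ (hac i hi)
  have hMeas : Measurable fun x => (s.card : ℝ≥0∞)⁻¹ * ∑ i ∈ s, (M i).rnDeriv ν x := by fun_prop
  have hav : (s.card : ℝ≥0∞)⁻¹ • ∑ i ∈ s, M i =
      ν.withDensity fun x => (s.card : ℝ≥0∞)⁻¹ * ∑ i ∈ s, (M i).rnDeriv ν x := by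
    ext A hA
    rw [withDensity_apply _ hA, lintegral_const_mul _ (by fun_prop),
      lintegral_finsetSum _ (by fun_prop), Measure.smul_apply, Measure.finsetSum_apply, smul_eq_mul]
    congr 1
    refine Finset.sum_congr rfl fun i hi => ?_
    rw [← withDensity_apply _ hA, hM i hi]
  have hac2 : (s.card : ℝ≥0∞)⁻¹ • ∑ i ∈ s, M i ≪ ν := by
    rw [hav]; exact withDensity_absolutelyContinuous _ _
  have : IsFiniteMeasure (∑ i ∈ s, M i) := by
    refine ⟨?_⟩
    rw [Measure.finsetSum_apply]
    exact ENNReal.sum_lt_top.2 fun i _ => measure_lt_top _ _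
  have : IsFiniteMeasure ((s.card : ℝ≥0∞)⁻¹ • ∑ i ∈ s, M i) :=
    Measure.smul_finite _ (ENNReal.inv_ne_top.2 hc0)
  rw [klDiv_eq_lintegral_klFun_of_ac hac2]
  have hrn : ((s.card : ℝ≥0∞)⁻¹ • ∑ i ∈ s, M i).rnDeriv ν =ᵐ[ν]
      fun x => (s.card : ℝ≥0∞)⁻¹ * ∑ i ∈ s, (M i).rnDeriv ν x := by
    rw [hav]; exact Measure.rnDeriv_withDensity _ hMeas
  have hfin : ∀ᵐ x ∂ν, ∀ i ∈ s, (M i).rnDeriv ν x < ∞ :=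
    (ae_ball_iff s.countable_toSet).2 fun i _ => Measure.rnDeriv_lt_top (M i) ν
  calc _ ≤ ∫⁻ x, (s.card : ℝ≥0∞)⁻¹ * ∑ i ∈ s,
          ENNReal.ofReal (klFun ((M i).rnDeriv ν x).toReal) ∂ν := by
        refine lintegral_mono_ae ?_
        filter_upwards [hrn, hfin] with x hx hx2
        rw [hx, ENNReal.toReal_mul, ENNReal.toReal_sum fun i hi => (hx2 i hi).ne]
        have hconv := convexOn_klFun.map_sum_le (t := s) (w := fun _ => ((s.card : ℝ))⁻¹)
          (p := fun i => ((M i).rnDeriv ν x).toReal) (fun _ _ => by positivity)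
          (by simp [hs.ne_empty])
          (fun _ _ => ENNReal.toReal_nonneg)
        simp only [smul_eq_mul, ← Finset.mul_sum] at hconv
        rw [← ENNReal.ofReal_sum_of_nonneg fun i _ => klFun_nonneg ENNReal.toReal_nonneg]
        have h1 : (s.card : ℝ≥0∞)⁻¹ = ENNReal.ofReal (s.card : ℝ)⁻¹ := by
          rw [ENNReal.ofReal_inv_of_pos (by simpa using hs), ENNReal.ofReal_natCast]
        rw [h1, ← ENNReal.ofReal_mul (by positivity),
          ENNReal.toReal_ofReal (by positivity)]
        exact ENNReal.ofReal_le_ofReal hconv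
    _ = _ := by
        rw [lintegral_const_mul _ (by fun_prop), lintegral_finsetSum _ (by fun_prop)]
        congr 1
        refine Finset.sum_congr rfl fun i hi => ?_
        rw [klDiv_eq_lintegral_klFun_of_ac (hac i hi)]

/-- Write `t = s ^ 2`. Then `(s - 1) ^ 2 ≤ klFun t`, the Hellinger bound, and `|t - 1| = |s - 1| *
(s + 1)` is split by the inequality between arithmetic and geometric means, weighted by `a`. -/
theorem abs_sub_one_le_klFun {a t : ℝ} (ha : 0 < a) (ht : 0 ≤ t) :
    |t - 1| ≤ a * klFun t + (2 * a)⁻¹ * (t + 1) := by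
  obtain ⟨s, hs, rfl⟩ : ∃ s, 0 ≤ s ∧ t = s ^ 2 := ⟨√t, Real.sqrt_nonneg t, (Real.sq_sqrt ht).symm⟩
  have h1 : (s - 1) ^ 2 ≤ klFun (s ^ 2) := by
    rcases hs.eq_or_lt with rfl | hs
    · simp [klFun]
    · rw [klFun_apply, Real.log_pow]
      have h2 := Real.one_sub_inv_le_log_of_pos hs
      have h3 : s ^ 2 * (1 - s⁻¹) ≤ s ^ 2 * Real.log s := by gcongr
      have h4 : s ^ 2 * (1 - s⁻¹) = s ^ 2 - s := by field_simp
      push_cast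
      nlinarith
  have h2 : |s ^ 2 - 1| = |s - 1| * (s + 1) := by
    rw [show s ^ 2 - 1 = (s - 1) * (s + 1) by ring, abs_mul, abs_of_pos (by linarith : 0 < s + 1)]
  have h3 : |s - 1| * (s + 1) ≤ a * (s - 1) ^ 2 + (4 * a)⁻¹ * (s + 1) ^ 2 := by
    have h4 : 0 ≤ (4 * a)⁻¹ * (2 * a * |s - 1| - (s + 1)) ^ 2 := by positivity
    have h5 : (4 * a)⁻¹ * (2 * a * |s - 1| - (s + 1)) ^ 2 =
        a * |s - 1| ^ 2 + (4 * a)⁻¹ * (s + 1) ^ 2 - |s - 1| * (s + 1) := by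
      field_simp; ring
    rw [sq_abs] at h5
    linarith
  have h4 : (4 * a)⁻¹ * (s + 1) ^ 2 ≤ (2 * a)⁻¹ * (s ^ 2 + 1) := by
    have : (2 * a)⁻¹ * (s ^ 2 + 1) = (4 * a)⁻¹ * (2 * (s ^ 2 + 1)) := by field_simp; ring
    rw [this]
    gcongr
    nlinarith [sq_nonneg (s - 1)]
  rw [h2]
  nlinarith

/-- A form of Pinsker's inequality. -/
theorem measureReal_sub_le_of_klDiv {M P : Measure X} [IsProbabilityMeasure M]
    [IsProbabilityMeasure P] {ε a : ℝ} (ha : 0 < a) (hε : 0 ≤ ε)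
    (h : klDiv M P ≤ ENNReal.ofReal ε) (D : Set X) :
    M.real D - P.real D ≤ a * ε + a⁻¹ := by
  have hne : klDiv M P ≠ ∞ := ne_top_of_le_ne_top ENNReal.ofReal_ne_top h
  obtain ⟨h1, h2⟩ := klDiv_ne_top_iff.1 hne
  have hk : Integrable (fun x => klFun (M.rnDeriv P x).toReal) P :=
    (integrable_klFun_rnDeriv_iff h1).2 h2
  have hr : Integrable (fun x => (M.rnDeriv P x).toReal) P := Measure.integrable_toReal_rnDeriv
  have hr1 : ∫ x, (M.rnDeriv P x).toReal ∂P = 1 := by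
    rw [Measure.integral_toReal_rnDeriv h1]; simp
  have hkε : ∫ x, klFun (M.rnDeriv P x).toReal ∂P ≤ ε := by
    rw [← toReal_klDiv_eq_integral_klFun h1]
    exact ENNReal.toReal_le_of_le_ofReal hε h
  have hMD : M.real D = ∫ x in D, (M.rnDeriv P x).toReal ∂P :=
    (Measure.setIntegral_toReal_rnDeriv h1 D).symm
  have hPD : P.real D = ∫ x in D, (1 : ℝ) ∂P := by simp
  -- The majorant has integral at most `a * ε + a⁻¹` over the whole space. The parameter `a` remains
  -- free; the best choice is the inverse square root of `ε`.
  have hi : Integrable (fun x => a * klFun (M.rnDeriv P x).toReal +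
      (2 * a)⁻¹ * ((M.rnDeriv P x).toReal + 1)) P :=
    (hk.const_mul a).add ((hr.add (integrable_const 1)).const_mul _)
  rw [hMD, hPD, ← integral_sub hr.integrableOn (integrable_const (1 : ℝ)).integrableOn]
  calc ∫ x in D, ((M.rnDeriv P x).toReal - 1) ∂P
      ≤ ∫ x in D, (a * klFun (M.rnDeriv P x).toReal +
          (2 * a)⁻¹ * ((M.rnDeriv P x).toReal + 1)) ∂P := by
        refine setIntegral_mono (hr.sub (integrable_const 1)).integrableOn hi.integrableOn ?_
        exact fun x => (le_abs_self _).trans (abs_sub_one_le_klFun ha ENNReal.toReal_nonneg)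
    _ ≤ ∫ x, (a * klFun (M.rnDeriv P x).toReal +
          (2 * a)⁻¹ * ((M.rnDeriv P x).toReal + 1)) ∂P := by
        refine setIntegral_le_integral hi (Eventually.of_forall fun x => ?_)
        have := klFun_nonneg (x := (M.rnDeriv P x).toReal) ENNReal.toReal_nonneg
        have := ENNReal.toReal_nonneg (a := M.rnDeriv P x)
        positivity
    _ = a * ∫ x, klFun (M.rnDeriv P x).toReal ∂P + (2 * a)⁻¹ * (1 + 1) := by
        have hr' : Integrable (fun x => (M.rnDeriv P x).toReal + 1) P :=
          hr.add (integrable_const 1)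
        rw [integral_add (hk.const_mul a) (hr'.const_mul _),
          integral_const_mul, integral_const_mul, integral_add hr (integrable_const 1), hr1]
        simp
    _ ≤ a * ε + a⁻¹ := by
        have : (2 * a)⁻¹ * (1 + 1) = a⁻¹ := by field_simp; norm_num
        rw [this]
        gcongr

/-- If the conditional laws `κ` and `η` are close in relative entropy, then they assign close
probabilities to events. -/
theorem lintegral_abs_sub_le_of_klDiv {m : Measure X} [IsProbabilityMeasure m] {κ η : Kernel X Y}
    [IsMarkovKernel κ] [IsMarkovKernel η] {ε a : ℝ} (ha : 0 < a) (hε : 0 ≤ ε)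
    (h : klDiv (m ⊗ₘ κ) (m ⊗ₘ η) ≤ ENNReal.ofReal ε) {D : Set (X × Y)} (hD : MeasurableSet D) :
    ∫⁻ x, ENNReal.ofReal |(κ x).real (Prod.mk x ⁻¹' D) - (η x).real (Prod.mk x ⁻¹' D)| ∂m ≤
      ENNReal.ofReal (2 * (a * ε + a⁻¹)) := by
  have meas : ∀ κ : Kernel X Y, IsMarkovKernel κ → ∀ {D : Set (X × Y)}, MeasurableSet D →
      Measurable fun x => (κ x).real (Prod.mk x ⁻¹' D) := fun κ _ D hD =>
    (Kernel.measurable_kernel_prodMk_left hD).ennreal_toReal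
  have key : ∀ D : Set (X × Y), MeasurableSet D →
      (∀ x, 0 ≤ (κ x).real (Prod.mk x ⁻¹' D) - (η x).real (Prod.mk x ⁻¹' D)) →
      ∫⁻ x, ENNReal.ofReal ((κ x).real (Prod.mk x ⁻¹' D) - (η x).real (Prod.mk x ⁻¹' D)) ∂m ≤
        ENNReal.ofReal (a * ε + a⁻¹) := by
    intro D hD hpos
    have hint : ∀ κ : Kernel X Y, IsMarkovKernel κ →
        Integrable (fun x => (κ x).real (Prod.mk x ⁻¹' D)) m := fun κ _ =>
      (integrable_const (1 : ℝ)).mono' (meas κ inferInstance hD).aestronglyMeasurable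
        (Eventually.of_forall fun x => by
          rw [Real.norm_of_nonneg measureReal_nonneg]; exact measureReal_le_one)
    have hcp : ∀ κ : Kernel X Y, IsMarkovKernel κ →
        ∫ x, (κ x).real (Prod.mk x ⁻¹' D) ∂m = (m ⊗ₘ κ).real D := fun κ _ => by
      rw [measureReal_def, Measure.compProd_apply hD, ← integral_toReal]
      · rfl
      · exact (Kernel.measurable_kernel_prodMk_left hD).aemeasurable
      · exact Eventually.of_forall fun x => measure_lt_top _ _
    have hsub : Integrable (fun x => (κ x).real (Prod.mk x ⁻¹' D) - (η x).real (Prod.mk x ⁻¹' D)) m :=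
      (hint κ inferInstance).sub (hint η inferInstance)
    rw [← ofReal_integral_eq_lintegral_ofReal hsub (Eventually.of_forall hpos), integral_sub (hint κ inferInstance) (hint η inferInstance),
      hcp κ inferInstance, hcp η inferInstance]
    exact ENNReal.ofReal_le_ofReal (measureReal_sub_le_of_klDiv ha hε h D)
  set g : X → ℝ := fun x => (κ x).real (Prod.mk x ⁻¹' D) - (η x).real (Prod.mk x ⁻¹' D) with hg
  have hgm : Measurable g := (meas κ inferInstance hD).sub (meas η inferInstance hD)
  have hA : MeasurableSet {x | 0 ≤ g x} := measurableSet_le measurable_const hgm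
  -- The difference of the kernels is split by its sign: `D₁` is `D` over the points where `κ`
  -- charges `D` at least as much as `η`, and `D₂` is the complement of `D` over the others. On each
  -- of them the fibrewise difference is nonnegative, so it integrates to a difference of joint
  -- probabilities, and Pinsker's inequality applies.
  set D₁ : Set (X × Y) := D ∩ Prod.fst ⁻¹' {x | 0 ≤ g x} with hD₁
  set D₂ : Set (X × Y) := Dᶜ ∩ Prod.fst ⁻¹' {x | 0 ≤ g x}ᶜ with hD₂
  have mD₁ : MeasurableSet D₁ := hD.inter (measurable_fst hA)
  have mD₂ : MeasurableSet D₂ := hD.compl.inter (measurable_fst hA.compl)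
  have e₁ : ∀ x, (κ x).real (Prod.mk x ⁻¹' D₁) - (η x).real (Prod.mk x ⁻¹' D₁) = max (g x) 0 := by
    intro x
    by_cases hx : 0 ≤ g x
    · have : Prod.mk x ⁻¹' D₁ = Prod.mk x ⁻¹' D := by ext y; simp [hD₁, hx]
      rw [this, max_eq_left hx]
    · have : Prod.mk x ⁻¹' D₁ = ∅ := by ext y; simp [hD₁, hx]
      rw [this, max_eq_right (not_le.1 hx).le]; simp
  have e₂ : ∀ x, (κ x).real (Prod.mk x ⁻¹' D₂) - (η x).real (Prod.mk x ⁻¹' D₂) =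
      max (-g x) 0 := by
    intro x
    by_cases hx : 0 ≤ g x
    · have : Prod.mk x ⁻¹' D₂ = ∅ := by ext y; simp [hD₂, hx]
      rw [this, max_eq_right (by linarith)]; simp
    · have : Prod.mk x ⁻¹' D₂ = (Prod.mk x ⁻¹' D)ᶜ := by ext y; simp [hD₂, hx]
      rw [this, max_eq_left (by linarith), probReal_compl_eq_one_sub (measurable_prodMk_left hD),
        probReal_compl_eq_one_sub (measurable_prodMk_left hD), hg]
      ring
  have k₁ := key D₁ mD₁ fun x => by rw [e₁]; exact le_max_right _ _
  have k₂ := key D₂ mD₂ fun x => by rw [e₂]; exact le_max_right _ _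
  simp only [e₁, e₂] at k₁ k₂
  have hsplit : ∀ x, ENNReal.ofReal |g x| =
      ENNReal.ofReal (max (g x) 0) + ENNReal.ofReal (max (-g x) 0) := by
    intro x
    rw [← ENNReal.ofReal_add (le_max_right _ _) (le_max_right _ _)]
    congr 1
    rcases le_total 0 (g x) with h0 | h0
    · rw [abs_of_nonneg h0, max_eq_left h0, max_eq_right (by linarith), add_zero]
    · rw [abs_of_nonpos h0, max_eq_right h0, max_eq_left (by linarith), zero_add]
  have hb : 0 ≤ a * ε + a⁻¹ := by positivity
  calc ∫⁻ x, ENNReal.ofReal |g x| ∂m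
      = ∫⁻ x, ENNReal.ofReal (max (g x) 0) ∂m + ∫⁻ x, ENNReal.ofReal (max (-g x) 0) ∂m := by
        simp_rw [hsplit]
        exact lintegral_add_left (by fun_prop) _
    _ ≤ ENNReal.ofReal (a * ε + a⁻¹) + ENNReal.ofReal (a * ε + a⁻¹) := add_le_add k₁ k₂
    _ = _ := by rw [← ENNReal.ofReal_add hb hb, two_mul]

end Entropy

/-! ### Energies and Boltzmann weights -/

section Weights

variable {d : ℕ} {k : HeightKind}

/-- The finite sets of vertices that meet `Λ` and are contained in `Δ`. -/
def meeting (Λ : Finset (Site d)) (Δ : Set (Site d)) : Set (Finset (Site d)) :=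
  {Γ | (Γ : Set (Site d)) ⊆ Δ ∧ ∃ x ∈ Γ, x ∈ Λ}

/-- The Boltzmann weight of the total energy of the sets in `𝒢`. -/
noncomputable def weight (Φ : Potential d k) (𝒢 : Set (Finset (Site d))) (φ : HeightFn d k) :
    ℝ≥0∞ := EReal.exp (-∑' Γ : 𝒢, Φ Γ φ)

theorem weight_meeting (Φ : Potential d k) (Λ : Finset (Site d)) (Δ : Set (Site d))
    (φ : HeightFn d k) : weight Φ (meeting Λ Δ) φ = EReal.exp (-hamiltonianIn Φ Λ Δ φ) := rfl

/-- A decomposition of a potential into a strong and a weak interaction, with all data fixed. -/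
structure Interaction (L : AddSubgroup (Site d)) (Φ : Potential d k) where
  Ψ : Potential d k
  Ξ : Potential d k
  strong : IsStrongInteraction L Ψ
  weak : IsWeakInteraction L Ξ
  sum : ∀ Λ φ, Φ Λ φ = Ψ Λ φ + Ξ Λ φ
  A : SimpleGraph (Site d)
  q : Site d → Site d → ℝ
  constraint : IsLocalLipschitzConstraint L A q
  lipschitz : IsLipschitzPotential Ψ A q
  R : ℕ
  range : ∀ Λ : Finset (Site d), (∃ x ∈ Λ, ∃ y ∈ Λ, R < dist1 x y) → ∀ φ, Ψ Λ φ = 0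

theorem IsStrongPlusWeak.nonempty_interaction {L : AddSubgroup (Site d)} {Φ : Potential d k}
    (h : IsStrongPlusWeak L Φ) : Nonempty (Interaction L Φ) := by
  obtain ⟨Ψ, Ξ, hs, hw, hsum⟩ := h
  obtain ⟨A, q, h1, h2, -, -⟩ := hs.lipschitz
  obtain ⟨R, hR⟩ := hs.finite_range
  exact ⟨⟨Ψ, Ξ, hs, hw, hsum, A, q, h1, h2, R, hR⟩⟩

theorem gradSigmaOn_le (Λ : Set (Site d)) : gradSigmaOn k Λ ≤ MeasurableSpace.pi := by
  refine iSup₂_le fun x _ => iSup₂_le fun y _ => ?_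
  refine Measurable.comap_le ?_
  fun_prop

theorem gradSigma_le : gradSigma d k ≤ MeasurableSpace.pi := by
  refine iSup₂_le fun x y => ?_
  refine Measurable.comap_le ?_
  fun_prop

/-- A function that is measurable with respect to `F^∇_Λ` only depends on height differences
within `Λ`. -/
theorem eq_of_measurable_gradSigmaOn {Λ : Set (Site d)} {f : HeightFn d k → EReal}
    (hf : Measurable[gradSigmaOn k Λ] f) {φ φ' : HeightFn d k}
    (h : ∀ x ∈ Λ, ∀ y ∈ Λ, φ y - φ x = φ' y - φ' x) : f φ = f φ' := by
  -- The σ-algebra of all sets that do not separate `φ` from `φ'`. It contains the generators, hence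
  -- all of `F^∇_Λ`.
  let m : MeasurableSpace (HeightFn d k) :=
    { MeasurableSet' := fun A => φ ∈ A ↔ φ' ∈ A
      measurableSet_empty := Iff.rfl
      measurableSet_compl := fun A hA => not_congr hA
      measurableSet_iUnion := fun A hA => by
        simp only [Set.mem_iUnion]
        exact exists_congr hA }
  have hm : gradSigmaOn k Λ ≤ m := by
    refine iSup₂_le fun x hx => iSup₂_le fun y hy => ?_
    rintro _ ⟨B, -, rfl⟩
    change (φ y - φ x ∈ B ↔ φ' y - φ' x ∈ B)
    rw [h x hx y hy]
  have h1 : MeasurableSet[m] (f ⁻¹' {f φ}) := hm _ (hf (measurableSet_singleton _))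
  exact ((h1 : φ ∈ f ⁻¹' {f φ} ↔ φ' ∈ f ⁻¹' {f φ}).1 rfl).symm

/-- `𝒢` is thin if there is a finite set that meets all its elements. -/
def IsThin (𝒢 : Set (Finset (Site d))) : Prop := ∃ V : Finset (Site d), ∀ Γ ∈ 𝒢, ∃ x ∈ Γ, x ∈ V

theorem isThin_meeting (Λ : Finset (Site d)) (Δ : Set (Site d)) : IsThin (meeting Λ Δ) :=
  ⟨Λ, fun _ h => h.2⟩

theorem IsThin.mono {𝒢 𝒢' : Set (Finset (Site d))} (h : IsThin 𝒢) (hs : 𝒢' ⊆ 𝒢) : IsThin 𝒢' :=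
  h.imp fun _ hV Γ hΓ => hV Γ (hs hΓ)

/-- A finite neighbourhood of `V` in the square lattice. -/
noncomputable def thicken (R : ℕ) (V : Finset (Site d)) : Finset (Site d) :=
  V.biUnion fun x => Fintype.piFinset fun i => Finset.Icc (x i - R) (x i + R)

theorem mem_thicken {R : ℕ} {V : Finset (Site d)} {y : Site d} :
    y ∈ thicken R V ↔ ∃ x ∈ V, ∀ i, |y i - x i| ≤ R := by
  simp only [thicken, Finset.mem_biUnion, Fintype.mem_piFinset, Finset.mem_Icc, abs_le]
  refine exists_congr fun x => and_congr_right fun _ => forall_congr' fun i => ?_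
  constructor <;> rintro ⟨h1, h2⟩ <;> constructor <;> linarith

theorem subset_thicken (R : ℕ) (V : Finset (Site d)) : V ⊆ thicken R V := fun x hx =>
  mem_thicken.2 ⟨x, hx, fun i => by simp⟩

theorem abs_sub_le_dist1 (x y : Site d) (i : Fin d) : |y i - x i| ≤ dist1 x y := by
  have : (x i - y i).natAbs ≤ dist1 x y :=
    Finset.single_le_sum (f := fun i => (x i - y i).natAbs) (fun _ _ => Nat.zero_le _)
      (Finset.mem_univ i)
  rw [abs_sub_comm, Int.abs_eq_natAbs]
  exact_mod_cast this

namespace Interaction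

variable {L : AddSubgroup (Site d)} {Φ : Potential d k} (I : Interaction L Φ)

theorem weak_ne_top_bot (Γ : Finset (Site d)) (φ : HeightFn d k) : (I.Ξ Γ φ).abs ≠ ∞ := by
  rcases Γ.eq_empty_or_nonempty with rfl | ⟨x, hx⟩
  · rw [I.weak.periodicGradient.trivial_zero _ (by simp)]; simp
  · have h1 : (I.Ξ Γ φ).abs ≤ potentialNorm I.Ξ := by
      refine le_trans ?_ (le_iSup₂ (f := fun (x : Site d) (φ : HeightFn d k) =>
        ∑' Λ : {Λ : Finset (Site d) // x ∈ Λ}, (I.Ξ Λ.1 φ).abs) x φ)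
      exact ENNReal.le_tsum (f := fun Λ : {Λ : Finset (Site d) // x ∈ Λ} => (I.Ξ Λ.1 φ).abs)
        ⟨Γ, hx⟩
    exact ne_top_of_le_ne_top I.weak.summable.ne h1

theorem coe_toReal_weak (Γ : Finset (Site d)) (φ : HeightFn d k) :
    (((I.Ξ Γ φ).toReal : ℝ) : EReal) = I.Ξ Γ φ := by
  refine EReal.coe_toReal ?_ ?_
  · intro h; exact I.weak_ne_top_bot Γ φ (by rw [h]; rfl)
  · intro h; exact I.weak_ne_top_bot Γ φ (by rw [h]; rfl)

theorem abs_weak (Γ : Finset (Site d)) (φ : HeightFn d k) :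
    (I.Ξ Γ φ).abs = ENNReal.ofReal |(I.Ξ Γ φ).toReal| := by
  conv_lhs => rw [← I.coe_toReal_weak]
  rfl

/-- The total strong energy of the sets in `𝒢`. -/
noncomputable def strongEnergy (𝒢 : Set (Finset (Site d))) (φ : HeightFn d k) : ℝ≥0∞ :=
  ∑' Γ : 𝒢, (I.Ψ Γ φ).toENNReal

/-- The sum of the absolute values of the weak energies of the sets in `𝒢`. -/
noncomputable def weakAbs (𝒢 : Set (Finset (Site d))) (φ : HeightFn d k) : ℝ≥0∞ :=
  ∑' Γ : 𝒢, (I.Ξ Γ φ).abs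

/-- The total weak energy of the sets in `𝒢`. -/
noncomputable def weakEnergy (𝒢 : Set (Finset (Site d))) (φ : HeightFn d k) : ℝ :=
  (∑' Γ : 𝒢, ENNReal.ofReal (I.Ξ Γ φ).toReal).toReal -
    (∑' Γ : 𝒢, ENNReal.ofReal (-(I.Ξ Γ φ).toReal)).toReal

/-- A uniform bound on the weak energy of the sets that meet `V`. -/
noncomputable def weakBound (V : Finset (Site d)) : ℝ := V.card * (potentialNorm I.Ξ).toReal

theorem weakBound_nonneg (V : Finset (Site d)) : 0 ≤ I.weakBound V := by
  unfold weakBound; positivity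

/-- Every set is charged to one of its vertices in `V`, and every vertex carries at most the norm of
the weak interaction. -/
theorem weakAbs_le_of_meets {𝒢 : Set (Finset (Site d))} {V : Finset (Site d)}
    (h : ∀ Γ ∈ 𝒢, ∃ x ∈ Γ, x ∈ V) (φ : HeightFn d k) :
    I.weakAbs 𝒢 φ ≤ ENNReal.ofReal (I.weakBound V) := by
  calc I.weakAbs 𝒢 φ ≤ ∑' p : (Σ x : V, {Λ : Finset (Site d) // (x : Site d) ∈ Λ}),
          (I.Ξ p.2.1 φ).abs := by
        have hc : ∀ Γ : 𝒢, ∃ x : V, (x : Site d) ∈ (Γ : Finset (Site d)) := fun Γ => by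
          obtain ⟨x, hx, hxV⟩ := h Γ Γ.2
          exact ⟨⟨x, hxV⟩, hx⟩
        choose g hg using hc
        refine ENNReal.tsum_comp_le_tsum_of_injective
          (f := fun Γ : 𝒢 => (⟨g Γ, ⟨Γ, hg Γ⟩⟩ :
            Σ x : V, {Λ : Finset (Site d) // (x : Site d) ∈ Λ})) ?_ (fun p => (I.Ξ p.2.1 φ).abs)
        intro Γ Γ' he
        exact Subtype.ext (congrArg (fun p : Σ x : V, {Λ : Finset (Site d) // (x : Site d) ∈ Λ} =>
          (p.2 : Finset (Site d))) he)
    _ = ∑ x : V, ∑' Λ : {Λ : Finset (Site d) // (x : Site d) ∈ Λ}, (I.Ξ Λ.1 φ).abs := by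
        rw [ENNReal.tsum_sigma' (fun p : Σ x : V, {Λ : Finset (Site d) // (x : Site d) ∈ Λ} =>
          (I.Ξ p.2.1 φ).abs), tsum_fintype]
    _ ≤ ∑ x : V, potentialNorm I.Ξ := by
        refine Finset.sum_le_sum fun x _ => ?_
        exact le_iSup₂ (f := fun (x : Site d) (φ : HeightFn d k) =>
          ∑' Λ : {Λ : Finset (Site d) // x ∈ Λ}, (I.Ξ Λ.1 φ).abs) (x : Site d) φ
    _ = ENNReal.ofReal (I.weakBound V) := by
        rw [weakBound, ENNReal.ofReal_mul (by positivity), ENNReal.ofReal_natCast,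
          ENNReal.ofReal_toReal I.weak.summable.ne]
        simp

/-- The exterior bound of `V` as a real number. -/
noncomputable def extBound (V : Finset (Site d)) : ℝ := (lowerExteriorBound I.Ξ V).toReal

theorem extBound_nonneg (V : Finset (Site d)) : 0 ≤ I.extBound V := ENNReal.toReal_nonneg

theorem weakAbs_le_of_crosses {𝒢 : Set (Finset (Site d))} {V : Finset (Site d)}
    (h : ∀ Γ ∈ 𝒢, (∃ x ∈ Γ, x ∈ V) ∧ ∃ x ∈ Γ, x ∉ V) (φ : HeightFn d k) :
    I.weakAbs 𝒢 φ ≤ ENNReal.ofReal (I.extBound V) := by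
  rw [extBound, ENNReal.ofReal_toReal (I.weak.amenable.finite V).ne]
  refine le_trans ?_ (le_iSup (f := fun φ : HeightFn d k =>
    ∑' Δ : {Δ : Finset (Site d) // (∃ x ∈ Δ, x ∈ V) ∧ ∃ x ∈ Δ, x ∉ V}, (I.Ξ Δ.1 φ).abs) φ)
  exact ENNReal.tsum_comp_le_tsum_of_injective
    (f := fun Γ : 𝒢 => (⟨Γ, h Γ Γ.2⟩ :
      {Δ : Finset (Site d) // (∃ x ∈ Δ, x ∈ V) ∧ ∃ x ∈ Δ, x ∉ V}))
    (fun Γ Γ' he => Subtype.ext (congrArg (fun p :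
      {Δ : Finset (Site d) // (∃ x ∈ Δ, x ∈ V) ∧ ∃ x ∈ Δ, x ∉ V} => (p : Finset (Site d))) he)) (fun Δ => (I.Ξ Δ.1 φ).abs)

theorem weakAbs_lt_top {𝒢 : Set (Finset (Site d))} (h : IsThin 𝒢) (φ : HeightFn d k) :
    I.weakAbs 𝒢 φ < ∞ := by
  obtain ⟨V, hV⟩ := h
  exact (I.weakAbs_le_of_meets hV φ).trans_lt ENNReal.ofReal_lt_top

theorem hasSum_weakEnergy {𝒢 : Set (Finset (Site d))} (h : IsThin 𝒢) (φ : HeightFn d k) :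
    HasSum (fun Γ : 𝒢 => (I.Ξ Γ φ).toReal) (I.weakEnergy 𝒢 φ) := by
  have h0 := (I.weakAbs_lt_top h φ).ne
  have h1 : ∑' Γ : 𝒢, ENNReal.ofReal (I.Ξ Γ φ).toReal ≠ ∞ := by
    refine ne_top_of_le_ne_top h0 (ENNReal.tsum_le_tsum fun Γ => ?_)
    rw [I.abs_weak]; exact ENNReal.ofReal_le_ofReal (le_abs_self _)
  have h2 : ∑' Γ : 𝒢, ENNReal.ofReal (-(I.Ξ Γ φ).toReal) ≠ ∞ := by
    refine ne_top_of_le_ne_top h0 (ENNReal.tsum_le_tsum fun Γ => ?_)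
    rw [I.abs_weak]; exact ENNReal.ofReal_le_ofReal (neg_le_abs _)
  have h3 := (ENNReal.hasSum_toReal h1).sub (ENNReal.hasSum_toReal h2)
  rw [← ENNReal.tsum_toReal_eq fun _ => ENNReal.ofReal_ne_top,
    ← ENNReal.tsum_toReal_eq fun _ => ENNReal.ofReal_ne_top] at h3
  refine (iff_of_eq (congrArg (fun f => HasSum f (I.weakEnergy 𝒢 φ)) (funext fun Γ => ?_))).1 h3
  rcases le_total 0 (I.Ξ Γ φ).toReal with h | h
  · rw [ENNReal.toReal_ofReal h, ENNReal.ofReal_of_nonpos (by linarith)]; simp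
  · rw [ENNReal.ofReal_of_nonpos h, ENNReal.toReal_ofReal (neg_nonneg.2 h)]; simp

theorem abs_weakEnergy_le {𝒢 : Set (Finset (Site d))} (φ : HeightFn d k) {c : ℝ}
    (hth : IsThin 𝒢) (hc : 0 ≤ c) (h : I.weakAbs 𝒢 φ ≤ ENNReal.ofReal c) :
    |I.weakEnergy 𝒢 φ| ≤ c := by
  have hs := I.hasSum_weakEnergy hth φ
  have h0 : I.weakAbs 𝒢 φ ≠ ∞ := ne_top_of_le_ne_top ENNReal.ofReal_ne_top h
  have h1 : Summable fun Γ : 𝒢 => |(I.Ξ Γ φ).toReal| := by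
    have := ENNReal.summable_toReal h0
    refine this.congr fun Γ => ?_
    rw [I.abs_weak, ENNReal.toReal_ofReal (abs_nonneg _)]
  have h2 : ∑' Γ : 𝒢, |(I.Ξ Γ φ).toReal| ≤ c := by
    have h3 := ENNReal.toReal_mono ENNReal.ofReal_ne_top h
    rw [ENNReal.toReal_ofReal hc, weakAbs, ENNReal.tsum_toReal_eq] at h3
    · refine le_trans (le_of_eq ?_) h3
      refine tsum_congr fun Γ => ?_
      rw [I.abs_weak, ENNReal.toReal_ofReal (abs_nonneg _)]
    · exact fun Γ => I.weak_ne_top_bot _ _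
  rw [← hs.tsum_eq]
  refine le_trans ?_ h2
  have := norm_tsum_le_tsum_norm (f := fun Γ : 𝒢 => (I.Ξ Γ φ).toReal) h1
  simpa only [Real.norm_eq_abs] using this

/-- The energy is defined as a sum in `EReal`, where addition is not continuous everywhere. Here the
strong part converges in `[0, ∞]` and the weak part converges absolutely to a real number, and
addition is continuous at such a pair. -/
theorem tsum_energy {𝒢 : Set (Finset (Site d))} (h : IsThin 𝒢) (φ : HeightFn d k) :
    ∑' Γ : 𝒢, Φ Γ φ = (I.strongEnergy 𝒢 φ : EReal) + (I.weakEnergy 𝒢 φ : ℝ) := by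
  have h1 : HasSum (fun Γ : 𝒢 => (((I.Ψ Γ φ).toENNReal : ℝ≥0∞) : EReal))
      (I.strongEnergy 𝒢 φ : EReal) := by
    have h0 : HasSum (fun Γ : 𝒢 => (I.Ψ Γ φ).toENNReal) (I.strongEnergy 𝒢 φ) :=
      ENNReal.summable.hasSum
    exact h0.map (⟨⟨((↑) : ℝ≥0∞ → EReal), EReal.coe_ennreal_zero⟩, EReal.coe_ennreal_add⟩ :
      ℝ≥0∞ →+ EReal) continuous_coe_ennreal_ereal
  have h2 : HasSum (fun Γ : 𝒢 => (((I.Ξ Γ φ).toReal : ℝ) : EReal))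
      ((I.weakEnergy 𝒢 φ : ℝ) : EReal) :=
    (I.hasSum_weakEnergy h φ).map (⟨⟨((↑) : ℝ → EReal), EReal.coe_zero⟩, EReal.coe_add⟩ :
      ℝ →+ EReal) continuous_coe_real_ereal
  have h3 : HasSum (fun Γ : 𝒢 => Φ Γ φ)
      ((I.strongEnergy 𝒢 φ : EReal) + (I.weakEnergy 𝒢 φ : ℝ)) := by
    have hc := EReal.continuousAt_add (p := ((I.strongEnergy 𝒢 φ : EReal),
      ((I.weakEnergy 𝒢 φ : ℝ) : EReal))) (Or.inr (EReal.coe_ne_bot _))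
      (Or.inr (EReal.coe_ne_top _))
    have ht := hc.tendsto.comp (Filter.Tendsto.prodMk_nhds h1 h2)
    refine ht.congr fun s => ?_
    simp only [Function.comp_apply]
    rw [← Finset.sum_add_distrib]
    refine Finset.sum_congr rfl fun Γ _ => ?_
    rw [EReal.coe_toENNReal (I.strong.nonneg _ _), I.coe_toReal_weak, I.sum]
  exact h3.tsum_eq

/-- The first factor lies in `[0, 1]` and carries the Lipschitz constraint. The second factor is
bounded away from `0` and `∞`, uniformly in the height function. -/
theorem weight_eq {𝒢 : Set (Finset (Site d))} (h : IsThin 𝒢) (φ : HeightFn d k) :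
    weight Φ 𝒢 φ = EReal.exp (-(I.strongEnergy 𝒢 φ : EReal)) *
      ENNReal.ofReal (Real.exp (-I.weakEnergy 𝒢 φ)) := by
  rw [weight, I.tsum_energy h, EReal.neg_add (Or.inr (EReal.coe_ne_top _))
    (Or.inr (EReal.coe_ne_bot _)), sub_eq_add_neg, EReal.exp_add, ← EReal.coe_neg, EReal.exp_coe]

theorem strongEnergy_union {𝒢 𝒢' : Set (Finset (Site d))} (h : Disjoint 𝒢 𝒢')
    (φ : HeightFn d k) :
    I.strongEnergy (𝒢 ∪ 𝒢') φ = I.strongEnergy 𝒢 φ + I.strongEnergy 𝒢' φ :=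
  ENNReal.summable.tsum_union_disjoint (f := fun Γ => (I.Ψ Γ φ).toENNReal) h ENNReal.summable

theorem weakEnergy_union {𝒢 𝒢' : Set (Finset (Site d))} (h : Disjoint 𝒢 𝒢')
    (hth : IsThin (𝒢 ∪ 𝒢')) (φ : HeightFn d k) :
    I.weakEnergy (𝒢 ∪ 𝒢') φ = I.weakEnergy 𝒢 φ + I.weakEnergy 𝒢' φ := by
  have h1 := I.hasSum_weakEnergy (hth.mono Set.subset_union_left) φ
  have h2 := I.hasSum_weakEnergy (hth.mono Set.subset_union_right) φ
  rw [← (I.hasSum_weakEnergy hth φ).tsum_eq, ← h1.tsum_eq, ← h2.tsum_eq]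
  exact h1.summable.tsum_union_disjoint (f := fun Γ => (I.Ξ Γ φ).toReal) h h2.summable

include I in
theorem weight_union {𝒢 𝒢' : Set (Finset (Site d))} (h : Disjoint 𝒢 𝒢')
    (hth : IsThin (𝒢 ∪ 𝒢')) (φ : HeightFn d k) :
    weight Φ (𝒢 ∪ 𝒢') φ = weight Φ 𝒢 φ * weight Φ 𝒢' φ := by
  rw [I.weight_eq hth, I.weight_eq (hth.mono Set.subset_union_left),
    I.weight_eq (hth.mono Set.subset_union_right), I.strongEnergy_union h,
    I.weakEnergy_union h hth, EReal.coe_ennreal_add, EReal.neg_add, sub_eq_add_neg, EReal.exp_add,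
    neg_add, Real.exp_add, ENNReal.ofReal_mul (Real.exp_pos _).le]
  · ring
  · exact Or.inl (by simp)
  · exact Or.inr (by simp)

include I in
theorem measurable_weight {𝒢 : Set (Finset (Site d))} (h : IsThin 𝒢) :
    Measurable (weight Φ 𝒢) := by
  have hf : weight Φ 𝒢 = fun φ => EReal.exp (-(I.strongEnergy 𝒢 φ : EReal)) *
      ENNReal.ofReal (Real.exp (-I.weakEnergy 𝒢 φ)) := funext fun φ => I.weight_eq h φ
  have m1 : ∀ Γ, Measurable (I.Ψ Γ) := fun Γ =>
    (I.strong.periodicGradient.measurable Γ).mono (gradSigmaOn_le _) le_rfl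
  have m2 : ∀ Γ, Measurable (I.Ξ Γ) := fun Γ =>
    (I.weak.periodicGradient.measurable Γ).mono (gradSigmaOn_le _) le_rfl
  have m3 : Measurable (I.strongEnergy 𝒢) :=
    Measurable.tsum fun Γ => (m1 Γ).ereal_toENNReal
  have m4 : Measurable (I.weakEnergy 𝒢) := by
    refine Measurable.sub ?_ ?_
    · exact (Measurable.tsum (L := .unconditional 𝒢) fun Γ : 𝒢 =>
        (m2 Γ).ereal_toReal.ennreal_ofReal).ennreal_toReal
    · exact (Measurable.tsum (L := .unconditional 𝒢) fun Γ : 𝒢 =>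
        (m2 Γ).ereal_toReal.neg.ennreal_ofReal).ennreal_toReal
  rw [hf]
  refine Measurable.mul ?_ (by fun_prop)
  exact EReal.measurable_exp.comp m3.coe_ereal_ennreal.neg

theorem exp_neg_coe_le_one (a : ℝ≥0∞) : EReal.exp (-(a : EReal)) ≤ 1 := by
  rw [← EReal.exp_zero]
  exact EReal.exp_monotone (by simpa using EReal.coe_ennreal_nonneg a)

include I in
theorem weight_lt_top {𝒢 : Set (Finset (Site d))} (h : IsThin 𝒢) (φ : HeightFn d k) :
    weight Φ 𝒢 φ < ∞ := by
  rw [I.weight_eq h]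
  exact ENNReal.mul_lt_top ((exp_neg_coe_le_one _).trans_lt ENNReal.one_lt_top)
    ENNReal.ofReal_lt_top

theorem weight_le {𝒢 : Set (Finset (Site d))} (hth : IsThin 𝒢) {φ : HeightFn d k} {c : ℝ}
    (hc : 0 ≤ c) (h : I.weakAbs 𝒢 φ ≤ ENNReal.ofReal c) :
    weight Φ 𝒢 φ ≤ ENNReal.ofReal (Real.exp c) := by
  rw [I.weight_eq hth]
  refine (mul_le_mul_left (exp_neg_coe_le_one _) _).trans ?_
  rw [one_mul]
  apply ENNReal.ofReal_le_ofReal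
  have := (abs_le.1 (I.abs_weakEnergy_le φ hth hc h)).1
  gcongr; linarith

theorem le_weight {𝒢 : Set (Finset (Site d))} (hth : IsThin 𝒢) {φ : HeightFn d k} {c : ℝ}
    (hc : 0 ≤ c) (h : I.weakAbs 𝒢 φ ≤ ENNReal.ofReal c) (hΨ : ∀ Γ ∈ 𝒢, I.Ψ Γ φ = 0) :
    ENNReal.ofReal (Real.exp (-c)) ≤ weight Φ 𝒢 φ := by
  have h0 : I.strongEnergy 𝒢 φ = 0 := by
    rw [strongEnergy, ENNReal.tsum_eq_zero]
    intro Γ; rw [hΨ Γ Γ.2]; simp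
  rw [I.weight_eq hth, h0]
  simp only [EReal.coe_ennreal_zero, neg_zero, EReal.exp_zero, one_mul]
  apply ENNReal.ofReal_le_ofReal
  have := (abs_le.1 (I.abs_weakEnergy_le φ hth hc h)).2
  gcongr

include I in
theorem potential_congr {Γ : Finset (Site d)} {φ φ' : HeightFn d k}
    (h : ∀ x ∈ Γ, ∀ y ∈ Γ, φ y - φ x = φ' y - φ' x) : Φ Γ φ = Φ Γ φ' := by
  rw [I.sum, I.sum, eq_of_measurable_gradSigmaOn (I.strong.periodicGradient.measurable Γ) h,
    eq_of_measurable_gradSigmaOn (I.weak.periodicGradient.measurable Γ) h]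

include I in
theorem weight_congr {𝒢 : Set (Finset (Site d))} {φ φ' : HeightFn d k}
    (h : ∀ Γ ∈ 𝒢, ∀ x ∈ Γ, ∀ y ∈ Γ, φ y - φ x = φ' y - φ' x) :
    weight Φ 𝒢 φ = weight Φ 𝒢 φ' := by
  unfold weight
  congr 2
  exact tsum_congr fun Γ => I.potential_congr (h Γ Γ.2)

include I in
theorem weight_add_const (𝒢 : Set (Finset (Site d))) (φ : HeightFn d k) (c : k.E) :
    weight Φ 𝒢 (φ + fun _ => c) = weight Φ 𝒢 φ :=
  I.weight_congr fun Γ _ x _ y _ => by simp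

include I in
theorem potential_translate {v : Site d} (hv : v ∈ L) (Γ : Finset (Site d)) (φ : HeightFn d k) :
    Φ (translateSet v Γ) φ = Φ Γ (shift v φ) := by
  rw [I.sum, I.sum, I.strong.periodicGradient.periodic v hv, I.weak.periodicGradient.periodic v hv]

end Interaction

theorem mem_translateSet {v x : Site d} {Γ : Finset (Site d)} :
    x ∈ translateSet v Γ ↔ x - v ∈ Γ := by
  simp only [translateSet, Finset.mem_map, addRightEmbedding_apply]
  constructor
  · rintro ⟨y, hy, rfl⟩; simpa using hy
  · intro h; exact ⟨x - v, h, by simp⟩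

theorem translateSet_translateSet (v w : Site d) (Γ : Finset (Site d)) :
    translateSet v (translateSet w Γ) = translateSet (v + w) Γ := by
  ext x; simp only [mem_translateSet, sub_sub]

theorem translateSet_zero (Γ : Finset (Site d)) : translateSet 0 Γ = Γ := by
  ext x; simp [mem_translateSet]

/-- Translation of finite sets as a permutation. -/
noncomputable def translateEquiv (v : Site d) : Finset (Site d) ≃ Finset (Site d) where
  toFun := translateSet v
  invFun := translateSet (-v)
  left_inv Γ := by rw [translateSet_translateSet, neg_add_cancel, translateSet_zero]
  right_inv Γ := by rw [translateSet_translateSet, add_neg_cancel, translateSet_zero]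

theorem Interaction.weight_shift {L : AddSubgroup (Site d)} {Φ : Potential d k}
    (I : Interaction L Φ) {v : Site d} (hv : v ∈ L) (V : Finset (Site d)) (Δ : Set (Site d))
    (φ : HeightFn d k) :
    weight Φ (meeting (translateSet v V) ((fun x => x - v) ⁻¹' Δ)) φ =
      weight Φ (meeting V Δ) (shift v φ) := by
  unfold weight
  congr 2
  have hm : ∀ Γ, Γ ∈ meeting V Δ ↔
      translateEquiv v Γ ∈ meeting (translateSet v V) ((fun x => x - v) ⁻¹' Δ) := by
    intro Γ
    change _ ↔ translateSet v Γ ∈ _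
    simp only [meeting, Set.mem_ofPred_eq, Set.subset_def, Finset.mem_coe, mem_translateSet,
      Set.mem_preimage]
    constructor
    · rintro ⟨h1, x, hx, hx2⟩
      exact ⟨fun y hy => h1 _ hy, x + v, by simpa using hx, by simpa using hx2⟩
    · rintro ⟨h1, x, hx, hx2⟩
      exact ⟨fun y hy => by simpa using h1 (y + v) (by simpa using hy), _, hx, hx2⟩
  have := ((translateEquiv v).subtypeEquiv hm).tsum_eq
    (fun Γ : meeting (translateSet v V) ((fun x => x - v) ⁻¹' Δ) => Φ Γ φ)
  rw [← this]
  exact tsum_congr fun Γ => I.potential_translate hv Γ φ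

end Weights

/-! ### Lipschitz functions -/

section Lipschitz

variable {d : ℕ} {k : HeightKind} {L : AddSubgroup (Site d)} {Φ : Potential d k}

theorem index_smul_mem (L : AddSubgroup (Site d)) (z : Site d) :
    (fun i => (L.index : ℤ) * z i) ∈ L := by
  have h := L.nsmul_index_mem z
  convert h using 1
  ext i
  simp

/-- Division with remainder by the index in every coordinate: all multiples of the index lie in `L`.
-/
theorem exists_mem_box (hL : L.FiniteIndex) (x : Site d) :
    ∃ v ∈ L, x - v ∈ box d L.index := by
  have hN : (0 : ℤ) < L.index := by
    have := hL.index_ne_zero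
    omega
  refine ⟨fun i => (L.index : ℤ) * (x i / L.index), index_smul_mem L _, ?_⟩
  simp only [box, Fintype.mem_piFinset, Finset.mem_Ico, Pi.sub_apply]
  intro i
  have := Int.emod_add_mul_ediv (x i) L.index
  have h1 := Int.emod_nonneg (x i) hN.ne'
  have h2 := Int.emod_lt_of_pos (x i) hN
  constructor <;> linarith

/-- A periodic family of bounds is uniform. -/
theorem exists_uniform_bound (hL : L.FiniteIndex) (P : Site d → ℝ → Prop)
    (hmono : ∀ x a b, a ≤ b → P x a → P x b) (hper : ∀ v ∈ L, ∀ x a, P x a → P (x + v) a)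
    (h : ∀ x, ∃ a, P x a) : ∃ a, 0 ≤ a ∧ ∀ x, P x a := by
  choose f hf using h
  refine ⟨∑ x ∈ box d L.index, |f x|, Finset.sum_nonneg fun _ _ => abs_nonneg _, fun x => ?_⟩
  obtain ⟨v, hv, hx⟩ := exists_mem_box hL x
  have h1 : P (x - v) (∑ x ∈ box d L.index, |f x|) := by
    refine hmono _ (f (x - v)) _ ?_ (hf _)
    exact (le_abs_self _).trans
      (Finset.single_le_sum (f := fun x => |f x|) (fun _ _ => abs_nonneg _) hx)
  simpa using hper v hv _ _ h1

namespace Interaction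

variable (I : Interaction L Φ)

theorem strong_eq_zero_of_not_subset {V Γ : Finset (Site d)} (h : ∃ x ∈ Γ, x ∈ V)
    (h2 : ¬ Γ ⊆ thicken I.R V) (φ : HeightFn d k) : I.Ψ Γ φ = 0 := by
  obtain ⟨x, hx, hxV⟩ := h
  refine I.range Γ ?_ φ
  by_contra! hcon
  refine h2 fun y hy => mem_thicken.2 ⟨x, hxV, fun i => ?_⟩
  exact (abs_sub_le_dist1 x y i).trans (by exact_mod_cast hcon x hx y hy)

/-- By finite range only finitely many of the sets that meet `V` contribute, so an infinite sum has
an infinite term. -/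
theorem strongEnergy_ne_top_iff {𝒢 : Set (Finset (Site d))} (hth : IsThin 𝒢)
    (φ : HeightFn d k) : I.strongEnergy 𝒢 φ ≠ ∞ ↔ ∀ Γ ∈ 𝒢, I.Ψ Γ φ ≠ ⊤ := by
  obtain ⟨V, hV⟩ := hth
  constructor
  · intro h Γ hΓ h2
    refine h (top_unique ?_)
    calc ∞ = (I.Ψ Γ φ).toENNReal := by rw [h2]; simp
      _ ≤ _ := ENNReal.le_tsum (f := fun Γ : 𝒢 => (I.Ψ Γ φ).toENNReal) ⟨Γ, hΓ⟩
  · intro h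
    have hfin : {Γ : 𝒢 | (Γ : Finset (Site d)) ⊆ thicken I.R V}.Finite := by
      refine Set.Finite.preimage Subtype.val_injective.injOn
        (s := {Γ : Finset (Site d) | Γ ⊆ thicken I.R V}) ?_
      exact (Finset.finite_toSet (thicken I.R V).powerset).subset fun Γ hΓ => by simpa using hΓ
    rw [strongEnergy, tsum_eq_sum (s := hfin.toFinset)]
    · refine ENNReal.sum_ne_top.2 fun Γ _ => ?_
      exact (EReal.toENNReal_ne_top_iff).2 (h Γ Γ.2)
    · intro Γ hΓ
      rw [I.strong_eq_zero_of_not_subset (hV Γ Γ.2) (fun h2 => hΓ (by simpa using h2))]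
      simp

theorem weight_ne_zero_iff_strong {𝒢 : Set (Finset (Site d))} (hth : IsThin 𝒢)
    (φ : HeightFn d k) : weight Φ 𝒢 φ ≠ 0 ↔ ∀ Γ ∈ 𝒢, I.Ψ Γ φ ≠ ⊤ := by
  rw [← I.strongEnergy_ne_top_iff hth, I.weight_eq hth]
  simp [Real.exp_pos]

/-- The local Lipschitz inequalities on the edges with an end in `V` and both ends in `Δ`. -/
def EdgeLip (V : Set (Site d)) (Δ : Set (Site d)) (φ : HeightFn d k) : Prop :=
  ∀ x y, I.A.Adj x y → x ∈ Δ → y ∈ Δ → (x ∈ V ∨ y ∈ V) → k.val (φ y - φ x) ≤ I.q x y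

theorem weight_ne_zero_iff (V : Finset (Site d)) (Δ : Set (Site d)) (φ : HeightFn d k) :
    weight Φ (meeting V Δ) φ ≠ 0 ↔ I.EdgeLip V Δ φ := by
  rw [I.weight_ne_zero_iff_strong (isThin_meeting _ _)]
  constructor
  · intro h x y hxy hx hy hV
    by_contra! hcon
    refine h {x, y} ⟨?_, ?_⟩ ((I.lipschitz {x, y} φ).2 ⟨x, y, rfl, hxy, hcon⟩)
    · intro z hz
      simp only [Finset.coe_insert, Finset.coe_singleton, Set.mem_insert_iff,
        Set.mem_singleton_iff] at hz
      rcases hz with rfl | rfl <;> assumption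
    · rcases hV with hV | hV
      · exact ⟨x, by simp, hV⟩
      · exact ⟨y, by simp, hV⟩
  · rintro h Γ ⟨hΓ, z, hz, hzV⟩ htop
    obtain ⟨x, y, rfl, hxy, hlt⟩ := (I.lipschitz Γ φ).1 htop
    refine absurd (h x y hxy (hΓ (by simp)) (hΓ (by simp)) ?_) (not_le.2 hlt)
    simp only [Finset.mem_insert, Finset.mem_singleton] at hz
    rcases hz with rfl | rfl
    · exact Or.inl hzV
    · exact Or.inr hzV

/-- The height functions that satisfy all local Lipschitz inequalities. -/
def Lip : Set (HeightFn d k) := {φ | ∀ x y, I.A.Adj x y → k.val (φ y - φ x) ≤ I.q x y}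

theorem measurableSet_lip : MeasurableSet I.Lip := by
  have : I.Lip = ⋂ (x : Site d) (y : Site d) (_ : I.A.Adj x y),
      {φ | k.val (φ y - φ x) ≤ I.q x y} := by ext; simp [Lip]
  rw [this]
  refine MeasurableSet.iInter fun x => MeasurableSet.iInter fun y => MeasurableSet.iInter fun _ => ?_
  exact measurableSet_le (k.measurable_val.comp (by fun_prop)) measurable_const

theorem measurableSet_edgeLip (V Δ : Set (Site d)) : MeasurableSet {φ | I.EdgeLip V Δ φ} := by
  have : {φ | I.EdgeLip V Δ φ} = ⋂ (x : Site d) (y : Site d) (_ : I.A.Adj x y ∧ x ∈ Δ ∧ y ∈ Δ ∧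
      (x ∈ V ∨ y ∈ V)), {φ | k.val (φ y - φ x) ≤ I.q x y} := by
    ext φ
    simp only [EdgeLip, Set.mem_ofPred_eq, Set.mem_iInter, and_imp]
  rw [this]
  refine MeasurableSet.iInter fun x => MeasurableSet.iInter fun y => MeasurableSet.iInter fun _ => ?_
  exact measurableSet_le (k.measurable_val.comp (by fun_prop)) measurable_const

theorem shift_mem_lip {v : Site d} (hv : v ∈ L) {φ : HeightFn d k} (h : φ ∈ I.Lip) :
    shift v φ ∈ I.Lip := by
  intro x y hxy
  rw [← I.constraint.quasimetric.invariant v hv]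
  exact h _ _ ((I.constraint.graph.invariant v hv x y).2 hxy)

theorem exists_edge_length (hL : L.FiniteIndex) :
    ∃ r : ℕ, ∀ x y, I.A.Adj x y → ∀ i, |y i - x i| ≤ r := by
  have hex : ∀ x, ∃ a : ℝ, ∀ y, I.A.Adj x y → ∀ i, ((|y i - x i| : ℤ) : ℝ) ≤ a := by
    intro x
    obtain ⟨D, hD⟩ := I.constraint.graph.bounded_degree
    have hfin : (I.A.neighborSet x).Finite :=
      Set.finite_of_encard_le_coe (hD x)
    refine ⟨∑ y ∈ hfin.toFinset, ∑ i, ((|y i - x i| : ℤ) : ℝ), fun y hy i => ?_⟩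
    refine le_trans ?_ (Finset.single_le_sum
      (f := fun y : Site d => ∑ i, ((|y i - x i| : ℤ) : ℝ))
      (fun _ _ => Finset.sum_nonneg fun _ _ => by positivity)
      (show y ∈ hfin.toFinset by simpa using hy))
    exact Finset.single_le_sum (f := fun i => ((|y i - x i| : ℤ) : ℝ))
      (fun _ _ => by positivity) (Finset.mem_univ i)
  obtain ⟨a, ha, h⟩ := exists_uniform_bound hL
    (fun x a => ∀ y, I.A.Adj x y → ∀ i, ((|y i - x i| : ℤ) : ℝ) ≤ a)
    (fun x a b hab h y hy i => (h y hy i).trans hab)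
    (fun v hv x a h y hy i => by
      have := h (y - v) (by
        rw [← I.constraint.graph.invariant v hv]; simpa using hy) i
      simpa [sub_sub, add_comm] using this) hex
  refine ⟨⌈a⌉₊, fun x y hxy i => ?_⟩
  have h1 := (h x y hxy i).trans (Nat.le_ceil a)
  exact_mod_cast h1

/-- Connectedness of the graph: the edge bounds add up along a path. The maximality of `q` is not
what is used here, only its values on the edges. -/
theorem exists_bound_of_reachable (x y : Site d) :
    ∃ a : ℝ, ∀ φ ∈ I.Lip, k.val (φ y - φ x) ≤ a := by
  obtain ⟨p⟩ := I.constraint.graph.connected.preconnected x y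
  induction p with
  | nil => exact ⟨0, fun φ _ => by simp [HeightKind.val_zero]⟩
  | @cons u v w h p ih =>
    obtain ⟨a, ha⟩ := ih
    refine ⟨I.q u v + a, fun φ hφ => ?_⟩
    have h1 := hφ u v h
    have h2 := ha φ hφ
    rw [HeightKind.val_sub] at *
    linarith

theorem exists_displacement_bound (hL : L.FiniteIndex) (w : Site d) :
    ∃ a : ℝ, 0 ≤ a ∧ ∀ φ ∈ I.Lip, ∀ x, |k.val (φ (x + w) - φ x)| ≤ a := by
  have hex : ∀ x, ∃ a : ℝ, ∀ φ ∈ I.Lip, |k.val (φ (x + w) - φ x)| ≤ a := by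
    intro x
    obtain ⟨a, ha⟩ := I.exists_bound_of_reachable x (x + w)
    obtain ⟨b, hb⟩ := I.exists_bound_of_reachable (x + w) x
    refine ⟨max a b, fun φ hφ => abs_le.2 ⟨?_, (ha φ hφ).trans (le_max_left _ _)⟩⟩
    have h1 := hb φ hφ
    have h2 := le_max_right a b
    rw [HeightKind.val_sub] at *
    linarith
  obtain ⟨a, ha, h⟩ := exists_uniform_bound hL
    (fun x a => ∀ φ ∈ I.Lip, |k.val (φ (x + w) - φ x)| ≤ a)
    (fun x a b hab h φ hφ => (h φ hφ).trans hab)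
    (fun v hv x a h φ hφ => by
      have := h _ (I.shift_mem_lip hv hφ)
      simpa [shift, add_right_comm] using this) hex
  exact ⟨a, ha, fun φ hφ x => h x φ hφ⟩

/-- Nearest-neighbour bounds are summed along a path that corrects the coordinates one by one; the
induction is over the set of coordinates in which the two vertices differ. -/
theorem abs_val_sub_le_of_nn {C : ℝ} {φ : HeightFn d k}
    (h : ∀ x i, |k.val (φ (x + Pi.single i 1) - φ x)| ≤ C) (x y : Site d) :
    |k.val (φ y - φ x)| ≤ C * dist1 x y := by
  have line : ∀ (n : ℕ) (x : Site d) (i : Fin d),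
      |k.val (φ (x + Pi.single i (n : ℤ)) - φ x)| ≤ C * n := by
    intro n x i
    induction n with
    | zero => simp [HeightKind.val_zero]
    | succ n ih =>
      have h1 := h (x + Pi.single i (n : ℤ)) i
      have h2 : x + Pi.single i (n : ℤ) + Pi.single i 1 = x + Pi.single i ((n + 1 : ℕ) : ℤ) := by
        rw [add_assoc, ← Pi.single_add]; push_cast; rfl
      rw [h2, HeightKind.val_sub] at h1
      rw [HeightKind.val_sub] at ih ⊢
      have h3 : ((n + 1 : ℕ) : ℝ) = n + 1 := by push_cast; ring
      rw [abs_le] at *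
      rw [h3]
      constructor <;> linarith [h1.1, h1.2, ih.1, ih.2]
  have line' : ∀ (x : Site d) (i : Fin d) (m : ℤ),
      |k.val (φ (x + Pi.single i m) - φ x)| ≤ C * m.natAbs := by
    intro x i m
    rcases Int.natAbs_eq m with hm | hm
    · have := line m.natAbs x i
      rwa [← hm] at this
    · have := line m.natAbs (x + Pi.single i m) i
      rw [add_assoc, ← Pi.single_add] at this
      have h0 : m + (m.natAbs : ℤ) = 0 := by omega
      rw [h0, Pi.single_zero, add_zero, HeightKind.val_sub, abs_sub_comm, ← HeightKind.val_sub] at this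
      exact this
  have main : ∀ s : Finset (Fin d), ∀ x y : Site d, (∀ i ∉ s, x i = y i) →
      |k.val (φ y - φ x)| ≤ C * (∑ i ∈ s, (x i - y i).natAbs : ℕ) := by
    intro s
    induction s using Finset.induction_on with
    | empty =>
      intro x y hxy
      have : x = y := funext fun i => hxy i (by simp)
      simp [this, HeightKind.val_zero]
    | insert i s hi ih =>
      intro x y hxy
      set x' : Site d := x + Pi.single i (y i - x i) with hx'
      have h1 := line' x i (y i - x i)
      have hne : ∀ j, j ≠ i → x' j = x j := fun j hj => by simp [hx', hj]
      have h2 := ih x' y (fun j hj => by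
        by_cases hji : j = i
        · subst hji; simp [hx']
        · rw [hne j hji]; exact hxy j (by simp [hji, hj]))
      have h3 : ∑ j ∈ s, (x' j - y j).natAbs = ∑ j ∈ s, (x j - y j).natAbs :=
        Finset.sum_congr rfl fun j hj => by rw [hne j (fun h => hi (h ▸ hj))]
      rw [h3] at h2
      rw [Finset.sum_insert hi]
      have h4 : (y i - x i).natAbs = (x i - y i).natAbs := by omega
      rw [← hx', h4] at h1
      push_cast at h1 h2 ⊢
      rw [HeightKind.val_sub] at *
      rw [abs_le] at *
      constructor <;> nlinarith [h1.1, h1.2, h2.1, h2.2]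
  exact main Finset.univ x y (by simp)

theorem exists_lipschitz_constant (hL : L.FiniteIndex) :
    ∃ C : ℝ, 0 ≤ C ∧ ∀ φ ∈ I.Lip, ∀ x y, |k.val (φ y - φ x)| ≤ C * dist1 x y := by
  choose a ha h using fun i : Fin d => I.exists_displacement_bound hL (Pi.single i 1)
  refine ⟨∑ i, a i, Finset.sum_nonneg fun i _ => ha i, fun φ hφ => abs_val_sub_le_of_nn ?_⟩
  intro x i
  exact (h i φ hφ x).trans (Finset.single_le_sum (f := a) (fun i _ => ha i) (Finset.mem_univ i))

theorem exists_notMem (hd : 0 < d) (V : Finset (Site d)) : ∃ x, x ∉ V := by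
  have : Nonempty (Fin d) := ⟨⟨0, hd⟩⟩
  exact Infinite.exists_notMem_finset V

/-- From each vertex of `V` one may leave `V` along a path on which the Lipschitz inequalities
bound the height differences. -/
theorem exists_exit (hd : 0 < d) (V : Finset (Site d)) {x : Site d} (hx : x ∈ V) :
    ∃ y ∉ V, (∃ z ∈ V, I.A.Adj z y) ∧
      ∃ a : ℝ, ∀ φ : HeightFn d k, (∀ u ∈ V, ∀ v, I.A.Adj u v →
        k.val (φ v - φ u) ≤ I.q u v ∧ k.val (φ u - φ v) ≤ I.q v u) →
        |k.val (φ x - φ y)| ≤ a := by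
  obtain ⟨y, hy⟩ := exists_notMem hd V
  obtain ⟨p⟩ := I.constraint.graph.connected.preconnected x y
  induction p with
  | nil => exact absurd hx hy
  | @cons u v w h p ih =>
    have step : ∀ φ : HeightFn d k, (∀ u ∈ V, ∀ v, I.A.Adj u v →
        k.val (φ v - φ u) ≤ I.q u v ∧ k.val (φ u - φ v) ≤ I.q v u) →
        |k.val (φ u - φ v)| ≤ max (I.q u v) (I.q v u) := by
      intro φ hφ
      obtain ⟨h1, h2⟩ := hφ u hx v h
      have h3 := le_max_left (I.q u v) (I.q v u)
      have h4 := le_max_right (I.q u v) (I.q v u)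
      rw [HeightKind.val_sub] at *
      rw [abs_le]
      constructor <;> linarith
    by_cases hv : v ∈ V
    · obtain ⟨y', hy', hz, a, ha⟩ := ih hv hy
      refine ⟨y', hy', hz, max (I.q u v) (I.q v u) + a, fun φ hφ => ?_⟩
      have h1 := step φ hφ
      have h2 := ha φ hφ
      rw [HeightKind.val_sub] at *
      rw [abs_le] at *
      constructor <;> linarith [h1.1, h1.2, h2.1, h2.2]
    · exact ⟨v, hv, ⟨u, hx, h⟩, _, step⟩

theorem edgeLip_iff_of_closed {V : Finset (Site d)} {Δ : Set (Site d)} (hVΔ : (V : Set (Site d)) ⊆ Δ)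
    (hΔ : ∀ u ∈ V, ∀ v, I.A.Adj u v → v ∈ Δ) {φ : HeightFn d k} (h : I.EdgeLip V Δ φ) :
    ∀ u ∈ V, ∀ v, I.A.Adj u v → k.val (φ v - φ u) ≤ I.q u v ∧ k.val (φ u - φ v) ≤ I.q v u :=
  fun u hu v huv => ⟨h u v huv (hVΔ hu) (hΔ u hu v huv) (Or.inl hu),
    h v u huv.symm (hΔ u hu v huv) (hVΔ hu) (Or.inr hu)⟩

end Interaction

/-- A bounded set of configurations has finite reference measure. -/
theorem refInt_indicator_bounded_lt_top (V : Finset (Site d)) (c : Site d → k.E) (a : Site d → ℝ)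
    (φ : HeightFn d k) :
    refInt V ({φ' | ∀ x ∈ V, |k.val (φ' x - c x)| ≤ a x}.indicator 1) φ < ∞ := by
  have hs : MeasurableSet (Set.univ.pi fun x : V => {t : k.E | |k.val (t - c x)| ≤ |a x|}) := by
    refine MeasurableSet.univ_pi fun x => ?_
    exact measurableSet_le (k.measurable_val.comp (by fun_prop)).abs measurable_const
  calc refInt V ({φ' | ∀ x ∈ V, |k.val (φ' x - c x)| ≤ a x}.indicator 1) φ
      ≤ ∫⁻ ψ, (Set.univ.pi fun x : V => {t : k.E | |k.val (t - c x)| ≤ |a x|}).indicator 1 ψ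
          ∂(Measure.pi fun _ : V => k.ref) := by
        refine lintegral_mono fun ψ => ?_
        by_cases h : patch V φ ψ ∈ {φ' : HeightFn d k | ∀ x ∈ V, |k.val (φ' x - c x)| ≤ a x}
        · rw [Set.indicator_of_mem h, Set.indicator_of_mem]
          · rfl
          · intro x _
            have := h x x.2
            rw [patch_of_mem _ _ x.2] at this
            exact this.trans (le_abs_self _)
        · rw [Set.indicator_of_notMem h]; exact zero_le
    _ = ∏ x : V, k.ref {t : k.E | |k.val (t - c x)| ≤ |a x|} := by
        rw [lintegral_indicator_one hs, Measure.pi_pi]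
    _ < ∞ := ENNReal.prod_lt_top fun x _ =>
        (k.ref_ball_le (c x) (abs_nonneg _)).trans_lt ENNReal.ofReal_lt_top

namespace Interaction

variable (I : Interaction L Φ)

/-- Every vertex of `V` is joined by constrained edges to a vertex off `V`, whose height is fixed.
So the weight is supported on a bounded set of heights, on which it is at most the exponential of
the bound on the weak energy. This makes partition functions finite without any assumption on `φ`.
-/
theorem refInt_weight_lt_top (hd : 0 < d) (V : Finset (Site d)) {Δ : Set (Site d)}
    (hVΔ : (V : Set (Site d)) ⊆ Δ) (hΔ : ∀ u ∈ V, ∀ v, I.A.Adj u v → v ∈ Δ) (φ : HeightFn d k) :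
    refInt V (weight Φ (meeting V Δ)) φ < ∞ := by
  choose! y hy hz a ha using fun (x : Site d) (hx : x ∈ V) => I.exists_exit hd V hx
  set B : Set (HeightFn d k) := {φ' | ∀ x ∈ V, |k.val (φ' x - φ (y x))| ≤ a x} with hB
  have hBm : MeasurableSet B := by
    have : B = ⋂ (x : Site d) (_ : x ∈ V), {φ' | |k.val (φ' x - φ (y x))| ≤ a x} := by
      ext; simp [hB]
    rw [this]
    refine MeasurableSet.iInter fun x => MeasurableSet.iInter fun _ => ?_
    exact measurableSet_le (k.measurable_val.comp (by fun_prop)).abs measurable_const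
  calc refInt V (weight Φ (meeting V Δ)) φ
      ≤ refInt V (fun φ' => ENNReal.ofReal (Real.exp (I.weakBound V)) * B.indicator 1 φ') φ := by
        refine refInt_mono fun φ' hφ' => ?_
        by_cases h0 : weight Φ (meeting V Δ) φ' = 0
        · rw [h0]; exact zero_le
        · have h1 := I.edgeLip_iff_of_closed hVΔ hΔ ((I.weight_ne_zero_iff V Δ φ').1 h0)
          have h2 : φ' ∈ B := fun x hx => by
            have := ha x hx φ' h1
            rwa [hφ' _ (hy x hx)] at this
          rw [Set.indicator_of_mem h2, Pi.one_apply, mul_one]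
          exact I.weight_le (isThin_meeting _ _) (I.weakBound_nonneg V)
            (I.weakAbs_le_of_meets (fun _ h => h.2) φ')
    _ = ENNReal.ofReal (Real.exp (I.weakBound V)) * refInt V (B.indicator 1) φ :=
        refInt_const_mul (measurable_one.indicator hBm) _ _
    _ < ∞ := ENNReal.mul_lt_top ENNReal.ofReal_lt_top
        (refInt_indicator_bounded_lt_top V (fun x => φ (y x)) a φ)

end Interaction

end Lipschitz

/-! ### Gibbs kernels -/

section Gibbs

open ProbabilityTheory

variable {d : ℕ} {k : HeightKind}

/-- The reference measure on the heights in `V`, with boundary condition `φ`. -/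
noncomputable def refMeasure (V : Finset (Site d)) (φ : HeightFn d k) : Measure (HeightFn d k) :=
  (Measure.pi fun _ : V => k.ref).map (patch V φ)

theorem lintegral_refMeasure (V : Finset (Site d)) (φ : HeightFn d k) {f : HeightFn d k → ℝ≥0∞}
    (hf : Measurable f) : ∫⁻ φ', f φ' ∂(refMeasure V φ) = refInt V f φ :=
  lintegral_map hf (measurable_patch_right V φ)

theorem refMeasure_apply (V : Finset (Site d)) (φ : HeightFn d k) {A : Set (HeightFn d k)}
    (hA : MeasurableSet A) : refMeasure V φ A = refInt V (A.indicator 1) φ := by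
  rw [← lintegral_refMeasure V φ (measurable_one.indicator hA), lintegral_indicator_one hA]

/-- Resetting the heights on `V` to zero. -/
noncomputable def clear (V : Finset (Site d)) (φ : HeightFn d k) : HeightFn d k :=
  patch V φ fun _ => 0

theorem clear_of_mem {V : Finset (Site d)} (φ : HeightFn d k) {x : Site d} (h : x ∈ V) :
    clear V φ x = 0 := patch_of_mem _ _ h

theorem clear_of_notMem {V : Finset (Site d)} (φ : HeightFn d k) {x : Site d} (h : x ∉ V) :
    clear V φ x = φ x := patch_of_notMem _ _ h

theorem measurable_clear (V : Finset (Site d)) : Measurable (clear (k := k) V) :=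
  (measurable_patch V).comp (measurable_id.prodMk measurable_const)

theorem clear_congr {V : Finset (Site d)} {φ φ' : HeightFn d k} (h : ∀ x ∉ V, φ x = φ' x) :
    clear V φ = clear V φ' := by
  ext x
  by_cases hx : x ∈ V
  · rw [clear_of_mem _ hx, clear_of_mem _ hx]
  · rw [clear_of_notMem _ hx, clear_of_notMem _ hx, h x hx]

theorem patch_congr {V : Finset (Site d)} {φ φ' : HeightFn d k} (h : ∀ x ∉ V, φ x = φ' x) :
    patch V φ = patch V φ' := by
  ext ψ x
  by_cases hx : x ∈ V
  · rw [patch_of_mem _ _ hx, patch_of_mem _ _ hx]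
  · rw [patch_of_notMem _ _ hx, patch_of_notMem _ _ hx, h x hx]

/-- The condition that the weight `w` can be normalized on the fibre of `φ`. -/
def Normalizable (V : Finset (Site d)) (w : HeightFn d k → ℝ≥0∞) (φ : HeightFn d k) : Prop :=
  0 < refInt V w φ ∧ refInt V w φ < ∞

theorem measurableSet_normalizable (V : Finset (Site d)) {w : HeightFn d k → ℝ≥0∞}
    (hw : Measurable w) : MeasurableSet {φ | Normalizable V w φ} :=
  (measurableSet_lt measurable_const hw.refInt).inter (measurableSet_lt hw.refInt measurable_const)

open Classical in
/-- The law with density proportional to `w` on the heights in `V`. If `w` cannot be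
normalized, then it is the Dirac mass at `clear V φ`. -/
noncomputable def gibbsLaw (V : Finset (Site d)) (w : HeightFn d k → ℝ≥0∞) (φ : HeightFn d k) :
    Measure (HeightFn d k) :=
  if Normalizable V w φ then (refInt V w φ)⁻¹ • (refMeasure V φ).withDensity w
  else Measure.dirac (clear V φ)

theorem lintegral_gibbsLaw {V : Finset (Site d)} {w f : HeightFn d k → ℝ≥0∞} (hw : Measurable w)
    (hf : Measurable f) {φ : HeightFn d k} (h : Normalizable V w φ) :
    ∫⁻ φ', f φ' ∂(gibbsLaw V w φ) = (refInt V w φ)⁻¹ * refInt V (fun φ' => w φ' * f φ') φ := by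
  rw [gibbsLaw, if_pos h, lintegral_smul_measure, lintegral_withDensity_eq_lintegral_mul _ hw hf,
    lintegral_refMeasure _ _ (hw.mul hf)]
  rfl

theorem gibbsLaw_of_not {V : Finset (Site d)} {w : HeightFn d k → ℝ≥0∞} {φ : HeightFn d k}
    (h : ¬ Normalizable V w φ) : gibbsLaw V w φ = Measure.dirac (clear V φ) := if_neg h

theorem normalizable_congr {V : Finset (Site d)} {w : HeightFn d k → ℝ≥0∞} {φ φ' : HeightFn d k}
    (h : ∀ x ∉ V, φ x = φ' x) : Normalizable V w φ ↔ Normalizable V w φ' := by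
  rw [Normalizable, Normalizable, refInt_congr w h]

/-- The fallback in the definition is the Dirac mass at `clear V φ`, not at `φ`, exactly in order
that the law ignores the heights on `V` in all cases. The chain rule for resampling requires this
for every `φ`. -/
theorem gibbsLaw_congr {V : Finset (Site d)} {w : HeightFn d k → ℝ≥0∞} {φ φ' : HeightFn d k}
    (h : ∀ x ∉ V, φ x = φ' x) : gibbsLaw V w φ = gibbsLaw V w φ' := by
  unfold gibbsLaw refMeasure
  rw [refInt_congr w h, patch_congr h, clear_congr h]
  by_cases hn : Normalizable V w φ
  · rw [if_pos hn, if_pos ((normalizable_congr h).1 hn)]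
  · rw [if_neg hn, if_neg fun h' => hn ((normalizable_congr h).2 h')]

theorem measurable_gibbsLaw (V : Finset (Site d)) {w : HeightFn d k → ℝ≥0∞} (hw : Measurable w) :
    Measurable (gibbsLaw V w) := by
  classical
  refine Measure.measurable_of_measurable_coe _ fun A hA => ?_
  have h : (fun φ => gibbsLaw V w φ A) = {φ | Normalizable V w φ}.piecewise
      (fun φ => (refInt V w φ)⁻¹ * refInt V (fun φ' => w φ' * A.indicator 1 φ') φ)
      (fun φ => (clear V ⁻¹' A).indicator 1 φ) := by
    ext φ
    by_cases hφ : Normalizable V w φ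
    · rw [Set.piecewise_eq_of_mem {φ | Normalizable V w φ} _ _ hφ, ← lintegral_gibbsLaw hw (measurable_one.indicator hA) hφ,
        lintegral_indicator_one hA]
    · rw [Set.piecewise_eq_of_notMem {φ | Normalizable V w φ} _ _ hφ, gibbsLaw_of_not hφ, Measure.dirac_apply' _ hA]
      rfl
  rw [h]
  refine Measurable.piecewise (measurableSet_normalizable V hw) ?_ ?_
  · exact hw.refInt.inv.mul (hw.mul (measurable_one.indicator hA)).refInt
  · exact measurable_one.indicator (measurable_clear V hA)

/-- The Gibbs law as a kernel. -/
noncomputable def gibbs (V : Finset (Site d)) {w : HeightFn d k → ℝ≥0∞} (hw : Measurable w) :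
    Kernel (HeightFn d k) (HeightFn d k) := ⟨gibbsLaw V w, measurable_gibbsLaw V hw⟩

theorem gibbs_apply (V : Finset (Site d)) {w : HeightFn d k → ℝ≥0∞} (hw : Measurable w)
    (φ : HeightFn d k) : gibbs V hw φ = gibbsLaw V w φ := rfl

theorem isProbabilityMeasure_gibbsLaw (V : Finset (Site d)) {w : HeightFn d k → ℝ≥0∞}
    (hw : Measurable w) (φ : HeightFn d k) : IsProbabilityMeasure (gibbsLaw V w φ) := by
  by_cases h : Normalizable V w φ
  · refine ⟨?_⟩
    rw [← lintegral_one, lintegral_gibbsLaw hw measurable_const h]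
    simp only [mul_one]
    exact ENNReal.inv_mul_cancel h.1.ne' h.2.ne
  · rw [gibbsLaw_of_not h]; infer_instance

instance instIsMarkovKernelGibbs (V : Finset (Site d)) {w : HeightFn d k → ℝ≥0∞}
    (hw : Measurable w) : IsMarkovKernel (gibbs V hw) :=
  ⟨isProbabilityMeasure_gibbsLaw V hw⟩

theorem measurableSet_eq_off (V : Finset (Site d)) (φ : HeightFn d k) :
    MeasurableSet {φ' : HeightFn d k | ∀ x ∉ V, φ' x = φ x} := by
  have : {φ' : HeightFn d k | ∀ x ∉ V, φ' x = φ x} =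
      ⋂ (x : Site d) (_ : x ∉ V), {φ' | φ' x = φ x} := by ext; simp
  rw [this]
  refine MeasurableSet.iInter fun x => MeasurableSet.iInter fun _ => ?_
  exact measurable_pi_apply x (measurableSet_singleton _)

theorem ae_refMeasure_eq_off (V : Finset (Site d)) (φ : HeightFn d k) :
    ∀ᵐ φ' ∂(refMeasure V φ), ∀ x ∉ V, φ' x = φ x := by
  rw [refMeasure, ae_map_iff (measurable_patch_right V φ).aemeasurable (measurableSet_eq_off V φ)]
  exact Eventually.of_forall fun ψ x hx => patch_of_notMem _ _ hx

theorem ae_gibbsLaw_eq_off (V : Finset (Site d)) (w : HeightFn d k → ℝ≥0∞)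
    (φ : HeightFn d k) : ∀ᵐ φ' ∂(gibbsLaw V w φ), ∀ x ∉ V, φ' x = φ x := by
  by_cases h : Normalizable V w φ
  · rw [gibbsLaw, if_pos h]
    refine Measure.ae_smul_measure ?_ _
    exact (withDensity_absolutelyContinuous _ _).ae_le (ae_refMeasure_eq_off V φ)
  · rw [gibbsLaw_of_not h, ae_dirac_iff (measurableSet_eq_off V φ)]
    exact fun x hx => clear_of_notMem _ hx

theorem ae_gibbsLaw_ne_zero {V : Finset (Site d)} {w : HeightFn d k → ℝ≥0∞} (hw : Measurable w)
    {φ : HeightFn d k} (h : Normalizable V w φ) : ∀ᵐ φ' ∂(gibbsLaw V w φ), w φ' ≠ 0 := by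
  rw [gibbsLaw, if_pos h]
  refine Measure.ae_smul_measure ?_ _
  rw [ae_withDensity_iff hw]
  exact Eventually.of_forall fun _ h => h

theorem gibbsLaw_absolutelyContinuous {V : Finset (Site d)} {w : HeightFn d k → ℝ≥0∞}
    {φ : HeightFn d k} (h : Normalizable V w φ) : gibbsLaw V w φ ≪ refMeasure V φ := by
  rw [gibbsLaw, if_pos h]
  exact (withDensity_absolutelyContinuous _ _).smul_left _

theorem refInt_mul_eq_zero {V : Finset (Site d)} {w f : HeightFn d k → ℝ≥0∞} (hw : Measurable w)
    (hf : Measurable f) {φ : HeightFn d k} (h : refInt V w φ = 0) :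
    refInt V (fun φ' => w φ' * f φ') φ = 0 := by
  have hm : Measurable fun φ' => w φ' * f φ' := hw.mul hf
  rw [← lintegral_refMeasure _ _ hm, lintegral_eq_zero_iff hm]
  rw [← lintegral_refMeasure _ _ hw, lintegral_eq_zero_iff hw] at h
  filter_upwards [h] with φ' h'
  simp only [Pi.zero_apply] at h' ⊢
  rw [h', zero_mul]

theorem le_smul_of_lintegral_le {X : Type*} [MeasurableSpace X] {μ ν : Measure X} {c : ℝ≥0∞}
    (h : ∀ f : X → ℝ≥0∞, Measurable f → ∫⁻ x, f x ∂μ ≤ c * ∫⁻ x, f x ∂ν) : μ ≤ c • ν := by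
  refine Measure.le_iff.2 fun A hA => ?_
  have := h (A.indicator 1) (measurable_one.indicator hA)
  rwa [lintegral_indicator_one hA, lintegral_indicator_one hA] at this

/-- If `ν` has conditional density proportional to `w` on the heights in `V`, then resampling these
heights with a density proportional to a comparable weight `w'` does not change `ν` much. -/
theorem gibbs_comp_compare {V : Finset (Site d)} {w w' : HeightFn d k → ℝ≥0∞}
    (hw : Measurable w) (hw' : Measurable w') {α ν : Measure (HeightFn d k)}
    (hν : ∀ f : HeightFn d k → ℝ≥0∞, Measurable f →
      ∫⁻ φ, f φ ∂ν = ∫⁻ φ, refInt V (fun φ' => w φ' * f φ') φ ∂α)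
    {c : ℝ} (h1 : ∀ φ, w φ ≤ ENNReal.ofReal (Real.exp c) * w' φ)
    (h2 : ∀ φ, w' φ ≤ ENNReal.ofReal (Real.exp c) * w φ) (hfin : ∀ φ, refInt V w' φ < ∞) :
    ν ≤ ENNReal.ofReal (Real.exp (2 * c)) • (gibbs V hw' ∘ₘ ν) ∧
      (gibbs V hw' ∘ₘ ν) ≤ ENNReal.ofReal (Real.exp (2 * c)) • ν := by
  set e := ENNReal.ofReal (Real.exp c) with he
  have hee : ENNReal.ofReal (Real.exp (2 * c)) = e * e := by
    rw [he, ← ENNReal.ofReal_mul (Real.exp_pos _).le, ← Real.exp_add]; ring_nf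
  have hbound : ∀ {u u' : HeightFn d k → ℝ≥0∞}, Measurable u → Measurable u' →
      (∀ φ, u φ ≤ e * u' φ) → ∀ φ, refInt V u φ ≤ e * refInt V u' φ := by
    intro u u' hu hu' h φ
    rw [← refInt_const_mul hu']
    exact refInt_mono fun φ' _ => h φ'
  -- The Gibbs law does not depend on the heights on `V`, so `ν` enters only through the
  -- normalization `refInt V w`.
  have hcomp : ∀ f : HeightFn d k → ℝ≥0∞, Measurable f → ∫⁻ φ, f φ ∂(gibbs V hw' ∘ₘ ν) =
      ∫⁻ φ, (∫⁻ φ', f φ' ∂(gibbsLaw V w' φ)) * refInt V w φ ∂α := by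
    intro f hf
    rw [Measure.lintegral_bind (Kernel.measurable _).aemeasurable hf.aemeasurable,
      hν _ (hf.lintegral_kernel)]
    refine lintegral_congr fun φ => ?_
    simp_rw [mul_comm (w _)]
    exact refInt_mul_left hw fun φ' hφ' => by
      rw [gibbs_apply, gibbs_apply, gibbsLaw_congr hφ']
  -- One factor `e` comes from comparing the weights and one from comparing their normalizations. If
  -- `w'` has integral zero on the fibre, then so has `w`, and everything vanishes.
  have key : ∀ f : HeightFn d k → ℝ≥0∞, Measurable f → ∀ φ,
      refInt V (fun φ' => w φ' * f φ') φ ≤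
        (e * e) * ((∫⁻ φ', f φ' ∂(gibbsLaw V w' φ)) * refInt V w φ) ∧
      (∫⁻ φ', f φ' ∂(gibbsLaw V w' φ)) * refInt V w φ ≤
        (e * e) * refInt V (fun φ' => w φ' * f φ') φ := by
    intro f hf φ
    have z1 := hbound hw hw' h1 φ
    have z2 := hbound hw' hw h2 φ
    have f1 := hbound (hw.mul hf) (hw'.mul hf) (fun φ => by
      simp only [Pi.mul_apply, ← mul_assoc]; exact mul_le_mul_left (h1 φ) _) φ
    have f2 := hbound (hw'.mul hf) (hw.mul hf) (fun φ => by
      simp only [Pi.mul_apply, ← mul_assoc]; exact mul_le_mul_left (h2 φ) _) φ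
    by_cases h0 : refInt V w' φ = 0
    · have hz : refInt V w φ = 0 := by simpa [h0] using z1
      rw [refInt_mul_eq_zero hw hf hz, hz]
      simp
    · have hn : Normalizable V w' φ := ⟨pos_iff_ne_zero.2 h0, hfin φ⟩
      rw [lintegral_gibbsLaw hw' hf hn]
      have hc : (refInt V w' φ)⁻¹ * refInt V w' φ = 1 := ENNReal.inv_mul_cancel h0 (hfin φ).ne
      constructor
      · calc refInt V (fun φ' => w φ' * f φ') φ
            ≤ e * refInt V (fun φ' => w' φ' * f φ') φ := f1
          _ = e * ((refInt V w' φ)⁻¹ * refInt V w' φ) * refInt V (fun φ' => w' φ' * f φ') φ := by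
              rw [hc, mul_one]
          _ ≤ e * ((refInt V w' φ)⁻¹ * (e * refInt V w φ)) *
                refInt V (fun φ' => w' φ' * f φ') φ := by gcongr
          _ = _ := by ring
      · calc (refInt V w' φ)⁻¹ * refInt V (fun φ' => w' φ' * f φ') φ * refInt V w φ
            ≤ (refInt V w' φ)⁻¹ * (e * refInt V (fun φ' => w φ' * f φ') φ) *
                (e * refInt V w' φ) := by gcongr; exact f2
          _ = (e * e) * refInt V (fun φ' => w φ' * f φ') φ *
                ((refInt V w' φ)⁻¹ * refInt V w' φ) := by ring
          _ = _ := by rw [hc, mul_one]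
  have m1 : ∀ f : HeightFn d k → ℝ≥0∞, Measurable f →
      Measurable fun φ => (∫⁻ φ', f φ' ∂(gibbsLaw V w' φ)) * refInt V w φ := fun f hf =>
    (hf.lintegral_kernel (κ := gibbs V hw')).mul hw.refInt
  have m2 : ∀ f : HeightFn d k → ℝ≥0∞, Measurable f →
      Measurable (refInt V fun φ' => w φ' * f φ') := fun f hf => (hw.mul hf).refInt
  rw [hee]
  constructor
  · refine le_smul_of_lintegral_le fun f hf => ?_
    rw [hcomp f hf, hν f hf, ← lintegral_const_mul _ (m1 f hf)]
    exact lintegral_mono fun φ => (key f hf φ).1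
  · refine le_smul_of_lintegral_le fun f hf => ?_
    rw [hcomp f hf, hν f hf, ← lintegral_const_mul _ (m2 f hf)]
    exact lintegral_mono fun φ => (key f hf φ).2

/-- If the weight on `V` factorizes into a weight on `Λ ⊆ V` and a function that does not depend
on the heights on `Λ`, then Gibbs laws are consistent. -/
theorem gibbs_comp_gibbsLaw {V Λ : Finset (Site d)} (hΛ : Λ ⊆ V) {w w' u : HeightFn d k → ℝ≥0∞}
    (hw : Measurable w) (hw' : Measurable w') (hu : Measurable u)
    (hfac : ∀ φ, w φ = u φ * w' φ)
    (hoff : ∀ φ φ' : HeightFn d k, (∀ x ∉ Λ, φ x = φ' x) → u φ = u φ')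
    (hfin : ∀ φ, refInt Λ w' φ < ∞) {φ : HeightFn d k} (h : Normalizable V w φ) :
    gibbs Λ hw' ∘ₘ gibbsLaw V w φ = gibbsLaw V w φ := by
  -- The comparison is applied with equal weights and `c = 0`, so that its two inequalities become
  -- an equality. The measure `α` integrates over `V \ Λ` only.
  have key := gibbs_comp_compare (V := Λ) hw' hw'
    (α := (refInt V w φ)⁻¹ • (refMeasure (V \ Λ) φ).withDensity u) (ν := gibbsLaw V w φ)
    (c := 0) ?_ (by simp) (by simp) hfin
  · simp only [mul_zero, Real.exp_zero, ENNReal.ofReal_one, one_smul] at key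
    exact le_antisymm key.2 key.1
  · intro f hf
    have hm : Measurable (refInt Λ fun φ' => w' φ' * f φ') := (hw'.mul hf).refInt
    rw [lintegral_gibbsLaw hw hf h, lintegral_smul_measure,
      lintegral_withDensity_eq_lintegral_mul _ hu hm, lintegral_refMeasure _ _ (hu.mul hm)]
    have hun := refInt_union (S := V \ Λ) (T := Λ) (f := fun φ' => w φ' * f φ') (hw.mul hf)
        Finset.sdiff_disjoint
    rw [Finset.sdiff_union_of_subset hΛ] at hun
    rw [hun]
    rw [smul_eq_mul]
    congr 1
    refine refInt_congr_fun fun φ' _ => ?_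
    simp only [Pi.mul_apply]
    rw [← refInt_mul_left (f := u) (g := fun φ' => w' φ' * f φ') (hw'.mul hf)
      fun φ'' h'' => hoff _ _ h'']
    refine refInt_congr_fun fun φ'' _ => ?_
    rw [hfac, mul_assoc]

theorem refMeasure_map_shift (v : Site d) (V : Finset (Site d)) (φ : HeightFn d k) :
    (refMeasure (translateSet v V) φ).map (shift v) = refMeasure V (shift v φ) := by
  refine Measure.ext_of_lintegral _ fun f hf => ?_
  have hm : Measurable fun φ' => f (shift v φ') := hf.comp (measurable_shift v)
  rw [lintegral_map hf (measurable_shift v), lintegral_refMeasure _ _ hm,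
    lintegral_refMeasure _ _ hf, refInt_translateSet v V hm]
  refine refInt_congr_fun fun φ' _ => ?_
  simp [shift_shift, shift_zero]

theorem gibbsLaw_map_shift (v : Site d) (V : Finset (Site d)) {w : HeightFn d k → ℝ≥0∞}
    (hw : Measurable w) (φ : HeightFn d k) :
    (gibbsLaw (translateSet v V) w φ).map (shift v) =
      gibbsLaw V (fun φ' => w (shift (-v) φ')) (shift v φ) := by
  have hz := refInt_translateSet v V hw φ
  have hn : Normalizable (translateSet v V) w φ ↔
      Normalizable V (fun φ' => w (shift (-v) φ')) (shift v φ) := by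
    rw [Normalizable, Normalizable, hz]
  have hws : Measurable fun φ' => w (shift (-v) φ') := hw.comp (measurable_shift _)
  by_cases h : Normalizable (translateSet v V) w φ
  · refine Measure.ext_of_lintegral _ fun f hf => ?_
    have hm : Measurable fun φ' => f (shift v φ') := hf.comp (measurable_shift v)
    have hm' : Measurable fun φ' => w φ' * f (shift v φ') := hw.mul hm
    rw [lintegral_map hf (measurable_shift v), lintegral_gibbsLaw hw hm h,
      lintegral_gibbsLaw hws hf (hn.1 h), hz, refInt_translateSet v V hm']
    congr 1
    refine refInt_congr_fun fun φ' _ => ?_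
    simp [shift_shift, shift_zero]
  · rw [gibbsLaw_of_not h, gibbsLaw_of_not (fun h' => h (hn.2 h')),
      Measure.map_dirac' (measurable_shift v)]
    congr 1
    ext x
    by_cases hx : x ∈ V
    · rw [clear_of_mem _ hx, shift, clear_of_mem _ (by rw [mem_translateSet]; simpa using hx)]
    · rw [clear_of_notMem _ hx, shift,
        clear_of_notMem _ (by rw [mem_translateSet]; simpa using hx)]
      rfl

theorem normalizable_add_const {V : Finset (Site d)} {w : HeightFn d k → ℝ≥0∞}
    (hinv : ∀ φ (c : k.E), w (φ + fun _ => c) = w φ) (φ : HeightFn d k) (c : k.E) :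
    Normalizable V w (φ + fun _ => c) ↔ Normalizable V w φ := by
  rw [Normalizable, Normalizable, ← refInt_comp_add]
  simp only [hinv]

/-- Normalizability cannot be dropped: the fallback mass at `clear V φ` is not covariant under a
vertical translation. -/
theorem gibbsLaw_map_add_const {V : Finset (Site d)} {w : HeightFn d k → ℝ≥0∞}
    (hw : Measurable w) (hinv : ∀ φ (c : k.E), w (φ + fun _ => c) = w φ) {φ : HeightFn d k}
    (h : Normalizable V w φ) (c : k.E) :
    (gibbsLaw V w φ).map (fun φ' => φ' + fun _ => c) = gibbsLaw V w (φ + fun _ => c) := by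
  have hm : Measurable fun φ' : HeightFn d k => φ' + fun _ => c := by fun_prop
  refine Measure.ext_of_lintegral _ fun f hf => ?_
  have hm' : Measurable fun φ' : HeightFn d k => f (φ' + fun _ => c) := hf.comp hm
  rw [lintegral_map hf hm, lintegral_gibbsLaw hw hm' h,
    lintegral_gibbsLaw hw hf ((normalizable_add_const hinv φ c).2 h), ← refInt_comp_add,
    ← refInt_comp_add]
  simp only [hinv]

end Gibbs

/-! ### Gradient functions and pinned height functions -/

instance HeightKind.instIsNegInvariantRef : (k : HeightKind) → k.ref.IsNegInvariant
  | .int => inferInstanceAs ((Measure.count : Measure ℤ).IsNegInvariant)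
  | .real => inferInstanceAs ((volume : Measure ℝ).IsNegInvariant)

section Gradient

variable {d : ℕ} {k : HeightKind}

/-- Functions of the height differences. -/
def IsGrad {X : Type*} (f : HeightFn d k → X) : Prop := ∀ φ (c : k.E), f (φ + fun _ => c) = f φ

/-- The height function with the same differences as `φ` that vanishes at `o`. -/
def recenter (o : Site d) (φ : HeightFn d k) : HeightFn d k := fun x => φ x - φ o

/-- The height function that vanishes off `S` and that has on `S` the values of `φ - φ(o)`. -/
def localize (S : Finset (Site d)) (o : Site d) (φ : HeightFn d k) : HeightFn d k :=
  fun x => if x ∈ S then φ x - φ o else 0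

theorem recenter_eq_add (o : Site d) (φ : HeightFn d k) :
    recenter o φ = φ + fun _ => -φ o := by
  ext x; simp [recenter, sub_eq_add_neg]

theorem isGrad_recenter (o : Site d) : IsGrad (recenter (k := k) o) := by
  intro φ c; ext x; simp [recenter]

theorem isGrad_localize (S : Finset (Site d)) (o : Site d) : IsGrad (localize (k := k) S o) := by
  intro φ c; ext x; simp [localize]

theorem IsGrad.recenter {X : Type*} {f : HeightFn d k → X} (h : IsGrad f) (o : Site d)
    (φ : HeightFn d k) : f (recenter o φ) = f φ := by
  rw [recenter_eq_add, h]

theorem IsGrad.shift {X : Type*} {f : HeightFn d k → X} (h : IsGrad f) (v : Site d) :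
    IsGrad fun φ => f (shift v φ) := fun φ c => h (_root_.shift v φ) c

theorem localize_of_mem {S : Finset (Site d)} {x : Site d} (h : x ∈ S) (o : Site d)
    (φ : HeightFn d k) : localize S o φ x = φ x - φ o := if_pos h

theorem localize_of_notMem {S : Finset (Site d)} {x : Site d} (h : x ∉ S) (o : Site d)
    (φ : HeightFn d k) : localize S o φ x = 0 := if_neg h

theorem localize_localize {S T : Finset (Site d)} (hST : S ⊆ T) {o o' : Site d} (ho : o ∈ T)
    (φ : HeightFn d k) : localize S o (localize T o' φ) = localize S o φ := by
  ext x
  by_cases hx : x ∈ S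
  · rw [localize_of_mem hx, localize_of_mem hx, localize_of_mem (hST hx), localize_of_mem ho]; simp
  · rw [localize_of_notMem hx, localize_of_notMem hx]

theorem measurable_recenter (o : Site d) : Measurable (recenter (k := k) o) :=
  measurable_pi_lambda _ fun x => (measurable_pi_apply x).sub (measurable_pi_apply o)

theorem measurable_localize (S : Finset (Site d)) (o : Site d) :
    Measurable (localize (k := k) S o) := by
  refine measurable_pi_lambda _ fun x => ?_
  by_cases hx : x ∈ S
  · simp only [localize, if_pos hx]; exact (measurable_pi_apply x).sub (measurable_pi_apply o)
  · simp only [localize, if_neg hx]; exact measurable_const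

theorem IsGrad.eq_localize {X : Type*} {f : HeightFn d k → X} (hf : IsGrad f)
    {S : Finset (Site d)} (hS : DependsOn f (S : Set (Site d))) (o : Site d)
    (φ : HeightFn d k) : f (localize S o φ) = f φ := by
  rw [← hf.recenter o φ]
  refine hS fun x hx => ?_
  rw [localize_of_mem hx]; rfl

/-- All height differences are functions of the function pinned at `o`. Hence gradient measures can
be treated as laws of pinned height functions on the full product σ-algebra. -/
theorem gradSigma_eq_comap (o : Site d) :
    gradSigma d k = MeasurableSpace.comap (recenter o) MeasurableSpace.pi := by
  apply le_antisymm
  · refine iSup_le fun x => iSup_le fun y => ?_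
    have h : (fun φ : HeightFn d k => φ y - φ x) =
        (fun φ : HeightFn d k => φ y - φ x) ∘ recenter o := by ext φ; simp [recenter]
    rw [h, ← MeasurableSpace.comap_comp]
    refine MeasurableSpace.comap_mono ?_
    exact Measurable.comap_le ((measurable_pi_apply y).sub (measurable_pi_apply x))
  · refine measurable_iff_comap_le.1 (@measurable_pi_lambda _ _ _ (gradSigma d k) _ _ fun x => ?_)
    have h : MeasurableSpace.comap (fun φ : HeightFn d k => φ x - φ o) inferInstance ≤
        gradSigma d k :=
      le_iSup₂_of_le (f := fun x y => MeasurableSpace.comap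
        (fun φ : HeightFn d k => φ y - φ x) inferInstance) o x le_rfl
    exact measurable_iff_comap_le.2 h

theorem measurable_recenter_gradSigma (o : Site d) :
    Measurable[gradSigma d k] (recenter (k := k) o) := by
  rw [gradSigma_eq_comap o]; exact comap_measurable _

theorem IsGrad.measurable_gradSigma {X : Type*} [MeasurableSpace X] {f : HeightFn d k → X}
    (hf : IsGrad f) (hm : Measurable f) : Measurable[gradSigma d k] f := by
  have h : f = f ∘ _root_.recenter 0 := funext fun φ => (hf.recenter 0 φ).symm
  rw [h]
  exact Measurable.comp hm (measurable_recenter_gradSigma 0)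

theorem isGrad_indicator {A : Set (HeightFn d k)}
    (hA : ∀ φ (c : k.E), (φ + fun _ => c) ∈ A ↔ φ ∈ A) :
    IsGrad (A.indicator (1 : HeightFn d k → ℝ≥0∞)) := by
  intro φ c
  by_cases h : φ ∈ A
  · rw [Set.indicator_of_mem h, Set.indicator_of_mem ((hA φ c).2 h)]; rfl
  · rw [Set.indicator_of_notMem h, Set.indicator_of_notMem fun h' => h ((hA φ c).1 h')]

theorem add_const_mem_iff_of_gradSigma {A : Set (HeightFn d k)}
    (hA : MeasurableSet[gradSigma d k] A) (φ : HeightFn d k) (c : k.E) :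
    (φ + fun _ => c) ∈ A ↔ φ ∈ A := by
  rw [gradSigma_eq_comap 0] at hA
  obtain ⟨B, _, rfl⟩ := hA
  rw [Set.mem_preimage, Set.mem_preimage, isGrad_recenter]

/-- The law of the height function pinned at `0`. -/
noncomputable def lift (μ : Measure[gradSigma d k] (HeightFn d k)) : Measure (HeightFn d k) :=
  @Measure.map _ _ (gradSigma d k) _ (recenter 0) μ

theorem lift_apply (μ : Measure[gradSigma d k] (HeightFn d k)) {A : Set (HeightFn d k)}
    (hA : MeasurableSet[gradSigma d k] A) : lift μ A = μ A := by
  rw [lift, Measure.map_apply (measurable_recenter_gradSigma 0) (gradSigma_le _ hA)]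
  congr 1
  ext φ
  rw [Set.mem_preimage, recenter_eq_add, add_const_mem_iff_of_gradSigma hA]

theorem lift_trim (M : Measure (HeightFn d k)) : lift (M.trim gradSigma_le) = M.map (recenter 0) := by
  refine Measure.ext fun A hA => ?_
  rw [lift, Measure.map_apply (measurable_recenter_gradSigma 0) hA,
    trim_measurableSet_eq gradSigma_le (measurable_recenter_gradSigma 0 hA),
    Measure.map_apply (measurable_recenter 0) hA]

theorem map_lift {X : Type*} [MeasurableSpace X] (μ : Measure[gradSigma d k] (HeightFn d k))
    {f : HeightFn d k → X} (hf : IsGrad f) (hm : Measurable f) :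
    (lift μ).map f = @Measure.map _ _ (gradSigma d k) _ f μ := by
  rw [lift, Measure.map_map hm (measurable_recenter_gradSigma 0)]
  congr 1
  exact funext fun φ => hf.recenter 0 φ

theorem ae_of_ae_lift {μ : Measure[gradSigma d k] (HeightFn d k)} {p : HeightFn d k → Prop}
    (hp : ∀ φ (c : k.E), p (φ + fun _ => c) ↔ p φ) (h : ∀ᵐ φ ∂(lift μ), p φ) : ∀ᵐ φ ∂μ, p φ := by
  have := ae_of_ae_map (measurable_recenter_gradSigma 0).aemeasurable h
  filter_upwards [this] with φ hφ
  rwa [recenter_eq_add, hp] at hφ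

theorem isProbabilityMeasure_lift (μ : Measure[gradSigma d k] (HeightFn d k))
    (h : IsProbabilityMeasure μ) : IsProbabilityMeasure (lift μ) :=
  ⟨by rw [lift_apply μ MeasurableSet.univ]; exact h.measure_univ⟩

/-- Invariance of the law of the height differences under the shifts in `L`. -/
def IsGradInvariant (L : AddSubgroup (Site d)) (M : Measure (HeightFn d k)) : Prop :=
  ∀ v ∈ L, M.map (fun φ => recenter 0 (shift v φ)) = M.map (recenter 0)

theorem isGradInvariant_lift {L : AddSubgroup (Site d)}
    {μ : Measure[gradSigma d k] (HeightFn d k)} (h : IsInvariantGradientMeasure L μ) :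
    IsGradInvariant L (lift μ) := by
  intro v hv
  have hm : Measurable fun φ : HeightFn d k => recenter 0 (shift v φ) :=
    (measurable_recenter 0).comp (measurable_shift v)
  rw [map_lift μ ((isGrad_recenter 0).shift v) hm, map_lift μ (isGrad_recenter 0)
    (measurable_recenter 0)]
  refine Measure.ext fun A hA => ?_
  rw [Measure.map_apply (((isGrad_recenter 0).shift v).measurable_gradSigma hm) hA,
    Measure.map_apply (measurable_recenter_gradSigma 0) hA]
  exact h.invariant v hv _ (measurable_recenter_gradSigma 0 hA)

theorem IsGradInvariant.map_eq {L : AddSubgroup (Site d)} {M : Measure (HeightFn d k)}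
    (h : IsGradInvariant L M) {v : Site d} (hv : v ∈ L) {X : Type*} [MeasurableSpace X]
    {f : HeightFn d k → X} (hf : IsGrad f) (hm : Measurable f) :
    M.map (fun φ => f (shift v φ)) = M.map f := by
  have h1 := congrArg (fun N => Measure.map f N) (h v hv)
  have hms : Measurable fun φ : HeightFn d k => recenter 0 (shift v φ) :=
    (measurable_recenter 0).comp (measurable_shift v)
  simp only [Measure.map_map hm hms, Measure.map_map hm (measurable_recenter 0)] at h1
  have e1 : (f ∘ fun φ => recenter 0 (shift v φ)) = fun φ => f (shift v φ) :=
    funext fun φ => hf.recenter 0 _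
  have e2 : f ∘ recenter 0 = f := funext fun φ => hf.recenter 0 _
  rwa [e1, e2] at h1

theorem IsGradInvariant.ae_shift {L : AddSubgroup (Site d)} {M : Measure (HeightFn d k)}
    (h : IsGradInvariant L M) {v : Site d} (hv : v ∈ L) {p : HeightFn d k → Prop}
    (hp : ∀ φ (c : k.E), p (φ + fun _ => c) ↔ p φ) (hm : MeasurableSet {φ | p φ}) :
    (∀ᵐ φ ∂M, p (shift v φ)) ↔ ∀ᵐ φ ∂M, p φ := by
  have hpm : Measurable p := measurable_to_prop (by
    convert hm using 1; ext; simp)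
  have := h.map_eq hv (f := p) (fun φ c => propext (hp φ c)) hpm
  rw [← ae_map_iff (p := fun q : Prop => q) (f := fun φ => p (shift v φ))
    (hpm.comp (measurable_shift v)).aemeasurable (by trivial), this,
    ae_map_iff hpm.aemeasurable (by trivial)]

/-- The law of the height differences in `S`. -/
noncomputable def blockLaw (S : Finset (Site d)) (o : Site d) (M : Measure (HeightFn d k)) :
    Measure (HeightFn d k) := M.map (localize S o)

instance instIsProbabilityMeasureBlockLaw (S : Finset (Site d)) (o : Site d)
    (M : Measure (HeightFn d k)) [IsProbabilityMeasure M] : IsProbabilityMeasure (blockLaw S o M) :=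
  Measure.isProbabilityMeasure_map (measurable_localize S o).aemeasurable

theorem blockLaw_map_localize {S T : Finset (Site d)} (hST : S ⊆ T) {o o' : Site d} (ho : o ∈ T)
    (M : Measure (HeightFn d k)) : (blockLaw T o' M).map (localize S o) = blockLaw S o M := by
  rw [blockLaw, Measure.map_map (measurable_localize _ _) (measurable_localize _ _)]
  congr 1
  exact funext fun φ => localize_localize hST ho φ

theorem localize_shift (v : Site d) (S : Finset (Site d)) (o : Site d) (φ : HeightFn d k) :
    shift v (localize (translateSet v S) (o + v) φ) = localize S o (shift v φ) := by
  ext x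
  by_cases hx : x ∈ S
  · rw [localize_of_mem hx, shift, localize_of_mem (by rw [mem_translateSet]; simpa using hx)]
    rfl
  · rw [localize_of_notMem hx, shift,
      localize_of_notMem (by rw [mem_translateSet]; simpa using hx)]

theorem IsGradInvariant.blockLaw_shift {L : AddSubgroup (Site d)} {M : Measure (HeightFn d k)}
    (h : IsGradInvariant L M) {v : Site d} (hv : v ∈ L) (S : Finset (Site d)) (o : Site d) :
    (blockLaw (translateSet v S) (o + v) M).map (shift v) = blockLaw S o M := by
  rw [blockLaw, Measure.map_map (measurable_shift v) (measurable_localize _ _), blockLaw,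
    ← h.map_eq hv (isGrad_localize S o) (measurable_localize S o)]
  congr 1
  exact funext fun φ => localize_shift v S o φ

theorem ae_blockLaw {S : Finset (Site d)} {o : Site d} {M : Measure (HeightFn d k)}
    {p : HeightFn d k → Prop} (hp : ∀ φ (c : k.E), p (φ + fun _ => c) ↔ p φ)
    (hS : DependsOn p (S : Set (Site d))) (hm : MeasurableSet {φ | p φ}) :
    (∀ᵐ φ ∂(blockLaw S o M), p φ) ↔ ∀ᵐ φ ∂M, p φ := by
  rw [blockLaw, ae_map_iff (measurable_localize S o).aemeasurable hm]
  refine eventually_congr (Eventually.of_forall fun φ => ?_)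
  have := IsGrad.eq_localize (f := p) (fun φ c => propext (hp φ c)) hS o φ
  rw [this]

/-! ### Changing the pinned vertex -/

/-- The choice of the pinned vertex does not matter for the reference measure. -/
theorem refInt_anchor {S : Finset (Site d)} {o o' : Site d} (ho : o ∈ S) (ho' : o' ∈ S)
    {f : HeightFn d k → ℝ≥0∞} (hm : Measurable f) (hf : IsGrad f)
    (hS : DependsOn f (S : Set (Site d))) :
    refInt (S.erase o) f 0 = refInt (S.erase o') f 0 := by
  by_cases hoo : o = o'
  · rw [hoo]
  set T := (S.erase o).erase o' with hT
  have h1 : S.erase o = {o'} ∪ T := by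
    ext x; simp only [hT, Finset.mem_erase, Finset.mem_union, Finset.mem_singleton]
    by_cases hx : x = o'
    · simp [hx, ho', Ne.symm hoo]
    · simp [hx]
  have h2 : S.erase o' = {o} ∪ T := by
    ext x; simp only [hT, Finset.mem_erase, Finset.mem_union, Finset.mem_singleton]
    by_cases hx : x = o
    · simp [hx, ho, hoo]
    · simp [hx]
  have d1 : Disjoint {o'} T := by simp [hT]
  have d2 : Disjoint {o} T := by simp [hT]
  have hs : ∀ (x : Site d) (g : HeightFn d k → ℝ≥0∞) , refInt {x} g 0 =
      ∫⁻ t, g (Function.update 0 x t) ∂k.ref := fun x g =>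
    congrFun (lmarginal_singleton (X := fun _ : Site d => k.E) (μ := fun _ => k.ref) g x) 0
  rw [h1, h2, refInt_union hm d1, refInt_union hm d2, hs, hs,
    ← lintegral_neg_eq_self (μ := k.ref) (fun t => refInt T f (Function.update 0 o t))]
  refine lintegral_congr fun t => ?_
  -- Subtracting `t` everywhere moves the pin from `o` to `o'` and leaves the height `-t` at `o`;
  -- this is why the reference measure was reflected above.
  have h3 : refInt T f (Function.update 0 o' t) =
      refInt T f (Function.update (0 : HeightFn d k) o' t + fun _ => -t) := by
    rw [← refInt_comp_add]
    exact refInt_congr_fun fun φ _ => (hf φ (-t)).symm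
  rw [h3]
  unfold refInt
  refine lintegral_congr fun ψ => hS fun x hx => ?_
  by_cases hxT : x ∈ T
  · rw [patch_of_mem _ _ hxT, patch_of_mem _ _ hxT]
  · rw [patch_of_notMem _ _ hxT, patch_of_notMem _ _ hxT]
    have hx' : x = o ∨ x = o' := by
      by_contra! hcon
      exact hxT (by simp [hT, hcon.1, hcon.2]; exact hx)
    rcases hx' with rfl | rfl
    · simp [hoo]
    · simp [Ne.symm hoo]

end Gradient

/-! ### Reference measures on blocks, and measures with local densities -/

section Block

open InformationTheory

variable {d : ℕ} {k : HeightKind}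

/-- Height functions that satisfy a Lipschitz bound on `S`. -/
def lipOn (C : ℝ) (S : Finset (Site d)) : Set (HeightFn d k) :=
  {φ | ∀ x ∈ S, ∀ y ∈ S, |k.val (φ y - φ x)| ≤ C * dist1 x y}

theorem measurableSet_lipOn (C : ℝ) (S : Finset (Site d)) :
    MeasurableSet (lipOn (k := k) C S) := by
  have : lipOn (k := k) C S =
      ⋂ (x : Site d) (_ : x ∈ S) (y : Site d) (_ : y ∈ S),
        {φ | |k.val (φ y - φ x)| ≤ C * dist1 x y} := by
    ext; simp [lipOn]
  rw [this]
  refine MeasurableSet.iInter fun x => MeasurableSet.iInter fun _ => MeasurableSet.iInter fun y =>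
    MeasurableSet.iInter fun _ => ?_
  exact measurableSet_le (k.measurable_val.comp
    ((measurable_pi_apply y).sub (measurable_pi_apply x))).abs measurable_const

theorem add_const_mem_lipOn (C : ℝ) (S : Finset (Site d)) (φ : HeightFn d k) (c : k.E) :
    (φ + fun _ => c) ∈ lipOn C S ↔ φ ∈ lipOn C S := by
  simp [lipOn]

theorem mem_lipOn_congr {C : ℝ} {S : Finset (Site d)} {φ φ' : HeightFn d k}
    (h : ∀ x ∈ S, φ x = φ' x) : φ ∈ lipOn C S ↔ φ' ∈ lipOn C S := by
  unfold lipOn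
  simp only [Set.mem_ofPred_eq]
  refine forall₂_congr fun x hx => forall₂_congr fun y hy => ?_
  rw [h x hx, h y hy]

theorem lipOn_mono {C : ℝ} {S T : Finset (Site d)} (h : S ⊆ T) :
    lipOn (k := k) C T ⊆ lipOn C S := fun _ hφ x hx y hy => hφ x (h hx) y (h hy)

open Classical in
/-- The weight of the interaction within `S`, restricted to height functions that satisfy a
Lipschitz bound. -/
noncomputable def blockWeight (Φ : Potential d k) (C : ℝ) (S : Finset (Site d)) :
    HeightFn d k → ℝ≥0∞ := (lipOn C S).indicator (weight Φ (meeting S S))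

/-- The reference measure on the height differences within `S`, restricted to height functions that
satisfy a Lipschitz bound. -/
noncomputable def blockRef (Φ : Potential d k) (C : ℝ) (S : Finset (Site d)) (o : Site d) :
    Measure (HeightFn d k) := (refMeasure (S.erase o) 0).withDensity (blockWeight Φ C S)

theorem indicator_one_comp {X Y : Type*} (A : Set Y) (g : X → Y) :
    (fun x => A.indicator (1 : Y → ℝ≥0∞) (g x)) = (g ⁻¹' A).indicator 1 := by
  ext x
  by_cases h : g x ∈ A
  · rw [Set.indicator_of_mem h, Set.indicator_of_mem (show x ∈ g ⁻¹' A from h)]; rfl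
  · rw [Set.indicator_of_notMem h, Set.indicator_of_notMem (show x ∉ g ⁻¹' A from h)]

/-- Restricting the reference measure to a smaller block. -/
theorem refMeasure_map_localize_ac {S T : Finset (Site d)} (hST : S ⊆ T) {a o : Site d}
    (ha : a ∈ S) (ho : o ∈ T) :
    (refMeasure (k := k) (T.erase o) 0).map (localize S a) ≪ refMeasure (S.erase a) 0 := by
  refine Measure.AbsolutelyContinuous.mk fun A hA h0 => ?_
  rw [Measure.map_apply (measurable_localize S a) hA,
    refMeasure_apply _ _ (measurable_localize S a hA), ← indicator_one_comp]
  rw [refMeasure_apply _ _ hA] at h0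
  set f : HeightFn d k → ℝ≥0∞ := fun φ => A.indicator 1 (localize S a φ) with hf
  have hfm : Measurable f := (measurable_one.indicator hA).comp (measurable_localize S a)
  have hfg : IsGrad f := fun φ c => by simp only [hf, isGrad_localize S a φ c]
  have hdep : DependsOn f (S : Set (Site d)) := by
    intro φ φ' h
    have : localize S a φ = localize S a φ' := by
      ext x
      by_cases hx : x ∈ S
      · rw [localize_of_mem hx, localize_of_mem hx, h x hx, h a ha]
      · rw [localize_of_notMem hx, localize_of_notMem hx]
    simp only [hf, this]
  -- The function depends on height differences in `S` only, so the larger block may be pinned at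
  -- `a`. For fixed heights on `T \ S` the inner integral over `S.erase a` is then the one that
  -- vanishes by assumption.
  rw [refInt_anchor ho (hST ha) hfm hfg (fun φ φ' h => hdep fun x hx => h x (hST hx))]
  have hun : T.erase a = (S.erase a) ∪ (T \ S) := by
    ext x; simp only [Finset.mem_erase, Finset.mem_union, Finset.mem_sdiff]
    by_cases hx : x ∈ S
    · simp [hx, hST hx]
    · simp only [hx, and_false, false_or, not_false_eq_true, and_true]
      exact ⟨fun h => h.2, fun h => ⟨fun e => hx (e ▸ ha), h⟩⟩
  have hdisj : Disjoint (S.erase a) (T \ S) :=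
    Finset.disjoint_of_subset_left (Finset.erase_subset _ _) Finset.disjoint_sdiff
  rw [hun, refInt_union' hfm hdisj, ← nonpos_iff_eq_zero]
  calc refInt (T \ S) (refInt (S.erase a) f) 0 = refInt (T \ S) (fun _ => 0) 0 := by
        refine refInt_congr_fun fun φ hφ => ?_
        rw [← h0]
        unfold refInt
        refine lintegral_congr fun ψ => ?_
        simp only [hf]
        congr 1
        have hz : ∀ x ∈ S, φ x = 0 := fun x hx => hφ x (by simp [hx])
        ext x
        by_cases hx : x ∈ S
        · rw [localize_of_mem hx, patch_of_notMem _ _ (Finset.notMem_erase a S), hz a ha, sub_zero]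
          by_cases hxa : x ∈ S.erase a
          · rw [patch_of_mem _ _ hxa, patch_of_mem _ _ hxa]
          · rw [patch_of_notMem _ _ hxa, patch_of_notMem _ _ hxa, hz x hx]; rfl
        · rw [localize_of_notMem hx, patch_of_notMem _ _ fun h => hx (Finset.mem_of_mem_erase h)]
          rfl
    _ ≤ 0 := by simp [refInt]

theorem gradCoords_ofGradCoords (S : Finset (Site d)) (o : Site d) (ω : ↥(S.erase o) → k.E) :
    gradCoords S o (ofGradCoords S o ω) = ω := by
  ext x
  rw [gradCoords, ofGradCoords, patch_of_mem _ _ x.2, patch_of_notMem _ _ (Finset.notMem_erase _ _)]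
  simp

theorem ofGradCoords_gradCoords (S : Finset (Site d)) (o : Site d)
    (φ : HeightFn d k) : ofGradCoords S o (gradCoords S o φ) = localize S o φ := by
  ext x
  by_cases hx : x ∈ S.erase o
  · rw [ofGradCoords, patch_of_mem _ _ hx, localize_of_mem (Finset.mem_of_mem_erase hx)]; rfl
  · rw [ofGradCoords, patch_of_notMem _ _ hx]
    by_cases hxS : x ∈ S
    · have : x = o := by by_contra h; exact hx (Finset.mem_erase.2 ⟨h, hxS⟩)
      rw [localize_of_mem hxS, this, sub_self]
    · rw [localize_of_notMem hxS]

theorem measurable_gradCoords (S : Finset (Site d)) (o : Site d) :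
    Measurable (gradCoords (k := k) S o) :=
  measurable_pi_lambda _ fun x => (measurable_pi_apply (x : Site d)).sub (measurable_pi_apply o)

theorem measurable_ofGradCoords (S : Finset (Site d)) (o : Site d) :
    Measurable (ofGradCoords (k := k) S o) := measurable_patch_right _ _

theorem map_ofGradCoords_withDensity (S : Finset (Site d)) (o : Site d)
    {w : HeightFn d k → ℝ≥0∞} (hw : Measurable w) :
    (((Measure.pi fun _ : ↥(S.erase o) => k.ref).withDensity fun ω =>
      w (ofGradCoords S o ω)).map (ofGradCoords S o)) =
      (refMeasure (S.erase o) 0).withDensity w := by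
  have hg := measurable_ofGradCoords (k := k) S o
  refine Measure.ext_of_lintegral _ fun f hf => ?_
  rw [lintegral_map hf hg, lintegral_withDensity_eq_lintegral_mul _
      (show Measurable fun ω => w (ofGradCoords S o ω) from hw.comp hg)
      (show Measurable fun ω => f (ofGradCoords S o ω) from hf.comp hg),
    lintegral_withDensity_eq_lintegral_mul _ hw hf, lintegral_refMeasure _ _ (hw.mul hf)]
  rfl

theorem map_ofGradCoords_blockLaw (S : Finset (Site d)) (o : Site d)
    (μ : Measure[gradSigma d k] (HeightFn d k)) :
    (@Measure.map _ _ (gradSigma d k) _ (gradCoords S o) μ).map (ofGradCoords S o) =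
      blockLaw S o (lift μ) := by
  rw [← map_lift μ (f := gradCoords S o) (fun φ c => by ext x; simp [gradCoords])
    (measurable_gradCoords S o),
    Measure.map_map (measurable_ofGradCoords S o) (measurable_gradCoords S o), blockLaw]
  congr 1
  exact funext fun φ => ofGradCoords_gradCoords S o φ

namespace Interaction

variable {L : AddSubgroup (Site d)} {Φ : Potential d k} (I : Interaction L Φ)
include I

theorem isGrad_weight (𝒢 : Set (Finset (Site d))) : IsGrad (weight Φ 𝒢) := I.weight_add_const 𝒢

theorem dependsOn_weight {𝒢 : Set (Finset (Site d))} {S : Set (Site d)}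
    (h : ∀ Γ ∈ 𝒢, (Γ : Set (Site d)) ⊆ S) : DependsOn (weight Φ 𝒢) S := fun φ φ' hφ =>
  I.weight_congr fun Γ hΓ x hx y hy => by rw [hφ x (h Γ hΓ hx), hφ y (h Γ hΓ hy)]

theorem measurable_blockWeight (C : ℝ) (S : Finset (Site d)) : Measurable (blockWeight Φ C S) :=
  (I.measurable_weight (isThin_meeting _ _)).indicator (measurableSet_lipOn C S)

theorem isGrad_blockWeight (C : ℝ) (S : Finset (Site d)) : IsGrad (blockWeight Φ C S) := by
  intro φ c
  unfold blockWeight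
  by_cases h : φ ∈ lipOn C S
  · rw [Set.indicator_of_mem h, Set.indicator_of_mem ((add_const_mem_lipOn C S φ c).2 h),
      I.weight_add_const]
  · rw [Set.indicator_of_notMem h,
      Set.indicator_of_notMem fun h' => h ((add_const_mem_lipOn C S φ c).1 h')]

theorem dependsOn_blockWeight (C : ℝ) (S : Finset (Site d)) :
    DependsOn (blockWeight Φ C S) (S : Set (Site d)) := by
  intro φ φ' h
  unfold blockWeight
  have hw := I.dependsOn_weight (𝒢 := meeting S S) (S := S) (fun Γ hΓ => hΓ.1) h
  by_cases hφ : φ ∈ lipOn C S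
  · rw [Set.indicator_of_mem hφ, Set.indicator_of_mem ((mem_lipOn_congr h).1 hφ), hw]
  · rw [Set.indicator_of_notMem hφ, Set.indicator_of_notMem fun h' => hφ ((mem_lipOn_congr h).2 h')]

theorem lintegral_blockRef (C : ℝ) (S : Finset (Site d)) (o : Site d) {f : HeightFn d k → ℝ≥0∞}
    (hf : Measurable f) : ∫⁻ φ, f φ ∂(blockRef Φ C S o) =
      refInt (S.erase o) (fun φ => blockWeight Φ C S φ * f φ) 0 := by
  have hm : Measurable fun φ => blockWeight Φ C S φ * f φ := (I.measurable_blockWeight C S).mul hf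
  rw [blockRef, lintegral_withDensity_eq_lintegral_mul _ (I.measurable_blockWeight C S) hf,
    ← lintegral_refMeasure _ _ hm]
  rfl

/-- The cut-off by `lipOn` confines the heights on `S` to a bounded set around the pinned one. The
constraint itself need not do so, since the edges within `S` may fail to connect `S`. -/
theorem isFiniteMeasure_blockRef (C : ℝ) {S : Finset (Site d)} {o : Site d} (ho : o ∈ S) :
    IsFiniteMeasure (blockRef Φ C S o) := by
  refine ⟨?_⟩
  rw [← lintegral_one, I.lintegral_blockRef C S o measurable_const]
  set B : Set (HeightFn d k) := {φ | ∀ x ∈ S.erase o, |k.val (φ x - 0)| ≤ C * dist1 o x} with hB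
  have hBm : MeasurableSet B := by
    have : B = ⋂ (x : Site d) (_ : x ∈ S.erase o), {φ | |k.val (φ x - 0)| ≤ C * dist1 o x} := by
      ext; simp [hB]
    rw [this]
    refine MeasurableSet.iInter fun x => MeasurableSet.iInter fun _ => ?_
    exact measurableSet_le (k.measurable_val.comp
      ((measurable_pi_apply x).sub measurable_const)).abs measurable_const
  calc refInt (S.erase o) (fun φ => blockWeight Φ C S φ * 1) 0
      ≤ refInt (S.erase o) (fun φ => ENNReal.ofReal (Real.exp (I.weakBound S)) *
          B.indicator 1 φ) 0 := by
        refine refInt_mono fun φ hφ => ?_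
        rw [mul_one]
        by_cases h : φ ∈ lipOn C S
        · have hb : φ ∈ B := fun x hx => by
            have := h o ho x (Finset.mem_of_mem_erase hx)
            rwa [hφ o (Finset.notMem_erase _ _)] at this
          rw [blockWeight, Set.indicator_of_mem h, Set.indicator_of_mem hb, Pi.one_apply, mul_one]
          exact I.weight_le (isThin_meeting _ _) (I.weakBound_nonneg S)
            (I.weakAbs_le_of_meets (fun _ h => h.2) φ)
        · rw [blockWeight, Set.indicator_of_notMem h]; exact zero_le
    _ = ENNReal.ofReal (Real.exp (I.weakBound S)) * refInt (S.erase o) (B.indicator 1) 0 :=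
        refInt_const_mul (measurable_one.indicator hBm) _ _
    _ < ∞ := ENNReal.mul_lt_top ENNReal.ofReal_lt_top
        (refInt_indicator_bounded_lt_top _ (fun _ => 0) (fun x => C * dist1 o x) 0)

/-- Block entropies therefore do not depend on the pinned vertex, which permits passing between
sub-blocks that do not share one. -/
theorem blockRef_map_localize (C : ℝ) {S : Finset (Site d)} {o o' : Site d} (ho : o ∈ S)
    (ho' : o' ∈ S) : (blockRef Φ C S o).map (localize S o') = blockRef Φ C S o' := by
  refine Measure.ext_of_lintegral _ fun f hf => ?_
  have hm : Measurable fun φ => f (localize S o' φ) := hf.comp (measurable_localize S o')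
  have hm' : Measurable fun φ => blockWeight Φ C S φ * f (localize S o' φ) :=
    (I.measurable_blockWeight C S).mul hm
  rw [lintegral_map hf (measurable_localize S o'), I.lintegral_blockRef C S o hm,
    I.lintegral_blockRef C S o' hf, refInt_anchor ho ho' hm']
  · refine refInt_congr_fun fun φ hφ => ?_
    have : localize S o' φ = φ := by
      ext x
      by_cases hx : x ∈ S
      · rw [localize_of_mem hx, hφ o' (Finset.notMem_erase _ _)]; simp
      · rw [localize_of_notMem hx, hφ x fun h => hx (Finset.mem_of_mem_erase h)]; rfl
    rw [this]
  · intro φ c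
    simp only [I.isGrad_blockWeight C S φ c, isGrad_localize S o' φ c]
  · intro φ φ' h
    have : localize S o' φ = localize S o' φ' := by
      ext x
      by_cases hx : x ∈ S
      · rw [localize_of_mem hx, localize_of_mem hx, h x hx, h o' ho']
      · rw [localize_of_notMem hx, localize_of_notMem hx]
    simp only [I.dependsOn_blockWeight C S h, this]

/-- The free energy as the entropy of a law of height functions. -/
theorem freeEnergy_eq (C : ℝ) {S : Finset (Site d)} {o : Site d} (ho : o ∈ S)
    {μ : Measure[gradSigma d k] (HeightFn d k)} (hμ : IsProbabilityMeasure μ)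
    (hlip : ∀ᵐ φ ∂(lift μ), φ ∈ lipOn C S) :
    (klDiv (blockLaw S o (lift μ)) (blockRef Φ C S o) = ∞ → freeEnergy Φ S o μ = ⊤) ∧
      (klDiv (blockLaw S o (lift μ)) (blockRef Φ C S o) ≠ ∞ →
        freeEnergy Φ S o μ = (ent (blockLaw S o (lift μ)) (blockRef Φ C S o) : ℝ)) := by
  have := isProbabilityMeasure_lift μ hμ
  have := I.isFiniteMeasure_blockRef C ho
  have hog := measurable_ofGradCoords (k := k) S o
  have hgc := measurable_gradCoords (k := k) S o
  have hw : Measurable (weight Φ (meeting S (S : Set (Site d)))) :=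
    I.measurable_weight (isThin_meeting _ _)
  set Q := @Measure.map _ _ (gradSigma d k) _ (gradCoords S o) μ with hQ
  have hQ' : Q = (lift μ).map (gradCoords S o) :=
    (map_lift μ (fun φ c => by ext x; simp [gradCoords]) hgc).symm
  have : IsProbabilityMeasure Q := by
    rw [hQ']; exact Measure.isProbabilityMeasure_map hgc.aemeasurable
  set ν := ((Measure.pi fun _ : ↥(S.erase o) => k.ref).withDensity fun ω =>
      EReal.exp (-interiorHamiltonian Φ S (ofGradCoords S o ω))) with hν
  have hνw : ν = (Measure.pi fun _ : ↥(S.erase o) => k.ref).withDensity fun ω =>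
      weight Φ (meeting S S) (ofGradCoords S o ω) := rfl
  have : SigmaFinite ν := by
    rw [hνw]
    exact SigmaFinite.withDensity_of_ne_top
      (Eventually.of_forall fun ω => (I.weight_lt_top (isThin_meeting _ _) _).ne)
  -- The free energy refers to a σ-finite measure without cut-off. The law is carried by `G`, so
  -- restricting the reference measure to `G` changes neither the density nor the entropy and makes
  -- the measure finite.
  set G := ofGradCoords S o ⁻¹' lipOn C S with hG
  have hGm : MeasurableSet G := hog (measurableSet_lipOn C S)
  have hνG : ν.restrict G = (Measure.pi fun _ : ↥(S.erase o) => k.ref).withDensity fun ω =>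
      blockWeight Φ C S (ofGradCoords S o ω) := by
    rw [hνw, restrict_withDensity hGm, ← withDensity_indicator hGm]
    rfl
  have hmap : (ν.restrict G).map (ofGradCoords S o) = blockRef Φ C S o := by
    rw [hνG, map_ofGradCoords_withDensity S o (I.measurable_blockWeight C S)]; rfl
  have hQmap : Q.map (ofGradCoords S o) = blockLaw S o (lift μ) := map_ofGradCoords_blockLaw S o μ
  have : IsFiniteMeasure (ν.restrict G) := by
    refine ⟨?_⟩
    have := measure_lt_top (blockRef Φ C S o) Set.univ
    rwa [← hmap, Measure.map_apply hog MeasurableSet.univ] at this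
  have hQG : ∀ᵐ ω ∂Q, ω ∈ G := by
    rw [hQ', ae_map_iff (p := fun ω => ω ∈ G) hgc.aemeasurable hGm]
    filter_upwards [hlip] with φ hφ
    change ofGradCoords S o (gradCoords S o φ) ∈ lipOn C S
    rw [ofGradCoords_gradCoords]
    intro x hx y hy
    rw [localize_of_mem hx, localize_of_mem hy]
    simpa using hφ x hx y hy
  have hid : ∀ N : Measure (↥(S.erase o) → k.E),
      (N.map (ofGradCoords S o)).map (gradCoords S o) = N := by
    intro N
    rw [Measure.map_map hgc hog]
    have : gradCoords (k := k) S o ∘ ofGradCoords S o = id :=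
      funext fun ω => gradCoords_ofGradCoords S o ω
    rw [this, Measure.map_id]
  have hkl : klDiv (blockLaw S o (lift μ)) (blockRef Φ C S o) = klDiv Q (ν.restrict G) := by
    rw [← hmap, ← hQmap]
    exact klDiv_map_eq hog hgc (hid _) (hid _)
  have key := relEntropy_eq (M := Q) (ν := ν) hGm hQG
  rw [hkl]
  refine ⟨key.1, fun h => (key.2 h).trans ?_⟩
  have e1 := toReal_klDiv_eq_ent h
  have e2 := toReal_klDiv_eq_ent (M := blockLaw S o (lift μ)) (ν := blockRef Φ C S o) (hkl ▸ h)
  have e3 : (blockRef Φ C S o).real Set.univ = (ν.restrict G).real Set.univ := by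
    rw [← hmap, map_measureReal_apply hog MeasurableSet.univ]; rfl
  rw [hkl, e3] at e2
  have : ent Q (ν.restrict G) = ent (blockLaw S o (lift μ)) (blockRef Φ C S o) := by linarith
  rw [this]

end Interaction

end Block

/-! ### Regular measures -/

section Regular

open InformationTheory

variable {d : ℕ} {k : HeightKind}

theorem exists_translate_subset_box {L : AddSubgroup (Site d)} (hL : L.FiniteIndex)
    (S : Finset (Site d)) : ∃ n₀ : ℕ, ∀ n ≥ n₀, ∃ v ∈ L, translateSet v S ⊆ box d n := by
  obtain ⟨B, hB⟩ : ∃ B : ℕ, ∀ x ∈ S, ∀ i, |x i| ≤ B := by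
    refine ⟨∑ x ∈ S, ∑ i, (x i).natAbs, fun x hx i => ?_⟩
    have h1 : (x i).natAbs ≤ ∑ i, (x i).natAbs :=
      Finset.single_le_sum (f := fun i => (x i).natAbs) (fun _ _ => Nat.zero_le _)
        (Finset.mem_univ i)
    have h2 : ∑ i, (x i).natAbs ≤ ∑ x ∈ S, ∑ i, (x i).natAbs :=
      Finset.single_le_sum (f := fun x => ∑ i, (x i).natAbs) (fun _ _ => Nat.zero_le _) hx
    rw [Int.abs_eq_natAbs]
    exact_mod_cast h1.trans h2
  have hidx : 1 ≤ (L.index : ℤ) := by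
    have := hL.index_ne_zero; omega
  -- The shift by `L.index * B` in each coordinate belongs to `L` and is at least `B`, so it moves
  -- `S` into the positive orthant.
  refine ⟨L.index * B + B + 1, fun n hn => ⟨fun i => (L.index : ℤ) * B,
    index_smul_mem L (fun _ => (B : ℤ)), fun y hy => ?_⟩⟩
  rw [mem_translateSet] at hy
  rw [box, Fintype.mem_piFinset]
  intro i
  have h := abs_le.1 (hB _ hy i)
  simp only [Pi.sub_apply] at h
  have hn' : (L.index : ℤ) * B + B + 1 ≤ n := by exact_mod_cast hn
  rw [Finset.mem_Ico]
  constructor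
  · nlinarith [h.1, Nat.zero_le B]
  · linarith [h.2]

theorem zero_mem_box {n : ℕ} (hn : 0 < n) : (0 : Site d) ∈ box d n := by
  rw [box, Fintype.mem_piFinset]; intro i; simpa using hn

theorem translateSet_erase (v : Site d) (S : Finset (Site d)) (a : Site d) :
    translateSet v (S.erase a) = (translateSet v S).erase (a + v) := by
  ext x
  simp only [mem_translateSet, Finset.mem_erase, ne_eq, sub_eq_iff_eq_add]

theorem eventually_freeEnergy_ne_top {Φ : Potential d k}
    {μ : Measure[gradSigma d k] (HeightFn d k)} {h : EReal}
    (hμ : HasSpecificFreeEnergy Φ μ h) (hlt : h < ⊤) :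
    ∀ᶠ n : ℕ in atTop, freeEnergy Φ (box d n) 0 μ ≠ ⊤ := by
  filter_upwards [hμ.eventually (gt_mem_nhds hlt), eventually_gt_atTop 0] with n hn hn0 htop
  rw [htop, EReal.coe_mul_top_of_pos (by positivity)] at hn
  exact lt_irrefl _ hn

namespace Interaction

variable {L : AddSubgroup (Site d)} {Φ : Potential d k} (I : Interaction L Φ)
include I

/-- Laws of height functions that satisfy the local Lipschitz constraint, and for which the height
differences in finite sets have densities. -/
structure Regular (M : Measure (HeightFn d k)) : Prop where
  lip : ∀ᵐ φ ∂M, φ ∈ I.Lip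
  ac : ∀ (S : Finset (Site d)) (a : Site d), a ∈ S → blockLaw S a M ≪ refMeasure (S.erase a) 0

theorem lip_of_grad : ∀ φ (c : k.E), (φ + fun _ => c) ∈ I.Lip ↔ φ ∈ I.Lip := by
  intro φ c
  simp [Lip]

theorem ac_of_freeEnergy_ne_top {μ : Measure[gradSigma d k] (HeightFn d k)} {S : Finset (Site d)}
    {o : Site d} (h : freeEnergy Φ S o μ ≠ ⊤) :
    blockLaw S o (lift μ) ≪ (refMeasure (S.erase o) 0).withDensity (weight Φ (meeting S S)) := by
  rw [← map_ofGradCoords_withDensity S o (I.measurable_weight (isThin_meeting _ _)),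
    ← map_ofGradCoords_blockLaw S o μ]
  refine Measure.AbsolutelyContinuous.map ?_ (measurable_ofGradCoords S o)
  by_contra hac
  apply h
  unfold freeEnergy relEntropy
  rw [if_neg]
  exact fun h' => hac h'.1

/-- Finite entropy in a box entails absolute continuity with respect to the weighted reference
measure, which charges no violated edge inside the box. Every finite set has an `L`-translate in a
large box, and invariance carries the conclusion back. -/
theorem regular_of_freeEnergy (hL : L.FiniteIndex) {μ : Measure[gradSigma d k] (HeightFn d k)}
    (hinv : IsInvariantGradientMeasure L μ)
    (h : ∀ᶠ n : ℕ in atTop, freeEnergy Φ (box d n) 0 μ ≠ ⊤) : I.Regular (lift μ) := by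
  have hgi := isGradInvariant_lift hinv
  obtain ⟨n₁, hn₁⟩ := eventually_atTop.1 h
  have hplace : ∀ S : Finset (Site d), ∃ n : ℕ, n₁ ≤ n ∧ 0 < n ∧ ∃ v ∈ L,
      translateSet v S ⊆ box d n := by
    intro S
    obtain ⟨n₀, hn₀⟩ := exists_translate_subset_box hL S
    exact ⟨max n₀ (max n₁ 1), by simp, by simp, hn₀ _ (by simp)⟩
  constructor
  · have hedge : ∀ x y, I.A.Adj x y → ∀ᵐ φ ∂(lift μ), k.val (φ y - φ x) ≤ I.q x y := by
      intro x y hxy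
      obtain ⟨n, hn, hn0, v, hv, hsub⟩ := hplace {x, y}
      have hac := I.ac_of_freeEnergy_ne_top (hn₁ n hn)
      have hx : x + v ∈ box d n := hsub (by rw [mem_translateSet]; simp)
      have hy : y + v ∈ box d n := hsub (by rw [mem_translateSet]; simp)
      have hw : ∀ᵐ φ ∂(blockLaw (box d n) 0 (lift μ)),
          weight Φ (meeting (box d n) (box d n)) φ ≠ 0 := by
        exact hac.ae_le ((ae_withDensity_iff (I.measurable_weight (isThin_meeting _ _))).2
          (Eventually.of_forall fun _ h => h))
      have hm : ∀ a b : Site d, MeasurableSet {φ : HeightFn d k | k.val (φ b - φ a) ≤ I.q x y} :=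
        fun a b => measurableSet_le (k.measurable_val.comp
          ((measurable_pi_apply b).sub (measurable_pi_apply a))) measurable_const
      have h1 : ∀ᵐ φ ∂(lift μ), k.val (φ (y + v) - φ (x + v)) ≤ I.q x y := by
        rw [← ae_blockLaw (S := box d n) (o := 0) (fun φ c => by simp) ?_ (hm _ _)]
        · filter_upwards [hw] with φ hφ
          rw [I.weight_ne_zero_iff] at hφ
          have := hφ (x + v) (y + v) ((I.constraint.graph.invariant v hv x y).2 hxy) hx hy (Or.inl hx)
          rwa [I.constraint.quasimetric.invariant v hv] at this
        · intro φ φ' hφ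
          simp only [hφ _ hx, hφ _ hy]
      exact (hgi.ae_shift hv (p := fun φ => k.val (φ y - φ x) ≤ I.q x y)
        (fun φ c => by simp) (hm x y)).1 h1
    have : ∀ᵐ φ ∂(lift μ), ∀ x y, I.A.Adj x y → k.val (φ y - φ x) ≤ I.q x y := by
      rw [ae_all_iff]; intro x
      rw [ae_all_iff]; intro y
      by_cases hxy : I.A.Adj x y
      · filter_upwards [hedge x y hxy] with φ hφ _ using hφ
      · exact Eventually.of_forall fun φ h => absurd h hxy
    exact this
  · intro S a ha
    obtain ⟨n, hn, hn0, v, hv, hsub⟩ := hplace S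
    have hac := (I.ac_of_freeEnergy_ne_top (hn₁ n hn)).trans (withDensity_absolutelyContinuous _ _)
    have ha' : a + v ∈ translateSet v S := by rw [mem_translateSet]; simpa using ha
    have h1 := (hac.map (measurable_localize (translateSet v S) (a + v))).trans
      (refMeasure_map_localize_ac hsub ha' (zero_mem_box hn0))
    rw [blockLaw_map_localize hsub (hsub ha')] at h1
    have h2 := h1.map (measurable_shift v)
    rw [hgi.blockLaw_shift hv, ← translateSet_erase, refMeasure_map_shift] at h2
    exact h2

/-- The full weight of the interactions that involve the heights in `V`. -/
theorem measurable_fullWeight (V : Finset (Site d)) :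
    Measurable (weight Φ (meeting V Set.univ)) := I.measurable_weight (isThin_meeting _ _)

theorem refInt_weight_eq_zero_iff (V : Finset (Site d)) (φ : HeightFn d k) :
    refInt V (weight Φ (meeting V Set.univ)) φ = 0 ↔
      refInt V ({φ | I.EdgeLip V Set.univ φ}.indicator 1) φ = 0 := by
  have hm := I.measurable_fullWeight V
  have hm' : Measurable ({φ | I.EdgeLip V Set.univ φ}.indicator (1 : HeightFn d k → ℝ≥0∞)) :=
    measurable_one.indicator (I.measurableSet_edgeLip V Set.univ)
  rw [← lintegral_refMeasure _ _ hm, ← lintegral_refMeasure _ _ hm', lintegral_eq_zero_iff hm,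
    lintegral_eq_zero_iff hm']
  refine eventually_congr (Eventually.of_forall fun φ' => ?_)
  have := I.weight_ne_zero_iff V Set.univ φ'
  by_cases h : I.EdgeLip V Set.univ φ'
  · rw [Set.indicator_of_mem (show φ' ∈ {φ | I.EdgeLip V Set.univ φ} from h)]
    simp [this.2 h]
  · rw [Set.indicator_of_notMem (show φ' ∉ {φ | I.EdgeLip V Set.univ φ} from h)]
    have : weight Φ (meeting V Set.univ) φ' = 0 := by by_contra hc; exact h (this.1 hc)
    simp [this]

theorem refInt_fullWeight_lt_top (hd : 0 < d) (V : Finset (Site d)) (φ : HeightFn d k) :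
    refInt V (weight Φ (meeting V Set.univ)) φ < ∞ :=
  I.refInt_weight_lt_top hd V (Set.subset_univ _) (fun _ _ _ _ => Set.mem_univ _) φ

/-- Height functions that satisfy the local Lipschitz constraint and have positive partition
functions. -/
def Good : Set (HeightFn d k) :=
  {φ | φ ∈ I.Lip ∧ ∀ V : Finset (Site d), refInt V (weight Φ (meeting V Set.univ)) φ ≠ 0}

theorem measurableSet_good : MeasurableSet I.Good := by
  refine I.measurableSet_lip.inter ?_
  have : {φ : HeightFn d k | ∀ V : Finset (Site d), refInt V (weight Φ (meeting V Set.univ)) φ ≠ 0} =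
      ⋂ V : Finset (Site d), {φ | refInt V (weight Φ (meeting V Set.univ)) φ ≠ 0} := by ext; simp
  change MeasurableSet {φ : HeightFn d k | ∀ V : Finset (Site d), _}
  rw [this]
  refine MeasurableSet.iInter fun V => ?_
  exact (measurableSet_eq_fun (I.measurable_fullWeight V).refInt measurable_const).compl

theorem add_const_mem_good (φ : HeightFn d k) (c : k.E) : (φ + fun _ => c) ∈ I.Good ↔ φ ∈ I.Good := by
  unfold Good
  simp only [Set.mem_ofPred_eq, I.lip_of_grad φ c]
  refine and_congr_right fun _ => forall_congr' fun V => ?_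
  rw [← refInt_comp_add]
  simp only [I.weight_add_const]

theorem normalizable_of_good (hd : 0 < d) {φ : HeightFn d k} (h : φ ∈ I.Good)
    (V : Finset (Site d)) : Normalizable V (weight Φ (meeting V Set.univ)) φ :=
  ⟨pos_iff_ne_zero.2 (h.2 V), I.refInt_fullWeight_lt_top hd V φ⟩

/-- With `good_of_admissible` this identifies `Good` with the admissible height functions. Only
positivity of the partition functions is a genuine condition; finiteness is automatic. -/
theorem admissible_of_good (hd : 0 < d) {φ : HeightFn d k} (h : φ ∈ I.Good) : Admissible Φ φ := by
  refine ⟨fun Λ => ?_, fun Λ => ⟨pos_iff_ne_zero.2 (h.2 Λ), I.refInt_fullWeight_lt_top hd Λ φ⟩⟩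
  rw [I.sum, ← I.coe_toReal_weak]
  have h1 : I.Ψ Λ φ ≠ ⊤ := by
    intro htop
    obtain ⟨x, y, _, hxy, hq⟩ := (I.lipschitz Λ φ).1 htop
    exact absurd (h.1 x y hxy) (not_le.2 hq)
  exact EReal.add_lt_top h1 (EReal.coe_ne_top _)

theorem good_of_admissible {φ : HeightFn d k} (h : Admissible Φ φ) : φ ∈ I.Good := by
  refine ⟨fun x y hxy => ?_, fun V => (h.2 V).1.ne'⟩
  by_contra! hq
  have h1 : I.Ψ {x, y} φ = ⊤ := (I.lipschitz _ φ).2 ⟨x, y, rfl, hxy, hq⟩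
  have h2 := h.1 {x, y}
  rw [I.sum, ← I.coe_toReal_weak, h1, EReal.top_add_coe] at h2
  exact lt_irrefl _ h2

/-- Height functions that violate positivity of the partition function on `Λ`, although they
satisfy the constraint around `Λ`, are negligible. -/
theorem Regular.ae_refInt_bad_eq_zero (hd : 0 < d) (hL : L.FiniteIndex)
    {M : Measure (HeightFn d k)} (hM : I.Regular M) (V Λ : Finset (Site d)) :
    ∀ᵐ φ ∂M, refInt V (({φ | I.EdgeLip Λ Set.univ φ} ∩
      {φ | refInt Λ ({φ | I.EdgeLip Λ Set.univ φ}.indicator 1) φ = 0}).indicator 1) φ = 0 := by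
  obtain ⟨r, hr⟩ := I.exists_edge_length hL
  -- The pinned vertex is chosen away from `V` and from the neighbourhood of `Λ`, so that the
  -- integrations over `V` and over `Λ` leave it untouched.
  obtain ⟨a, ha⟩ := exists_notMem hd (V ∪ thicken r Λ)
  set S := insert a (V ∪ thicken r Λ) with hS
  set Y : Set (HeightFn d k) := {φ | I.EdgeLip Λ Set.univ φ} with hY
  set f : HeightFn d k → ℝ≥0∞ := Y.indicator 1 with hf
  have hYm : MeasurableSet Y := I.measurableSet_edgeLip Λ Set.univ
  have hfm : Measurable f := measurable_one.indicator hYm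
  set N : Set (HeightFn d k) := Y ∩ {φ | refInt Λ f φ = 0} with hN
  have hNm : MeasurableSet N := hYm.inter (measurableSet_eq_fun hfm.refInt measurable_const)
  set g : HeightFn d k → ℝ≥0∞ := N.indicator 1 with hg
  have hgm : Measurable g := measurable_one.indicator hNm
  have haV : a ∉ V := fun h => ha (Finset.mem_union_left _ h)
  have haΛ : a ∉ Λ := fun h => ha (Finset.mem_union_right _ (subset_thicken r Λ h))
  have hΛS : thicken r Λ ⊆ S := fun x hx => by simp [hS, hx]
  -- dependence on finitely many heights
  have hYdep : ∀ φ φ' : HeightFn d k, (∀ x ∈ thicken r Λ, φ x = φ' x) → φ ∈ Y → φ' ∈ Y := by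
    intro φ φ' h hφ x y hxy _ _ hV
    have hmem : x ∈ thicken r Λ ∧ y ∈ thicken r Λ := by
      rcases hV with hx | hy
      · exact ⟨subset_thicken r Λ hx, mem_thicken.2 ⟨x, hx, hr x y hxy⟩⟩
      · exact ⟨mem_thicken.2 ⟨y, hy, hr y x hxy.symm⟩, subset_thicken r Λ hy⟩
    rw [← h x hmem.1, ← h y hmem.2]
    exact hφ x y hxy trivial trivial hV
  have hfdep : DependsOn f (thicken r Λ : Set (Site d)) := by
    intro φ φ' h
    by_cases hφ : φ ∈ Y
    · simp only [hf]
      rw [Set.indicator_of_mem hφ, Set.indicator_of_mem (hYdep φ φ' h hφ)]; rfl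
    · simp only [hf]
      rw [Set.indicator_of_notMem hφ, Set.indicator_of_notMem fun h' => hφ (hYdep φ' φ
        (fun x hx => (h x hx).symm) h')]
  have hrdep : ∀ (T : Finset (Site d)) (u : HeightFn d k → ℝ≥0∞) (Q : Finset (Site d)),
      DependsOn u (Q : Set (Site d)) → DependsOn (refInt T u) ((Q \ T : Finset _) : Set (Site d)) := by
    intro T u Q hu φ φ' h
    unfold refInt
    refine lintegral_congr fun ψ => hu fun x hx => ?_
    by_cases hxT : x ∈ T
    · rw [patch_of_mem _ _ hxT, patch_of_mem _ _ hxT]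
    · rw [patch_of_notMem _ _ hxT, patch_of_notMem _ _ hxT]
      exact h x (by simp [hxT]; exact hx)
  have hNdep : ∀ φ φ' : HeightFn d k, (∀ x ∈ thicken r Λ, φ x = φ' x) → φ ∈ N → φ' ∈ N := by
    intro φ φ' h hφ
    refine ⟨hYdep φ φ' h hφ.1, ?_⟩
    have := hrdep Λ f _ hfdep (x := φ) (y := φ') fun x hx => h x (by
      have := Finset.mem_sdiff.1 (Finset.mem_coe.1 hx); exact this.1)
    change refInt Λ f φ' = 0
    rw [← this]; exact hφ.2
  have hgdep : DependsOn g (S : Set (Site d)) := by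
    intro φ φ' h
    have h' : ∀ x ∈ thicken r Λ, φ x = φ' x := fun x hx => h x (hΛS hx)
    by_cases hφ : φ ∈ N
    · simp only [hg]
      rw [Set.indicator_of_mem hφ, Set.indicator_of_mem (hNdep φ φ' h' hφ)]; rfl
    · simp only [hg]
      rw [Set.indicator_of_notMem hφ, Set.indicator_of_notMem fun h'' => hφ (hNdep φ' φ
        (fun x hx => (h' x hx).symm) h'')]
  have hfg : IsGrad f := isGrad_indicator fun φ c => by
    simp only [hY, Set.mem_ofPred_eq, EdgeLip]; simp
  have hrg : ∀ (T : Finset (Site d)) (u : HeightFn d k → ℝ≥0∞), IsGrad u → IsGrad (refInt T u) := by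
    intro T u hu φ c
    rw [← refInt_comp_add]
    exact refInt_congr_fun fun φ' _ => hu φ' c
  have hgg : IsGrad g := isGrad_indicator fun φ c => by
    simp only [hN, Set.mem_inter_iff, Set.mem_ofPred_eq, hrg Λ f hfg φ c]
    refine and_congr_left fun _ => ?_
    simp only [hY, Set.mem_ofPred_eq, EdgeLip]; simp
  -- the reference measure does not charge bad height functions
  have hz : ∀ φ, refInt Λ g φ = 0 := by
    intro φ
    by_cases h0 : refInt Λ f φ = 0
    · refine nonpos_iff_eq_zero.1 (le_trans (refInt_mono fun φ' _ => ?_) h0.le)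
      simp only [hg, hf]
      exact Set.indicator_le_indicator_of_subset Set.inter_subset_left (fun _ => zero_le) φ'
    · have : refInt Λ g φ = refInt Λ (fun _ => 0) φ := by
        refine refInt_congr_fun fun φ' hφ' => ?_
        simp only [hg]
        refine Set.indicator_of_notMem (fun h => h0 ?_) _
        rw [← refInt_congr f hφ']; exact h.2
      rw [this]; simp [refInt]
  have hS0 : refInt (S.erase a) g 0 = 0 := by
    have hsub : Λ ⊆ S.erase a := fun x hx =>
      Finset.mem_erase.2 ⟨fun h => haΛ (h ▸ hx), hΛS (subset_thicken r Λ hx)⟩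
    rw [← Finset.sdiff_union_of_subset hsub, refInt_union hgm Finset.sdiff_disjoint]
    have : refInt Λ g = fun _ => 0 := funext hz
    rw [this]; simp [refInt]
  -- Integrating over `V` first leaves a null set in the coordinates on `S \ V`, whose law under `M`
  -- has a density by regularity.
  have hV0 : refInt ((S \ V).erase a) (refInt V g) 0 = 0 := by
    rw [← hS0]
    have : S.erase a = ((S \ V).erase a) ∪ V := by
      ext x
      simp only [Finset.mem_erase, Finset.mem_union, Finset.mem_sdiff]
      by_cases hx : x ∈ V
      · have : x ≠ a := fun h => haV (h ▸ hx)
        simp [hx, this, hS]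
      · simp [hx]
    rw [this, refInt_union hgm]
    exact Finset.disjoint_left.2 fun x hx hxV =>
      (Finset.mem_sdiff.1 (Finset.mem_of_mem_erase hx)).2 hxV
  have hac := hM.ac (S \ V) a (by simp [hS, haV])
  have h1 : ∀ᵐ φ ∂(refMeasure (k := k) ((S \ V).erase a) 0), refInt V g φ = 0 := by
    rw [← lintegral_refMeasure _ _ hgm.refInt, lintegral_eq_zero_iff hgm.refInt] at hV0
    exact hV0
  have hgr := hrg V g hgg
  have hdr := hrdep V g S hgdep
  exact (ae_blockLaw (p := fun φ => refInt V g φ = 0) (S := S \ V) (o := a) (M := M)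
    (fun φ c => by rw [hgr φ c]) (fun φ φ' h => by simp only [hdr h])
    (measurableSet_eq_fun hgm.refInt measurable_const)).1 (hac.ae_le h1)

theorem good_of_lip {φ : HeightFn d k} (h : φ ∈ I.Lip)
    (hbad : ∀ Λ : Finset (Site d), φ ∉ ({φ | I.EdgeLip Λ Set.univ φ} ∩
      {φ | refInt Λ ({φ | I.EdgeLip Λ Set.univ φ}.indicator 1) φ = 0})) : φ ∈ I.Good := by
  refine ⟨h, fun Λ h0 => hbad Λ ⟨fun x y hxy _ _ _ => h x y hxy, ?_⟩⟩
  exact (I.refInt_weight_eq_zero_iff Λ φ).1 h0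

/-- The case `V = ∅` of the previous estimate, for the countably many finite sets `Λ`. -/
theorem Regular.ae_good (hd : 0 < d) (hL : L.FiniteIndex)
    {M : Measure (HeightFn d k)} (hM : I.Regular M) : ∀ᵐ φ ∂M, φ ∈ I.Good := by
  have h := ae_all_iff.2 fun Λ : Finset (Site d) => hM.ae_refInt_bad_eq_zero I hd hL ∅ Λ
  filter_upwards [hM.lip, h] with φ hφ hb
  refine I.good_of_lip hφ fun Λ hΛ => ?_
  have := hb Λ
  rw [refInt_empty, Set.indicator_of_mem hΛ] at this
  exact one_ne_zero this

/-- Resampling must not leave the admissible height functions. On each fibre the Gibbs law has a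
density with respect to the reference measure on `V`, so it avoids the negligible sets above; edges
that touch `V` hold because the weight is nonzero, the others because the heights off `V` are
unchanged. -/
theorem Regular.ae_ae_good (hd : 0 < d) (hL : L.FiniteIndex)
    {M : Measure (HeightFn d k)} (hM : I.Regular M) (V : Finset (Site d)) :
    ∀ᵐ φ ∂M, ∀ᵐ φ' ∂(gibbsLaw V (weight Φ (meeting V Set.univ)) φ), φ' ∈ I.Good := by
  have h := ae_all_iff.2 fun Λ : Finset (Site d) => hM.ae_refInt_bad_eq_zero I hd hL V Λ
  filter_upwards [hM.ae_good I hd hL, h] with φ hφ hb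
  have hn := I.normalizable_of_good hd hφ V
  have h1 : ∀ᵐ φ' ∂(gibbsLaw V (weight Φ (meeting V Set.univ)) φ), ∀ Λ : Finset (Site d),
      φ' ∉ ({φ | I.EdgeLip Λ Set.univ φ} ∩
        {φ | refInt Λ ({φ | I.EdgeLip Λ Set.univ φ}.indicator 1) φ = 0}) := by
    rw [ae_all_iff]
    intro Λ
    refine (gibbsLaw_absolutelyContinuous hn).ae_le ?_
    have hm : MeasurableSet ({φ | I.EdgeLip Λ Set.univ φ} ∩
        {φ | refInt Λ ({φ | I.EdgeLip Λ Set.univ φ}.indicator 1) φ = 0}) :=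
      (I.measurableSet_edgeLip Λ Set.univ).inter (measurableSet_eq_fun
        (measurable_one.indicator (I.measurableSet_edgeLip Λ Set.univ)).refInt measurable_const)
    have := hb Λ
    rw [← refMeasure_apply _ _ hm] at this
    exact measure_eq_zero_iff_ae_notMem.1 this
  filter_upwards [h1, ae_gibbsLaw_ne_zero (I.measurable_fullWeight V) hn,
    ae_gibbsLaw_eq_off V (weight Φ (meeting V Set.univ)) φ] with φ' hb' hw hoff
  refine I.good_of_lip (fun x y hxy => ?_) hb'
  by_cases hV : x ∈ V ∨ y ∈ V
  · exact (I.weight_ne_zero_iff V Set.univ φ').1 hw x y hxy trivial trivial hV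
  · push Not at hV
    rw [hoff x hV.1, hoff y hV.2]
    exact hφ.1 x y hxy

end Interaction

end Regular

/-! ### Entropy of blocks -/

section BlockEntropy

open InformationTheory

variable {d : ℕ} {k : HeightKind}

/-- The entropy of the height differences in `S`. -/
noncomputable def blockEnt (Φ : Potential d k) (C : ℝ) (S : Finset (Site d)) (o : Site d)
    (M : Measure (HeightFn d k)) : ℝ := ent (blockLaw S o M) (blockRef Φ C S o)

/-- The entropy of the height differences in `S` is finite. -/
def FiniteEnt (Φ : Potential d k) (C : ℝ) (S : Finset (Site d)) (o : Site d)
    (M : Measure (HeightFn d k)) : Prop := klDiv (blockLaw S o M) (blockRef Φ C S o) ≠ ∞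

/-- Pinning: integrating a function of the height differences in `S` over all heights in `S`
but one. -/
theorem refInt_erase_eq {S : Finset (Site d)} {o : Site d}
    {h : HeightFn d k → ℝ≥0∞} (hg : IsGrad h) (hS : DependsOn h (S : Set (Site d)))
    (φ : HeightFn d k) : refInt (S.erase o) h φ = refInt (S.erase o) h 0 := by
  have h1 : refInt (S.erase o) h φ = refInt (S.erase o) h (φ + fun _ => -φ o) := by
    rw [← refInt_comp_add]
    exact refInt_congr_fun fun φ' _ => (hg φ' _).symm
  rw [h1]
  unfold refInt
  refine lintegral_congr fun ψ => hS fun x hx => ?_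
  by_cases hxS : x ∈ S.erase o
  · rw [patch_of_mem _ _ hxS, patch_of_mem _ _ hxS]
  · have : x = o := by by_contra hc; exact hxS (Finset.mem_erase.2 ⟨hc, hx⟩)
    rw [patch_of_notMem _ _ hxS, patch_of_notMem _ _ hxS, this]
    simp

theorem refInt_singleton_ball_le (o p : Site d) (hop : o ≠ p) {K : ℝ} (hK : 0 ≤ K)
    (φ : HeightFn d k) :
    refInt {o} ({φ | |k.val (φ o - φ p)| ≤ K}.indicator 1) φ ≤ ENNReal.ofReal (2 * K + 1) := by
  have hs : refInt {o} ({φ | |k.val (φ o - φ p)| ≤ K}.indicator 1) φ =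
      ∫⁻ t, ({φ | |k.val (φ o - φ p)| ≤ K}.indicator 1 : HeightFn d k → ℝ≥0∞)
        (Function.update φ o t) ∂k.ref :=
    congrFun (lmarginal_singleton (X := fun _ : Site d => k.E) (μ := fun _ => k.ref) _ o) φ
  rw [hs]
  refine le_trans ?_ (k.ref_ball_le (φ p) hK)
  have hm : MeasurableSet {t : k.E | |k.val (t - φ p)| ≤ K} :=
    measurableSet_le (k.measurable_val.comp (measurable_id.sub measurable_const)).abs
      measurable_const
  rw [← lintegral_indicator_one hm]
  refine lintegral_mono fun t => ?_
  by_cases ht : |k.val (t - φ p)| ≤ K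
  · rw [Set.indicator_of_mem (show t ∈ {t : k.E | |k.val (t - φ p)| ≤ K} from ht)]
    refine Set.indicator_le_self' (fun _ _ => zero_le) _
  · rw [Set.indicator_of_notMem]
    · exact zero_le
    · simpa [Ne.symm hop] using ht

theorem localize_congr {S : Finset (Site d)} {o : Site d} (ho : o ∈ S) {φ φ' : HeightFn d k}
    (h : ∀ x ∈ S, φ x = φ' x) : localize S o φ = localize S o φ' := by
  ext x
  by_cases hx : x ∈ S
  · rw [localize_of_mem hx, localize_of_mem hx, h x hx, h o ho]
  · rw [localize_of_notMem hx, localize_of_notMem hx]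

theorem localize_eq_self {S : Finset (Site d)} {o : Site d} {φ : HeightFn d k}
    (h : ∀ x ∉ S.erase o, φ x = 0) : localize S o φ = φ := by
  ext x
  by_cases hx : x ∈ S
  · rw [localize_of_mem hx, h o (Finset.notMem_erase _ _), sub_zero]
  · rw [localize_of_notMem hx, h x fun h' => hx (Finset.mem_of_mem_erase h')]

namespace Interaction

variable {L : AddSubgroup (Site d)} {Φ : Potential d k} (I : Interaction L Φ)
include I

/-- The sets that meet both blocks carry a nonnegative strong energy, which only lowers the weight,
and a weak energy that is at most the exterior bound of `Λ`. -/
theorem weight_union_block_le {Δ Λ : Finset (Site d)} (h : Disjoint Δ Λ) (φ : HeightFn d k) :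
    weight Φ (meeting (Δ ∪ Λ) (Δ ∪ Λ : Finset (Site d))) φ ≤
      ENNReal.ofReal (Real.exp (I.extBound Λ)) *
        (weight Φ (meeting Δ Δ) φ * weight Φ (meeting Λ Λ) φ) := by
  set S := Δ ∪ Λ
  set 𝒞 : Set (Finset (Site d)) :=
    {Γ | (Γ : Set (Site d)) ⊆ S ∧ (∃ x ∈ Γ, x ∈ Λ) ∧ ∃ x ∈ Γ, x ∈ Δ} with h𝒞
  have hd' : ∀ x, x ∈ Δ → x ∉ Λ := fun x hx hx' => Finset.disjoint_left.1 h hx hx'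
  have h1 : meeting S (S : Set (Site d)) = (meeting Δ Δ ∪ meeting Λ Λ) ∪ 𝒞 := by
    ext Γ
    simp only [Set.mem_union]
    constructor
    · rintro ⟨hs, x, hx, hxS⟩
      by_cases hΔ : ∃ y ∈ Γ, y ∈ Δ
      · by_cases hΛ : ∃ y ∈ Γ, y ∈ Λ
        · exact Or.inr ⟨hs, hΛ, hΔ⟩
        · refine Or.inl (Or.inl ⟨fun y hy => ?_, hΔ⟩)
          rcases Finset.mem_union.1 (Finset.mem_coe.1 (hs hy)) with h' | h'
          · exact h'
          · exact absurd ⟨y, hy, h'⟩ hΛ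
      · have hΛ : (Γ : Set (Site d)) ⊆ Λ := fun y hy => by
          rcases Finset.mem_union.1 (Finset.mem_coe.1 (hs hy)) with h' | h'
          · exact absurd ⟨y, hy, h'⟩ hΔ
          · exact h'
        exact Or.inl (Or.inr ⟨hΛ, x, hx, hΛ hx⟩)
    · rintro ((⟨hs, x, hx, hx'⟩ | ⟨hs, x, hx, hx'⟩) | ⟨hs, ⟨x, hx, hx'⟩, _⟩)
      · exact ⟨hs.trans (by simp [S]), x, hx, by simp [S, hx']⟩
      · exact ⟨hs.trans (by simp [S]), x, hx, by simp [S, hx']⟩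
      · exact ⟨hs, x, hx, by simp [S, hx']⟩
  have hthin := isThin_meeting S (S : Set (Site d))
  rw [h1] at hthin ⊢
  have hdj1 : Disjoint (meeting Δ (Δ : Set (Site d)) ∪ meeting Λ (Λ : Set (Site d))) 𝒞 := by
    rw [Set.disjoint_left]
    rintro Γ (⟨hs, _⟩ | ⟨hs, _⟩) ⟨_, ⟨x, hx, hx'⟩, ⟨y, hy, hy'⟩⟩
    · exact hd' x (hs hx) hx'
    · exact hd' y hy' (hs hy)
  have hdj2 : Disjoint (meeting Δ (Δ : Set (Site d))) (meeting Λ (Λ : Set (Site d))) := by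
    rw [Set.disjoint_left]
    rintro Γ ⟨hs, x, hx, hx'⟩ ⟨hs', _⟩
    exact hd' x hx' (hs' hx)
  rw [I.weight_union hdj1 hthin, I.weight_union hdj2 (hthin.mono Set.subset_union_left), mul_comm]
  gcongr
  refine I.weight_le (hthin.mono Set.subset_union_right) (I.extBound_nonneg Λ)
    (I.weakAbs_le_of_crosses ?_ φ)
  rintro Γ ⟨_, hΛ, x, hx, hx'⟩
  exact ⟨hΛ, x, hx, hd' x hx'⟩

/-- Of all Lipschitz inequalities between the blocks only the one between `p` and `o` is kept. It
bounds the single free height left when both blocks are described relative to a pinned vertex of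
their own. -/
theorem blockWeight_union_le (C : ℝ) {Δ Λ : Finset (Site d)} (h : Disjoint Δ Λ) {o p : Site d}
    (ho : o ∈ Λ) (hp : p ∈ Δ) (φ : HeightFn d k) :
    blockWeight Φ C (Δ ∪ Λ) φ ≤ ENNReal.ofReal (Real.exp (I.extBound Λ)) *
      (blockWeight Φ C Δ φ * (({φ | |k.val (φ o - φ p)| ≤ C * dist1 p o}.indicator 1 φ) *
        blockWeight Φ C Λ φ)) := by
  by_cases hφ : φ ∈ lipOn C (Δ ∪ Λ)
  · have hb : φ ∈ {φ : HeightFn d k | |k.val (φ o - φ p)| ≤ C * dist1 p o} :=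
      hφ p (Finset.mem_union_left _ hp) o (Finset.mem_union_right _ ho)
    rw [blockWeight, blockWeight, blockWeight, Set.indicator_of_mem hφ, Set.indicator_of_mem hb,
      Set.indicator_of_mem (lipOn_mono Finset.subset_union_left hφ),
      Set.indicator_of_mem (lipOn_mono Finset.subset_union_right hφ), Pi.one_apply, one_mul]
    exact I.weight_union_block_le h φ
  · rw [blockWeight, Set.indicator_of_notMem hφ]; exact zero_le

/-- The reference measure of a union of two blocks. -/
theorem blockRef_union_le {C : ℝ} (hC : 0 ≤ C) {Δ Λ : Finset (Site d)} (h : Disjoint Δ Λ)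
    {o' o p : Site d} (ho' : o' ∈ Δ) (ho : o ∈ Λ) (hp : p ∈ Δ) :
    (blockRef Φ C (Δ ∪ Λ) o').map (fun φ => (localize Δ o' φ, localize Λ o φ)) ≤
      ENNReal.ofReal (Real.exp (I.extBound Λ + Real.log (2 * (C * dist1 p o) + 1))) •
        (blockRef Φ C Δ o').prod (blockRef Φ C Λ o) := by
  have hK : 0 ≤ C * dist1 p o := by positivity
  have := I.isFiniteMeasure_blockRef C ho
  have hd' : ∀ x, x ∈ Δ → x ∉ Λ := fun x hx hx' => Finset.disjoint_left.1 h hx hx'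
  have hop : o ≠ p := fun e => hd' p hp (e ▸ ho)
  have hgm : Measurable fun φ : HeightFn d k => (localize Δ o' φ, localize Λ o φ) :=
    (measurable_localize Δ o').prodMk (measurable_localize Λ o)
  set E := ENNReal.ofReal (Real.exp (I.extBound Λ)) with hE
  have hexp : ENNReal.ofReal (Real.exp (I.extBound Λ + Real.log (2 * (C * dist1 p o) + 1))) =
      E * ENNReal.ofReal (2 * (C * dist1 p o) + 1) := by
    rw [Real.exp_add, Real.exp_log (by positivity), ENNReal.ofReal_mul (Real.exp_pos _).le]
  set b : HeightFn d k → ℝ≥0∞ := {φ | |k.val (φ o - φ p)| ≤ C * dist1 p o}.indicator 1 with hb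
  have hbm : Measurable b := measurable_one.indicator (measurableSet_le (k.measurable_val.comp
    ((measurable_pi_apply o).sub (measurable_pi_apply p))).abs measurable_const)
  have hwΔ := I.measurable_blockWeight C Δ
  have hwΛ := I.measurable_blockWeight C Λ
  refine le_smul_of_lintegral_le fun f hf => ?_
  have hfg : Measurable fun φ : HeightFn d k => f (localize Δ o' φ, localize Λ o φ) := hf.comp hgm
  rw [lintegral_map hf hgm, I.lintegral_blockRef C _ _ hfg, lintegral_prod _ hf.aemeasurable, hexp]
  set J : HeightFn d k → ℝ≥0∞ := fun x => ∫⁻ y, f (x, y) ∂(blockRef Φ C Λ o) with hJ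
  have hJm : Measurable J := hf.lintegral_prod_right'
  rw [I.lintegral_blockRef C Δ o' hJm]
  set F : HeightFn d k → ℝ≥0∞ := fun φ =>
    blockWeight Φ C Δ φ * (b φ * (blockWeight Φ C Λ φ * f (localize Δ o' φ, localize Λ o φ)))
    with hF
  have hFm : Measurable F := hwΔ.mul (hbm.mul (hwΛ.mul hfg))
  have hset : (Δ ∪ Λ).erase o' = Δ.erase o' ∪ Λ := by
    rw [Finset.erase_union_distrib, Finset.erase_eq_of_notMem (hd' o' ho')]
  have hdisj : Disjoint (Δ.erase o') Λ := Finset.disjoint_of_subset_left (Finset.erase_subset _ _) h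
  have hJm' : Measurable fun φ => blockWeight Φ C Δ φ * J φ := hwΔ.mul hJm
  calc refInt ((Δ ∪ Λ).erase o')
        (fun φ => blockWeight Φ C (Δ ∪ Λ) φ * f (localize Δ o' φ, localize Λ o φ)) 0
      ≤ refInt ((Δ ∪ Λ).erase o') (fun φ => E * F φ) 0 := by
        refine refInt_mono fun φ _ => ?_
        refine (mul_le_mul_left (I.blockWeight_union_le C h ho hp φ) _).trans (le_of_eq ?_)
        simp only [hF, hb]
        ring
    _ = E * refInt (Δ.erase o') (refInt Λ F) 0 := by
        rw [refInt_const_mul hFm, hset, refInt_union hFm hdisj]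
    _ ≤ E * refInt (Δ.erase o') (fun φ => ENNReal.ofReal (2 * (C * dist1 p o) + 1) *
          (blockWeight Φ C Δ φ * J φ)) 0 := by
        gcongr
        refine refInt_mono fun φ hφ => ?_
        set a := localize Δ o' φ with ha
        set g : HeightFn d k → ℝ≥0∞ := fun φ' => blockWeight Φ C Λ φ' * f (a, localize Λ o φ')
          with hg
        have hgm' : Measurable g := hwΛ.mul (hf.comp (measurable_const.prodMk (measurable_localize Λ o)))
        have hgg : IsGrad g := fun φ' c => by
          simp only [hg, I.isGrad_blockWeight C Λ φ' c, isGrad_localize Λ o φ' c]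
        have hgS : DependsOn g (Λ : Set (Site d)) := fun φ₁ φ₂ h' => by
          simp only [hg, I.dependsOn_blockWeight C Λ h', localize_congr ho h']
        have e1 : refInt Λ F φ = blockWeight Φ C Δ φ * refInt Λ (fun φ' => b φ' * g φ') φ := by
          have hbg : Measurable fun φ' => b φ' * g φ' := hbm.mul hgm'
          rw [← refInt_mul_left hbg fun φ' hφ' => I.dependsOn_blockWeight C Δ fun x hx =>
            hφ' x (hd' x hx)]
          refine refInt_congr_fun fun φ' hφ' => ?_
          simp only [hF, hg, ha]
          rw [localize_congr ho' fun x hx => hφ' x (hd' x hx)]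
        have e2 : refInt (Λ.erase o) g 0 = J a := by
          have hmy : Measurable fun y => f (a, y) := hf.comp (measurable_const.prodMk measurable_id)
          simp only [hJ]
          rw [I.lintegral_blockRef C Λ o hmy]
          refine refInt_congr_fun fun φ' hφ' => ?_
          simp only [hg]
          rw [localize_eq_self hφ']
        -- Once the height at `o` is split off, the gradient function `g` integrates to `J a`
        -- whatever that height is. Of the heights in `Λ` the indicator `b` sees only the one at
        -- `o`, which contributes the measure of a ball of radius `C * dist1 p o`.
        have e3 : refInt Λ (fun φ' => b φ' * g φ') φ = refInt {o} b φ * J a := by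
          have hΛo : Λ = {o} ∪ Λ.erase o := by
            rw [← Finset.insert_eq, Finset.insert_erase ho]
          have hbg : Measurable fun φ' => b φ' * g φ' := hbm.mul hgm'
          have hu := refInt_union (S := {o}) (T := Λ.erase o) hbg (by simp)
          rw [← hΛo] at hu
          rw [hu, mul_comm, ← refInt_const_mul hbm]
          refine refInt_congr_fun fun φ' _ => ?_
          rw [refInt_mul_left hgm', refInt_erase_eq hgg hgS, e2, mul_comm]
          intro φ'' hφ''
          have h1 := hφ'' o (Finset.notMem_erase _ _)
          have h2 := hφ'' p (fun h' => hd' p hp (Finset.mem_of_mem_erase h'))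
          simp only [hb, Set.indicator, Set.mem_ofPred_eq, h1, h2]
          rfl
        have e4 : J a = J φ := by rw [ha, localize_eq_self hφ]
        rw [e1, e3, e4]
        calc blockWeight Φ C Δ φ * (refInt {o} b φ * J φ)
            ≤ blockWeight Φ C Δ φ * (ENNReal.ofReal (2 * (C * dist1 p o) + 1) * J φ) := by
              gcongr; exact refInt_singleton_ball_le o p hop hK φ
          _ = _ := by ring
    _ = _ := by rw [refInt_const_mul hJm', mul_assoc]

/-- Superadditivity of the entropy for two blocks. -/
theorem blockEnt_union_ge {C : ℝ} (hC : 0 ≤ C) {M : Measure (HeightFn d k)}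
    [IsProbabilityMeasure M] {Δ Λ : Finset (Site d)} (h : Disjoint Δ Λ)
    {o' o p : Site d} (ho' : o' ∈ Δ) (ho : o ∈ Λ) (hp : p ∈ Δ)
    (hfin : FiniteEnt Φ C (Δ ∪ Λ) o' M) :
    (FiniteEnt Φ C Δ o' M ∧ FiniteEnt Φ C Λ o M) ∧
      blockEnt Φ C Δ o' M + blockEnt Φ C Λ o M ≤ blockEnt Φ C (Δ ∪ Λ) o' M +
        (I.extBound Λ + Real.log (2 * (C * dist1 p o) + 1)) := by
  have := I.isFiniteMeasure_blockRef C ho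
  have := I.isFiniteMeasure_blockRef C ho'
  have ho'' : o' ∈ Δ ∪ Λ := Finset.mem_union_left _ ho'
  have hoo : o ∈ Δ ∪ Λ := Finset.mem_union_right _ ho
  have := I.isFiniteMeasure_blockRef C ho''
  have hgm : Measurable fun φ : HeightFn d k => (localize Δ o' φ, localize Λ o φ) :=
    (measurable_localize Δ o').prodMk (measurable_localize Λ o)
  have h1 := ent_map_le hgm hfin
  have hP : IsProbabilityMeasure ((blockLaw (Δ ∪ Λ) o' M).map
      fun φ => (localize Δ o' φ, localize Λ o φ)) :=
    Measure.isProbabilityMeasure_map hgm.aemeasurable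
  have h2 := ent_mono_right (I.blockRef_union_le hC h ho' ho hp) h1.1
  have h3 := ent_prod_ge h2.1
  have e1 : ((blockLaw (Δ ∪ Λ) o' M).map fun φ => (localize Δ o' φ, localize Λ o φ)).map Prod.fst =
      blockLaw Δ o' M := by
    rw [Measure.map_map measurable_fst hgm]
    exact blockLaw_map_localize Finset.subset_union_left ho'' M
  have e2 : ((blockLaw (Δ ∪ Λ) o' M).map fun φ => (localize Δ o' φ, localize Λ o φ)).map Prod.snd =
      blockLaw Λ o M := by
    rw [Measure.map_map measurable_snd hgm]
    exact blockLaw_map_localize Finset.subset_union_right hoo M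
  rw [e1, e2] at h3
  refine ⟨h3.1, ?_⟩
  have h12 := h1.2
  have h22 := h2.2
  have h32 := h3.2
  unfold blockEnt
  linarith

theorem blockRef_singleton (C : ℝ) (hC : 0 ≤ C) (o : Site d) :
    blockRef Φ C {o} o = Measure.dirac 0 := by
  have hw : blockWeight Φ C {o} = 1 := by
    ext φ
    have hl : φ ∈ lipOn C {o} := by
      intro x hx y hy
      rw [Finset.mem_singleton] at hx hy
      rw [hx, hy, sub_self, k.val_zero, abs_zero]
      positivity
    rw [blockWeight, Set.indicator_of_mem hl, weight]
    have : ∀ Γ : meeting {o} (({o} : Finset (Site d)) : Set (Site d)), Φ Γ φ = 0 := by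
      intro Γ
      have hc : (Γ : Finset (Site d)).card ≤ 1 := by
        have := Finset.card_le_card (show (Γ : Finset (Site d)) ⊆ {o} from Finset.coe_subset.1 Γ.2.1)
        simpa using this
      rw [I.sum, I.strong.periodicGradient.trivial_zero _ hc,
        I.weak.periodicGradient.trivial_zero _ hc, add_zero]
    simp [this]
  rw [blockRef, hw, withDensity_one]
  refine Measure.ext fun A hA => ?_
  rw [refMeasure_apply _ _ hA, Finset.erase_singleton, refInt_empty, Measure.dirac_apply' _ hA]

theorem blockEnt_singleton {C : ℝ} (hC : 0 ≤ C) (o : Site d) (M : Measure (HeightFn d k))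
    [IsProbabilityMeasure M] : blockEnt Φ C {o} o M = 0 := by
  have h : blockLaw {o} o M = Measure.dirac 0 := by
    have : localize (k := k) {o} o = fun _ => 0 := by
      ext φ x
      by_cases hx : x ∈ ({o} : Finset (Site d))
      · rw [localize_of_mem hx, Finset.mem_singleton.1 hx, sub_self]; rfl
      · rw [localize_of_notMem hx]; rfl
    rw [blockLaw, this, Measure.map_const, measure_univ, one_smul]
  rw [blockEnt, h, I.blockRef_singleton C hC, ent]
  have := llr_self (Measure.dirac (0 : HeightFn d k))
  rw [integral_congr_ae this]
  simp

theorem extBound_le_weakBound (V : Finset (Site d)) : I.extBound V ≤ I.weakBound V := by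
  refine ENNReal.toReal_le_of_le_ofReal (I.weakBound_nonneg V) (iSup_le fun φ => ?_)
  exact I.weakAbs_le_of_meets (𝒢 := {Γ | (∃ x ∈ Γ, x ∈ V) ∧ ∃ x ∈ Γ, x ∉ V}) (fun _ h => h.1) φ

/-- The entropy is almost monotone. -/
theorem blockEnt_mono {C : ℝ} (hC : 0 ≤ C) {M : Measure (HeightFn d k)}
    [IsProbabilityMeasure M] {S T : Finset (Site d)} (hST : S ⊆ T) {o : Site d} (ho : o ∈ S)
    {D : ℝ} (hD : ∀ x ∈ T, (dist1 o x : ℝ) ≤ D) (hfin : FiniteEnt Φ C T o M) :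
    FiniteEnt Φ C S o M ∧ blockEnt Φ C S o M ≤ blockEnt Φ C T o M +
      ((T.card : ℝ) - S.card) * (I.weakBound {0} + Real.log (2 * (C * D) + 1)) := by
  -- Vertices are added one at a time and linked to `o`. A single vertex has zero entropy, so each
  -- step costs only the weak energy at one vertex and the logarithm of the link.
  have key : ∀ U : Finset (Site d), Disjoint S U → (∀ x ∈ U, (dist1 o x : ℝ) ≤ D) →
      FiniteEnt Φ C (S ∪ U) o M → FiniteEnt Φ C S o M ∧ blockEnt Φ C S o M ≤
        blockEnt Φ C (S ∪ U) o M +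
          (U.card : ℝ) * (I.weakBound {0} + Real.log (2 * (C * D) + 1)) := by
    intro U
    induction U using Finset.induction_on with
    | empty => intro _ _ h; simpa using h
    | insert a U ha ih =>
      intro hdisj hDU hf
      rw [Finset.disjoint_insert_right] at hdisj
      have e : S ∪ insert a U = (S ∪ U) ∪ {a} := by ext x; simp
      rw [e] at hf ⊢
      have hd2 : Disjoint (S ∪ U) {a} := by simp [hdisj.1, ha]
      have h1 := I.blockEnt_union_ge hC hd2 (Finset.mem_union_left _ ho) (Finset.mem_singleton_self a)
        (Finset.mem_union_left _ ho) hf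
      have h2 := ih hdisj.2 (fun x hx => hDU x (Finset.mem_insert_of_mem hx)) h1.1.1
      refine ⟨h2.1, ?_⟩
      have h3 := h1.2
      rw [I.blockEnt_singleton hC a M, add_zero] at h3
      have h4 : I.extBound {a} ≤ I.weakBound {0} := by
        refine (I.extBound_le_weakBound {a}).trans (le_of_eq ?_)
        simp [weakBound]
      have h5 : Real.log (2 * (C * dist1 o a) + 1) ≤ Real.log (2 * (C * D) + 1) := by
        apply Real.log_le_log (by positivity)
        have := hDU a (Finset.mem_insert_self a U)
        gcongr
      rw [Finset.card_insert_of_notMem ha]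
      push_cast
      linarith [h2.2]
  have hTS : S ∪ (T \ S) = T := Finset.union_sdiff_of_subset hST
  have := key (T \ S) Finset.disjoint_sdiff (fun x hx => hD x (Finset.mem_sdiff.1 hx).1)
    (by rwa [hTS])
  rw [hTS, Finset.cast_card_sdiff hST] at this
  exact this

theorem weight_translate_block {v : Site d} (hv : v ∈ L) (S : Finset (Site d))
    (φ : HeightFn d k) : weight Φ (meeting (translateSet v S) (translateSet v S)) φ =
      weight Φ (meeting S S) (shift v φ) := by
  rw [← I.weight_shift hv]
  congr 2
  ext x
  simp [mem_translateSet]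

theorem blockRef_shift (C : ℝ) {v : Site d} (hv : v ∈ L) (S : Finset (Site d)) (o : Site d) :
    (blockRef Φ C (translateSet v S) (o + v)).map (shift v) = blockRef Φ C S o := by
  have hw : ∀ φ, blockWeight Φ C (translateSet v S) φ = blockWeight Φ C S (shift v φ) := by
    intro φ
    have hl : φ ∈ lipOn C (translateSet v S) ↔ shift v φ ∈ lipOn C S := by
      have hdist : ∀ x y : Site d, dist1 (x + v) (y + v) = dist1 x y := by
        intro x y; simp [dist1]
      constructor
      · intro h x hx y hy
        have := h (x + v) (by simpa [mem_translateSet] using hx) (y + v)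
          (by simpa [mem_translateSet] using hy)
        rwa [hdist] at this
      · intro h x hx y hy
        have := h (x - v) (mem_translateSet.1 hx) (y - v) (mem_translateSet.1 hy)
        rw [← hdist] at this
        simpa [shift] using this
    unfold blockWeight
    by_cases h : φ ∈ lipOn C (translateSet v S)
    · rw [Set.indicator_of_mem h, Set.indicator_of_mem (hl.1 h), I.weight_translate_block hv]
    · rw [Set.indicator_of_notMem h, Set.indicator_of_notMem fun h' => h (hl.2 h')]
  refine Measure.ext_of_lintegral _ fun f hf => ?_
  have hm : Measurable fun φ => f (shift v φ) := hf.comp (measurable_shift v)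
  rw [lintegral_map hf (measurable_shift v), I.lintegral_blockRef C _ _ hm,
    I.lintegral_blockRef C S o hf, ← translateSet_erase, refInt_translateSet]
  · refine refInt_congr_fun fun φ' _ => ?_
    rw [hw]; simp [shift_shift, shift_zero]
  · exact (I.measurable_blockWeight C _).mul hm

theorem klDiv_translate (C : ℝ) {M : Measure (HeightFn d k)} [IsProbabilityMeasure M]
    (hM : IsGradInvariant L M) {v : Site d} (hv : v ∈ L) {S : Finset (Site d)} {o : Site d}
    (ho : o ∈ S) : klDiv (blockLaw (translateSet v S) (o + v) M)
      (blockRef Φ C (translateSet v S) (o + v)) = klDiv (blockLaw S o M) (blockRef Φ C S o) ∧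
      (blockRef Φ C (translateSet v S) (o + v)).real Set.univ = (blockRef Φ C S o).real Set.univ := by
  have hid : ∀ N : Measure (HeightFn d k), (N.map (shift v)).map (shift (-v)) = N := by
    intro N
    rw [Measure.map_map (measurable_shift _) (measurable_shift _)]
    have : shift (k := k) (-v) ∘ shift v = id := by
      ext φ : 1; simp [shift_shift, shift_zero]
    rw [this, Measure.map_id]
  have := I.isFiniteMeasure_blockRef C ho
  have hov : o + v ∈ translateSet v S := by rw [mem_translateSet]; simpa using ho
  have := I.isFiniteMeasure_blockRef C hov
  constructor
  · rw [← hM.blockLaw_shift hv S o, ← I.blockRef_shift C hv S o]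
    exact (klDiv_map_eq (measurable_shift v) (measurable_shift (-v)) (hid _) (hid _)).symm
  · rw [← I.blockRef_shift C hv S o, map_measureReal_apply (measurable_shift v) MeasurableSet.univ]
    rfl

theorem blockEnt_translate (C : ℝ) {M : Measure (HeightFn d k)} [IsProbabilityMeasure M]
    (hM : IsGradInvariant L M) {v : Site d} (hv : v ∈ L) {S : Finset (Site d)} {o : Site d}
    (ho : o ∈ S) : (FiniteEnt Φ C (translateSet v S) (o + v) M ↔ FiniteEnt Φ C S o M) ∧
      (FiniteEnt Φ C S o M →
        blockEnt Φ C (translateSet v S) (o + v) M = blockEnt Φ C S o M) := by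
  have := I.isFiniteMeasure_blockRef C ho
  have hov : o + v ∈ translateSet v S := by rw [mem_translateSet]; simpa using ho
  have := I.isFiniteMeasure_blockRef C hov
  have h := I.klDiv_translate C hM hv ho
  refine ⟨by unfold FiniteEnt; rw [h.1], fun hf => ?_⟩
  have e1 := toReal_klDiv_eq_ent hf
  have e2 := toReal_klDiv_eq_ent (M := blockLaw (translateSet v S) (o + v) M)
    (ν := blockRef Φ C (translateSet v S) (o + v)) (by rw [h.1]; exact hf)
  rw [h.1, h.2] at e2
  unfold blockEnt
  linarith

theorem blockEnt_anchor (C : ℝ) {M : Measure (HeightFn d k)} [IsProbabilityMeasure M]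
    {S : Finset (Site d)} {o o' : Site d} (ho : o ∈ S) (ho' : o' ∈ S)
    (hf : FiniteEnt Φ C S o M) :
    FiniteEnt Φ C S o' M ∧ blockEnt Φ C S o' M = blockEnt Φ C S o M := by
  have := I.isFiniteMeasure_blockRef C ho
  have := I.isFiniteMeasure_blockRef C ho'
  have h1 := ent_map_le (measurable_localize S o') hf
  rw [I.blockRef_map_localize C ho ho', blockLaw_map_localize subset_rfl ho' M] at h1
  have h2 := ent_map_le (measurable_localize S o) h1.1
  rw [I.blockRef_map_localize C ho' ho, blockLaw_map_localize subset_rfl ho M] at h2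
  exact ⟨h1.1, le_antisymm h1.2 h2.2⟩

theorem extBound_translate {v : Site d} (hv : v ∈ L) (S : Finset (Site d)) :
    I.extBound (translateSet v S) = I.extBound S := by
  unfold extBound; rw [I.weak.amenable.invariant v hv]

end Interaction

end BlockEntropy

/-! ### Tiles, and the existence of the specific free energy -/

section Asymptotics

theorem tendsto_log_mul_add_div {A : ℝ} (hA : 0 ≤ A) :
    Tendsto (fun n : ℕ => Real.log (A * n + 1) / n) atTop (𝓝 0) := by
  have h1 : Tendsto (fun n : ℕ => Real.log (A + 1) / (n : ℝ) + Real.log n / (n : ℝ)) atTop (𝓝 0) := by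
    have h2 := (Real.tendsto_pow_log_div_mul_add_atTop 1 0 1 one_ne_zero).comp
      (tendsto_natCast_atTop_atTop (R := ℝ))
    have h3 := (tendsto_const_div_atTop_nhds_zero_nat (Real.log (A + 1))).add h2
    simpa using h3
  refine squeeze_zero' (Eventually.of_forall fun n => ?_) ?_ h1
  · exact div_nonneg (Real.log_nonneg (by nlinarith [Nat.cast_nonneg (α := ℝ) n])) n.cast_nonneg
  · filter_upwards [eventually_gt_atTop 0] with n hn
    have hn' : (1 : ℝ) ≤ n := by exact_mod_cast hn
    rw [← add_div, ← Real.log_mul (by positivity) (by positivity)]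
    gcongr
    nlinarith

theorem tendsto_mul_div_nat {m : ℕ} (hm : 0 < m) :
    Tendsto (fun n : ℕ => ((m * (n / m) : ℕ) : ℝ) / n) atTop (𝓝 1) := by
  have h1 : Tendsto (fun n : ℕ => 1 - (m : ℝ) / n) atTop (𝓝 1) := by
    simpa using (tendsto_const_div_atTop_nhds_zero_nat (m : ℝ)).const_sub 1
  refine tendsto_of_tendsto_of_tendsto_of_le_of_le' h1 tendsto_const_nhds ?_ ?_
  · filter_upwards [eventually_gt_atTop 0] with n hn
    have hn' : (0 : ℝ) < n := by exact_mod_cast hn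
    rw [one_sub_div hn'.ne']
    gcongr
    have := Nat.div_add_mod n m
    have h2 := Nat.mod_lt n hm
    have : n ≤ m * (n / m) + m := by omega
    rw [sub_le_iff_le_add]
    exact_mod_cast this
  · refine Eventually.of_forall fun n => div_le_one_of_le₀ ?_ n.cast_nonneg
    exact_mod_cast Nat.mul_div_le n m

theorem one_sub_pow_le (d : ℕ) {t : ℝ} (h0 : 0 ≤ t) : 1 - t ^ d ≤ d * (1 - t) := by
  have := one_add_mul_le_pow (a := t - 1) (by linarith) d
  rw [add_sub_cancel] at this
  linarith

theorem pow_sub_one_le (d : ℕ) {y : ℝ} (h1 : 1 ≤ y) (h2 : y ≤ 2) :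
    y ^ d - 1 ≤ (y - 1) * (d * 2 ^ d) := by
  induction d with
  | zero => simp
  | succ d ih =>
    have h3 : (0 : ℝ) ≤ d * 2 ^ d := by positivity
    have h4 : (1 : ℝ) ≤ 2 ^ d := one_le_pow₀ (by norm_num)
    rw [pow_succ, pow_succ]
    push_cast
    nlinarith [mul_nonneg (sub_nonneg.2 h1) h3, mul_nonneg (sub_nonneg.2 h1) (sub_nonneg.2 h4)]

/-- A sequence that is almost superadditive along the multiples of `p` converges. -/
theorem exists_tendsto_of_almost_superadditive {x e r δ : ℕ → ℝ} {p : ℕ} (hp : 0 < p)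
    (he : Tendsto e atTop (𝓝 0)) (hr : Tendsto r atTop (𝓝 1)) (hδ : Tendsto δ atTop (𝓝 0))
    (h1 : ∀ m, 0 < m → p ∣ m → ∀ ε > 0, ∀ᶠ n in atTop, x m - e m - ε ≤ x n)
    (h2 : ∀ᶠ n in atTop, 0 ≤ r n ∧ x n ≤ r n * x (p * (n / p + 1)) + δ n)
    (h3 : ∃ B, ∃ᶠ n in atTop, x n ≤ B) : ∃ ℓ, Tendsto x atTop (𝓝 ℓ) := by
  -- -
  obtain ⟨B, hB⟩ := h3
  -- The limit is the supremum of `x m - e m` over the multiples `m` of `p`. Assumption `h1` bounds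
  -- the sequence below by each of these values, and with `h3` makes the supremum finite; `h2`
  -- bounds `x n` above by the value at the next multiple.
  set Y : Set ℝ := {y | ∃ m, 0 < m ∧ p ∣ m ∧ y = x m - e m} with hY
  have hne : Y.Nonempty := ⟨_, p, hp, dvd_rfl, rfl⟩
  have hbdd : BddAbove Y := by
    refine ⟨B + 1, ?_⟩
    rintro y ⟨m, hm, hpm, rfl⟩
    obtain ⟨n, hn1, hn2⟩ := (hB.and_eventually (h1 m hm hpm 1 one_pos)).exists
    linarith
  refine ⟨sSup Y, ?_⟩
  rw [Metric.tendsto_nhds]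
  intro ε hε
  have hlow : ∀ᶠ n in atTop, sSup Y - ε < x n := by
    obtain ⟨y, ⟨m, hm, hpm, rfl⟩, hy⟩ := exists_lt_of_lt_csSup hne (sub_lt_self (sSup Y) (half_pos hε))
    filter_upwards [h1 m hm hpm (ε / 4) (by linarith)] with n hn
    linarith
  have hm : Tendsto (fun n : ℕ => p * (n / p + 1)) atTop atTop := by
    refine tendsto_atTop_mono (fun n => ?_) tendsto_id
    have := Nat.div_add_mod n p
    have h2 := Nat.mod_lt n hp
    rw [mul_add]; simp only [id]; omega
  have hup : ∀ᶠ n in atTop, x n < sSup Y + ε := by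
    have hlim : Tendsto (fun n => r n * (sSup Y + e (p * (n / p + 1))) + δ n) atTop (𝓝 (sSup Y)) := by
      have := (hr.mul ((he.comp hm).const_add (sSup Y))).add hδ
      simpa using this
    filter_upwards [h2, hlim.eventually (gt_mem_nhds (show sSup Y < sSup Y + ε by linarith))]
      with n hn hn'
    refine lt_of_le_of_lt hn.2 (lt_of_le_of_lt ?_ hn')
    have : x (p * (n / p + 1)) - e (p * (n / p + 1)) ≤ sSup Y :=
      le_csSup hbdd ⟨_, by positivity, dvd_mul_right _ _, rfl⟩
    have h4 : x (p * (n / p + 1)) ≤ sSup Y + e (p * (n / p + 1)) := by linarith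
    gcongr
    exact hn.1
  filter_upwards [hlow, hup] with n ha hb
  rw [Real.dist_eq, abs_lt]
  constructor <;> linarith

end Asymptotics

/-! ### Tilings by boxes, and superadditivity along them. -/

section Tiles

variable {d : ℕ} {k : HeightKind}

/-- The corner of the tile with index `z` in the tiling by boxes of side `m`. -/
def corner (m : ℕ) (z : Site d) : Site d := fun i => (m : ℤ) * z i

/-- The tile with index `z`. -/
noncomputable def tile (m : ℕ) (z : Site d) : Finset (Site d) := translateSet (corner m z) (box d m)

theorem mem_box {n : ℕ} {x : Site d} : x ∈ box d n ↔ ∀ i, 0 ≤ x i ∧ x i < n := by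
  simp [box, Fintype.mem_piFinset]

theorem mem_tile {m : ℕ} {z x : Site d} :
    x ∈ tile m z ↔ ∀ i, m * z i ≤ x i ∧ x i < m * z i + m := by
  rw [tile, mem_translateSet, mem_box]
  refine forall_congr' fun i => ?_
  simp only [Pi.sub_apply, corner]
  constructor <;> intro h <;> constructor <;> linarith [h.1, h.2]

theorem mem_tile_iff_div {m : ℕ} (hm : 0 < m) {z x : Site d} :
    x ∈ tile m z ↔ ∀ i, x i / m = z i := by
  rw [mem_tile]
  have hm' : (0 : ℤ) < m := by exact_mod_cast hm
  refine forall_congr' fun i => ?_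
  rw [Int.ediv_eq_iff_of_pos hm']
  constructor
  · rintro ⟨h1, h2⟩; constructor <;> nlinarith
  · rintro ⟨h1, h2⟩; constructor <;> nlinarith

theorem tile_disjoint {m : ℕ} (hm : 0 < m) {z z' : Site d} (h : z ≠ z') :
    Disjoint (tile m z) (tile m z') := by
  rw [Finset.disjoint_left]
  intro x hx hx'
  rw [mem_tile_iff_div hm] at hx hx'
  exact h (funext fun i => (hx i).symm.trans (hx' i))

theorem corner_mem_tile {m : ℕ} (hm : 0 < m) (z : Site d) : corner m z ∈ tile m z := by
  rw [mem_tile]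
  have hm' : (0 : ℤ) < m := by exact_mod_cast hm
  intro i
  simp only [corner]
  constructor <;> linarith

theorem corner_zero (m : ℕ) : corner m (0 : Site d) = 0 := by ext i; simp [corner]

theorem tile_zero (m : ℕ) : tile m (0 : Site d) = box d m := by
  rw [tile, corner_zero, translateSet_zero]

theorem biUnion_tile_box {m : ℕ} (hm : 0 < m) (n : ℕ) :
    (box d n).biUnion (tile m) = box d (m * n) := by
  have hm' : (0 : ℤ) < m := by exact_mod_cast hm
  ext x
  simp only [Finset.mem_biUnion, mem_box]
  constructor
  · rintro ⟨z, hz, hx⟩ i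
    rw [mem_tile] at hx
    have h1 := hx i
    have h2 := hz i
    push_cast
    constructor
    · nlinarith
    · nlinarith
  · intro h
    refine ⟨fun i => x i / m, fun i => ?_, (mem_tile_iff_div hm).2 fun i => rfl⟩
    have := h i
    push_cast at this
    exact ⟨Int.ediv_nonneg this.1 hm'.le, Int.ediv_lt_of_lt_mul hm' (by linarith)⟩

theorem corner_mem {L : AddSubgroup (Site d)} {m : ℕ} (hm : L.index ∣ m) (z : Site d) :
    corner m z ∈ L := by
  obtain ⟨a, rfl⟩ := hm
  have := index_smul_mem L (fun i => (a : ℤ) * z i)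
  convert this using 1
  ext i
  simp [corner, mul_assoc]

theorem dist1_corner (m : ℕ) (z : Site d) (i : Fin d) :
    dist1 (corner m (z - Pi.single i 1)) (corner m z) = m := by
  unfold dist1 corner
  rw [Finset.sum_eq_single i]
  · simp [mul_sub]
  · intro j _ hj; simp [hj]
  · simp

theorem card_box (n : ℕ) : (box d n).card = n ^ d := by
  simp [box]

theorem dist1_zero_le_of_mem_box {n : ℕ} {x : Site d} (h : x ∈ box d n) :
    (dist1 0 x : ℝ) ≤ d * n := by
  rw [mem_box] at h
  have : dist1 0 x ≤ ∑ _i : Fin d, n := by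
    refine Finset.sum_le_sum fun i _ => ?_
    have := h i
    simp only [Pi.zero_apply]
    omega
  simp only [Finset.sum_const, Finset.card_univ, Fintype.card_fin, smul_eq_mul] at this
  exact_mod_cast this

theorem box_subset {m n : ℕ} (h : m ≤ n) : box d m ⊆ box d n := by
  intro x hx
  rw [mem_box] at hx ⊢
  have h' : (m : ℤ) ≤ n := by exact_mod_cast h
  exact fun i => ⟨(hx i).1, lt_of_lt_of_le (hx i).2 h'⟩

theorem isVanHove_box (hd : 0 < d) : IsVanHove fun n => box d n := by
  constructor
  · simp only [card_box]
    exact tendsto_pow_atTop hd.ne'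
  · simp only [card_box]
    have hsub : ∀ n, outerBoundary (box d n) ⊆
        ((translateSet (fun _ => -1) (box d (n + 2)) \ box d n : Finset (Site d)) : Set (Site d)) := by
      rintro n x ⟨hx, y, hy, hxy⟩
      rw [Finset.coe_sdiff]
      refine ⟨?_, hx⟩
      rw [Finset.mem_coe, mem_translateSet, mem_box]
      rw [mem_box] at hy
      intro i
      have h1 : (x i - y i).natAbs ≤ 1 := by
        rw [← hxy]
        exact Finset.single_le_sum (f := fun i => (x i - y i).natAbs) (fun _ _ => Nat.zero_le _)
          (Finset.mem_univ i)
      have := hy i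
      simp only [Pi.sub_apply]
      push_cast
      omega
    have hcard : ∀ n, ((outerBoundary (box d n)).ncard : ℝ) ≤ (n + 2 : ℝ) ^ d - (n : ℝ) ^ d := by
      intro n
      have h1 := Set.ncard_le_ncard (hsub n) (Finset.finite_toSet _)
      rw [Set.ncard_coe_finset] at h1
      have h2 : box d n ⊆ translateSet (fun _ => -1) (box d (n + 2)) := by
        intro x hx
        rw [mem_translateSet, mem_box]
        rw [mem_box] at hx
        intro i
        have := hx i
        simp only [Pi.sub_apply]
        push_cast
        omega
      have h3 := Finset.cast_card_sdiff (R := ℝ) h2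
      rw [translateSet, Finset.card_map, card_box, card_box] at h3
      push_cast at h3
      rw [← h3]
      exact_mod_cast h1
    have hlim : Tendsto (fun n : ℕ => (1 + 2 / (n : ℝ)) ^ d - 1) atTop (𝓝 0) := by
      have := (((tendsto_const_div_atTop_nhds_zero_nat (2 : ℝ)).const_add 1).pow d).sub_const 1
      simpa using this
    refine squeeze_zero' (Eventually.of_forall fun n => by positivity) ?_ hlim
    filter_upwards [eventually_gt_atTop 0] with n hn
    have hn' : (0 : ℝ) < n := by exact_mod_cast hn
    push_cast
    rw [div_le_iff₀ (by positivity), sub_mul, one_mul, ← mul_pow]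
    have : (1 + 2 / (n : ℝ)) * n = n + 2 := by field_simp
    rw [this]
    exact hcard n

namespace Interaction

variable {L : AddSubgroup (Site d)} {Φ : Potential d k} (I : Interaction L Φ)
include I

theorem tendsto_extBound_box (hd : 0 < d) :
    Tendsto (fun n : ℕ => I.extBound (box d n) / (n : ℝ) ^ d) atTop (𝓝 0) := by
  have h := I.weak.amenable.sublinear _ (isVanHove_box (d := d) hd)
  have h2 := (ENNReal.tendsto_toReal ENNReal.zero_ne_top).comp h
  simp only [ENNReal.toReal_zero] at h2
  refine h2.congr fun n => ?_
  simp only [Function.comp, ENNReal.toReal_div, card_box, ENNReal.toReal_natCast, extBound]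
  push_cast
  rfl

/-- The error in the superadditivity of the entropy of boxes of side `m`. -/
noncomputable def boxError (C : ℝ) (m : ℕ) : ℝ :=
  I.extBound (box d m) + Real.log (2 * (C * m) + 1)

theorem boxError_nonneg {C : ℝ} (hC : 0 ≤ C) (m : ℕ) : 0 ≤ I.boxError C m :=
  add_nonneg (I.extBound_nonneg _) (Real.log_nonneg (by
    have : 0 ≤ C * m := by positivity
    linarith))

theorem tendsto_boxError (hd : 0 < d) {C : ℝ} (hC : 0 ≤ C) :
    Tendsto (fun n : ℕ => I.boxError C n / (n : ℝ) ^ d) atTop (𝓝 0) := by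
  have h1 : Tendsto (fun n : ℕ => Real.log (2 * (C * n) + 1) / (n : ℝ) ^ d) atTop (𝓝 0) := by
    have h2 := tendsto_log_mul_add_div (A := 2 * C) (by positivity)
    refine squeeze_zero' (Eventually.of_forall fun n => ?_) ?_ h2
    · have : 0 ≤ C * n := by positivity
      exact div_nonneg (Real.log_nonneg (by linarith)) (by positivity)
    · filter_upwards [eventually_gt_atTop 0] with n hn
      have hn' : (1 : ℝ) ≤ n := by exact_mod_cast hn
      have : 0 ≤ C * n := by positivity
      rw [mul_assoc]
      refine div_le_div_of_nonneg_left (Real.log_nonneg (by linarith)) (by positivity) ?_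
      exact le_self_pow₀ hn' hd.ne'
  have := (I.tendsto_extBound_box hd).add h1
  simpa [boxError, add_div] using this

/-- Superadditivity of the entropy for unions of tiles. -/
theorem blockEnt_tiles_ge {C : ℝ} (hC : 0 ≤ C) {M : Measure (HeightFn d k)}
    [IsProbabilityMeasure M] (hM : IsGradInvariant L M) {m : ℕ} (hm : 0 < m) (hLm : L.index ∣ m)
    (Z : Finset (Site d)) : (∀ z ∈ Z, ∀ i, 0 ≤ z i) →
    (∀ z ∈ Z, ∀ i, 0 < z i → z - Pi.single i 1 ∈ Z) → Z.Nonempty →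
    FiniteEnt Φ C (Z.biUnion (tile m)) 0 M →
    0 ∈ Z ∧ FiniteEnt Φ C (box d m) 0 M ∧
      Z.card * (blockEnt Φ C (box d m) 0 M - I.boxError C m) ≤
        blockEnt Φ C (Z.biUnion (tile m)) 0 M := by
  -- Tiles are removed in order of decreasing coordinate sum, which preserves the property of being
  -- closed under predecessors. The last tile is thus glued to a neighbour that is still present, at
  -- corner distance exactly `m`, so that the error does not depend on `Z`.
  induction Z using Finset.induction_on_max_value (fun z : Site d => ∑ i, z i) with
  | empty => intro _ _ h; simp at h
  | insert a s ha hmax ih =>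
    intro hpos hlow _ hfin
    by_cases ha0 : a = 0
    · have hs : s = ∅ := by
        rw [Finset.eq_empty_iff_forall_notMem]
        intro z hz
        have h1 := hmax z hz
        have hzp : ∀ i, 0 ≤ z i := hpos z (Finset.mem_insert_of_mem hz)
        have h2 : ∑ i, z i = 0 := le_antisymm (by simpa [ha0] using h1)
          (Finset.sum_nonneg fun i _ => hzp i)
        have h3 := (Finset.sum_eq_zero_iff_of_nonneg fun i _ => hzp i).1 h2
        have : z = 0 := funext fun i => h3 i (Finset.mem_univ i)
        exact ha (ha0 ▸ this ▸ hz)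
      subst hs ha0
      have e : (insert (0 : Site d) ∅ : Finset (Site d)).biUnion (tile m) = box d m := by
        simp [tile_zero]
      rw [e] at hfin ⊢
      refine ⟨by simp, hfin, ?_⟩
      have := I.boxError_nonneg hC m
      simp only [insert_empty_eq, Finset.card_singleton, Nat.cast_one, one_mul]
      linarith
    · obtain ⟨i, hi⟩ : ∃ i, 0 < a i := by
        by_contra! hcon
        exact ha0 (funext fun i => le_antisymm (hcon i) (hpos a (Finset.mem_insert_self _ _) i))
      have hlows : ∀ z ∈ s, ∀ i, 0 < z i → z - Pi.single i 1 ∈ s := by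
        intro z hz i hzi
        rcases Finset.mem_insert.1 (hlow z (Finset.mem_insert_of_mem hz) i hzi) with h | h
        · exfalso
          have h1 := hmax z hz
          rw [← h] at h1
          simp only [Pi.sub_apply, Finset.sum_sub_distrib, Finset.sum_pi_single', Finset.mem_univ,
            if_true] at h1
          have : ∑ j, (Pi.single i (1 : ℤ) : Site d) j = 1 := by simp
          linarith
        · exact h
      have hp : a - Pi.single i 1 ∈ s := by
        rcases Finset.mem_insert.1 (hlow a (Finset.mem_insert_self _ _) i hi) with h | h
        · have := congrFun h i
          simp at this
        · exact h
      have hdisj : Disjoint (s.biUnion (tile m)) (tile m a) := by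
        rw [Finset.disjoint_biUnion_left]
        exact fun z hz => tile_disjoint hm fun h => ha (h ▸ hz)
      have e : (insert a s).biUnion (tile m) = s.biUnion (tile m) ∪ tile m a := by
        rw [Finset.biUnion_insert, Finset.union_comm]
      rw [e] at hfin ⊢
      have h0s : 0 ∈ s := by
        by_contra h0
        have hne : s.Nonempty := ⟨_, hp⟩
        obtain ⟨z, hz, hzmin⟩ := s.exists_min_image (fun z => ∑ i, z i) hne
        have hz0 : z ≠ 0 := fun h => h0 (h ▸ hz)
        obtain ⟨j, hj⟩ : ∃ j, 0 < z j := by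
          by_contra! hcon
          exact hz0 (funext fun i => le_antisymm (hcon i) (hpos z (Finset.mem_insert_of_mem hz) i))
        have h1 := hzmin _ (hlows z hz j hj)
        simp only [Pi.sub_apply, Finset.sum_sub_distrib] at h1
        have : ∑ i, (Pi.single j (1 : ℤ) : Site d) i = 1 := by simp
        linarith
      have h0t : (0 : Site d) ∈ s.biUnion (tile m) :=
        Finset.mem_biUnion.2 ⟨0, h0s, by rw [tile_zero]; exact zero_mem_box hm⟩
      have h1 := I.blockEnt_union_ge hC hdisj h0t (corner_mem_tile hm a)
        (Finset.mem_biUnion.2 ⟨_, hp, corner_mem_tile hm (a - Pi.single i 1)⟩) hfin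
      have h2 := ih (fun z hz => hpos z (Finset.mem_insert_of_mem hz)) hlows ⟨_, hp⟩ h1.1.1
      refine ⟨Finset.mem_insert_of_mem h2.1, h2.2.1, ?_⟩
      have h3 := h1.2
      have h4 := (I.blockEnt_translate C hM (corner_mem hLm a) (zero_mem_box hm)).2 h2.2.1
      rw [zero_add] at h4
      rw [dist1_corner, tile, h4, I.extBound_translate (corner_mem hLm a)] at h3
      rw [Finset.card_insert_of_notMem ha]
      have h5 : I.boxError C m = I.extBound (box d m) + Real.log (2 * (C * m) + 1) := rfl
      push_cast
      rw [tile]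
      linarith [h2.2.2]

/-- The specific free energy exists. -/
theorem exists_tendsto_blockEnt (hd : 0 < d) (hL : L.FiniteIndex) {C : ℝ} (hC : 0 ≤ C)
    {M : Measure (HeightFn d k)} [IsProbabilityMeasure M] (hM : IsGradInvariant L M)
    (hfin : ∀ n, 0 < n → FiniteEnt Φ C (box d n) 0 M)
    (hB : ∃ B, ∃ᶠ n : ℕ in atTop, blockEnt Φ C (box d n) 0 M / (n : ℝ) ^ d ≤ B) :
    ∃ ℓ : ℝ, Tendsto (fun n : ℕ => blockEnt Φ C (box d n) 0 M / (n : ℝ) ^ d) atTop (𝓝 ℓ) := by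
  have hp : 0 < L.index := Nat.pos_of_ne_zero hL.index_ne_zero
  set p := L.index with hpdef
  set w := I.weakBound {0} with hw
  have hw0 : 0 ≤ w := I.weakBound_nonneg _
  set a : ℕ → ℝ := fun n => blockEnt Φ C (box d n) 0 M with ha
  set lg : ℕ → ℝ := fun n => w + Real.log (2 * (C * (d * n)) + 1) with hlg
  have hlg0 : ∀ n, 0 ≤ lg n := fun n => add_nonneg hw0 (Real.log_nonneg (by
    have : 0 ≤ C * (d * n) := by positivity
    linarith))
  have hlgn : Tendsto (fun n : ℕ => lg n / n) atTop (𝓝 0) := by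
    have h1 := tendsto_log_mul_add_div (A := 2 * C * d) (by positivity)
    have h2 := (tendsto_const_div_atTop_nhds_zero_nat w).add h1
    rw [add_zero] at h2
    refine h2.congr fun n => ?_
    simp only [hlg, add_div]
    ring_nf
  have hmono : ∀ m n : ℕ, 0 < m → m ≤ n → a m ≤ a n + ((n : ℝ) ^ d - (m : ℝ) ^ d) * lg n := by
    intro m n hm hmn
    have := (I.blockEnt_mono hC (box_subset hmn) (zero_mem_box hm)
      (fun x hx => dist1_zero_le_of_mem_box hx) (hfin n (hm.trans_le hmn))).2
    simpa [card_box] using this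
  have htiles : ∀ m j : ℕ, 0 < m → 0 < j → p ∣ m →
      (j : ℝ) ^ d * (a m - I.boxError C m) ≤ a (m * j) := by
    intro m j hm hj hpm
    have := I.blockEnt_tiles_ge hC hM hm hpm (box d j) (fun z hz i => (mem_box.1 hz i).1)
      (fun z hz i hi => ?_) ⟨0, zero_mem_box hj⟩
      (by rw [biUnion_tile_box hm]; exact hfin _ (by positivity))
    · rw [biUnion_tile_box hm, card_box] at this
      exact_mod_cast this.2.2
    · rw [mem_box] at hz ⊢
      intro i'
      have := hz i'
      by_cases h : i' = i
      · subst h; simp only [Pi.sub_apply, Pi.single_eq_same]; omega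
      · simp only [Pi.sub_apply, Pi.single_eq_of_ne h, sub_zero]; exact this
  -- The error `e` is that of gluing a tile of side `m`; `r` and `δ` arise from completing a box to
  -- the next multiple of the index by almost monotonicity.
  refine exists_tendsto_of_almost_superadditive (p := p)
    (x := fun n : ℕ => a n / (n : ℝ) ^ d) (e := fun n => I.boxError C n / (n : ℝ) ^ d)
    (r := fun n : ℕ => (((p * (n / p + 1) : ℕ) : ℝ) / n) ^ d)
    (δ := fun n : ℕ => ((((p * (n / p + 1) : ℕ) : ℝ) / n) ^ d - 1) * lg (p * (n / p + 1)))
    hp (I.tendsto_boxError hd hC) ?_ ?_ ?_ ?_ hB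
  · have h1 := (tendsto_mul_div_nat hp).add (tendsto_const_div_atTop_nhds_zero_nat (p : ℝ))
    rw [add_zero] at h1
    have h2 := h1.pow d
    rw [one_pow] at h2
    refine h2.congr fun n => ?_
    rw [← add_div]
    congr 2
    push_cast; ring
  · -- the error term from completing boxes
    have hbig : Tendsto (fun n : ℕ => (2 * (p : ℝ) * (d * 2 ^ d)) * (lg (p * (n / p + 1)) /
        ((p * (n / p + 1) : ℕ) : ℝ))) atTop (𝓝 0) := by
      have hm : Tendsto (fun n : ℕ => p * (n / p + 1)) atTop atTop := by
        refine tendsto_atTop_mono (fun n => ?_) tendsto_id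
        have := Nat.div_add_mod n p
        have h2 := Nat.mod_lt n hp
        rw [mul_add]; simp only [id]; omega
      have := (hlgn.comp hm).const_mul (2 * (p : ℝ) * (d * 2 ^ d))
      simpa using this
    refine squeeze_zero' ?_ ?_ hbig
    · filter_upwards [eventually_gt_atTop 0] with n hn
      have hn' : (0 : ℝ) < n := by exact_mod_cast hn
      refine mul_nonneg (sub_nonneg.2 (one_le_pow₀ ?_)) (hlg0 _)
      rw [one_le_div hn']
      have := Nat.div_add_mod n p
      have h2 := Nat.mod_lt n hp
      have : n ≤ p * (n / p + 1) := by rw [mul_add]; omega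
      exact_mod_cast this
    · filter_upwards [eventually_ge_atTop p] with n hn
      have hn0 : 0 < n := hp.trans_le hn
      have hn' : (0 : ℝ) < n := by exact_mod_cast hn0
      set m := p * (n / p + 1) with hmdef
      have hnm : n ≤ m := by
        have := Nat.div_add_mod n p
        have h2 := Nat.mod_lt n hp
        rw [hmdef, mul_add]; omega
      have hmn : m ≤ n + p := by
        have := Nat.mul_div_le n p
        rw [hmdef, mul_add]; omega
      have hnm' : (n : ℝ) ≤ m := by exact_mod_cast hnm
      have hmn' : (m : ℝ) ≤ n + p := by exact_mod_cast hmn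
      have hpn' : (p : ℝ) ≤ n := by exact_mod_cast hn
      have h1 := pow_sub_one_le d (y := (m : ℝ) / n) ((one_le_div hn').2 hnm')
        ((div_le_iff₀ hn').2 (by linarith))
      have h2 : (m : ℝ) / n - 1 ≤ p / n := by
        rw [div_sub_one hn'.ne']
        gcongr
        linarith
      have hm' : (0 : ℝ) < m := hn'.trans_le hnm'
      have h3 : (p : ℝ) / n ≤ 2 * p / m := by
        rw [div_le_div_iff₀ hn' hm']
        nlinarith [Nat.cast_nonneg (α := ℝ) p]
      calc (((m : ℝ) / n) ^ d - 1) * lg m ≤ ((2 * p / m) * (d * 2 ^ d)) * lg m := by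
            refine mul_le_mul_of_nonneg_right (h1.trans ?_) (hlg0 _)
            exact mul_le_mul_of_nonneg_right (h2.trans h3) (by positivity)
        _ = _ := by ring
  · -- lower bounds by tiling
    intro m hm hpm ε hε
    have hm' : (0 : ℝ) < m := by exact_mod_cast hm
    have hlim : Tendsto (fun n : ℕ => (((m * (n / m) : ℕ) : ℝ) / n) ^ d *
        ((a m - I.boxError C m) / (m : ℝ) ^ d) - d * m * (lg n / n)) atTop
        (𝓝 ((a m - I.boxError C m) / (m : ℝ) ^ d)) := by
      have := (((tendsto_mul_div_nat hm).pow d).mul_const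
        ((a m - I.boxError C m) / (m : ℝ) ^ d)).sub (hlgn.const_mul (d * m : ℝ))
      simpa using this
    have hlt : (a m - I.boxError C m) / (m : ℝ) ^ d - ε < (a m - I.boxError C m) / (m : ℝ) ^ d := by
      linarith
    filter_upwards [hlim.eventually (lt_mem_nhds hlt), eventually_ge_atTop m] with n hn hnm
    have hn0 : 0 < n := hm.trans_le hnm
    have hn' : (0 : ℝ) < n := by exact_mod_cast hn0
    have hj : 0 < n / m := Nat.div_pos hnm hm
    have h1 := htiles m (n / m) hm hj hpm
    have h2 := hmono (m * (n / m)) n (by positivity) (Nat.mul_div_le n m)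
    have hpos : 0 < (n : ℝ) ^ d := by positivity
    rw [← sub_div, le_div_iff₀ hpos]
    set t : ℝ := ((m * (n / m) : ℕ) : ℝ) / n with ht
    have htn : t * n = ((m * (n / m) : ℕ) : ℝ) := by rw [ht]; field_simp
    have ht0 : 0 ≤ t := by rw [ht]; positivity
    have h3 : 1 - t ≤ m / n := by
      rw [sub_le_iff_le_add, ht, ← add_div, le_div_iff₀ hn', one_mul]
      have := Nat.div_add_mod n m
      have h2 := Nat.mod_lt n hm
      have : n ≤ m + m * (n / m) := by omega
      exact_mod_cast this
    have h4 := one_sub_pow_le d ht0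
    have h5 : (n : ℝ) ^ d - ((m * (n / m) : ℕ) : ℝ) ^ d = (1 - t ^ d) * (n : ℝ) ^ d := by
      rw [← htn, mul_pow]; ring
    have h6 : (t ^ d * ((a m - I.boxError C m) / (m : ℝ) ^ d)) * (n : ℝ) ^ d =
        ((n / m : ℕ) : ℝ) ^ d * (a m - I.boxError C m) := by
      have : t ^ d * (n : ℝ) ^ d = (m : ℝ) ^ d * ((n / m : ℕ) : ℝ) ^ d := by
        rw [← mul_pow, htn, ← mul_pow]; push_cast; rfl
      rw [mul_right_comm, this]
      field_simp
    have h7 : (1 - t ^ d) * (n : ℝ) ^ d * lg n ≤ (d * m * (lg n / n)) * (n : ℝ) ^ d := by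
      have : (1 - t ^ d) ≤ d * (m / n) := h4.trans (by gcongr)
      calc (1 - t ^ d) * (n : ℝ) ^ d * lg n ≤ (d * (m / n)) * (n : ℝ) ^ d * lg n := by
            refine mul_le_mul_of_nonneg_right ?_ (hlg0 n)
            exact mul_le_mul_of_nonneg_right this (by positivity)
        _ = _ := by ring
    rw [h5] at h2
    refine (mul_le_mul_of_nonneg_right hn.le hpos.le).trans ?_
    rw [sub_mul, h6]
    linarith
  · filter_upwards [eventually_gt_atTop 0] with n hn
    have hn' : (0 : ℝ) < n := by exact_mod_cast hn
    refine ⟨by positivity, ?_⟩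
    set m := p * (n / p + 1) with hmdef
    have hnm : n ≤ m := by
      have := Nat.div_add_mod n p
      have h2 := Nat.mod_lt n hp
      rw [hmdef, mul_add]; omega
    have hm' : (0 : ℝ) < m := hn'.trans_le (by exact_mod_cast hnm)
    have := hmono n m hn hnm
    rw [div_le_iff₀ (by positivity)]
    calc a n ≤ a m + ((m : ℝ) ^ d - (n : ℝ) ^ d) * lg m := this
      _ = _ := by rw [div_pow]; field_simp

end Interaction

end Tiles

/-! ### Resampling all tiles independently -/

section Resampling

open ProbabilityTheory

variable {d : ℕ} {k : HeightKind}

/-- A realization, by means of a uniform random variable, of the Gibbs kernel with weight `w` on a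
subset `V` of a box of side `m`. -/
structure TileKernel (d : ℕ) (k : HeightKind) (m : ℕ) where
  V : Finset (Site d)
  w : HeightFn d k → ℝ≥0∞
  f : HeightFn d k → unitInterval → HeightFn d k
  pos : 0 < m
  subset : V ⊆ box d m
  zero_notMem : 0 ∉ V
  measurable_w : Measurable w
  grad_w : IsGrad w
  dep_w : DependsOn w (box d m : Set (Site d))
  measurable_f : Measurable (Function.uncurry f)
  map_f : ∀ φ, (volume : Measure unitInterval).map (f φ) = gibbsLaw V w φ

theorem exists_tileKernel {m : ℕ} {V : Finset (Site d)} {w : HeightFn d k → ℝ≥0∞} (hm : 0 < m)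
    (hV : V ⊆ box d m) (h0 : 0 ∉ V) (hw : Measurable w) (hg : IsGrad w)
    (hdep : DependsOn w (box d m : Set (Site d))) :
    ∃ T : TileKernel d k m, T.V = V ∧ T.w = w := by
  obtain ⟨f, hf, hmap⟩ := Kernel.exists_measurable_map_eq_unitInterval (gibbs V hw)
  exact ⟨⟨V, w, f, hm, hV, h0, hw, hg, hdep, hf, hmap⟩, rfl, rfl⟩

/-- The index of the tile that contains `x`. -/
def tileIndex (m : ℕ) (x : Site d) : Site d := fun i => x i / m

theorem tileIndex_eq_iff {m : ℕ} (hm : 0 < m) {x z : Site d} : tileIndex m x = z ↔ x ∈ tile m z := by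
  rw [mem_tile_iff_div hm]
  exact funext_iff

theorem tileIndex_add_corner {m : ℕ} (hm : 0 < m) (x z : Site d) :
    tileIndex m (x + corner m z) = tileIndex m x + z := by
  have hm' : (m : ℤ) ≠ 0 := by exact_mod_cast hm.ne'
  ext i
  simp only [tileIndex, Pi.add_apply, corner]
  rw [mul_comm, Int.add_mul_ediv_right _ _ hm']

theorem corner_add (m : ℕ) (z z' : Site d) : corner m (z + z') = corner m z + corner m z' := by
  ext i; simp [corner, mul_add]

theorem sub_corner_mem_box {m : ℕ} {x z : Site d} : x - corner m z ∈ box d m ↔ x ∈ tile m z := by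
  rw [tile, mem_translateSet]

/-- Independent uniform random variables, one for each tile. -/
noncomputable def uniforms (d : ℕ) : Measure (Site d → unitInterval) :=
  Measure.infinitePi fun _ => volume

instance instIsProbabilityMeasureUniforms (d : ℕ) : IsProbabilityMeasure (uniforms d) := by
  unfold uniforms; infer_instance

/-- Refreshing one coordinate preserves the product law. The randomness of one tile can thus be
integrated separately from that of the others. -/
theorem uniforms_map_update (z : Site d) :
    ((uniforms d).prod volume).map (fun p => Function.update p.1 z p.2) = uniforms d := by
  have hm : Measurable fun p : (Site d → unitInterval) × unitInterval =>
      Function.update p.1 z p.2 := by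
    refine measurable_pi_lambda _ fun x => ?_
    by_cases h : x = z
    · subst h; simpa using measurable_snd
    · simp only [Function.update_of_ne h]
      exact (measurable_pi_apply x).comp measurable_fst
  refine Measure.eq_infinitePi _ fun s t ht => ?_
  have hA : MeasurableSet (Set.pi (s : Set (Site d)) t) :=
    MeasurableSet.pi s.countable_toSet fun i _ => ht i
  rw [Measure.map_apply hm hA]
  by_cases hz : z ∈ s
  · have : (fun p : (Site d → unitInterval) × unitInterval => Function.update p.1 z p.2) ⁻¹'
        (Set.pi (s : Set (Site d)) t) = (Set.pi ((s.erase z : Finset (Site d)) : Set (Site d)) t) ×ˢ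
          t z := by
      ext p
      simp only [Set.mem_preimage, Set.mem_pi, Set.mem_prod, Finset.mem_coe, Finset.mem_erase]
      constructor
      · intro h
        refine ⟨fun i hi => ?_, by simpa using h z hz⟩
        have := h i hi.2
        rwa [Function.update_of_ne hi.1] at this
      · rintro ⟨h1, h2⟩ i hi
        by_cases hiz : i = z
        · subst hiz; simpa using h2
        · rw [Function.update_of_ne hiz]; exact h1 i ⟨hiz, hi⟩
    rw [this, Measure.prod_prod, uniforms, Measure.infinitePi_pi _ (fun i _ => ht i), mul_comm, Finset.mul_prod_erase s (fun i => volume (t i)) hz]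
  · have : (fun p : (Site d → unitInterval) × unitInterval => Function.update p.1 z p.2) ⁻¹'
        (Set.pi (s : Set (Site d)) t) = (Set.pi (s : Set (Site d)) t) ×ˢ Set.univ := by
      ext p
      simp only [Set.mem_preimage, Set.mem_pi, Set.mem_prod, Finset.mem_coe, Set.mem_univ, and_true]
      refine forall₂_congr fun i hi => ?_
      rw [Function.update_of_ne (by rintro rfl; exact hz hi)]
    rw [this, Measure.prod_prod, measure_univ, mul_one, uniforms, Measure.infinitePi_pi _ fun i _ => ht i]

theorem uniforms_map_shift (z : Site d) :
    (uniforms d).map (fun u x => u (x + z)) = uniforms d := by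
  have hm : Measurable fun (u : Site d → unitInterval) (x : Site d) => u (x + z) :=
    measurable_pi_lambda _ fun x => measurable_pi_apply _
  refine Measure.eq_infinitePi _ fun s t ht => ?_
  rw [Measure.map_apply hm (MeasurableSet.pi s.countable_toSet fun i _ => ht i)]
  have : (fun (u : Site d → unitInterval) (x : Site d) => u (x + z)) ⁻¹'
      (Set.pi (s : Set (Site d)) t) =
      Set.pi ((s.map (addRightEmbedding z) : Finset (Site d)) : Set (Site d))
        fun y => t (y - z) := by
    ext u
    simp only [Set.mem_preimage, Set.mem_pi, Finset.mem_coe, Finset.mem_map,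
      addRightEmbedding_apply]
    constructor
    · rintro h _ ⟨i, hi, rfl⟩
      rw [add_sub_cancel_right]; exact h i hi
    · intro h i hi
      have := h _ ⟨i, hi, rfl⟩
      rwa [add_sub_cancel_right] at this
  rw [this, uniforms, Measure.infinitePi_pi _ fun i _ => ht _, Finset.prod_map]
  simp

namespace TileKernel

variable {m : ℕ} (T : TileKernel d k m)

/-- The region in which the heights of the tile with index `z` are resampled. -/
noncomputable def region (z : Site d) : Finset (Site d) := translateSet (corner m z) T.V

/-- The weight on the tile with index `z`. -/
def tileWeight (z : Site d) (φ : HeightFn d k) : ℝ≥0∞ := T.w (shift (corner m z) φ)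

theorem measurable_tileWeight (z : Site d) : Measurable (T.tileWeight z) :=
  T.measurable_w.comp (measurable_shift _)

theorem mem_region {z x : Site d} : x ∈ T.region z ↔ x - corner m z ∈ T.V := mem_translateSet

theorem region_subset (z : Site d) : T.region z ⊆ tile m z := fun _ hx =>
  sub_corner_mem_box.1 (T.subset (T.mem_region.1 hx))

/-- The corners are frozen. They fix the reference height inside each tile, and they keep the mean
height differences along the tiling, hence the slope. -/
theorem corner_notMem_region (z z' : Site d) : corner m z ∉ T.region z' := by
  intro h
  have h1 := (tileIndex_eq_iff T.pos).2 (T.region_subset z' h)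
  have h2 := (tileIndex_eq_iff T.pos).2 (corner_mem_tile T.pos z)
  rw [h2] at h1
  rw [← h1, T.mem_region, sub_self] at h
  exact T.zero_notMem h

theorem dependsOn_tileWeight (z : Site d) :
    DependsOn (T.tileWeight z) (tile m z : Set (Site d)) := fun φ φ' h =>
  T.dep_w fun x hx => h _ (by
    rw [Finset.mem_coe, ← sub_corner_mem_box]; simpa using hx)

theorem isGrad_tileWeight (z : Site d) : IsGrad (T.tileWeight z) := T.grad_w.shift _

/-- Resampling the heights in the tile with index `z`. -/
noncomputable def resampleTile (z : Site d) (φ : HeightFn d k) (t : unitInterval) : HeightFn d k := fun x =>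
  if x - corner m z ∈ T.V then
    -- The frozen heights of the tile enter relative to its corner, seen from the origin, and the
    -- corner height is added back. Resampling therefore commutes with vertical translations and
    -- with the shifts of the tiling.
    φ (corner m z) + T.f (localize (box d m \ T.V) 0 (shift (corner m z) φ)) t (x - corner m z)
  else φ x

open Classical in
/-- Resampling the heights in the tiles with index in `Z`. -/
noncomputable def resample (Z : Set (Site d)) (φ : HeightFn d k) (u : Site d → unitInterval) :
    HeightFn d k := fun x =>
  if tileIndex m x ∈ Z then T.resampleTile (tileIndex m x) φ (u (tileIndex m x)) x else φ x

theorem measurable_resampleTile (z : Site d) :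
    Measurable fun p : HeightFn d k × unitInterval => T.resampleTile z p.1 p.2 := by
  refine measurable_pi_lambda _ fun x => ?_
  unfold resampleTile
  by_cases h : x - corner m z ∈ T.V
  · simp only [if_pos h]
    refine ((measurable_pi_apply _).comp measurable_fst).add ((measurable_pi_apply _).comp ?_)
    exact T.measurable_f.comp ((((measurable_localize _ _).comp (measurable_shift _)).comp
      measurable_fst).prodMk measurable_snd)
  · simp only [if_neg h]
    exact (measurable_pi_apply x).comp measurable_fst

theorem measurable_resample (Z : Set (Site d)) :
    Measurable fun p : HeightFn d k × (Site d → unitInterval) => T.resample Z p.1 p.2 := by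
  refine measurable_pi_lambda _ fun x => ?_
  unfold resample
  by_cases h : tileIndex m x ∈ Z
  · simp only [if_pos h]
    exact (measurable_pi_apply x).comp ((T.measurable_resampleTile (tileIndex m x)).comp
      (measurable_fst.prodMk ((measurable_pi_apply (tileIndex m x)).comp measurable_snd)))
  · simp only [if_neg h]
    exact (measurable_pi_apply x).comp measurable_fst

theorem resampleTile_of_notMem {z x : Site d} (h : x ∉ T.region z) (φ : HeightFn d k)
    (t : unitInterval) : T.resampleTile z φ t x = φ x := if_neg fun h' => h (T.mem_region.2 h')

theorem resampleTile_congr {z : Site d} {φ φ' : HeightFn d k} (h : ∀ y ∈ tile m z, φ y = φ' y)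
    (t : unitInterval) {x : Site d} (hx : x ∈ tile m z) :
    T.resampleTile z φ t x = T.resampleTile z φ' t x := by
  have h1 : localize (box d m \ T.V) 0 (shift (corner m z) φ) =
      localize (box d m \ T.V) 0 (shift (corner m z) φ') := by
    refine localize_congr (by simp [T.zero_notMem, zero_mem_box T.pos]) fun y hy => ?_
    exact h _ (by rw [← sub_corner_mem_box]; simpa using (Finset.mem_sdiff.1 hy).1)
  unfold resampleTile
  rw [h1, h _ (corner_mem_tile T.pos z), h x hx]

theorem resample_of_notMem {Z : Set (Site d)} {x : Site d} (h : tileIndex m x ∉ Z)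
    (φ : HeightFn d k) (u : Site d → unitInterval) : T.resample Z φ u x = φ x := if_neg h

theorem resample_of_mem {Z : Set (Site d)} {x : Site d} (h : tileIndex m x ∈ Z)
    (φ : HeightFn d k) (u : Site d → unitInterval) :
    T.resample Z φ u x = T.resampleTile (tileIndex m x) φ (u (tileIndex m x)) x := if_pos h

theorem resample_of_frozen {Z : Set (Site d)} {x : Site d} (h : ∀ z, x ∉ T.region z)
    (φ : HeightFn d k) (u : Site d → unitInterval) : T.resample Z φ u x = φ x := by
  by_cases hx : tileIndex m x ∈ Z
  · rw [T.resample_of_mem hx, T.resampleTile_of_notMem (h _)]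
  · exact T.resample_of_notMem hx φ u

theorem resample_empty (φ : HeightFn d k) (u : Site d → unitInterval) :
    T.resample ∅ φ u = φ := by
  ext x; exact T.resample_of_notMem (Set.notMem_empty _) φ u

/-- Resampling a tile reads and changes only heights in that tile, so the simultaneous operation can
be carried out tile by tile in any order. -/
theorem resample_insert {Z : Set (Site d)} {z : Site d} (hz : z ∉ Z) (φ : HeightFn d k)
    (u : Site d → unitInterval) :
    T.resample (insert z Z) φ u = T.resampleTile z (T.resample Z φ u) (u z) := by
  ext x
  by_cases hx : tileIndex m x = z
  · have hxt := (tileIndex_eq_iff T.pos).1 hx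
    rw [T.resample_of_mem (by rw [hx]; exact Set.mem_insert _ _), hx]
    refine T.resampleTile_congr (fun y hy => ?_) _ hxt
    rw [T.resample_of_notMem]
    rw [(tileIndex_eq_iff T.pos).2 hy]; exact hz
  · have hxr : x ∉ T.region z := fun h =>
      hx ((tileIndex_eq_iff T.pos).2 (T.region_subset z h))
    rw [T.resampleTile_of_notMem hxr]
    by_cases hxZ : tileIndex m x ∈ Z
    · rw [T.resample_of_mem hxZ, T.resample_of_mem (Set.mem_insert_of_mem _ hxZ)]
    · rw [T.resample_of_notMem hxZ, T.resample_of_notMem]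
      simp [hx, hxZ]

theorem resample_update {Z : Set (Site d)} {z : Site d} (hz : z ∉ Z) (φ : HeightFn d k)
    (u : Site d → unitInterval) (t : unitInterval) :
    T.resample Z φ (Function.update u z t) = T.resample Z φ u := by
  ext x
  by_cases hxZ : tileIndex m x ∈ Z
  · rw [T.resample_of_mem hxZ, T.resample_of_mem hxZ,
      Function.update_of_ne (by rintro rfl; exact hz hxZ)]
  · rw [T.resample_of_notMem hxZ, T.resample_of_notMem hxZ]

theorem resample_congr_on {Z Z' : Set (Site d)} {x : Site d}
    (h : tileIndex m x ∈ Z ↔ tileIndex m x ∈ Z') (φ : HeightFn d k) (u : Site d → unitInterval) :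
    T.resample Z φ u x = T.resample Z' φ u x := by
  by_cases hx : tileIndex m x ∈ Z
  · rw [T.resample_of_mem hx, T.resample_of_mem (h.1 hx)]
  · rw [T.resample_of_notMem hx, T.resample_of_notMem fun h' => hx (h.2 h')]

theorem resample_add_const (Z : Set (Site d)) (φ : HeightFn d k) (c : k.E)
    (u : Site d → unitInterval) :
    T.resample Z (φ + fun _ => c) u = T.resample Z φ u + fun _ => c := by
  have h : ∀ z t x, T.resampleTile z (φ + fun _ => c) t x = T.resampleTile z φ t x + c := by
    intro z t x
    have h1 : localize (box d m \ T.V) 0 (shift (corner m z) (φ + fun _ => c)) =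
        localize (box d m \ T.V) 0 (shift (corner m z) φ) :=
      (isGrad_localize (box d m \ T.V) 0).shift (corner m z) φ c
    unfold resampleTile
    rw [h1]
    by_cases hx : x - corner m z ∈ T.V
    · rw [if_pos hx, if_pos hx]; simp only [Pi.add_apply]; abel
    · rw [if_neg hx, if_neg hx]; rfl
  ext x
  simp only [Pi.add_apply]
  by_cases hx : tileIndex m x ∈ Z
  · rw [T.resample_of_mem hx, T.resample_of_mem hx, h]
  · rw [T.resample_of_notMem hx, T.resample_of_notMem hx]; rfl

theorem shift_resample (z₀ : Site d) (φ : HeightFn d k) (u : Site d → unitInterval) :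
    shift (corner m z₀) (T.resample Set.univ φ u) =
      T.resample Set.univ (shift (corner m z₀) φ) (fun z => u (z + z₀)) := by
  ext x
  rw [shift, T.resample_of_mem (Set.mem_univ _), T.resample_of_mem (Set.mem_univ _),
    tileIndex_add_corner T.pos]
  unfold resampleTile
  rw [shift_shift, corner_add, add_sub_add_right_eq_sub]
  rfl

/-- The law of the resampled heights in one tile. -/
theorem map_resampleTile {z : Site d} {φ : HeightFn d k}
    (h : Normalizable (T.region z) (T.tileWeight z) φ) :
    (volume : Measure unitInterval).map (T.resampleTile z φ) =
      gibbsLaw (T.region z) (T.tileWeight z) φ := by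
  set c := corner m z with hc
  set ψ := localize (box d m \ T.V) 0 (shift c φ) with hψ
  -- The map `G` carries a configuration near the origin back to the tile and restores the corner
  -- height. Under it the reference measures correspond, by translation invariance in both senses,
  -- and so do the weights.
  set G : HeightFn d k → HeightFn d k := fun χ x =>
    if x - c ∈ T.V then φ c + χ (x - c) else φ x with hG
  have hGm : Measurable G := by
    refine measurable_pi_lambda _ fun x => ?_
    by_cases hx : x - c ∈ T.V
    · simp only [hG, if_pos hx]; exact measurable_const.add (measurable_pi_apply _)
    · simp only [hG, if_neg hx]; exact measurable_const
  have hfm : Measurable (T.f ψ) := T.measurable_f.comp (measurable_const.prodMk measurable_id)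
  have e1 : T.resampleTile z φ = G ∘ T.f ψ := rfl
  rw [e1, ← Measure.map_map hGm hfm, T.map_f]
  have star : ∀ H : HeightFn d k → ℝ≥0∞, Measurable H →
      refInt T.V (fun χ => H (G χ)) ψ = refInt (T.region z) H φ := by
    intro H hH
    rw [region, refInt_translateSet _ _ hH]
    unfold refInt
    rw [← lintegral_add_left_eq_self (fun η => H (shift (-corner m z) (patch T.V
      (shift (corner m z) φ) η))) (fun _ : T.V => φ c)]
    refine lintegral_congr fun η => ?_
    refine congrArg H (funext fun x => ?_)
    simp only [hG, shift]
    by_cases hx : x - c ∈ T.V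
    · rw [if_pos hx, patch_of_mem _ _ hx, patch_of_mem _ _ (by rwa [← sub_eq_add_neg])]
      simp only [Pi.add_apply, ← sub_eq_add_neg]
      rfl
    · rw [if_neg hx, patch_of_notMem _ _ (by rwa [← sub_eq_add_neg])]
      change φ x = φ (x + -c + c)
      rw [neg_add_cancel_right]
  have hw : ∀ χ, (∀ x ∉ T.V, χ x = ψ x) → T.w χ = T.tileWeight z (G χ) := by
    intro χ hχ
    have e2 : T.w χ = T.w (χ + fun _ => φ c) := (T.grad_w χ (φ c)).symm
    rw [e2, tileWeight]
    refine T.dep_w fun x hx => ?_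
    simp only [Pi.add_apply, hG, shift, ← hc, add_sub_cancel_right]
    by_cases hxV : x ∈ T.V
    · rw [if_pos hxV, add_comm]
    · rw [if_neg hxV, hχ x hxV, hψ, localize_of_mem (Finset.mem_sdiff.2 ⟨hx, hxV⟩)]
      simp [shift]
  have hZ : refInt T.V T.w ψ = refInt (T.region z) (T.tileWeight z) φ := by
    rw [← star _ (T.measurable_tileWeight z)]
    exact refInt_congr_fun hw
  have hn : Normalizable T.V T.w ψ := by rw [Normalizable, hZ]; exact h
  refine Measure.ext_of_lintegral _ fun F hF => ?_
  have hFG : Measurable fun χ => F (G χ) := hF.comp hGm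
  have hwF : Measurable fun χ => T.tileWeight z χ * F χ := (T.measurable_tileWeight z).mul hF
  rw [lintegral_map hF hGm, lintegral_gibbsLaw T.measurable_w hFG hn,
    lintegral_gibbsLaw (T.measurable_tileWeight z) hF h, hZ, ← star _ hwF]
  congr 1
  refine refInt_congr_fun fun χ hχ => ?_
  rw [hw χ hχ]

/-- The law of the height function after resampling the tiles with index in `Z`. -/
noncomputable def law (Z : Set (Site d)) (M : Measure (HeightFn d k)) : Measure (HeightFn d k) :=
  (M.prod (uniforms d)).map fun p => T.resample Z p.1 p.2

instance instIsProbabilityMeasureLaw (Z : Set (Site d)) (M : Measure (HeightFn d k))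
    [IsProbabilityMeasure M] : IsProbabilityMeasure (T.law Z M) :=
  Measure.isProbabilityMeasure_map (T.measurable_resample Z).aemeasurable

theorem lintegral_law (Z : Set (Site d)) (M : Measure (HeightFn d k)) [SFinite M]
    {F : HeightFn d k → ℝ≥0∞} (hF : Measurable F) :
    ∫⁻ φ, F φ ∂(T.law Z M) = ∫⁻ φ, ∫⁻ u, F (T.resample Z φ u) ∂(uniforms d) ∂M := by
  rw [law, lintegral_map hF (T.measurable_resample Z)]
  exact lintegral_prod (fun p => F (T.resample Z p.1 p.2))
    (hF.comp (T.measurable_resample Z)).aemeasurable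

theorem law_empty (M : Measure (HeightFn d k)) [SFinite M] : T.law ∅ M = M := by
  refine Measure.ext_of_lintegral _ fun F hF => ?_
  rw [T.lintegral_law ∅ M hF]
  simp [T.resample_empty]

theorem ae_normalizable_resample {Z : Set (Site d)} {z : Site d} (hz : z ∉ Z) {φ : HeightFn d k}
    (h : Normalizable (T.region z) (T.tileWeight z) φ) (u : Site d → unitInterval) :
    Normalizable (T.region z) (T.tileWeight z) (T.resample Z φ u) := by
  have e : refInt (T.region z) (T.tileWeight z) (T.resample Z φ u) =
      refInt (T.region z) (T.tileWeight z) φ := by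
    unfold refInt
    refine lintegral_congr fun η => T.dependsOn_tileWeight z fun x hx => ?_
    by_cases hxr : x ∈ T.region z
    · rw [patch_of_mem _ _ hxr, patch_of_mem _ _ hxr]
    · rw [patch_of_notMem _ _ hxr, patch_of_notMem _ _ hxr, T.resample_of_notMem]
      rw [(tileIndex_eq_iff T.pos).2 hx]; exact hz
  rw [Normalizable, e]; exact h

/-- Resampling one more tile amounts to an application of a Gibbs kernel. -/
theorem law_insert {Z : Set (Site d)} {z : Site d} (hz : z ∉ Z) (M : Measure (HeightFn d k))
    [SFinite M] (h : ∀ᵐ φ ∂M, Normalizable (T.region z) (T.tileWeight z) φ) :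
    T.law (insert z Z) M = gibbs (T.region z) (T.measurable_tileWeight z) ∘ₘ T.law Z M := by
  have hup : Measurable fun p : (Site d → unitInterval) × unitInterval =>
      Function.update p.1 z p.2 := by
    refine measurable_pi_lambda _ fun x => ?_
    by_cases h : x = z
    · subst h; simpa using measurable_snd
    · simp only [Function.update_of_ne h]
      exact (measurable_pi_apply x).comp measurable_fst
  refine Measure.ext_of_lintegral _ fun F hF => ?_
  rw [T.lintegral_law _ M hF, Measure.lintegral_bind (Kernel.measurable _).aemeasurable
    hF.aemeasurable, T.lintegral_law Z M hF.lintegral_kernel]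
  refine lintegral_congr_ae ?_
  filter_upwards [h] with φ hφ
  have hm1 : Measurable fun u => F (T.resample (insert z Z) φ u) :=
    hF.comp ((T.measurable_resample _).comp (measurable_const.prodMk measurable_id))
  conv_lhs => rw [← uniforms_map_update z]
  rw [lintegral_map hm1 hup, lintegral_prod (fun p : (Site d → unitInterval) × unitInterval =>
    F (T.resample (insert z Z) φ (Function.update p.1 z p.2))) (hm1.comp hup).aemeasurable]
  refine lintegral_congr fun u => ?_
  have hm2 : Measurable (T.resampleTile z (T.resample Z φ u)) :=
    (T.measurable_resampleTile z).comp (measurable_const.prodMk measurable_id)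
  rw [gibbs_apply, ← T.map_resampleTile (T.ae_normalizable_resample hz hφ u),
    lintegral_map hF hm2]
  refine lintegral_congr fun t => ?_
  rw [T.resample_insert hz, T.resample_update hz, Function.update_self]

/-- The law of the resampled height function is invariant under the shifts of the tiling. -/
theorem law_map_shift {L : AddSubgroup (Site d)} {M : Measure (HeightFn d k)}
    [IsProbabilityMeasure M] (hM : IsGradInvariant L M) {z : Site d} (hz : corner m z ∈ L)
    {F : HeightFn d k → ℝ≥0∞} (hF : Measurable F) (hFg : IsGrad F) :
    ∫⁻ φ, F (shift (corner m z) φ) ∂(T.law Set.univ M) = ∫⁻ φ, F φ ∂(T.law Set.univ M) := by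
  have hF' : Measurable fun φ => F (shift (corner m z) φ) := hF.comp (measurable_shift _)
  rw [T.lintegral_law _ M hF', T.lintegral_law _ M hF]
  have hm1 : ∀ φ, Measurable fun u => F (T.resample Set.univ φ u) := fun φ =>
    hF.comp ((T.measurable_resample _).comp (measurable_const.prodMk measurable_id))
  have hsh : Measurable fun (u : Site d → unitInterval) (x : Site d) => u (x + z) :=
    measurable_pi_lambda _ fun x => measurable_pi_apply _
  set J : HeightFn d k → ℝ≥0∞ := fun φ => ∫⁻ u, F (T.resample Set.univ φ u) ∂(uniforms d) with hJ
  have hJm : Measurable J := Measurable.lintegral_prod_right'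
    (f := fun p : HeightFn d k × (Site d → unitInterval) => F (T.resample Set.univ p.1 p.2))
    (hF.comp (T.measurable_resample Set.univ))
  have hJg : IsGrad J := fun φ c => by
    simp only [hJ, T.resample_add_const, hFg _ c]
  have e : ∀ φ, ∫⁻ u, F (shift (corner m z) (T.resample Set.univ φ u)) ∂(uniforms d) =
      J (shift (corner m z) φ) := by
    intro φ
    simp only [hJ]
    conv_rhs => rw [← uniforms_map_shift z]
    rw [lintegral_map (hm1 _) hsh]
    refine lintegral_congr fun u => ?_
    rw [T.shift_resample]
  simp_rw [e]
  have hmap := hM.map_eq hz hJg hJm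
  have h1 : ∫⁻ φ, J (shift (corner m z) φ) ∂M = ∫⁻ y, y ∂(M.map fun φ => J (shift (corner m z) φ)) :=
    (lintegral_map measurable_id (hJm.comp (measurable_shift _))).symm
  rw [h1, hmap]
  exact lintegral_map measurable_id hJm

end TileKernel

end Resampling

/-! ### Resampling with the weights of the interaction -/

section InteractionResampling

open ProbabilityTheory InformationTheory

variable {d : ℕ} {k : HeightKind}

namespace Interaction

variable {L : AddSubgroup (Site d)} {Φ : Potential d k} (I : Interaction L Φ)
include I

/-- The strong interaction of the heights in `V` is confined to `W`. -/
structure Collar (V W : Finset (Site d)) : Prop where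
  subset : V ⊆ W
  closed : ∀ u ∈ V, ∀ v, I.A.Adj u v → v ∈ W
  strong_zero : ∀ Γ : Finset (Site d), (∃ x ∈ Γ, x ∈ V) → ¬ Γ ⊆ W → ∀ φ, I.Ψ Γ φ = 0

theorem exists_collar_width (hL : L.FiniteIndex) :
    ∃ s : ℕ, 0 < s ∧ ∀ V W : Finset (Site d), thicken s V ⊆ W → I.Collar V W := by
  obtain ⟨r, hr⟩ := I.exists_edge_length hL
  refine ⟨max r I.R + 1, Nat.succ_pos _, fun V W h => ⟨fun x hx => h (subset_thicken _ _ hx),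
    fun u hu v huv => h (mem_thicken.2 ⟨u, hu, fun i => (hr u v huv i).trans ?_⟩),
    fun Γ hΓ hW φ => I.strong_eq_zero_of_not_subset hΓ (fun hsub => hW fun x hx => ?_) φ⟩⟩
  · push_cast; have := le_max_left (r : ℤ) I.R; linarith
  · obtain ⟨y, hy, hxy⟩ := mem_thicken.1 (hsub hx)
    refine h (mem_thicken.2 ⟨y, hy, fun i => (hxy i).trans ?_⟩)
    push_cast; have := le_max_right (r : ℤ) I.R; linarith

theorem Collar.translate {V W : Finset (Site d)} (h : I.Collar V W) {v : Site d} (hv : v ∈ L) :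
    I.Collar (translateSet v V) (translateSet v W) := by
  refine ⟨fun x hx => mem_translateSet.2 (h.subset (mem_translateSet.1 hx)), fun x hx y hxy => ?_,
    fun Γ hΓ hW φ => ?_⟩
  · refine mem_translateSet.2 (h.closed _ (mem_translateSet.1 hx) _ ?_)
    rw [← I.constraint.graph.invariant v hv]
    simpa using hxy
  · have e : Γ = translateSet v (translateSet (-v) Γ) := by
      rw [translateSet_translateSet, add_neg_cancel, translateSet_zero]
    rw [e, I.strong.periodicGradient.periodic v hv]
    obtain ⟨x, hx, hxV⟩ := hΓ
    refine h.strong_zero _ ⟨x - v, ?_, mem_translateSet.1 hxV⟩ (fun hs => hW fun y hy => ?_) _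
    · rw [mem_translateSet]; simpa using hx
    · exact mem_translateSet.2 (hs (by rw [mem_translateSet]; simpa using hy))

/-- Enlarging the region in which interactions are taken into account does not change the weight
much. -/
theorem Collar.weight_compare {V W : Finset (Site d)} (h : I.Collar V W) {Δ : Set (Site d)}
    (hΔ : (W : Set (Site d)) ⊆ Δ) (φ : HeightFn d k) :
    weight Φ (meeting V Δ) φ ≤ ENNReal.ofReal (Real.exp (I.extBound W)) *
        weight Φ (meeting V W) φ ∧
      weight Φ (meeting V W) φ ≤ ENNReal.ofReal (Real.exp (I.extBound W)) *
        weight Φ (meeting V Δ) φ := by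
  -- These are the sets that meet `V` and leave `W`. By the collar property their strong energy
  -- vanishes, and their weak energy is at most the exterior bound of `W`, with either sign.
  set 𝒞 : Set (Finset (Site d)) := {Γ | Γ ∈ meeting V Δ ∧ ¬ Γ ⊆ W} with h𝒞
  have h1 : meeting V Δ = meeting V W ∪ 𝒞 := by
    ext Γ
    simp only [Set.mem_union]
    constructor
    · intro hΓ
      by_cases hs : Γ ⊆ W
      · exact Or.inl ⟨Finset.coe_subset.2 hs, hΓ.2⟩
      · exact Or.inr ⟨hΓ, hs⟩
    · rintro (⟨hs, hm⟩ | hΓ)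
      · exact ⟨hs.trans hΔ, hm⟩
      · exact hΓ.1
  have hdisj : Disjoint (meeting V (W : Set (Site d))) 𝒞 :=
    Set.disjoint_left.2 fun Γ h1 h2 => h2.2 (Finset.coe_subset.1 h1.1)
  have hth := isThin_meeting V Δ
  rw [h1] at hth ⊢
  rw [I.weight_union hdisj hth]
  have hth' := hth.mono Set.subset_union_right
  have hc := I.extBound_nonneg W
  have hab : I.weakAbs 𝒞 φ ≤ ENNReal.ofReal (I.extBound W) :=
    I.weakAbs_le_of_crosses (fun Γ hΓ => by
      obtain ⟨⟨_, x, hx, hxV⟩, hs⟩ := hΓ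
      exact ⟨⟨x, hx, h.subset hxV⟩, Finset.not_subset.1 hs⟩) φ
  have h2 := I.weight_le hth' hc hab
  have h3 := I.le_weight hth' hc hab fun Γ hΓ => h.strong_zero Γ hΓ.1.2 hΓ.2 φ
  constructor
  · rw [mul_comm]; gcongr
  · calc weight Φ (meeting V W) φ = ENNReal.ofReal (Real.exp (I.extBound W)) *
          (weight Φ (meeting V W) φ * ENNReal.ofReal (Real.exp (-I.extBound W))) := by
          rw [mul_left_comm, ← ENNReal.ofReal_mul (Real.exp_pos _).le, ← Real.exp_add]
          simp
      _ ≤ _ := by gcongr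

theorem Collar.refInt_weight_lt_top (hd : 0 < d) {V W : Finset (Site d)} (h : I.Collar V W)
    {Δ : Set (Site d)} (hΔ : (W : Set (Site d)) ⊆ Δ) (φ : HeightFn d k) :
    refInt V (weight Φ (meeting V Δ)) φ < ∞ :=
  I.refInt_weight_lt_top hd V (fun _ hx => hΔ (h.subset hx)) (fun u hu v huv => hΔ (h.closed u hu v huv)) φ

theorem Collar.normalizable (hd : 0 < d) {V W : Finset (Site d)} (h : I.Collar V W)
    {φ : HeightFn d k} (hφ : φ ∈ I.Good) : Normalizable V (weight Φ (meeting V W)) φ := by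
  refine ⟨pos_iff_ne_zero.2 fun h0 => hφ.2 V ?_, h.refInt_weight_lt_top I hd subset_rfl φ⟩
  refine nonpos_iff_eq_zero.1 ?_
  calc refInt V (weight Φ (meeting V Set.univ)) φ
      ≤ refInt V (fun φ' => ENNReal.ofReal (Real.exp (I.extBound W)) *
          weight Φ (meeting V W) φ') φ :=
        refInt_mono fun φ' _ => (h.weight_compare I (Set.subset_univ _) φ').1
    _ = 0 := by
        rw [refInt_const_mul (I.measurable_weight (isThin_meeting _ _)), h0, mul_zero]

end Interaction

namespace TileKernel

variable {m : ℕ} (T : TileKernel d k m)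

/-- The laws of the heights in a tile after resampling. -/
theorem law_map_congr {X : Type*} [MeasurableSpace X] {f : HeightFn d k → X} (hf : Measurable f)
    {S : Set (Site d)} (hS : DependsOn f S) {Z Z' : Set (Site d)}
    (h : ∀ x ∈ S, tileIndex m x ∈ Z ↔ tileIndex m x ∈ Z')
    (M : Measure (HeightFn d k)) : (T.law Z M).map f = (T.law Z' M).map f := by
  rw [law, law, Measure.map_map hf (T.measurable_resample _),
    Measure.map_map hf (T.measurable_resample _)]
  congr 1
  ext1 p
  exact hS fun x hx => T.resample_congr_on (h x hx) p.1 p.2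

theorem law_map_frozen {X : Type*} [MeasurableSpace X] {f : HeightFn d k → X} (hf : Measurable f)
    {S : Set (Site d)} (hS : DependsOn f S) (h : ∀ x ∈ S, ∀ z, x ∉ T.region z)
    (Z : Set (Site d)) (M : Measure (HeightFn d k)) [SFinite M] : (T.law Z M).map f = M.map f := by
  conv_rhs => rw [← T.law_empty M]
  rw [law, law, Measure.map_map hf (T.measurable_resample _),
    Measure.map_map hf (T.measurable_resample _)]
  congr 1
  ext1 p
  refine hS fun x hx => ?_
  exact (T.resample_of_frozen (h x hx) _ _).trans (T.resample_of_frozen (h x hx) _ _).symm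

end TileKernel

/-- The lattice of the corners of the tiles. -/
def tileLattice (d m : ℕ) : AddSubgroup (Site d) where
  carrier := Set.range (corner m)
  add_mem' := by
    rintro _ _ ⟨z, rfl⟩ ⟨z', rfl⟩; exact ⟨z + z', corner_add m z z'⟩
  zero_mem' := ⟨0, by ext i; simp [corner]⟩
  neg_mem' := by
    rintro _ ⟨z, rfl⟩; exact ⟨-z, by ext i; simp [corner]⟩

theorem corner_mem_tileLattice (m : ℕ) (z : Site d) : corner m z ∈ tileLattice d m := ⟨z, rfl⟩

theorem TileKernel.isGradInvariant_law {m : ℕ} (T : TileKernel d k m) {L : AddSubgroup (Site d)}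
    (hmL : L.index ∣ m) {M : Measure (HeightFn d k)} [IsProbabilityMeasure M]
    (hM : IsGradInvariant L M) : IsGradInvariant (tileLattice d m) (T.law Set.univ M) := by
  rintro _ ⟨z, rfl⟩
  have hms : Measurable fun φ : HeightFn d k => recenter 0 (shift (corner m z) φ) :=
    (measurable_recenter 0).comp (measurable_shift _)
  refine Measure.ext_of_lintegral _ fun F hF => ?_
  rw [lintegral_map hF hms, lintegral_map hF (measurable_recenter 0)]
  exact T.law_map_shift hM (corner_mem hmL z) (F := fun φ => F (recenter 0 φ))
    (hF.comp (measurable_recenter 0)) fun φ c => congrArg F (isGrad_recenter 0 φ c)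

/-- A tile kernel that resamples with the weights of the interaction. -/
structure IsTileKernel {L : AddSubgroup (Site d)} {Φ : Potential d k} (I : Interaction L Φ) {m : ℕ}
    (T : TileKernel d k m) : Prop where
  dvd : L.index ∣ m
  collar : I.Collar T.V (box d m)
  weight_eq : T.w = weight Φ (meeting T.V (box d m))

namespace Interaction

variable {L : AddSubgroup (Site d)} {Φ : Potential d k} (I : Interaction L Φ)
include I

theorem exists_isTileKernel {m : ℕ} (hm : 0 < m) (hmL : L.index ∣ m) {V : Finset (Site d)}
    (h0 : 0 ∉ V) (hV : I.Collar V (box d m)) :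
    ∃ T : TileKernel d k m, T.V = V ∧ IsTileKernel I T := by
  obtain ⟨T, hTV, hTw⟩ := exists_tileKernel (k := k) hm hV.subset h0
    (I.measurable_weight (isThin_meeting V (box d m : Set (Site d)))) (I.isGrad_weight _)
    (I.dependsOn_weight fun Γ hΓ => hΓ.1)
  exact ⟨T, hTV, hmL, hTV.symm ▸ hV, by rw [hTw, hTV]⟩

end Interaction

namespace IsTileKernel

variable {L : AddSubgroup (Site d)} {Φ : Potential d k} {I : Interaction L Φ} {m : ℕ}
  {T : TileKernel d k m} (hT : IsTileKernel I T)
include hT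

theorem collar_region (z : Site d) : I.Collar (T.region z) (tile m z) :=
  hT.collar.translate I (corner_mem hT.dvd z)

theorem tileWeight_eq (z : Site d) :
    T.tileWeight z = weight Φ (meeting (T.region z) (tile m z)) := by
  ext φ
  rw [TileKernel.tileWeight, hT.weight_eq, ← I.weight_shift (corner_mem hT.dvd z)]
  congr 2
  ext x
  simp [tile, mem_translateSet]

theorem normalizable (hd : 0 < d) {φ : HeightFn d k} (hφ : φ ∈ I.Good) (z : Site d) :
    Normalizable (T.region z) (T.tileWeight z) φ := by
  rw [hT.tileWeight_eq]
  exact (hT.collar_region z).normalizable I hd hφ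

theorem law_insert (hd : 0 < d) {M : Measure (HeightFn d k)} [SFinite M]
    (hM : ∀ᵐ φ ∂M, φ ∈ I.Good) {Z : Set (Site d)} {z : Site d} (hz : z ∉ Z) :
    T.law (insert z Z) M = gibbs (T.region z) (T.measurable_tileWeight z) ∘ₘ T.law Z M :=
  T.law_insert hz M (by filter_upwards [hM] with φ hφ using hT.normalizable hd hφ z)

/-- Resampling preserves the local Lipschitz constraint. -/
theorem ae_law_lip (hd : 0 < d) {M : Measure (HeightFn d k)} [IsProbabilityMeasure M]
    (hM : ∀ᵐ φ ∂M, φ ∈ I.Good) : ∀ᵐ φ ∂(T.law Set.univ M), φ ∈ I.Lip := by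
  have hedge : ∀ x y, I.A.Adj x y →
      ∀ᵐ φ ∂(T.law Set.univ M), k.val (φ y - φ x) ≤ I.q x y := by
    intro x y hxy
    set p : HeightFn d k → Prop := fun φ => k.val (φ y - φ x) ≤ I.q x y with hp
    have hpm : MeasurableSet {φ | p φ} := measurableSet_le (k.measurable_val.comp
      ((measurable_pi_apply y).sub (measurable_pi_apply x))) measurable_const
    have hpm' : Measurable p := measurable_to_prop (by convert hpm using 1; ext; simp)
    have hdep : DependsOn p ({x, y} : Set (Site d)) := fun φ φ' h => by
      simp only [hp, h x (by simp), h y (by simp)]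
    have hto : ∀ N N' : Measure (HeightFn d k), N.map p = N'.map p → (∀ᵐ φ ∂N, p φ) →
        ∀ᵐ φ ∂N', p φ := by
      intro N N' h hN
      have h1 := (ae_map_iff (μ := N) (p := fun q : Prop => q) hpm'.aemeasurable (by trivial)).2 hN
      rw [h] at h1
      exact ae_of_ae_map hpm'.aemeasurable h1
    -- Either both ends of the edge are frozen, or one end lies in a region, and then the collar
    -- puts the whole edge into one tile. In the latter case only the resampling of that tile
    -- matters, and its Gibbs law does not charge violated edges.
    by_cases hfr : ∃ z, x ∈ T.region z ∨ y ∈ T.region z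
    · obtain ⟨z, hz⟩ := hfr
      have hcol := hT.collar_region z
      have hxt : x ∈ tile m z ∧ y ∈ tile m z := by
        rcases hz with h | h
        · exact ⟨hcol.subset h, hcol.closed x h y hxy⟩
        · exact ⟨hcol.closed y h x hxy.symm, hcol.subset h⟩
      have e : T.law (insert z ∅) M = gibbs (T.region z) (T.measurable_tileWeight z) ∘ₘ M := by
        rw [hT.law_insert hd hM (Set.notMem_empty z), T.law_empty]
      refine hto (T.law (insert z ∅) M) _ (T.law_map_congr hpm' hdep ?_ M) ?_
      · intro w hw
        have : w ∈ tile m z := by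
          rcases hw with rfl | hw
          · exact hxt.1
          · rw [Set.mem_singleton_iff.1 hw]; exact hxt.2
        rw [(tileIndex_eq_iff T.pos).2 this]; simp
      · rw [e, Measure.ae_comp_iff hpm]
        filter_upwards [hM] with φ hφ
        have hn := hT.normalizable hd hφ z
        filter_upwards [ae_gibbsLaw_ne_zero (T.measurable_tileWeight z) hn] with φ' hφ'
        rw [hT.tileWeight_eq, I.weight_ne_zero_iff] at hφ'
        exact hφ' x y hxy hxt.1 hxt.2 hz
    · push Not at hfr
      refine hto M _ (T.law_map_frozen hpm' hdep ?_ _ M).symm ?_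
      · rintro w (rfl | hw) z
        · exact (hfr z).1
        · rw [Set.mem_singleton_iff.1 hw]; exact (hfr z).2
      · filter_upwards [hM] with φ hφ using hφ.1 x y hxy
  have : ∀ᵐ φ ∂(T.law Set.univ M), ∀ x y, I.A.Adj x y → k.val (φ y - φ x) ≤ I.q x y := by
    rw [ae_all_iff]; intro x
    rw [ae_all_iff]; intro y
    by_cases hxy : I.A.Adj x y
    · filter_upwards [hedge x y hxy] with φ hφ _ using hφ
    · exact Eventually.of_forall fun φ h => absurd h hxy
  exact this

end IsTileKernel

end InteractionResampling

/-! ### The entropy gained by resampling -/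

section Gain

open ProbabilityTheory InformationTheory

/-- Resampling with a kernel that almost preserves the reference measure lowers the entropy. -/
theorem ent_resample_le {X : Type*} [MeasurableSpace X] [StandardBorelSpace X] [Nonempty X]
    {N ν : Measure X} [IsProbabilityMeasure N] [IsFiniteMeasure ν] {z : X → X} (hz : Measurable z)
    (R : Kernel X X) [IsMarkovKernel R] (hR : ∀ x, R (z x) = R x)
    (hRz : ∀ x, ∀ᵐ y ∂(R x), z y = z x) {c : ℝ}
    (h1 : ν ≤ ENNReal.ofReal (Real.exp c) • (R ∘ₘ ν))
    (h2 : (R ∘ₘ ν) ≤ ENNReal.ofReal (Real.exp c) • ν) (h : klDiv N ν ≠ ∞) :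
    klDiv N (R ∘ₘ N) ≠ ∞ ∧ klDiv (R ∘ₘ N) ν ≠ ∞ ∧
      ent (R ∘ₘ N) ν + (klDiv N (R ∘ₘ N)).toReal ≤ ent N ν + 2 * c := by
  have a1 := ent_mono_right h1 h
  have a2 := klDiv_resample (M := N) (ν := ν) hz R hR hRz
  have hzR : ∀ N : Measure X, (R ∘ₘ N).map z = N.map z := by
    intro N
    refine Measure.ext_of_lintegral _ fun f hf => ?_
    have hfz : Measurable fun x => f (z x) := hf.comp hz
    rw [lintegral_map hf hz, lintegral_map hf hz, Measure.lintegral_bind R.measurable.aemeasurable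
      hfz.aemeasurable]
    refine lintegral_congr fun x => ?_
    rw [lintegral_congr_ae (g := fun _ => f (z x)) (by filter_upwards [hRz x] with y hy; rw [hy])]
    simp
  -- The kernel is idempotent. Hence the chain rule for `R ∘ₘ N` has no conditional term, and the
  -- marginal term for `N` is the divergence of `R ∘ₘ N` from `R ∘ₘ ν`.
  have hRR : R ∘ₘ (R ∘ₘ N) = R ∘ₘ N := by
    refine Measure.ext_of_lintegral _ fun f hf => ?_
    rw [Measure.lintegral_bind R.measurable.aemeasurable hf.aemeasurable,
      Measure.lintegral_bind R.measurable.aemeasurable hf.lintegral_kernel.aemeasurable,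
      Measure.lintegral_bind R.measurable.aemeasurable hf.aemeasurable]
    refine lintegral_congr fun x => ?_
    rw [lintegral_congr_ae (g := fun _ => ∫⁻ y, f y ∂(R x))]
    · simp
    · filter_upwards [hRz x] with y hy
      rw [← hR y, hy, hR x]
  have a3 := klDiv_resample (M := R ∘ₘ N) (ν := ν) hz R hR hRz
  rw [hRR, klDiv_self, add_zero, hzR] at a3
  rw [← a3] at a2
  have b1 : klDiv (R ∘ₘ N) (R ∘ₘ ν) ≠ ∞ := fun h' => a1.1 (by rw [a2, h', top_add])
  have b2 : klDiv N (R ∘ₘ N) ≠ ∞ := fun h' => a1.1 (by rw [a2, h', add_top])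
  have c1 := toReal_klDiv_eq_ent a1.1
  have c2 := toReal_klDiv_eq_ent b1
  have c3 := congrArg ENNReal.toReal a2
  rw [ENNReal.toReal_add b1 b2] at c3
  -- The cost `c` is paid twice: in passing from `ν` to `R ∘ₘ ν`, and now on the way back.
  have c4 := ent_mono_right h2 b1
  exact ⟨b2, c4.1, by linarith [a1.2, c4.2]⟩

variable {d : ℕ} {k : HeightKind}

/-- Gibbs laws commute with localization. -/
theorem gibbsLaw_map_localize {V S : Finset (Site d)} (hVS : V ⊆ S) {o : Site d}
    (hoV : o ∉ V) {w : HeightFn d k → ℝ≥0∞} (hw : Measurable w) (hg : IsGrad w)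
    (hdep : DependsOn w (S : Set (Site d))) {φ : HeightFn d k} (h : Normalizable V w φ) :
    (gibbsLaw V w φ).map (localize S o) = gibbsLaw V w (localize S o φ) := by
  have star : ∀ H : HeightFn d k → ℝ≥0∞,
      refInt V (fun χ => H (localize S o χ)) φ = refInt V H (localize S o φ) := by
    intro H
    unfold refInt
    rw [← lintegral_add_left_eq_self (fun η => H (localize S o (patch V φ η))) (fun _ : V => φ o)]
    refine lintegral_congr fun η => ?_
    refine congrArg H (funext fun x => ?_)
    by_cases hxV : x ∈ V
    · rw [localize_of_mem (hVS hxV), patch_of_mem _ _ hxV, patch_of_mem _ _ hxV,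
        patch_of_notMem _ _ hoV]
      simp
    · rw [patch_of_notMem _ _ hxV]
      by_cases hx : x ∈ S
      · rw [localize_of_mem hx, localize_of_mem hx, patch_of_notMem _ _ hxV,
          patch_of_notMem _ _ hoV]
      · rw [localize_of_notMem hx, localize_of_notMem hx]
  have hwl : ∀ χ, w χ = w (localize S o χ) := fun χ => (hg.eq_localize hdep o χ).symm
  have hn : Normalizable V w (localize S o φ) := by
    rw [Normalizable, ← star]
    simp_rw [← hwl]
    exact h
  refine Measure.ext_of_lintegral _ fun F hF => ?_
  have hF' : Measurable fun χ => F (localize S o χ) := hF.comp (measurable_localize S o)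
  rw [lintegral_map hF (measurable_localize S o), lintegral_gibbsLaw hw hF' h,
    lintegral_gibbsLaw hw hF hn, ← star, ← star]
  simp_rw [← hwl]

theorem gibbs_comp_blockLaw {V S : Finset (Site d)} (hVS : V ⊆ S) {o : Site d}
    (hoV : o ∉ V) {w : HeightFn d k → ℝ≥0∞} (hw : Measurable w) (hg : IsGrad w)
    (hdep : DependsOn w (S : Set (Site d))) {M : Measure (HeightFn d k)}
    (h : ∀ᵐ φ ∂M, Normalizable V w φ) :
    gibbs V hw ∘ₘ blockLaw S o M = blockLaw S o (gibbs V hw ∘ₘ M) := by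
  have hl := measurable_localize (k := k) S o
  refine Measure.ext_of_lintegral _ fun F hF => ?_
  have hF' : Measurable fun χ => F (localize S o χ) := hF.comp hl
  rw [blockLaw, blockLaw, lintegral_map hF hl, Measure.lintegral_bind
    (Kernel.measurable _).aemeasurable hF.aemeasurable, lintegral_map hF.lintegral_kernel hl,
    Measure.lintegral_bind (Kernel.measurable _).aemeasurable hF'.aemeasurable]
  refine lintegral_congr_ae ?_
  filter_upwards [h] with φ hφ
  rw [gibbs_apply, gibbs_apply, ← gibbsLaw_map_localize hVS hoV hw hg hdep hφ,
    lintegral_map hF hl]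

namespace Interaction

variable {L : AddSubgroup (Site d)} {Φ : Potential d k} (I : Interaction L Φ)
include I

/-- Reference measures with weaker constraints: the Lipschitz bound is imposed on `F` only. -/
theorem isFiniteMeasure_partial {C : ℝ} {S F : Finset (Site d)} {o : Site d} (ho : o ∈ F)
    (h : ∀ x ∈ S, x ∉ F → ∃ y ∈ F, ∃ a : ℝ, ∀ φ : HeightFn d k, I.EdgeLip S S φ →
      |k.val (φ x - φ y)| ≤ a) :
    IsFiniteMeasure ((refMeasure (S.erase o) 0).withDensity
      ((lipOn C F).indicator (weight Φ (meeting S S)))) := by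
  have hwm := I.measurable_weight (isThin_meeting S (S : Set (Site d)))
  have hum : Measurable ((lipOn (k := k) C F).indicator (weight Φ (meeting S S))) :=
    hwm.indicator (measurableSet_lipOn C F)
  -- A height is controlled either by the Lipschitz bound on `F`, or by a path of constrained edges
  -- that ends in `F`.
  have hb : ∀ x : Site d, ∃ a : ℝ, x ∈ S → ∀ φ : HeightFn d k, I.EdgeLip S S φ → φ ∈ lipOn C F →
      |k.val (φ x - φ o)| ≤ a := by
    intro x
    by_cases hx : x ∈ S
    · by_cases hxF : x ∈ F
      · exact ⟨C * dist1 o x, fun _ φ _ hφ => hφ o ho x hxF⟩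
      · obtain ⟨y, hy, a, ha⟩ := h x hx hxF
        refine ⟨a + C * dist1 o y, fun _ φ he hφ => ?_⟩
        have h1 := ha φ he
        have h2 := hφ o ho y hy
        have e : φ x - φ o = (φ x - φ y) + (φ y - φ o) := by abel
        rw [e, k.val_add]
        exact (abs_add_le _ _).trans (add_le_add h1 h2)
    · exact ⟨0, fun h => absurd h hx⟩
  choose a ha using hb
  set B : Set (HeightFn d k) := {φ | ∀ x ∈ S.erase o, |k.val (φ x - 0)| ≤ a x} with hB
  have hBm : MeasurableSet B := by
    have : B = ⋂ (x : Site d) (_ : x ∈ S.erase o), {φ | |k.val (φ x - 0)| ≤ a x} := by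
      ext; simp [hB]
    rw [this]
    refine MeasurableSet.iInter fun x => MeasurableSet.iInter fun _ => ?_
    exact measurableSet_le (k.measurable_val.comp
      ((measurable_pi_apply x).sub measurable_const)).abs measurable_const
  refine ⟨?_⟩
  rw [withDensity_apply _ MeasurableSet.univ, Measure.restrict_univ, lintegral_refMeasure _ _ hum]
  calc refInt (S.erase o) ((lipOn C F).indicator (weight Φ (meeting S S))) 0
      ≤ refInt (S.erase o) (fun φ => ENNReal.ofReal (Real.exp (I.weakBound S)) *
          B.indicator 1 φ) 0 := by
        refine refInt_mono fun φ hφ => ?_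
        by_cases hl : φ ∈ lipOn C F
        · rw [Set.indicator_of_mem hl]
          by_cases hw : weight Φ (meeting S S) φ = 0
          · rw [hw]; exact zero_le
          · have he := (I.weight_ne_zero_iff _ _ _).1 hw
            have hb : φ ∈ B := fun x hx => by
              have := ha x (Finset.mem_of_mem_erase hx) φ he hl
              rwa [hφ o (Finset.notMem_erase _ _)] at this
            rw [Set.indicator_of_mem hb, Pi.one_apply, mul_one]
            exact I.weight_le (isThin_meeting _ _) (I.weakBound_nonneg S)
              (I.weakAbs_le_of_meets (fun _ h => h.2) φ)
        · rw [Set.indicator_of_notMem hl]; exact zero_le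
    _ = ENNReal.ofReal (Real.exp (I.weakBound S)) * refInt (S.erase o) (B.indicator 1) 0 :=
        refInt_const_mul (measurable_one.indicator hBm) _ _
    _ < ∞ := ENNReal.mul_lt_top ENNReal.ofReal_lt_top
        (refInt_indicator_bounded_lt_top _ (fun _ => 0) a 0)

/-- Resampling the heights in `V` almost preserves the reference measure of a block. -/
theorem gibbs_comp_partial (hd : 0 < d) {C : ℝ} {S F V W : Finset (Site d)} {o : Site d}
    (hVW : I.Collar V W) (hWS : W ⊆ S) (hoV : o ∉ V) (hFV : Disjoint F V)
    {w : HeightFn d k → ℝ≥0∞} (hw : Measurable w) (hwe : w = weight Φ (meeting V W))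
    {ν : Measure (HeightFn d k)} (hν : ν = (refMeasure (S.erase o) 0).withDensity
      ((lipOn C F).indicator (weight Φ (meeting S S)))) :
    ν ≤ ENNReal.ofReal (Real.exp (2 * I.extBound W)) • (gibbs V hw ∘ₘ ν) ∧
      (gibbs V hw ∘ₘ ν) ≤ ENNReal.ofReal (Real.exp (2 * I.extBound W)) • ν := by
  have hVS : V ⊆ S := hVW.subset.trans hWS
  have hVe : V ⊆ S.erase o := fun x hx => Finset.mem_erase.2 ⟨fun h => hoV (h ▸ hx), hVS hx⟩
  set rest : Set (Finset (Site d)) := meeting S S \ meeting V S with hrest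
  have hmeet : meeting S (S : Set (Site d)) = rest ∪ meeting V S := by
    rw [hrest, Set.sdiff_union_of_subset]
    rintro Γ ⟨hs, x, hx, hxV⟩
    exact ⟨hs, x, hx, hVS hxV⟩
  have hthin := isThin_meeting S (S : Set (Site d))
  have hthr : IsThin rest := hthin.mono Set.sdiff_subset
  have hrm := I.measurable_weight hthr
  have hwS := I.measurable_weight (isThin_meeting V (S : Set (Site d)))
  -- The factor `u` collects the cut-off on `F`, which is disjoint from `V`, and the energies of the
  -- sets that avoid `V`. It does not see the heights on `V`, so the conditional density there is
  -- proportional to the weight of the sets that meet `V`.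
  set u : HeightFn d k → ℝ≥0∞ := (lipOn C F).indicator (weight Φ rest) with hu
  have hum : Measurable u := hrm.indicator (measurableSet_lipOn C F)
  have hfac : ∀ φ, (lipOn C F).indicator (weight Φ (meeting S S)) φ =
      u φ * weight Φ (meeting V S) φ := by
    intro φ
    by_cases hφ : φ ∈ lipOn C F
    · rw [hu, Set.indicator_of_mem hφ, Set.indicator_of_mem hφ, hmeet,
        I.weight_union Set.disjoint_sdiff_left (hmeet ▸ hthin)]
    · rw [hu, Set.indicator_of_notMem hφ, Set.indicator_of_notMem hφ, zero_mul]
  have hoff : ∀ φ φ' : HeightFn d k, (∀ x ∉ V, φ x = φ' x) → u φ = u φ' := by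
    intro φ φ' h
    have hl : φ ∈ lipOn C F ↔ φ' ∈ lipOn C F :=
      mem_lipOn_congr fun x hx => h x (Finset.disjoint_left.1 hFV hx)
    have hwt : weight Φ rest φ = weight Φ rest φ' := by
      refine I.weight_congr fun Γ hΓ => ?_
      have hn : ∀ x ∈ Γ, x ∉ V := fun x hx hxV => hΓ.2 ⟨hΓ.1.1, x, hx, hxV⟩
      intro x hx y hy
      rw [h x (hn x hx), h y (hn y hy)]
    by_cases hφ : φ ∈ lipOn C F
    · rw [hu, Set.indicator_of_mem hφ, Set.indicator_of_mem (hl.1 hφ), hwt]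
    · rw [hu, Set.indicator_of_notMem hφ, Set.indicator_of_notMem fun h' => hφ (hl.2 h')]
  refine gibbs_comp_compare hwS hw
    (α := (refMeasure (S.erase o \ V) 0).withDensity u) ?_ (fun φ => ?_) (fun φ => ?_) (fun φ => ?_)
  · intro f hf
    have hm : Measurable (refInt V fun φ' => weight Φ (meeting V S) φ' * f φ') :=
      (hwS.mul hf).refInt
    have hwum : Measurable ((lipOn (k := k) C F).indicator (weight Φ (meeting S S))) :=
      (I.measurable_weight hthin).indicator (measurableSet_lipOn C F)
    have hum' : Measurable fun φ => ((lipOn (k := k) C F).indicator (weight Φ (meeting S S)) * f) φ :=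
      hwum.mul hf
    rw [hν, lintegral_withDensity_eq_lintegral_mul _ hwum hf, lintegral_refMeasure _ _ hum',
      lintegral_withDensity_eq_lintegral_mul _ hum hm, lintegral_refMeasure _ _ (hum.mul hm)]
    have hun := refInt_union (S := S.erase o \ V) (T := V) hum' Finset.sdiff_disjoint
    rw [Finset.sdiff_union_of_subset hVe] at hun
    rw [hun]
    refine refInt_congr_fun fun φ _ => ?_
    simp only [Pi.mul_apply]
    rw [← refInt_mul_left (f := u) (g := fun φ' => weight Φ (meeting V S) φ' * f φ') (hwS.mul hf)
      fun φ'' h'' => hoff _ _ h'']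
    refine refInt_congr_fun fun φ'' _ => ?_
    rw [hfac, mul_assoc]
  · rw [hwe]; exact (hVW.weight_compare I (Finset.coe_subset.2 hWS) φ).1
  · rw [hwe]; exact (hVW.weight_compare I (Finset.coe_subset.2 hWS) φ).2
  · rw [hwe]; exact hVW.refInt_weight_lt_top I hd subset_rfl φ

end Interaction

namespace IsTileKernel

variable {L : AddSubgroup (Site d)} {Φ : Potential d k} {I : Interaction L Φ} {m : ℕ}
  {T : TileKernel d k m} (hT : IsTileKernel I T)
include hT

theorem extBound_tile (z : Site d) : I.extBound (tile m z) = I.extBound (box d m) :=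
  I.extBound_translate (corner_mem hT.dvd z) _

/-- The entropy gained by resampling a single tile. -/
theorem klDiv_single_tile {M : Measure (HeightFn d k)}
    [IsProbabilityMeasure M] (hinv : IsGradInvariant L M) {Z : Set (Site d)} {z : Site d} (hz : z ∉ Z)
    {S : Finset (Site d)} (hzS : tile m z ⊆ S) (o : Site d) :
    klDiv (blockLaw (box d m) 0 M) (blockLaw (box d m) 0 (T.law Set.univ M)) ≤
      klDiv (blockLaw S o (T.law Z M)) (blockLaw S o (T.law (insert z Z) M)) := by
  have hg : ∀ (N : Measure (HeightFn d k)),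
      (blockLaw S o N).map (fun φ => shift (corner m z) (localize (tile m z) (corner m z) φ)) =
        (blockLaw (tile m z) (corner m z) N).map (shift (corner m z)) := by
    intro N
    rw [← blockLaw_map_localize hzS (o := corner m z) (o' := o) (hzS (corner_mem_tile T.pos z)) N,
      Measure.map_map (measurable_shift _)
      (measurable_localize _ _)]
    rfl
  have hm : Measurable fun φ : HeightFn d k =>
      shift (corner m z) (localize (tile m z) (corner m z) φ) :=
    (measurable_shift _).comp (measurable_localize _ _)
  have hdep : DependsOn (localize (k := k) (tile m z) (corner m z)) (tile m z : Set (Site d)) :=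
    fun φ φ' h => localize_congr (corner_mem_tile T.pos z) h
  have hidx : ∀ x ∈ (tile m z : Set (Site d)), tileIndex m x = z := fun x hx =>
    (tileIndex_eq_iff T.pos).2 hx
  -- Seen from within tile `z`, resampling `Z` does nothing and resampling `insert z Z` is the same
  -- as resampling every tile. So the divergence seen in each tile is, after a shift, the same
  -- number.
  have e1 : blockLaw (tile m z) (corner m z) (T.law Z M) = blockLaw (tile m z) (corner m z) M := by
    conv_rhs => rw [← T.law_empty M]
    exact T.law_map_congr (measurable_localize _ _) hdep
      (fun x hx => by rw [hidx x hx]; simp [hz]) M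
  have e2 : blockLaw (tile m z) (corner m z) (T.law (insert z Z) M) =
      blockLaw (tile m z) (corner m z) (T.law Set.univ M) :=
    T.law_map_congr (measurable_localize _ _) hdep (fun x hx => by rw [hidx x hx]; simp) M
  have h0 : corner m z = 0 + corner m z := (zero_add _).symm
  have f1 := hinv.blockLaw_shift (corner_mem hT.dvd z) (box d m) 0
  have f2 := (T.isGradInvariant_law hT.dvd hinv).blockLaw_shift (corner_mem_tileLattice m z)
    (box d m) 0
  rw [zero_add] at f1 f2
  have h := klDiv_map_le (μ := blockLaw S o (T.law Z M)) (ν := blockLaw S o (T.law (insert z Z) M)) hm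
  rw [hg, hg, e1, e2] at h
  change klDiv ((blockLaw (translateSet (corner m z) (box d m)) (corner m z) M).map _)
    ((blockLaw (translateSet (corner m z) (box d m)) (corner m z) (T.law Set.univ M)).map _) ≤ _ at h
  rwa [f1, f2] at h

/-- The entropy gained by resampling all tiles in a box. -/
theorem blockEnt_law_le (hd : 0 < d) {C : ℝ}
    (hC : ∀ φ ∈ I.Lip (k := k), ∀ x y, |k.val (φ y - φ x)| ≤ C * dist1 x y)
    {M : Measure (HeightFn d k)} [IsProbabilityMeasure M] (hinv : IsGradInvariant L M)
    (hM : ∀ᵐ φ ∂M, φ ∈ I.Good) {n : ℕ} (hn : 0 < n) (hfin : FiniteEnt Φ C (box d (m * n)) 0 M) :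
    klDiv (blockLaw (box d m) 0 M) (blockLaw (box d m) 0 (T.law Set.univ M)) ≠ ∞ ∧
      FiniteEnt Φ C (box d (m * n)) 0 (T.law Set.univ M) ∧
      blockEnt Φ C (box d (m * n)) 0 (T.law Set.univ M) ≤ blockEnt Φ C (box d (m * n)) 0 M +
        (n : ℝ) ^ d * (4 * I.extBound (box d m) -
          (klDiv (blockLaw (box d m) 0 M) (blockLaw (box d m) 0 (T.law Set.univ M))).toReal) := by
  set S := box d (m * n) with hS
  have hmn : 0 < m * n := Nat.mul_pos T.pos hn
  have h0S : (0 : Site d) ∈ S := zero_mem_box hmn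
  set F : Finset (Site d) := S.filter fun x => ∀ z ∈ box d n, x ∉ T.region z with hF
  have htile : ∀ z ∈ box d n, tile m z ⊆ S := fun z hz => by
    rw [hS, ← biUnion_tile_box T.pos]
    exact Finset.subset_biUnion_of_mem (tile m) hz
  have h0r : ∀ z, (0 : Site d) ∉ T.region z := fun z => by
    have := T.corner_notMem_region 0 z
    rwa [corner_zero] at this
  have h0F : (0 : Site d) ∈ F := Finset.mem_filter.2 ⟨h0S, fun z _ => h0r z⟩
  have hsep : ∀ z z' x, x ∈ T.region z → x ∈ tile m z' → z = z' := fun z z' x h1 h2 => by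
    rw [← (tileIndex_eq_iff T.pos).2 (T.region_subset z h1), (tileIndex_eq_iff T.pos).2 h2]
  -- The Lipschitz cut-off is imposed only on the frozen vertices. A cut-off on all of `S` would
  -- change the conditional density inside the tiles, and resampling would not almost preserve the
  -- reference measure.
  set ν := (refMeasure (k := k) (S.erase 0) 0).withDensity
    ((lipOn C F).indicator (weight Φ (meeting S S))) with hν
  have hνfin : IsFiniteMeasure ν := by
    refine I.isFiniteMeasure_partial h0F fun x hx hxF => ?_
    have : ∃ z ∈ box d n, x ∈ T.region z := by
      by_contra! hcon
      exact hxF (Finset.mem_filter.2 ⟨hx, hcon⟩)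
    obtain ⟨z, hz, hxz⟩ := this
    have hcol := hT.collar_region z
    obtain ⟨y, hy, ⟨u, hu, huy⟩, a, ha⟩ := I.exists_exit hd (T.region z) hxz
    have hyt := hcol.closed u hu y huy
    refine ⟨y, Finset.mem_filter.2 ⟨htile z hz hyt, fun z' _ hyz' => ?_⟩, a, fun φ hφ => ha φ ?_⟩
    · exact hy ((hsep z' z y hyz' hyt) ▸ hyz')
    · intro u hu v huv
      have hus := htile z hz (hcol.subset hu)
      have hvs := htile z hz (hcol.closed u hu v huv)
      exact ⟨hφ u v huv hus hvs (Or.inl hus), hφ v u huv.symm hvs hus (Or.inl hvs)⟩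
  set g := klDiv (blockLaw (box d m) 0 M) (blockLaw (box d m) 0 (T.law Set.univ M)) with hg
  have hrestr : blockRef Φ C S 0 = ν.restrict (lipOn C S) := by
    have hlm := measurableSet_lipOn (k := k) C S
    rw [hν, restrict_withDensity hlm, ← withDensity_indicator hlm, Set.indicator_indicator,
      Set.inter_eq_left.2 (lipOn_mono (Finset.filter_subset _ _))]
    rfl
  -- resampling the tiles one by one
  have key : ∀ Z : Finset (Site d), Z ⊆ box d n → klDiv (blockLaw S 0 M) ν ≠ ∞ →
      klDiv (blockLaw S 0 (T.law Z M)) ν ≠ ∞ ∧ ent (blockLaw S 0 (T.law Z M)) ν ≤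
        ent (blockLaw S 0 M) ν + Z.card * (4 * I.extBound (box d m) - g.toReal) ∧
        (Z.Nonempty → g ≠ ∞) := by
    intro Z
    induction Z using Finset.induction_on with
    | empty => intro _ h; simpa [T.law_empty] using h
    | insert z Z hz ih =>
      intro hsub h
      have hzb := hsub (Finset.mem_insert_self z Z)
      obtain ⟨i1, i2, -⟩ := ih ((Finset.subset_insert z Z).trans hsub) h
      have hzZ : z ∉ (Z : Set (Site d)) := hz
      rw [Finset.coe_insert]
      have hcol := hT.collar_region z
      have hVS : T.region z ⊆ S := hcol.subset.trans (htile z hzb)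
      have hdepw : DependsOn (T.tileWeight z) (S : Set (Site d)) := fun φ φ' h =>
        T.dependsOn_tileWeight z fun x hx => h x (htile z hzb hx)
      have hnorm : ∀ᵐ φ ∂(T.law (Z : Set (Site d)) M),
          Normalizable (T.region z) (T.tileWeight z) φ := by
        rw [TileKernel.law, ae_map_iff (T.measurable_resample _).aemeasurable
          (measurableSet_normalizable _ (T.measurable_tileWeight z))]
        have h1 : ∀ᵐ p ∂(M.prod (uniforms d)), p.1 ∈ I.Good := Measure.quasiMeasurePreserving_fst.ae hM
        filter_upwards [h1] with p hp
        exact T.ae_normalizable_resample hzZ (hT.normalizable hd hp z) p.2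
      have e1 : blockLaw S 0 (T.law (insert z (Z : Set (Site d))) M) =
          gibbs (T.region z) (T.measurable_tileWeight z) ∘ₘ blockLaw S 0 (T.law Z M) := by
        rw [hT.law_insert hd hM hzZ]
        exact (gibbs_comp_blockLaw hVS (h0r z) (T.measurable_tileWeight z)
          (T.isGrad_tileWeight z) hdepw hnorm).symm
      have hFV : Disjoint F (T.region z) :=
        Finset.disjoint_left.2 fun x hx => (Finset.mem_filter.1 hx).2 z hzb
      have hcmp := I.gibbs_comp_partial hd (C := C) (ν := ν) hcol (htile z hzb) (h0r z) hFV
        (T.measurable_tileWeight z) (hT.tileWeight_eq z) hν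
      rw [hT.extBound_tile] at hcmp
      -- The reference measure changes by a factor `exp (2 * I.extBound (box d m))` in either
      -- direction, which accounts for the `4` in the loss per tile.
      have hres := ent_resample_le (N := blockLaw S 0 (T.law Z M)) (ν := ν)
        (measurable_clear (T.region z)) (gibbs (T.region z) (T.measurable_tileWeight z))
        (fun φ => gibbsLaw_congr fun x hx => clear_of_notMem _ hx)
        (fun φ => by
          filter_upwards [ae_gibbsLaw_eq_off (T.region z) (T.tileWeight z) φ] with φ' h'
          exact clear_congr h') hcmp.1 hcmp.2 i1
      rw [← e1] at hres
      have hgle := hT.klDiv_single_tile hinv hzZ (htile z hzb) 0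
      rw [← hg] at hgle
      have hgr := ENNReal.toReal_mono hres.1 hgle
      refine ⟨hres.2.1, ?_, fun _ => ne_top_of_le_ne_top hres.1 hgle⟩
      rw [Finset.card_insert_of_notMem hz]
      push_cast
      linarith [hres.2.2]
  have hlipM : ∀ᵐ φ ∂(blockLaw S 0 M), φ ∈ lipOn C S := by
    rw [ae_blockLaw (fun φ c => add_const_mem_lipOn C S φ c)
      (fun φ φ' h => propext (mem_lipOn_congr h)) (measurableSet_lipOn C S)]
    filter_upwards [hM] with φ hφ x _ y _ using hC φ hφ.1 x y
  have hlipL : ∀ᵐ φ ∂(blockLaw S 0 (T.law Set.univ M)), φ ∈ lipOn C S := by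
    rw [ae_blockLaw (fun φ c => add_const_mem_lipOn C S φ c)
      (fun φ φ' h => propext (mem_lipOn_congr h)) (measurableSet_lipOn C S)]
    filter_upwards [hT.ae_law_lip hd hM] with φ hφ x _ y _ using hC φ hφ x y
  have hlm := measurableSet_lipOn (k := k) C S
  -- Both the original and the resampled law satisfy the full Lipschitz bound, so that `ν` may be
  -- exchanged for its restriction `blockRef`.
  have hM0 : klDiv (blockLaw S 0 M) ν ≠ ∞ := by
    rw [← klDiv_restrict_ne_top_iff hlm hlipM, ← hrestr]; exact hfin
  obtain ⟨k1, k2, k3⟩ := key (box d n) subset_rfl hM0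
  have eu : blockLaw S 0 (T.law (box d n : Set (Site d)) M) = blockLaw S 0 (T.law Set.univ M) := by
    refine T.law_map_congr (S := S) (measurable_localize _ _)
      (fun φ φ' h => localize_congr h0S h) (fun x hx => ?_) M
    rw [Finset.mem_coe, hS, ← biUnion_tile_box T.pos, Finset.mem_biUnion] at hx
    obtain ⟨z, hz, hxz⟩ := hx
    rw [(tileIndex_eq_iff T.pos).2 hxz]
    simp [hz]
  rw [eu] at k1 k2
  have hac1 : blockLaw S 0 M ≪ ν := (klDiv_ne_top_iff.1 hM0).1
  have hac2 : blockLaw S 0 (T.law Set.univ M) ≪ ν := (klDiv_ne_top_iff.1 k1).1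
  refine ⟨k3 ⟨0, zero_mem_box hn⟩, ?_, ?_⟩
  · rw [FiniteEnt, hrestr, klDiv_restrict_ne_top_iff hlm hlipL]; exact k1
  · rw [blockEnt, blockEnt, hrestr, ent_restrict hlm hlipL hac2, ent_restrict hlm hlipM hac1]
    rw [card_box] at k2
    push_cast at k2
    exact k2

end IsTileKernel

end Gain

/-! ### Averages over shifts -/

section Average

open ProbabilityTheory InformationTheory

variable {d : ℕ} {k : HeightKind}

open Classical in
/-- The lattice points in a box. -/
noncomputable def latticeBox (L : AddSubgroup (Site d)) (m : ℕ) : Finset (Site d) :=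
  (box d m).filter fun v => v ∈ L

theorem mem_latticeBox {L : AddSubgroup (Site d)} {m : ℕ} {v : Site d} :
    v ∈ latticeBox L m ↔ v ∈ box d m ∧ v ∈ L := by
  classical
  exact Finset.mem_filter

theorem zero_mem_latticeBox (L : AddSubgroup (Site d)) {m : ℕ} (hm : 0 < m) :
    (0 : Site d) ∈ latticeBox L m := mem_latticeBox.2 ⟨zero_mem_box hm, L.zero_mem⟩

/-- The average of the shifts of `N` over the lattice points in a box. -/
noncomputable def shiftAverage (L : AddSubgroup (Site d)) (m : ℕ) (N : Measure (HeightFn d k)) :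
    Measure (HeightFn d k) :=
  ((latticeBox L m).card : ℝ≥0∞)⁻¹ • ∑ v ∈ latticeBox L m, N.map (shift v)

theorem card_latticeBox_ne_zero (L : AddSubgroup (Site d)) {m : ℕ} (hm : 0 < m) :
    (latticeBox L m).card ≠ 0 := Finset.card_ne_zero.2 ⟨0, zero_mem_latticeBox L hm⟩

theorem isProbabilityMeasure_shiftAverage (L : AddSubgroup (Site d)) {m : ℕ} (hm : 0 < m)
    (N : Measure (HeightFn d k)) [IsProbabilityMeasure N] :
    IsProbabilityMeasure (shiftAverage L m N) := by
  refine ⟨?_⟩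
  have h : ∀ v ∈ latticeBox L m, (N.map (shift v)) Set.univ = 1 := fun v _ => by
    rw [Measure.map_apply (measurable_shift v) MeasurableSet.univ]; simp
  rw [shiftAverage, Measure.smul_apply, Measure.finsetSum_apply, Finset.sum_congr rfl h,
    Finset.sum_const, nsmul_eq_mul, mul_one, smul_eq_mul]
  exact ENNReal.inv_mul_cancel (by exact_mod_cast card_latticeBox_ne_zero L hm)
    (ENNReal.natCast_ne_top _)

theorem lintegral_shiftAverage (L : AddSubgroup (Site d)) (m : ℕ) (N : Measure (HeightFn d k))
    {f : HeightFn d k → ℝ≥0∞} (hf : Measurable f) :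
    ∫⁻ φ, f φ ∂(shiftAverage L m N) = ((latticeBox L m).card : ℝ≥0∞)⁻¹ *
      ∑ v ∈ latticeBox L m, ∫⁻ φ, f (shift v φ) ∂N := by
  rw [shiftAverage, lintegral_smul_measure, lintegral_finsetSum_measure, smul_eq_mul]
  simp_rw [lintegral_map hf (measurable_shift _)]

theorem ae_shiftAverage {L : AddSubgroup (Site d)} {m : ℕ} {N : Measure (HeightFn d k)}
    {p : HeightFn d k → Prop} (hp : MeasurableSet {φ | p φ})
    (h : ∀ v ∈ L, ∀ᵐ φ ∂N, p (shift v φ)) : ∀ᵐ φ ∂(shiftAverage L m N), p φ := by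
  refine Measure.ae_smul_measure ?_ _
  rw [ae_iff, Measure.finsetSum_apply]
  refine Finset.sum_eq_zero fun v hv => ?_
  rw [← ae_iff, ae_map_iff (measurable_shift v).aemeasurable hp]
  exact h v (mem_latticeBox.1 hv).2

/-- The representative in a box modulo the lattice of the corners. -/
def boxRep (m : ℕ) (x : Site d) : Site d := fun i => x i % m

theorem boxRep_add_corner (m : ℕ) (x : Site d) : boxRep m x + corner m (tileIndex m x) = x := by
  ext i
  exact Int.emod_add_mul_ediv (x i) m

theorem boxRep_mem_box {m : ℕ} (hm : 0 < m) (x : Site d) : boxRep m x ∈ box d m :=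
  mem_box.2 fun i => ⟨Int.emod_nonneg _ (by exact_mod_cast hm.ne'),
    Int.emod_lt_of_pos _ (by exact_mod_cast hm)⟩

theorem boxRep_mem {L : AddSubgroup (Site d)} {m : ℕ} (hmL : L.index ∣ m) {x : Site d}
    (hx : x ∈ L) : boxRep m x ∈ L := by
  rw [eq_sub_of_add_eq (boxRep_add_corner m x)]
  exact L.sub_mem hx (corner_mem hmL _)

theorem IsGradInvariant.lintegral_shift {L : AddSubgroup (Site d)} {M : Measure (HeightFn d k)}
    (hM : IsGradInvariant L M) {v : Site d} (hv : v ∈ L) {F : HeightFn d k → ℝ≥0∞}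
    (hF : Measurable F) (hg : IsGrad F) : ∫⁻ φ, F (shift v φ) ∂M = ∫⁻ φ, F φ ∂M := by
  have hms : Measurable fun φ : HeightFn d k => recenter 0 (shift v φ) :=
    (measurable_recenter 0).comp (measurable_shift _)
  have h := congrArg (fun ρ => ∫⁻ φ, F φ ∂ρ) (hM v hv)
  simpa only [lintegral_map hF hms, lintegral_map hF (measurable_recenter 0), hg.recenter] using h

theorem IsGradInvariant.integral_shift {L : AddSubgroup (Site d)} {M : Measure (HeightFn d k)}
    (hM : IsGradInvariant L M) {v : Site d} (hv : v ∈ L) {F : HeightFn d k → ℝ}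
    (hF : Measurable F) (hg : IsGrad F) : ∫ φ, F (shift v φ) ∂M = ∫ φ, F φ ∂M := by
  have hms : Measurable fun φ : HeightFn d k => recenter 0 (shift v φ) :=
    (measurable_recenter 0).comp (measurable_shift _)
  have h := congrArg (fun ρ => ∫ φ, F φ ∂ρ) (hM v hv)
  simpa only [integral_map hms.aemeasurable hF.aestronglyMeasurable,
    integral_map (measurable_recenter 0).aemeasurable hF.aestronglyMeasurable, hg.recenter] using h

/-- Since the index divides `m`, the points of `L` in the box represent `L` modulo the lattice of
the corners. A shift by an element of `L` permutes these classes, and `N` does not see the choice of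
representatives. -/
theorem isGradInvariant_shiftAverage {L : AddSubgroup (Site d)} {m : ℕ} (hm : 0 < m)
    (hmL : L.index ∣ m) {N : Measure (HeightFn d k)} (hN : IsGradInvariant (tileLattice d m) N) :
    IsGradInvariant L (shiftAverage L m N) := by
  intro u hu
  have hms : Measurable fun φ : HeightFn d k => recenter 0 (shift u φ) :=
    (measurable_recenter 0).comp (measurable_shift _)
  refine Measure.ext_of_lintegral _ fun F hF => ?_
  have hF1 : Measurable fun φ : HeightFn d k => F (recenter 0 φ) := hF.comp (measurable_recenter 0)
  have hF2 : Measurable fun φ : HeightFn d k => F (recenter 0 (shift u φ)) := hF.comp hms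
  rw [lintegral_map hF hms, lintegral_map hF (measurable_recenter 0),
    lintegral_shiftAverage L m N hF2, lintegral_shiftAverage L m N hF1]
  congr 1
  -- The permutation sends `v` to the representative of `u + v`; the difference is a corner, and it
  -- is absorbed by the invariance of `N`.
  refine Finset.sum_nbij' (fun v => boxRep m (u + v)) (fun v => boxRep m (v - u)) ?_ ?_ ?_ ?_ ?_
  · exact fun v hv => mem_latticeBox.2 ⟨boxRep_mem_box hm _,
      boxRep_mem hmL (L.add_mem hu (mem_latticeBox.1 hv).2)⟩
  · exact fun v hv => mem_latticeBox.2 ⟨boxRep_mem_box hm _,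
      boxRep_mem hmL (L.sub_mem (mem_latticeBox.1 hv).2 hu)⟩
  · intro v hv
    ext i
    have := mem_box.1 (mem_latticeBox.1 hv).1 i
    simp only [boxRep, Pi.sub_apply, Pi.add_apply, Int.emod_sub_emod, add_sub_cancel_left]
    exact Int.emod_eq_of_lt this.1 this.2
  · intro v hv
    ext i
    have := mem_box.1 (mem_latticeBox.1 hv).1 i
    simp only [boxRep, Pi.sub_apply, Pi.add_apply, Int.add_emod_emod, add_sub_cancel]
    exact Int.emod_eq_of_lt this.1 this.2
  · intro v _
    set v' := boxRep m (u + v) with hv'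
    set z := tileIndex m (u + v)
    have e : u + v = v' + corner m z := (boxRep_add_corner m _).symm
    have hg : IsGrad fun φ : HeightFn d k => F (recenter 0 (shift v' φ)) := fun φ c =>
      congrArg F (((isGrad_recenter 0).shift v') φ c)
    have hgm : Measurable fun φ : HeightFn d k => F (recenter 0 (shift v' φ)) :=
      hF1.comp (measurable_shift v')
    rw [← hN.lintegral_shift (corner_mem_tileLattice m z) hgm hg]
    refine lintegral_congr fun φ => ?_
    rw [shift_shift, shift_shift, e]

/-! ### Slopes -/

/-- A Lipschitz bound for all height differences. -/
def LipBound (C : ℝ) (φ : HeightFn d k) : Prop := ∀ x y, |k.val (φ y - φ x)| ≤ C * dist1 x y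

theorem measurable_diff (x y : Site d) : Measurable fun φ : HeightFn d k => k.val (φ y - φ x) :=
  k.measurable_val.comp ((measurable_pi_apply y).sub (measurable_pi_apply x))

theorem integrable_diff {C : ℝ} {M : Measure (HeightFn d k)} [IsFiniteMeasure M]
    (h : ∀ᵐ φ ∂M, LipBound C φ) (x y : Site d) :
    Integrable (fun φ : HeightFn d k => k.val (φ y - φ x)) M :=
  Integrable.of_bound (measurable_diff x y).aestronglyMeasurable (C * dist1 x y) (by
    filter_upwards [h] with φ hφ using hφ x y)

theorem trim_lift (μ : Measure[gradSigma d k] (HeightFn d k)) : (lift μ).trim gradSigma_le = μ := by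
  refine @Measure.ext _ (gradSigma d k) _ _ fun A hA => ?_
  rw [trim_measurableSet_eq gradSigma_le hA, lift_apply μ hA]

theorem hasSlope_trim_iff (L : AddSubgroup (Site d)) {C : ℝ} {M : Measure (HeightFn d k)}
    [IsFiniteMeasure M] (h : ∀ᵐ φ ∂M, LipBound C φ) (u : (Fin d → ℝ) →ₗ[ℝ] ℝ) :
    HasSlope L (M.trim gradSigma_le) u ↔
      ∀ x ∈ L, u (fun i => (x i : ℝ)) = ∫ φ, k.val (φ x - φ 0) ∂M := by
  have hsm : ∀ x y : Site d,
      StronglyMeasurable[gradSigma d k] fun φ : HeightFn d k => k.val (φ y - φ x) := fun x y =>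
    (IsGrad.measurable_gradSigma (fun φ c => by simp) (measurable_diff x y)).stronglyMeasurable
  unfold HasSlope
  constructor
  · rintro ⟨_, h2⟩ x hx
    rw [h2 x hx, ← integral_trim gradSigma_le (hsm 0 x)]
  · intro h2
    refine ⟨fun x y => (integrable_diff h x y).trim gradSigma_le (hsm x y), fun x hx => ?_⟩
    rw [h2 x hx, integral_trim gradSigma_le (hsm 0 x)]

theorem integral_diff_add {C : ℝ} {M : Measure (HeightFn d k)} [IsFiniteMeasure M]
    (h : ∀ᵐ φ ∂M, LipBound C φ) (x y z : Site d) :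
    ∫ φ, k.val (φ z - φ x) ∂M = ∫ φ, k.val (φ y - φ x) ∂M + ∫ φ, k.val (φ z - φ y) ∂M := by
  rw [← integral_add (integrable_diff h x y) (integrable_diff h y z)]
  refine integral_congr_ae (Eventually.of_forall fun φ => ?_)
  simp only [← k.val_add]
  congr 1; abel

theorem IsGradInvariant.integral_diff {L : AddSubgroup (Site d)} {M : Measure (HeightFn d k)}
    (hM : IsGradInvariant L M) {v : Site d} (hv : v ∈ L) (x y : Site d) :
    ∫ φ, k.val (φ (y + v) - φ (x + v)) ∂M = ∫ φ, k.val (φ y - φ x) ∂M :=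
  hM.integral_shift hv (measurable_diff x y) fun φ c => by simp

theorem IsGradInvariant.integral_corner {L : AddSubgroup (Site d)} {C : ℝ}
    {M : Measure (HeightFn d k)} [IsFiniteMeasure M] (hM : IsGradInvariant L M)
    (h : ∀ᵐ φ ∂M, LipBound C φ) {x : Site d} (hx : x ∈ L) (m : ℕ) :
    ∫ φ, k.val (φ (corner m x) - φ 0) ∂M = m * ∫ φ, k.val (φ x - φ 0) ∂M := by
  induction m with
  | zero =>
    have : corner 0 x = (0 : Site d) := by ext i; simp [corner]
    simp [this, k.val_zero]
  | succ m ih =>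
    have e : corner (m + 1) x = corner m x + x := by
      ext i; simp only [corner, Pi.add_apply]; push_cast; ring
    rw [integral_diff_add h 0 x, e]
    have := hM.integral_diff hx 0 (corner m x)
    rw [zero_add] at this
    rw [this, ih]
    push_cast; ring

/-- For a corner `c`, invariance under `c` gives the increments from `0` to `v` and from `c` to `c +
v` the same mean. Going from `0` to `c + v` by both routes shows that the mean increment along `c`
is the same from `v` as from `0`. -/
theorem integral_shiftAverage_corner {L : AddSubgroup (Site d)} {C : ℝ} {m : ℕ} (hm : 0 < m)
    {N : Measure (HeightFn d k)} [IsFiniteMeasure N] (hN : IsGradInvariant (tileLattice d m) N)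
    (h : ∀ᵐ φ ∂N, LipBound C φ) (x : Site d) :
    ∫ φ, k.val (φ (corner m x) - φ 0) ∂(shiftAverage L m N) =
      ∫ φ, k.val (φ (corner m x) - φ 0) ∂N := by
  set c := corner m x with hc
  have h1 : ∀ v ∈ latticeBox L m, ∫ φ, k.val (φ c - φ 0) ∂(N.map (shift v)) =
      ∫ φ, k.val (φ c - φ 0) ∂N := by
    intro v _
    rw [integral_map (measurable_shift v).aemeasurable (measurable_diff 0 c).aestronglyMeasurable]
    change ∫ φ, k.val (φ (c + v) - φ (0 + v)) ∂N = _
    have a1 := integral_diff_add h 0 c (c + v)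
    have a2 := integral_diff_add h 0 (0 + v) (c + v)
    have a3 := hN.integral_diff (corner_mem_tileLattice m x) 0 v
    rw [← hc, zero_add, add_comm v c] at a3
    rw [zero_add] at a2 ⊢
    linarith
  have hint : ∀ v ∈ latticeBox L m,
      Integrable (fun φ : HeightFn d k => k.val (φ c - φ 0)) (N.map (shift v)) := by
    intro v _
    rw [integrable_map_measure (measurable_diff 0 c).aestronglyMeasurable
      (measurable_shift v).aemeasurable]
    exact integrable_diff h (0 + v) (c + v)
  have hcard : ((latticeBox L m).card : ℝ) ≠ 0 := by exact_mod_cast card_latticeBox_ne_zero L hm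
  rw [shiftAverage, integral_smul_measure, integral_finsetSum_measure hint,
    Finset.sum_congr rfl h1, Finset.sum_const, nsmul_eq_mul, ENNReal.toReal_inv,
    ENNReal.toReal_natCast, smul_eq_mul, inv_mul_cancel_left₀ hcard]

end Average

/-! ### Minimizers gain nothing by resampling -/

section Minimality

open ProbabilityTheory InformationTheory

variable {d : ℕ} {k : HeightKind}

theorem dist1_le_of_mem_box {n : ℕ} {x y : Site d} (hx : x ∈ box d n) (hy : y ∈ box d n) :
    (dist1 x y : ℝ) ≤ d * n := by
  rw [mem_box] at hx hy
  have : dist1 x y ≤ ∑ _i : Fin d, n := by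
    refine Finset.sum_le_sum fun i _ => ?_
    have := hx i
    have := hy i
    omega
  simpa using (Nat.cast_le (α := ℝ)).2 this

theorem isProbabilityMeasure_of_average {X : Type*} [MeasurableSpace X] {ι : Type*}
    (s : Finset ι) (hs : s.Nonempty) (M : ι → Measure X) (h : ∀ i ∈ s, IsProbabilityMeasure (M i)) :
    IsProbabilityMeasure ((s.card : ℝ≥0∞)⁻¹ • ∑ i ∈ s, M i) := by
  refine ⟨?_⟩
  rw [Measure.smul_apply, Measure.finsetSum_apply,
    Finset.sum_congr rfl fun i hi => (h i hi).measure_univ, Finset.sum_const, nsmul_eq_mul, mul_one,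
    smul_eq_mul]
  exact ENNReal.inv_mul_cancel (by exact_mod_cast (Finset.card_pos.2 hs).ne') (ENNReal.natCast_ne_top _)

/-- Convexity of the entropy. -/
theorem ent_average_le {X : Type*} [MeasurableSpace X] {ι : Type*} (s : Finset ι)
    (hs : s.Nonempty) (M : ι → Measure X) (ν : Measure X) [∀ i, IsProbabilityMeasure (M i)]
    [IsFiniteMeasure ν] {B : ℝ} (h : ∀ i ∈ s, klDiv (M i) ν ≠ ∞ ∧ ent (M i) ν ≤ B) :
    klDiv ((s.card : ℝ≥0∞)⁻¹ • ∑ i ∈ s, M i) ν ≠ ∞ ∧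
      ent ((s.card : ℝ≥0∞)⁻¹ • ∑ i ∈ s, M i) ν ≤ B := by
  have := isProbabilityMeasure_of_average s hs M fun i _ => inferInstance
  have hc0 : (s.card : ℝ≥0∞) ≠ 0 := by exact_mod_cast (Finset.card_pos.2 hs).ne'
  have h1 : ∀ i ∈ s, klDiv (M i) ν ≤ ENNReal.ofReal (B + ν.real Set.univ - 1) := fun i hi => by
    rw [← ENNReal.ofReal_toReal (h i hi).1, toReal_klDiv_eq_ent (h i hi).1]
    exact ENNReal.ofReal_le_ofReal (by linarith [(h i hi).2])
  have h2 : klDiv ((s.card : ℝ≥0∞)⁻¹ • ∑ i ∈ s, M i) ν ≤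
      ENNReal.ofReal (B + ν.real Set.univ - 1) := by
    refine (klDiv_average_le s hs M ν).trans ?_
    refine (mul_le_mul_right (Finset.sum_le_sum h1) _).trans (le_of_eq ?_)
    rw [Finset.sum_const, nsmul_eq_mul, ← mul_assoc,
      ENNReal.inv_mul_cancel hc0 (ENNReal.natCast_ne_top _), one_mul]
  have h3 := ne_top_of_le_ne_top ENNReal.ofReal_ne_top h2
  refine ⟨h3, ?_⟩
  obtain ⟨i, hi⟩ := hs
  have h4 : 0 ≤ B + ν.real Set.univ - 1 := by
    have := toReal_klDiv_eq_ent (h i hi).1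
    have h5 : 0 ≤ (klDiv (M i) ν).toReal := ENNReal.toReal_nonneg
    linarith [(h i hi).2]
  have h5 := ENNReal.toReal_mono ENNReal.ofReal_ne_top h2
  rw [toReal_klDiv_eq_ent h3, ENNReal.toReal_ofReal h4] at h5
  linarith

namespace Interaction

variable {L : AddSubgroup (Site d)} {Φ : Potential d k} (I : Interaction L Φ)
include I

theorem blockEnt_map_shift (C : ℝ) (N : Measure (HeightFn d k)) [IsProbabilityMeasure N] {v : Site d}
    (hv : v ∈ L) {S : Finset (Site d)} {o : Site d} (ho : o ∈ S)
    (h : FiniteEnt Φ C (translateSet v S) (o + v) N) :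
    FiniteEnt Φ C S o (N.map (shift v)) ∧
      blockEnt Φ C S o (N.map (shift v)) = blockEnt Φ C (translateSet v S) (o + v) N := by
  have := I.isFiniteMeasure_blockRef C ho
  have hov : o + v ∈ translateSet v S := by rw [mem_translateSet]; simpa using ho
  have := I.isFiniteMeasure_blockRef C hov
  have := Measure.isProbabilityMeasure_map (μ := N) (measurable_shift (k := k) v).aemeasurable
  have hid : ∀ N : Measure (HeightFn d k), (N.map (shift v)).map (shift (-v)) = N := by
    intro N
    rw [Measure.map_map (measurable_shift _) (measurable_shift _)]
    have : shift (k := k) (-v) ∘ shift v = id := by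
      ext φ : 1; simp [shift_shift, shift_zero]
    rw [this, Measure.map_id]
  have e : blockLaw S o (N.map (shift v)) =
      (blockLaw (translateSet v S) (o + v) N).map (shift v) := by
    rw [blockLaw, blockLaw, Measure.map_map (measurable_localize _ _) (measurable_shift _),
      Measure.map_map (measurable_shift _) (measurable_localize _ _)]
    congr 1
    exact funext fun φ => (localize_shift v S o φ).symm
  have hkl : klDiv (blockLaw S o (N.map (shift v))) (blockRef Φ C S o) =
      klDiv (blockLaw (translateSet v S) (o + v) N) (blockRef Φ C (translateSet v S) (o + v)) := by
    rw [e, ← I.blockRef_shift C hv S o]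
    exact klDiv_map_eq (measurable_shift v) (measurable_shift (-v)) (hid _) (hid _)
  have huniv : (blockRef Φ C (translateSet v S) (o + v)).real Set.univ =
      (blockRef Φ C S o).real Set.univ := by
    rw [← I.blockRef_shift C hv S o, map_measureReal_apply (measurable_shift v) MeasurableSet.univ]
    rfl
  have h' : FiniteEnt Φ C S o (N.map (shift v)) := by rw [FiniteEnt, hkl]; exact h
  refine ⟨h', ?_⟩
  have e1 := toReal_klDiv_eq_ent h
  have e2 := toReal_klDiv_eq_ent h'
  rw [hkl, e1, huniv] at e2
  unfold blockEnt
  linarith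

/-- The entropy of an average of shifts. -/
theorem blockEnt_shiftAverage_le {C : ℝ} (hC : 0 ≤ C) {m n : ℕ} (hm : 0 < m) (hn : 0 < n)
    {N : Measure (HeightFn d k)} [IsProbabilityMeasure N]
    (h : FiniteEnt Φ C (box d (m * (n + 1))) 0 N) :
    FiniteEnt Φ C (box d (m * n)) 0 (shiftAverage L m N) ∧
      blockEnt Φ C (box d (m * n)) 0 (shiftAverage L m N) ≤ blockEnt Φ C (box d (m * (n + 1))) 0 N +
        (((m * (n + 1) : ℕ) : ℝ) ^ d - ((m * n : ℕ) : ℝ) ^ d) *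
          (I.weakBound {0} + Real.log (2 * (C * (d * (m * (n + 1) : ℕ))) + 1)) := by
  set S := box d (m * n) with hS
  set T := box d (m * (n + 1)) with hT
  have h0S : (0 : Site d) ∈ S := zero_mem_box (Nat.mul_pos hm hn)
  have h0T : (0 : Site d) ∈ T := zero_mem_box (by positivity)
  have := I.isFiniteMeasure_blockRef C h0S
  have hprob : ∀ v : Site d, IsProbabilityMeasure (N.map (shift v)) := fun v =>
    Measure.isProbabilityMeasure_map (measurable_shift v).aemeasurable
  have e : blockLaw S 0 (shiftAverage L m N) = ((latticeBox L m).card : ℝ≥0∞)⁻¹ •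
      ∑ v ∈ latticeBox L m, blockLaw S 0 (N.map (shift v)) := by
    rw [blockLaw, shiftAverage, Measure.map_smul, Measure.map_finset_sum
      (measurable_localize S 0).aemeasurable]
    rfl
  rw [FiniteEnt, blockEnt, e]
  refine ent_average_le _ ⟨0, zero_mem_latticeBox L hm⟩ _ _ fun v hv => ?_
  obtain ⟨hvb, hvL⟩ := mem_latticeBox.1 hv
  have hmT : m ≤ m * (n + 1) := Nat.le_mul_of_pos_right m (Nat.succ_pos n)
  have hvT : v ∈ T := box_subset hmT hvb
  -- All shifts of the box of side `m * n` that occur in the average fit into the box of side `m *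
  -- (n + 1)`, so almost monotonicity bounds their entropies by one quantity; convexity then treats
  -- the average.
  have hsub : translateSet v S ⊆ T := fun x hx => by
    rw [mem_translateSet, hS, mem_box] at hx
    rw [mem_box] at hvb
    rw [hT, mem_box]
    intro i
    have h1 := hx i
    have h2 := hvb i
    simp only [Pi.sub_apply] at h1
    push_cast at h1 ⊢
    constructor
    · linarith
    · linarith
  have hvS : v ∈ translateSet v S := by rw [mem_translateSet]; simpa using h0S
  have a1 := I.blockEnt_anchor C h0T hvT h
  have a2 := I.blockEnt_mono hC hsub hvS (fun x hx => dist1_le_of_mem_box hvT hx) a1.1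
  have a3 := I.blockEnt_map_shift C N hvL h0S (by rw [zero_add]; exact a2.1)
  rw [zero_add] at a3
  refine ⟨a3.1, ?_⟩
  have a4 := a3.2
  rw [blockEnt] at a4
  rw [a4]
  have hcard : ((translateSet v S).card : ℝ) = ((m * n : ℕ) : ℝ) ^ d := by
    rw [translateSet, Finset.card_map, hS, card_box]; push_cast; rfl
  have hcard' : (T.card : ℝ) = ((m * (n + 1) : ℕ) : ℝ) ^ d := by
    rw [hT, card_box]; push_cast; rfl
  rw [← hcard, ← hcard', ← a1.2]
  exact a2.2

/-- The free energies of the gradient measure determined by `M`. -/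
theorem freeEnergy_trim (C : ℝ) {M : Measure (HeightFn d k)} [IsProbabilityMeasure M]
    (hM : ∀ᵐ φ ∂M, LipBound C φ) {S : Finset (Site d)} (ho : 0 ∈ S) :
    (¬ FiniteEnt Φ C S 0 M → freeEnergy Φ S 0 (M.trim gradSigma_le) = ⊤) ∧
      (FiniteEnt Φ C S 0 M →
        freeEnergy Φ S 0 (M.trim gradSigma_le) = (blockEnt Φ C S 0 M : ℝ)) := by
  have hp : IsProbabilityMeasure (M.trim (gradSigma_le (d := d) (k := k))) := ⟨by
    rw [trim_measurableSet_eq gradSigma_le MeasurableSet.univ]; exact measure_univ⟩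
  have hlm := measurableSet_lipOn (k := k) C S
  have hlip : ∀ᵐ φ ∂(lift (M.trim gradSigma_le)), φ ∈ lipOn C S := by
    rw [lift_trim, ae_map_iff (p := fun φ => φ ∈ lipOn C S) (measurable_recenter 0).aemeasurable hlm]
    filter_upwards [hM] with φ hφ
    rw [recenter_eq_add, add_const_mem_lipOn]
    exact fun x _ y _ => hφ x y
  have e : blockLaw S 0 (lift (M.trim gradSigma_le)) = blockLaw S 0 M := by
    rw [lift_trim, blockLaw, Measure.map_map (measurable_localize _ _) (measurable_recenter _)]
    congr 1
    exact funext fun φ => (isGrad_localize S 0).recenter 0 φ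
  have h := I.freeEnergy_eq C ho hp hlip
  rw [e] at h
  exact ⟨fun hn => h.1 (not_not.1 hn), h.2⟩

theorem hasSpecificFreeEnergy_trim (C : ℝ) {M : Measure (HeightFn d k)} [IsProbabilityMeasure M]
    (hM : ∀ᵐ φ ∂M, LipBound C φ) (hfin : ∀ n, 0 < n → FiniteEnt Φ C (box d n) 0 M) {h : EReal} :
    HasSpecificFreeEnergy Φ (M.trim gradSigma_le) h ↔
      Tendsto (fun n : ℕ => ((blockEnt Φ C (box d n) 0 M / (n : ℝ) ^ d : ℝ) : EReal)) atTop (𝓝 h) := by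
  unfold HasSpecificFreeEnergy
  refine tendsto_congr' ?_
  filter_upwards [eventually_gt_atTop 0] with n hn
  rw [(I.freeEnergy_trim C hM (zero_mem_box hn)).2 (hfin n hn), ← EReal.coe_mul, div_eq_inv_mul]

/-- If the entropy of `M` is finite in large boxes, then it is finite in all boxes. -/
theorem finiteEnt_box {C : ℝ} (hC : 0 ≤ C) {M : Measure (HeightFn d k)} [IsProbabilityMeasure M]
    (h : ∃ᶠ n in atTop, FiniteEnt Φ C (box d n) 0 M) (n : ℕ) (hn : 0 < n) :
    FiniteEnt Φ C (box d n) 0 M := by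
  obtain ⟨m, hmn, hm⟩ := frequently_atTop.1 h n
  exact (I.blockEnt_mono hC (box_subset hmn) (zero_mem_box hn)
    (fun x hx => dist1_zero_le_of_mem_box hx) hm).1

end Interaction

theorem isInvariantGradientMeasure_trim {L : AddSubgroup (Site d)} {M : Measure (HeightFn d k)}
    [IsProbabilityMeasure M] (hM : IsGradInvariant L M) :
    IsInvariantGradientMeasure L (M.trim (gradSigma_le (d := d) (k := k))) := by
  refine ⟨⟨by rw [trim_measurableSet_eq gradSigma_le MeasurableSet.univ]; exact measure_univ⟩,
    fun v hv A hA => ?_⟩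
  have hA' := gradSigma_le _ hA
  have hg : IsGrad fun φ : HeightFn d k => φ ∈ A := fun φ c =>
    propext (add_const_mem_iff_of_gradSigma hA φ c)
  have hpm : Measurable fun φ : HeightFn d k => φ ∈ A := measurable_mem.2 hA'
  have hshA : MeasurableSet[gradSigma d k] (shift v ⁻¹' A) := by
    have : Measurable[gradSigma d k] fun φ : HeightFn d k => shift v φ ∈ A :=
      (hg.shift v).measurable_gradSigma (hpm.comp (measurable_shift v))
    exact @measurableSet_setOfPred _ (gradSigma d k) _ |>.2 this
  rw [trim_measurableSet_eq gradSigma_le hA, trim_measurableSet_eq gradSigma_le hshA]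
  have h := hM.lintegral_shift hv (F := A.indicator 1) (measurable_one.indicator hA')
    (isGrad_indicator fun φ c => add_const_mem_iff_of_gradSigma hA φ c)
  rwa [indicator_one_comp, lintegral_indicator_one hA',
    lintegral_indicator_one (measurable_shift v hA')] at h

end Minimality

/-! ### The competitor built from a minimizer. -/

section MinimizerResampling

open ProbabilityTheory InformationTheory

variable {d : ℕ} {k : HeightKind}

/-- The limits that appear when the entropies of enlarged boxes are compared. -/
theorem tendsto_enlarged_box {m : ℕ} (hm : 0 < m) {a lg : ℕ → ℝ} {ℓ b : ℝ}
    (ha : Tendsto (fun n : ℕ => a n / (n : ℝ) ^ d) atTop (𝓝 ℓ)) (hlg0 : ∀ n, 0 ≤ lg n)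
    (hlg : Tendsto (fun n : ℕ => lg n / n) atTop (𝓝 0)) :
    Tendsto (fun n : ℕ => (a (m * (n + 1)) + ((n + 1 : ℕ) : ℝ) ^ d * b +
      (((m * (n + 1) : ℕ) : ℝ) ^ d - ((m * n : ℕ) : ℝ) ^ d) * lg (m * (n + 1))) /
        ((m * n : ℕ) : ℝ) ^ d) atTop (𝓝 (ℓ + b / (m : ℝ) ^ d)) := by
  have hm' : (0 : ℝ) < m := by exact_mod_cast hm
  have hsub : Tendsto (fun n : ℕ => m * (n + 1)) atTop atTop :=
    tendsto_atTop_mono (fun n => (Nat.le_succ n).trans (Nat.le_mul_of_pos_left _ hm)) tendsto_id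
  have hr : Tendsto (fun n : ℕ => ((n + 1 : ℕ) : ℝ) / n) atTop (𝓝 1) := by
    have h := (tendsto_const_nhds (x := (1 : ℝ))).add (tendsto_const_div_atTop_nhds_zero_nat (1 : ℝ))
    rw [add_zero] at h
    refine h.congr' ?_
    filter_upwards [eventually_gt_atTop 0] with n hn
    have hn' : (n : ℝ) ≠ 0 := by exact_mod_cast hn.ne'
    push_cast
    rw [add_div, div_self hn']
  have hrd := hr.pow d
  rw [one_pow] at hrd
  have h3 : Tendsto (fun n : ℕ => ((((n + 1 : ℕ) : ℝ) / n) ^ d - 1) * lg (m * (n + 1))) atTop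
      (𝓝 0) := by
    have hb := (((hlg.comp hsub).mul (hr.const_mul (m : ℝ))).const_mul ((d : ℝ) * 2 ^ d))
    simp only [zero_mul, mul_zero] at hb
    refine squeeze_zero' ?_ ?_ hb
    · filter_upwards [eventually_gt_atTop 0] with n hn
      have hn' : (0 : ℝ) < n := by exact_mod_cast hn
      refine mul_nonneg (sub_nonneg.2 (one_le_pow₀ ?_)) (hlg0 _)
      rw [one_le_div hn']; push_cast; linarith
    · filter_upwards [eventually_gt_atTop 0] with n hn
      have hn' : (0 : ℝ) < n := by exact_mod_cast hn
      have hn1 : (1 : ℝ) ≤ n := by exact_mod_cast hn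
      have h1 := pow_sub_one_le d (y := ((n + 1 : ℕ) : ℝ) / n)
        (by rw [one_le_div hn']; push_cast; linarith)
        (by rw [div_le_iff₀ hn']; push_cast; linarith)
      refine (mul_le_mul_of_nonneg_right h1 (hlg0 _)).trans (le_of_eq ?_)
      simp only [Function.comp_apply]
      push_cast
      field_simp
      ring
  have h1 := (ha.comp hsub).mul hrd
  have h2 := hrd.mul_const (b / (m : ℝ) ^ d)
  have h := (h1.add h2).add h3
  simp only [mul_one, one_mul, add_zero] at h
  refine h.congr' ?_
  filter_upwards [eventually_gt_atTop 0] with n hn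
  have hn' : (0 : ℝ) < n := by exact_mod_cast hn
  simp only [Function.comp_apply]
  push_cast
  simp only [mul_pow, div_pow]
  field_simp

variable {L : AddSubgroup (Site d)} {Φ : Potential d k} (I : Interaction L Φ)

namespace IsMinimizer

variable {μ : Measure[gradSigma d k] (HeightFn d k)} (hμ : IsMinimizer L Φ μ)
include hμ

theorem isProbabilityMeasure_lift : IsProbabilityMeasure (lift μ) :=
  _root_.isProbabilityMeasure_lift μ hμ.1.prob

theorem isGradInvariant : IsGradInvariant L (lift μ) := isGradInvariant_lift hμ.1

theorem regular (hL : L.FiniteIndex) : I.Regular (lift μ) := by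
  obtain ⟨hinv, u, h, _, hh, _, hlt⟩ := hμ
  exact I.regular_of_freeEnergy hL hinv (eventually_freeEnergy_ne_top hh hlt)

theorem ae_good (hd : 0 < d) (hL : L.FiniteIndex) : ∀ᵐ φ ∂(lift μ), φ ∈ I.Good :=
  (hμ.regular I hL).ae_good I hd hL

/-- Resampling does not decrease the specific free energy of a minimizer. -/
theorem klDiv_resample_le (hd : 0 < d) (hL : L.FiniteIndex) {m : ℕ} {T : TileKernel d k m}
    (hT : IsTileKernel I T) :
    klDiv (blockLaw (box d m) 0 (lift μ)) (blockLaw (box d m) 0 (T.law Set.univ (lift μ))) ≤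
      ENNReal.ofReal (4 * I.extBound (box d m)) := by
  obtain ⟨C, hC, hlipC⟩ := I.exists_lipschitz_constant hL
  have hinv := hμ.isGradInvariant
  have hgood := hμ.ae_good I hd hL
  have := hμ.isProbabilityMeasure_lift
  obtain ⟨hμi, u, h, hslope, hh, hσ, hlt⟩ := hμ
  set M := lift μ with hM
  have hm := T.pos
  have hm' : (0 : ℝ) < m := by exact_mod_cast hm
  have htrim : M.trim gradSigma_le = μ := trim_lift μ
  have hlipM : ∀ᵐ φ ∂M, LipBound C φ := by
    filter_upwards [hgood] with φ hφ using hlipC φ hφ.1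
  -- the entropies of the minimizer
  have hfinM : ∀ n, 0 < n → FiniteEnt Φ C (box d n) 0 M := by
    refine I.finiteEnt_box hC (Eventually.frequently ?_)
    filter_upwards [eventually_freeEnergy_ne_top hh hlt, eventually_gt_atTop 0] with n hn hn0
    by_contra hcon
    have := (I.freeEnergy_trim C hlipM (zero_mem_box hn0)).1 hcon
    rw [htrim] at this
    exact hn this
  have htM := (I.hasSpecificFreeEnergy_trim C hlipM hfinM (h := h)).1 (by rwa [htrim])
  obtain ⟨ℓ, hℓ⟩ : ∃ ℓ : ℝ,
      Tendsto (fun n : ℕ => blockEnt Φ C (box d n) 0 M / (n : ℝ) ^ d) atTop (𝓝 ℓ) := by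
    refine I.exists_tendsto_blockEnt hd hL hC hinv hfinM ?_
    obtain ⟨B, hB, -⟩ := EReal.lt_iff_exists_real_btwn.1 hlt
    refine ⟨B, Eventually.frequently ?_⟩
    filter_upwards [htM.eventually (gt_mem_nhds hB)] with n hn
    exact (EReal.coe_lt_coe_iff.1 hn).le
  have hhℓ : h = (ℓ : EReal) :=
    tendsto_nhds_unique htM ((continuous_coe_real_ereal.tendsto ℓ).comp hℓ)
  -- the competitor
  set N := T.law Set.univ M with hN
  have hinvN : IsGradInvariant (tileLattice d m) N := T.isGradInvariant_law hT.dvd hinv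
  have hlipN : ∀ᵐ φ ∂N, φ ∈ I.Lip := hT.ae_law_lip hd hgood
  set A := shiftAverage L m N with hA
  have hAprob : IsProbabilityMeasure A := isProbabilityMeasure_shiftAverage L hm N
  have hinvA : IsGradInvariant L A := isGradInvariant_shiftAverage hm hT.dvd hinvN
  have hlipA : ∀ᵐ φ ∂A, LipBound C φ := by
    have : ∀ᵐ φ ∂A, φ ∈ I.Lip := ae_shiftAverage I.measurableSet_lip fun v hv => by
      filter_upwards [hlipN] with φ hφ using I.shift_mem_lip hv hφ
    filter_upwards [this] with φ hφ using hlipC φ hφ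
  have hlipN' : ∀ᵐ φ ∂N, LipBound C φ := by
    filter_upwards [hlipN] with φ hφ using hlipC φ hφ
  set c := I.extBound (box d m) with hc
  set g := klDiv (blockLaw (box d m) 0 M) (blockLaw (box d m) 0 N) with hg
  have hgain := fun n hn => hT.blockEnt_law_le hd hlipC hinv hgood (n := n) hn
    (hfinM _ (Nat.mul_pos hm hn))
  have hgtop : g ≠ ∞ := (hgain 1 one_pos).1
  set lg : ℕ → ℝ := fun n => I.weakBound {0} + Real.log (2 * (C * (d * n)) + 1) with hlg
  have hlg0 : ∀ n, 0 ≤ lg n := fun n => add_nonneg (I.weakBound_nonneg _) (Real.log_nonneg (by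
    have : 0 ≤ C * (d * n) := by positivity
    linarith))
  have hlgn : Tendsto (fun n : ℕ => lg n / n) atTop (𝓝 0) := by
    have h1 := tendsto_log_mul_add_div (A := 2 * C * d) (by positivity)
    have h2 := (tendsto_const_div_atTop_nhds_zero_nat (I.weakBound {0})).add h1
    rw [add_zero] at h2
    refine h2.congr fun n => ?_
    simp only [hlg, add_div]
    ring_nf
  -- The gain from all tiles of the larger box, followed by the boundary cost of averaging; that
  -- cost is negligible compared with the volume.
  have hbound : ∀ n, 0 < n → FiniteEnt Φ C (box d (m * n)) 0 A ∧
      blockEnt Φ C (box d (m * n)) 0 A ≤ blockEnt Φ C (box d (m * (n + 1))) 0 M +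
        ((n + 1 : ℕ) : ℝ) ^ d * (4 * c - g.toReal) +
        (((m * (n + 1) : ℕ) : ℝ) ^ d - ((m * n : ℕ) : ℝ) ^ d) * lg (m * (n + 1)) := by
    intro n hn
    obtain ⟨-, h2, h3⟩ := hgain (n + 1) (Nat.succ_pos n)
    have h4 := I.blockEnt_shiftAverage_le hC hm hn h2
    refine ⟨h4.1, h4.2.trans ?_⟩
    rw [← hN, ← hg, ← hc] at h3
    rw [← hN]
    simp only [hlg]
    linarith
  have hsubseq : Tendsto (fun n : ℕ => m * n) atTop atTop :=
    tendsto_atTop_mono (fun n => Nat.le_mul_of_pos_left n hm) tendsto_id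
  have hfinA : ∀ n, 0 < n → FiniteEnt Φ C (box d n) 0 A := by
    refine I.finiteEnt_box hC (hsubseq.frequently (Eventually.frequently ?_))
    filter_upwards [eventually_gt_atTop 0] with n hn using (hbound n hn).1
  have hlim := tendsto_enlarged_box (d := d) hm (b := 4 * c - g.toReal) hℓ hlg0 hlgn
  have hle : ∀ᶠ n : ℕ in atTop, blockEnt Φ C (box d (m * n)) 0 A / ((m * n : ℕ) : ℝ) ^ d ≤
      (blockEnt Φ C (box d (m * (n + 1))) 0 M + ((n + 1 : ℕ) : ℝ) ^ d * (4 * c - g.toReal) +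
        (((m * (n + 1) : ℕ) : ℝ) ^ d - ((m * n : ℕ) : ℝ) ^ d) * lg (m * (n + 1))) /
        ((m * n : ℕ) : ℝ) ^ d := by
    filter_upwards [eventually_gt_atTop 0] with n hn
    gcongr
    exact (hbound n hn).2
  obtain ⟨ℓ', hℓ'⟩ : ∃ ℓ' : ℝ,
      Tendsto (fun n : ℕ => blockEnt Φ C (box d n) 0 A / (n : ℝ) ^ d) atTop (𝓝 ℓ') := by
    refine I.exists_tendsto_blockEnt hd hL hC hinvA hfinA
      ⟨ℓ + (4 * c - g.toReal) / (m : ℝ) ^ d + 1, hsubseq.frequently (Eventually.frequently ?_)⟩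
    filter_upwards [hle, hlim.eventually (gt_mem_nhds (lt_add_one _))] with n h1 h2
    exact h1.trans h2.le
  -- Per unit of volume, each tile contributes `4 * c - g.toReal` divided by its volume.
  have hupper : ℓ' ≤ ℓ + (4 * c - g.toReal) / (m : ℝ) ^ d :=
    le_of_tendsto_of_tendsto (hℓ'.comp hsubseq) hlim hle
  -- minimality
  have hlower : ℓ ≤ ℓ' := by
    rw [← EReal.coe_le_coe_iff, ← hhℓ, hσ]
    refine sInf_le ⟨A.trim gradSigma_le, isInvariantGradientMeasure_trim hinvA, ?_, ?_⟩
    -- By invariance the mean increment along `x` is `1 / m` times the one along `corner m x`. The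
    -- latter is unchanged by the average over shifts, and by the resampling because corners are
    -- frozen.
    · rw [← htrim, hasSlope_trim_iff L hlipM] at hslope
      rw [hasSlope_trim_iff L hlipA]
      intro x hx
      rw [hslope x hx]
      have e1 := hinv.integral_corner hlipM hx m
      have e2 := hinvA.integral_corner hlipA hx m
      rw [hA, integral_shiftAverage_corner hm hinvN hlipN' x, ← hA] at e2
      have e3 : ∫ φ, k.val (φ (corner m x) - φ 0) ∂N =
          ∫ φ, k.val (φ (corner m x) - φ 0) ∂M := by
        have hmap := T.law_map_frozen (measurable_diff (k := k) 0 (corner m x))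
          (S := {0, corner m x}) (fun φ φ' h => by simp only [h 0 (by simp), h (corner m x) (by simp)])
          (fun y hy z => by
            rcases hy with rfl | hy
            · have := T.corner_notMem_region 0 z
              rwa [corner_zero] at this
            · rw [Set.mem_singleton_iff.1 hy]; exact T.corner_notMem_region x z) Set.univ M
        have := congrArg (fun ρ : Measure ℝ => ∫ t, t ∂ρ) hmap
        have hid : ∀ ρ : Measure ℝ, AEStronglyMeasurable (fun t : ℝ => t) ρ := fun ρ =>
          measurable_id'.aestronglyMeasurable
        have hdm := measurable_diff (k := k) 0 (corner m x)
        exact (integral_map hdm.aemeasurable (hid _)).symm.trans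
          (this.trans (integral_map hdm.aemeasurable (hid _)))
      rw [e3, e1] at e2
      exact mul_left_cancel₀ hm'.ne' e2
    · rw [I.hasSpecificFreeEnergy_trim C hlipA hfinA]
      exact (continuous_coe_real_ereal.tendsto ℓ').comp hℓ'
  have hfinal : 0 ≤ (4 * c - g.toReal) / (m : ℝ) ^ d := by linarith
  have h0 : 0 ≤ 4 * c - g.toReal := by
    by_contra! hneg
    have := div_neg_of_neg_of_pos hneg (show (0 : ℝ) < (m : ℝ) ^ d by positivity)
    linarith
  rw [← ENNReal.ofReal_toReal hgtop]
  exact ENNReal.ofReal_le_ofReal (by linarith)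

end IsMinimizer

end MinimizerResampling

/-! ### From a negligible gain in large boxes to an approximation near a fixed set. -/

section Approximation

open ProbabilityTheory InformationTheory

variable {d : ℕ} {k : HeightKind}

theorem comp_map_eq_of_comp_eq {X Y : Type*} [MeasurableSpace X] [MeasurableSpace Y]
    {Q : Measure X} {κ : Kernel X X} {κ' : Kernel Y Y} {f : X → Y} (hf : Measurable f)
    (h : ∀ᵐ x ∂Q, κ' (f x) = (κ x).map f) (hQ : κ ∘ₘ Q = Q) :
    κ' ∘ₘ Q.map f = Q.map f := by
  ext A hA
  rw [Measure.bind_apply hA κ'.measurable.aemeasurable,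
    lintegral_map (κ'.measurable_coe hA) hf, Measure.map_apply hf hA]
  conv_rhs => rw [← hQ]
  rw [Measure.bind_apply (hf hA) κ.measurable.aemeasurable]
  refine lintegral_congr_ae ?_
  filter_upwards [h] with x hx
  rw [hx, Measure.map_apply hf hA]

/-- For probability measures the mass corrections vanish, so the comparison of entropies is one of
divergences. -/
theorem klDiv_le_of_le_smul {X : Type*} [MeasurableSpace X] {M ν ν' : Measure X}
    [IsProbabilityMeasure M] [IsProbabilityMeasure ν] [IsProbabilityMeasure ν'] {a c : ℝ}
    (ha : 0 ≤ a) (hle : ν ≤ ENNReal.ofReal (Real.exp c) • ν')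
    (h : klDiv M ν ≤ ENNReal.ofReal a) : klDiv M ν' ≤ ENNReal.ofReal (a + c) := by
  have hne : klDiv M ν ≠ ∞ := (h.trans_lt ENNReal.ofReal_lt_top).ne
  obtain ⟨h1, h2⟩ := ent_mono_right hle hne
  have e1 := toReal_klDiv_eq_ent hne
  have e2 := toReal_klDiv_eq_ent h1
  rw [probReal_univ] at e1 e2
  have h3 := ENNReal.toReal_le_of_le_ofReal ha h
  rw [← ENNReal.ofReal_toReal h1]
  exact ENNReal.ofReal_le_ofReal (by linarith)

/-- One factor `e ^ c` comes from the densities and another from the partition functions. -/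
theorem gibbsLaw_le_of_weight_le {V : Finset (Site d)} {w w' : HeightFn d k → ℝ≥0∞}
    (hw : Measurable w) (hw' : Measurable w') {φ : HeightFn d k} {c : ℝ}
    (h1 : ∀ φ, w φ ≤ ENNReal.ofReal (Real.exp c) * w' φ)
    (h2 : ∀ φ, w' φ ≤ ENNReal.ofReal (Real.exp c) * w φ)
    (hn : Normalizable V w φ) (hn' : Normalizable V w' φ) :
    gibbsLaw V w φ ≤ ENNReal.ofReal (Real.exp (2 * c)) • gibbsLaw V w' φ := by
  have hc : ENNReal.ofReal (Real.exp c) ≠ 0 := by simp [Real.exp_pos]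
  refine le_smul_of_lintegral_le fun f hf => ?_
  rw [lintegral_gibbsLaw hw hf hn, lintegral_gibbsLaw hw' hf hn']
  have hZ : (refInt V w φ)⁻¹ ≤ ENNReal.ofReal (Real.exp c) * (refInt V w' φ)⁻¹ := by
    have h : refInt V w' φ ≤ ENNReal.ofReal (Real.exp c) * refInt V w φ := by
      rw [← refInt_const_mul hw]
      exact refInt_mono fun φ' _ => h2 φ'
    have h' := ENNReal.inv_le_inv.2 h
    rw [ENNReal.mul_inv (Or.inl hc) (Or.inl ENNReal.ofReal_ne_top)] at h'
    calc (refInt V w φ)⁻¹ = ENNReal.ofReal (Real.exp c) *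
          ((ENNReal.ofReal (Real.exp c))⁻¹ * (refInt V w φ)⁻¹) := by
          rw [← mul_assoc, ENNReal.mul_inv_cancel hc ENNReal.ofReal_ne_top, one_mul]
      _ ≤ _ := by gcongr
  have hI : refInt V (fun φ' => w φ' * f φ') φ ≤
      ENNReal.ofReal (Real.exp c) * refInt V (fun φ' => w' φ' * f φ') φ := by
    have hwf : Measurable fun φ' => w' φ' * f φ' := hw'.mul hf
    rw [← refInt_const_mul hwf]
    refine refInt_mono fun φ' _ => ?_
    rw [← mul_assoc]
    gcongr
    exact h1 φ'
  have hexp : ENNReal.ofReal (Real.exp (2 * c)) =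
      ENNReal.ofReal (Real.exp c) * ENNReal.ofReal (Real.exp c) := by
    rw [← ENNReal.ofReal_mul (Real.exp_nonneg _), ← Real.exp_add, two_mul]
  calc _ ≤ (ENNReal.ofReal (Real.exp c) * (refInt V w' φ)⁻¹) *
        (ENNReal.ofReal (Real.exp c) * refInt V (fun φ' => w' φ' * f φ') φ) :=
        mul_le_mul' hZ hI
    _ = _ := by rw [hexp]; ring

/-- If the increments of a monotone set function along disjoint sets `G z` were all bounded below,
the function would be large. -/
theorem exists_small_increment {ι α : Type*} [DecidableEq ι] [DecidableEq α]
    (K : Finset α → ℝ≥0∞) (T₀ : Finset α) (G A : ι → Finset α) (B : Finset ι)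
    (hK : ∀ S T, T₀ ⊆ S → S ⊆ T → T ⊆ T₀ ∪ B.biUnion G → K S ≤ K T)
    (hA : ∀ z ∈ B, Disjoint (A z) T₀ ∧ ∀ z' ∈ B, z' ≠ z → Disjoint (A z) (G z'))
    {ε : ℝ≥0∞} (h : K (T₀ ∪ B.biUnion G) < B.card * ε) :
    ∃ Z ⊆ B, ∃ z ∈ B, z ∉ Z ∧ K (T₀ ∪ (insert z Z).biUnion G) ≤
      K ((T₀ ∪ (insert z Z).biUnion G) \ A z) + ε := by
  by_contra! hcon
  refine h.not_ge ?_
  -- Otherwise every new index adds more than `ε`: removing `A z` from the enlarged set still leaves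
  -- the previous one, since `A z` is disjoint from all earlier pieces.
  suffices ∀ Z ⊆ B, Z.card * ε ≤ K (T₀ ∪ Z.biUnion G) from this B subset_rfl
  intro Z
  induction Z using Finset.induction_on with
  | empty => simp
  | insert z Z hz ih =>
    intro hZB
    have hzB := hZB (Finset.mem_insert_self z Z)
    have hZ := (Finset.subset_insert z Z).trans hZB
    rw [Finset.card_insert_of_notMem hz]
    push_cast
    rw [add_mul, one_mul]
    refine le_trans ?_ (hcon Z hZ z hzB hz).le
    gcongr
    refine (ih hZ).trans (hK _ _ Finset.subset_union_left ?_ ?_)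
    · intro x hx
      rw [Finset.mem_sdiff]
      refine ⟨Finset.union_subset_union_right
        (Finset.biUnion_subset_biUnion_of_subset_left _ (Finset.subset_insert _ _)) hx,
        fun hxA => ?_⟩
      rcases Finset.mem_union.1 hx with hx | hx
      · exact Finset.disjoint_left.1 (hA z hzB).1 hxA hx
      · obtain ⟨z', hz', hx'⟩ := Finset.mem_biUnion.1 hx
        exact Finset.disjoint_left.1 ((hA z hzB).2 z' (hZ hz') (by rintro rfl; exact hz hz')) hxA hx'
    · exact Finset.sdiff_subset.trans (Finset.union_subset_union_right
        (Finset.biUnion_subset_biUnion_of_subset_left _ hZB))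

theorem klDiv_blockLaw_mono {M Q : Measure (HeightFn d k)} [IsProbabilityMeasure M]
    [IsProbabilityMeasure Q] {S T : Finset (Site d)} (hST : S ⊆ T) {o : Site d} (ho : o ∈ S) :
    klDiv (blockLaw S o M) (blockLaw S o Q) ≤ klDiv (blockLaw T o M) (blockLaw T o Q) := by
  rw [← blockLaw_map_localize hST (hST ho) (o' := o) M,
    ← blockLaw_map_localize hST (hST ho) (o' := o) Q]
  exact klDiv_map_le _ _ (measurable_localize S o)

theorem klDiv_blockLaw_anchor {M Q : Measure (HeightFn d k)} [IsProbabilityMeasure M]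
    [IsProbabilityMeasure Q] {S : Finset (Site d)} {o o' : Site d} (ho : o ∈ S) (ho' : o' ∈ S) :
    klDiv (blockLaw S o M) (blockLaw S o Q) = klDiv (blockLaw S o' M) (blockLaw S o' Q) := by
  have h := klDiv_map_eq (M := blockLaw S o' M) (ν := blockLaw S o' Q)
    (measurable_localize S o) (measurable_localize S o')
    (by rw [blockLaw_map_localize subset_rfl ho, blockLaw_map_localize subset_rfl ho'])
    (by rw [blockLaw_map_localize subset_rfl ho, blockLaw_map_localize subset_rfl ho'])
  rwa [blockLaw_map_localize subset_rfl ho, blockLaw_map_localize subset_rfl ho] at h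

theorem blockLaw_map_shift (v : Site d) (S : Finset (Site d)) (o : Site d)
    (Q : Measure (HeightFn d k)) :
    (blockLaw (translateSet v S) (o + v) Q).map (shift v) = blockLaw S o (Q.map (shift v)) := by
  unfold blockLaw
  rw [Measure.map_map (measurable_shift v) (measurable_localize _ _),
    Measure.map_map (measurable_localize _ _) (measurable_shift v)]
  exact congrArg (fun f => Measure.map f Q) (funext fun φ => localize_shift v S o φ)

theorem blockLaw_map_recenter (S : Finset (Site d)) (o o' : Site d)
    (Q : Measure (HeightFn d k)) : blockLaw S o (Q.map (recenter o')) = blockLaw S o Q := by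
  unfold blockLaw
  rw [Measure.map_map (measurable_localize _ _) (measurable_recenter o')]
  exact congrArg (fun f => Measure.map f Q)
    (funext fun φ => (isGrad_localize S o).recenter o' φ)

theorem klDiv_blockLaw_shift {L : AddSubgroup (Site d)} {M Q : Measure (HeightFn d k)}
    [IsProbabilityMeasure M] [IsProbabilityMeasure Q] (hM : IsGradInvariant L M) {v : Site d}
    (hv : v ∈ L) {S : Finset (Site d)} {o a : Site d} (ho : o ∈ S) (ha : a ∈ translateSet v S) :
    klDiv (blockLaw S o M) (blockLaw S o (Q.map (shift v))) =
      klDiv (blockLaw (translateSet v S) a M) (blockLaw (translateSet v S) a Q) := by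
  have hov : o + v ∈ translateSet v S := by rw [mem_translateSet]; simpa using ho
  rw [klDiv_blockLaw_anchor ha hov, ← blockLaw_map_shift, ← hM.blockLaw_shift hv S o]
  have hinv : ∀ N : Measure (HeightFn d k), (N.map (shift v)).map (shift (-v)) = N := by
    intro N
    rw [Measure.map_map (measurable_shift _) (measurable_shift _)]
    have : (shift (-v) ∘ shift v : HeightFn d k → HeightFn d k) = id := by
      funext φ; simp [shift_shift, shift_zero]
    rw [this, Measure.map_id]
  exact klDiv_map_eq (measurable_shift v) (measurable_shift (-v)) (hinv _) (hinv _)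

variable {L : AddSubgroup (Site d)} {Φ : Potential d k} (I : Interaction L Φ)

namespace Interaction

include I

theorem fullWeight_shift {v : Site d} (hv : v ∈ L) (V : Finset (Site d)) (φ : HeightFn d k) :
    weight Φ (meeting (translateSet v V) Set.univ) φ =
      weight Φ (meeting V Set.univ) (shift v φ) := by
  have h := I.weight_shift hv V Set.univ φ
  rwa [Set.preimage_univ] at h

theorem shift_mem_good {v : Site d} (hv : v ∈ L) {φ : HeightFn d k} (h : φ ∈ I.Good) :
    shift v φ ∈ I.Good := by
  refine ⟨I.shift_mem_lip hv h.1, fun V => ?_⟩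
  have h' := h.2 (translateSet v V)
  rw [refInt_translateSet v V (I.measurable_fullWeight _)] at h'
  have : (fun φ' => weight Φ (meeting (translateSet v V) Set.univ) (shift (-v) φ')) =
      weight Φ (meeting V Set.univ) := by
    funext φ'
    rw [I.fullWeight_shift hv, shift_shift, add_neg_cancel, shift_zero]
  rwa [this] at h'

theorem gibbsLaw_shift {v : Site d} (hv : v ∈ L) (V : Finset (Site d)) (φ : HeightFn d k) :
    gibbsLaw V (weight Φ (meeting V Set.univ)) (shift v φ) =
      (gibbsLaw (translateSet v V) (weight Φ (meeting (translateSet v V) Set.univ)) φ).map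
        (shift v) := by
  rw [gibbsLaw_map_shift v V (I.measurable_fullWeight _)]
  congr 1
  funext φ'
  rw [I.fullWeight_shift hv, shift_shift, add_neg_cancel, shift_zero]

theorem recenter_mem_good (o : Site d) {φ : HeightFn d k} :
    recenter o φ ∈ I.Good ↔ φ ∈ I.Good := by
  rw [recenter_eq_add]
  exact I.add_const_mem_good φ _

theorem gibbsLaw_recenter (hd : 0 < d) {V : Finset (Site d)} {o : Site d} (ho : o ∉ V)
    {φ : HeightFn d k} (h : φ ∈ I.Good) :
    gibbsLaw V (weight Φ (meeting V Set.univ)) (recenter o φ) =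
      (gibbsLaw V (weight Φ (meeting V Set.univ)) φ).map (recenter o) := by
  rw [recenter_eq_add, ← gibbsLaw_map_add_const (I.measurable_fullWeight V)
    (fun φ c => I.weight_add_const _ φ c) (I.normalizable_of_good hd h V)]
  refine Measure.map_congr ?_
  filter_upwards [ae_gibbsLaw_eq_off V (weight Φ (meeting V Set.univ)) φ] with φ' hφ'
  rw [recenter_eq_add, hφ' o ho]

/-- Consistency of the specification: the energy of the sets that meet `V` but not `Λ` does not
depend on the heights on `Λ`. Admissibility makes the law on `V` normalizable. -/
theorem gibbs_comp_gibbs_of_subset (hd : 0 < d) {Λ V : Finset (Site d)} (h : Λ ⊆ V)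
    {M : Measure (HeightFn d k)} (hM : ∀ᵐ φ ∂M, φ ∈ I.Good) :
    gibbs Λ (I.measurable_fullWeight Λ) ∘ₘ (gibbs V (I.measurable_fullWeight V) ∘ₘ M) =
      gibbs V (I.measurable_fullWeight V) ∘ₘ M := by
  rw [Measure.comp_assoc]
  refine Measure.comp_congr ?_
  filter_upwards [hM] with φ hφ
  rw [Kernel.comp_apply, gibbs_apply]
  have hsub : meeting Λ Set.univ ⊆ meeting V (Set.univ : Set (Site d)) :=
    fun Γ hΓ => ⟨hΓ.1, hΓ.2.imp fun x hx => ⟨hx.1, h hx.2⟩⟩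
  have hun : meeting V Set.univ \ meeting Λ Set.univ ∪ meeting Λ Set.univ =
      meeting V (Set.univ : Set (Site d)) := Set.sdiff_union_of_subset hsub
  have hth := isThin_meeting V (Set.univ : Set (Site d))
  refine gibbs_comp_gibbsLaw h (I.measurable_fullWeight V) (I.measurable_fullWeight Λ)
    (u := weight Φ (meeting V Set.univ \ meeting Λ Set.univ))
    (I.measurable_weight (hth.mono Set.sdiff_subset)) (fun φ => ?_) (fun φ φ' hφφ' => ?_)
    (I.refInt_fullWeight_lt_top hd Λ) (I.normalizable_of_good hd hφ V)
  · rw [← I.weight_union Set.disjoint_sdiff_left (by rwa [hun]), hun]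
  · refine I.weight_congr fun Γ hΓ x hx y hy => ?_
    have hoff : ∀ z ∈ Γ, z ∉ Λ := fun z hz hzΛ => hΓ.2 ⟨Set.subset_univ _, z, hz, hzΛ⟩
    rw [hφφ' x (hoff x hx), hφφ' y (hoff y hy)]

end Interaction

namespace IsMinimizer

variable {μ : Measure[gradSigma d k] (HeightFn d k)} (hμ : IsMinimizer L Φ μ)
include hμ

/-- Within the tile at the origin, resampling all tiles amounts to resampling this one. Replacing
its weight, which only counts sets inside the box, by the full weight adds `2 * I.extBound (box d
m)` to the bound `4 * I.extBound (box d m)`. With the full weight, smaller Gibbs kernels inside `V`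
preserve the resampled law. -/
theorem klDiv_gibbs_le (hd : 0 < d) (hL : L.FiniteIndex) {m : ℕ} (hm : 0 < m)
    (hmL : L.index ∣ m) {V : Finset (Site d)} (h0 : 0 ∉ V) (hV : I.Collar V (box d m)) :
    klDiv (blockLaw (box d m) 0 (lift μ))
      (blockLaw (box d m) 0 (gibbs V (I.measurable_fullWeight V) ∘ₘ lift μ)) ≤
      ENNReal.ofReal (6 * I.extBound (box d m)) := by
  have hprob := hμ.isProbabilityMeasure_lift
  have hgood := hμ.ae_good I hd hL
  obtain ⟨T, hTV, hT⟩ := I.exists_isTileKernel hm hmL h0 hV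
  have hreg : T.region 0 = V := by
    ext x; rw [T.mem_region, corner_zero, sub_zero, hTV]
  have hdep : DependsOn (localize (k := k) (box d m) 0) (box d m : Set (Site d)) :=
    fun φ φ' h => localize_congr (zero_mem_box hm) h
  have hlaw : blockLaw (box d m) 0 (T.law Set.univ (lift μ)) =
      blockLaw (box d m) 0 (gibbs (T.region 0) (T.measurable_tileWeight 0) ∘ₘ lift μ) := by
    have h1 := T.law_map_congr (measurable_localize (box d m) 0) hdep
      (Z := Set.univ) (Z' := {0}) (fun x hx => by
        simp only [Set.mem_univ, Set.mem_singleton_iff, true_iff]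
        rw [tileIndex_eq_iff hm, tile_zero]
        exact hx) (lift μ)
    have h2 := hT.law_insert hd hgood (Z := ∅) (z := 0) (Set.notMem_empty _)
    rw [insert_empty_eq, T.law_empty] at h2
    unfold blockLaw
    rw [h1, h2]
  have hbase := hμ.klDiv_resample_le I hd hL hT
  rw [hlaw] at hbase
  have hc := I.extBound_nonneg (box d m)
  have hle : gibbs (T.region 0) (T.measurable_tileWeight 0) ∘ₘ lift μ ≤
      ENNReal.ofReal (Real.exp (2 * I.extBound (box d m))) •
        (gibbs V (I.measurable_fullWeight V) ∘ₘ lift μ) := by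
    refine Measure.le_iff.2 fun A hA => ?_
    rw [Measure.smul_apply, smul_eq_mul, Measure.bind_apply hA (Kernel.measurable _).aemeasurable,
      Measure.bind_apply hA (Kernel.measurable _).aemeasurable,
      ← lintegral_const_mul _ (Kernel.measurable_coe _ hA)]
    refine lintegral_mono_ae ?_
    filter_upwards [hgood] with φ hφ
    have hn := hT.normalizable hd hφ 0
    have hwm := T.measurable_tileWeight 0
    have hw := hT.tileWeight_eq 0
    rw [gibbs_apply, gibbs_apply]
    rw [hw, hreg, tile_zero] at hn ⊢
    rw [hw, hreg, tile_zero] at hwm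
    have h := gibbsLaw_le_of_weight_le hwm (I.measurable_fullWeight V) (c := I.extBound (box d m))
      (fun φ => (hV.weight_compare I (Set.subset_univ _) φ).2)
      (fun φ => (hV.weight_compare I (Set.subset_univ _) φ).1) hn (I.normalizable_of_good hd hφ V)
    exact h A
  have hle' : blockLaw (box d m) 0 (gibbs (T.region 0) (T.measurable_tileWeight 0) ∘ₘ lift μ) ≤
      ENNReal.ofReal (Real.exp (2 * I.extBound (box d m))) •
        blockLaw (box d m) 0 (gibbs V (I.measurable_fullWeight V) ∘ₘ lift μ) := by
    unfold blockLaw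
    rw [← Measure.map_smul]
    exact Measure.map_mono hle (measurable_localize _ _)
  have h := klDiv_le_of_le_smul (by positivity) hle' hbase
  refine h.trans_eq (congrArg _ (by ring))

/-- The divergence of the minimizer from its resampled version `Q` is of smaller order than the
number of disjoint translates of `Λ` that fit into `V`, so revealing the heights on some translate
adds at most `ε`. Consistency makes `Q` invariant under the Gibbs kernel of this translate. Shifting
it back to `Λ` and pinning at `o` produces `P`. -/
theorem exists_approximation (hd : 0 < d) (hL : L.FiniteIndex) {Λ : Finset (Site d)}
    (F : Finset (Site d)) {o : Site d} (ho : o ∉ Λ) {ε : ℝ} (hε : 0 < ε) :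
    ∃ S : Finset (Site d), o ∈ S ∧ Disjoint S Λ ∧ F \ Λ ⊆ S ∧
      ∃ P : Measure (HeightFn d k), IsProbabilityMeasure P ∧
        gibbs Λ (I.measurable_fullWeight Λ) ∘ₘ P = P ∧ (∀ᵐ φ ∂P, φ ∈ I.Good) ∧
        (∀ᵐ φ ∂P, φ o = 0) ∧
        klDiv (blockLaw (S ∪ Λ) o (lift μ)) (blockLaw (S ∪ Λ) o P) ≠ ∞ ∧
        klDiv (blockLaw (S ∪ Λ) o (lift μ)) (blockLaw (S ∪ Λ) o P) ≤
          klDiv (blockLaw S o (lift μ)) (blockLaw S o P) + ENNReal.ofReal ε := by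
  have hprob := hμ.isProbabilityMeasure_lift
  have hgood := hμ.ae_good I hd hL
  obtain ⟨s, _, hs⟩ := I.exists_collar_width hL
  obtain ⟨n₀, hn₀⟩ := exists_translate_subset_box hL (insert o (F ∪ Λ))
  have hidx : 0 < L.index := Nat.pos_of_ne_zero hL.index_ne_zero
  -- The cell side `p` is a multiple of the index, at least the collar width `s`, and large enough
  -- for a cell to contain a translate of `Λ`, `F` and `o`.
  obtain ⟨p, hp, hpL, hsp, hnp⟩ : ∃ p : ℕ, 0 < p ∧ L.index ∣ p ∧ s ≤ p ∧ n₀ ≤ p :=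
    ⟨L.index * (s + n₀ + 1), by positivity, dvd_mul_right _ _,
      le_trans (by omega) (Nat.le_mul_of_pos_left (s + n₀ + 1) hidx),
      le_trans (by omega) (Nat.le_mul_of_pos_left (s + n₀ + 1) hidx)⟩
  obtain ⟨v₀, hv₀, hsub⟩ := hn₀ p hnp
  -- The exterior bound of the box is of smaller order than its volume, which is comparable to the
  -- number `n ^ d` of cells since `N + 3 ≤ 3 * (N + 1)`.
  obtain ⟨n, hn⟩ : ∃ n : ℕ, 6 * I.extBound (box d (p * (n + 2))) < (n : ℝ) ^ d * ε := by
    have h := (I.tendsto_extBound_box hd).eventually_lt_const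
      (show (0 : ℝ) < ε / (6 * (3 * p) ^ d) by positivity)
    obtain ⟨N, hN⟩ := eventually_atTop.1 h
    refine ⟨N + 1, ?_⟩
    have hNle : N ≤ p * (N + 1 + 2) := le_trans (by omega) (Nat.le_mul_of_pos_left _ hp)
    have h1 := hN _ hNle
    have hpos : (0 : ℝ) < ((p * (N + 1 + 2) : ℕ) : ℝ) ^ d := by positivity
    rw [div_lt_iff₀ hpos] at h1
    have h2 : ((p * (N + 1 + 2) : ℕ) : ℝ) ^ d ≤ (3 * p) ^ d * ((N + 1 : ℕ) : ℝ) ^ d := by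
      rw [← mul_pow]
      refine pow_le_pow_left₀ (by positivity) ?_ d
      have : (0 : ℝ) ≤ (N : ℝ) * p := by positivity
      push_cast
      nlinarith
    calc 6 * I.extBound (box d (p * (N + 1 + 2)))
        < 6 * (ε / (6 * (3 * p) ^ d) * ((p * (N + 1 + 2) : ℕ) : ℝ) ^ d) := by linarith
      _ ≤ 6 * (ε / (6 * (3 * p) ^ d) * ((3 * p) ^ d * ((N + 1 : ℕ) : ℝ) ^ d)) := by gcongr
      _ = _ := by field_simp
  set m := p * (n + 2) with hm_def
  have hm : 0 < m := by positivity
  have hp' : (0 : ℤ) < p := by exact_mod_cast hp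
  -- The resampled region is the box without a layer of one cell along its boundary. This layer
  -- contains `0` and the collar.
  set V : Finset (Site d) := (box d m).filter fun x => ∀ i, (p : ℤ) ≤ x i ∧ x i < p * (n + 1)
    with hV_def
  have h0 : (0 : Site d) ∉ V := by
    intro h
    have := ((Finset.mem_filter.1 h).2 ⟨0, hd⟩).1
    simp only [Pi.zero_apply] at this
    omega
  have hcol : I.Collar V (box d m) := by
    refine hs V _ fun y hy => ?_
    obtain ⟨x, hx, hxy⟩ := mem_thicken.1 hy
    rw [mem_box]
    intro i
    have h1 := (Finset.mem_filter.1 hx).2 i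
    have h2 := abs_le.1 (hxy i)
    have h3 : (s : ℤ) ≤ p := by exact_mod_cast hsp
    have h4 : ((m : ℕ) : ℤ) = p * (n + 1) + p := by rw [hm_def]; push_cast; ring
    rw [h4]
    constructor <;> linarith [h1.1, h1.2, h2.1, h2.2]
  set Q := gibbs V (I.measurable_fullWeight V) ∘ₘ lift μ with hQ_def
  have hQgood : ∀ᵐ φ ∂Q, φ ∈ I.Good := by
    refine (Measure.ae_comp_iff I.measurableSet_good).2 ?_
    exact (hμ.regular I hL).ae_ae_good I hd hL V
  -- The cells in `V` have indices from `1` to `n` in each coordinate, hence `z + 1` for `z` in the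
  -- box of side `n`.
  set v : Site d → Site d := fun z => corner p (z + 1) + v₀ with hv_def
  have hvL : ∀ z, v z ∈ L := fun z => L.add_mem (corner_mem hpL _) hv₀
  set G : Site d → Finset (Site d) := fun z => translateSet (v z) (insert o (F ∪ Λ)) with hG_def
  have hGtile : ∀ z, G z ⊆ tile p (z + 1) := by
    intro z x hx
    rw [hG_def] at hx
    simp only [hv_def] at hx
    rw [← translateSet_translateSet] at hx
    rw [tile, mem_translateSet]
    exact hsub (mem_translateSet.1 hx)
  have hGV : ∀ z ∈ box d n, G z ⊆ V := by
    intro z hz x hx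
    have h1 := mem_tile.1 (hGtile z hx)
    have h2 := mem_box.1 hz
    have key : ∀ i, (p : ℤ) ≤ x i ∧ x i < p * (n + 1) := by
      intro i
      have h3 := h1 i
      have h4 := h2 i
      simp only [Pi.add_apply, Pi.one_apply] at h3
      have h5 : (0 : ℤ) ≤ p * z i := mul_nonneg hp'.le h4.1
      have h6 : (p : ℤ) * (z i + 1) ≤ p * n := mul_le_mul_of_nonneg_left (by linarith [h4.2]) hp'.le
      constructor <;> linarith [h3.1, h3.2]
    refine Finset.mem_filter.2 ⟨mem_box.2 fun i => ⟨by linarith [(key i).1], ?_⟩, key⟩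
    have h4 : ((m : ℕ) : ℤ) = p * (n + 1) + p := by rw [hm_def]; push_cast; ring
    linarith [(key i).2]
  have hΛG : ∀ z, translateSet (v z) Λ ⊆ G z := by
    intro z x hx
    rw [mem_translateSet] at hx ⊢
    exact Finset.mem_insert_of_mem (Finset.mem_union_right _ hx)
  have hVbox : V ⊆ box d m := Finset.filter_subset _ _
  have hTbox : {0} ∪ (box d n).biUnion G ⊆ box d m :=
    Finset.union_subset (Finset.singleton_subset_iff.2 (zero_mem_box hm))
      (Finset.biUnion_subset.2 fun z hz => (hGV z hz).trans hVbox)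
  -- The set function is the divergence of the height differences in a block. The blocks grow from
  -- `{0}` by translates of the neighbourhood of `Λ`, and the increments in question belong to the
  -- translates of `Λ`.
  obtain ⟨Z, hZ, z, hz, hzZ, hK⟩ := exists_small_increment
    (fun T => klDiv (blockLaw T 0 (lift μ)) (blockLaw T 0 Q)) {0} G
    (fun z => translateSet (v z) Λ) (box d n)
    (fun S T h1 h2 _ => klDiv_blockLaw_mono h2 (h1 (Finset.mem_singleton_self 0)))
    (fun z hz => ⟨by
      rw [Finset.disjoint_singleton_right]
      exact fun h => h0 (hGV z hz (hΛG z h)), fun z' _ hne =>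
      (tile_disjoint hp (fun h => hne (add_right_cancel h).symm)).mono
        ((hΛG z).trans (hGtile z)) (hGtile z')⟩)
    (ε := ENNReal.ofReal ε) (by
      refine ((klDiv_blockLaw_mono hTbox (Finset.mem_union_left _
        (Finset.mem_singleton_self 0))).trans
        (hμ.klDiv_gibbs_le I hd hL hm (hpL.mul_right _) h0 hcol)).trans_lt ?_
      rw [card_box, Nat.cast_pow, ← ENNReal.ofReal_natCast, ← ENNReal.ofReal_pow (by positivity),
        ← ENNReal.ofReal_mul (by positivity)]
      exact (ENNReal.ofReal_lt_ofReal_iff_of_nonneg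
        (mul_nonneg (by norm_num) (I.extBound_nonneg _))).2 hn)
  set T := {0} ∪ (insert z Z).biUnion G with hT_def
  have hGT : G z ⊆ T := fun x hx => Finset.mem_union_right _
    (Finset.mem_biUnion.2 ⟨z, Finset.mem_insert_self _ _, hx⟩)
  have hTbox' : T ⊆ box d m := (Finset.union_subset_union_right
    (Finset.biUnion_subset_biUnion_of_subset_left _ (Finset.insert_subset hz hZ))).trans hTbox
  have h0A : (0 : Site d) ∉ translateSet (v z) Λ := fun h => h0 (hGV z hz (hΛG z h))
  have h0T : (0 : Site d) ∈ T := Finset.mem_union_left _ (Finset.mem_singleton_self 0)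
  -- Everything revealed so far except the chosen translate of `Λ`, moved so that this translate
  -- becomes `Λ` itself.
  set S := translateSet (-v z) (T \ translateSet (v z) Λ) with hS_def
  have hmemS : ∀ x, x ∈ S ↔ x + v z ∈ T ∧ x ∉ Λ := by
    intro x
    rw [hS_def, mem_translateSet, sub_neg_eq_add, Finset.mem_sdiff, mem_translateSet,
      add_sub_cancel_right]
  have hin : ∀ x ∈ insert o (F ∪ Λ), x + v z ∈ T := fun x hx => hGT (by
    rw [hG_def]
    simp only
    rwa [mem_translateSet, add_sub_cancel_right])
  have hoS : o ∈ S := (hmemS o).2 ⟨hin o (Finset.mem_insert_self _ _), ho⟩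
  have hvS : translateSet (v z) S = T \ translateSet (v z) Λ := by
    rw [hS_def, translateSet_translateSet, add_neg_cancel, translateSet_zero]
  have hvT : translateSet (v z) (S ∪ Λ) = T := by
    have : translateSet (v z) (S ∪ Λ) = translateSet (v z) S ∪ translateSet (v z) Λ := by
      ext x; simp [mem_translateSet]
    rw [this, hvS, Finset.sdiff_union_of_subset ((hΛG z).trans hGT)]
  have hshiftGood : ∀ᵐ φ ∂(Q.map (shift (v z))), φ ∈ I.Good := by
    rw [ae_map_iff (p := fun φ => φ ∈ I.Good) (measurable_shift _).aemeasurable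
      I.measurableSet_good]
    filter_upwards [hQgood] with φ hφ using I.shift_mem_good (hvL z) hφ
  have hQinv : gibbs Λ (I.measurable_fullWeight Λ) ∘ₘ Q.map (shift (v z)) =
      Q.map (shift (v z)) := by
    refine comp_map_eq_of_comp_eq (measurable_shift _)
      (κ := gibbs (translateSet (v z) Λ) (I.measurable_fullWeight _))
      (ae_of_all _ fun φ => ?_)
      (I.gibbs_comp_gibbs_of_subset hd ((hΛG z).trans (hGV z hz)) hgood)
    rw [gibbs_apply, gibbs_apply, I.gibbsLaw_shift (hvL z)]
  have hprobS : IsProbabilityMeasure (Q.map (shift (v z))) :=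
    Measure.isProbabilityMeasure_map (measurable_shift _).aemeasurable
  have hkl : ∀ U : Finset (Site d), o ∈ U → 0 ∈ translateSet (v z) U →
      klDiv (blockLaw U o (lift μ)) (blockLaw U o ((Q.map (shift (v z))).map (recenter o))) =
      klDiv (blockLaw (translateSet (v z) U) 0 (lift μ))
        (blockLaw (translateSet (v z) U) 0 Q) := by
    intro U hoU h0U
    rw [blockLaw_map_recenter, klDiv_blockLaw_shift hμ.isGradInvariant (hvL z) hoU h0U]
  refine ⟨S, hoS, Finset.disjoint_left.2 fun x hx => ((hmemS x).1 hx).2, fun x hx => ?_,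
    (Q.map (shift (v z))).map (recenter o),
    Measure.isProbabilityMeasure_map (measurable_recenter o).aemeasurable, ?_, ?_, ?_, ?_, ?_⟩
  · rw [Finset.mem_sdiff] at hx
    exact (hmemS x).2 ⟨hin x (Finset.mem_insert_of_mem (Finset.mem_union_left _ hx.1)), hx.2⟩
  · refine comp_map_eq_of_comp_eq (measurable_recenter o) ?_ hQinv
    filter_upwards [hshiftGood] with φ hφ
    rw [gibbs_apply, gibbs_apply, I.gibbsLaw_recenter hd ho hφ]
  · rw [ae_map_iff (p := fun φ => φ ∈ I.Good) (measurable_recenter o).aemeasurable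
      I.measurableSet_good]
    filter_upwards [hshiftGood] with φ hφ using (I.recenter_mem_good o).2 hφ
  · have hms : MeasurableSet {φ : HeightFn d k | φ o = 0} :=
      measurable_pi_apply o (measurableSet_singleton 0)
    rw [ae_map_iff (p := fun φ => φ o = 0) (measurable_recenter o).aemeasurable hms]
    exact ae_of_all _ fun φ => sub_self _
  · rw [hkl _ (Finset.mem_union_left _ hoS) (by rwa [hvT]), hvT]
    exact ((klDiv_blockLaw_mono hTbox' h0T).trans
        (hμ.klDiv_gibbs_le I hd hL hm (hpL.mul_right _) h0 hcol)).trans_lt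
          ENNReal.ofReal_lt_top |>.ne
  · rw [hkl _ (Finset.mem_union_left _ hoS) (by rwa [hvT]), hvT,
      hkl _ hoS (by rw [hvS]; exact Finset.mem_sdiff.2 ⟨h0T, h0A⟩), hvS]
    exact hK

end IsMinimizer

end Approximation

/-! ### Conditional laws of a minimizer and mixtures of local Gibbs measures. -/

section KernelApproximation

open ProbabilityTheory InformationTheory

variable {d : ℕ} {k : HeightKind}

/-- The heights on `Λ` relative to the height at `o`. -/
def relHeights (Λ : Finset (Site d)) (o : Site d) (φ : HeightFn d k) : Λ → k.E :=
  fun x => φ x - φ o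

theorem measurable_relHeights (Λ : Finset (Site d)) (o : Site d) :
    Measurable (relHeights (k := k) Λ o) :=
  measurable_pi_iff.2 fun _ => (measurable_pi_apply _).sub (measurable_pi_apply _)

theorem isGrad_relHeights (Λ : Finset (Site d)) (o : Site d) :
    IsGrad (relHeights (k := k) Λ o) := by
  intro φ c
  funext x
  simp [relHeights]

theorem patch_restrict_of_eq_off {Λ : Finset (Site d)} {φ φ' : HeightFn d k}
    (h : ∀ x ∉ Λ, φ' x = φ x) : patch Λ φ (Λ.restrict φ') = φ' := by
  funext x
  by_cases hx : x ∈ Λ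
  · rw [patch_of_mem _ _ hx]; rfl
  · rw [patch_of_notMem _ _ hx, h x hx]

/-- The pair is a recoding of the height differences in `S ∪ Λ` that separates the two sets, so that
the chain rule can isolate the conditional law on `Λ` given `S`. -/
theorem klDiv_blockLaw_eq_joint {M P : Measure (HeightFn d k)} [IsProbabilityMeasure M]
    [IsProbabilityMeasure P] {S Λ : Finset (Site d)} (h : Disjoint S Λ) (o : Site d) :
    klDiv (M.map fun φ => (localize S o φ, relHeights Λ o φ))
      (P.map fun φ => (localize S o φ, relHeights Λ o φ)) =
      klDiv (blockLaw (S ∪ Λ) o M) (blockLaw (S ∪ Λ) o P) := by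
  have hf : Measurable fun φ : HeightFn d k => (clear Λ φ, Λ.restrict φ) :=
    (measurable_clear Λ).prodMk (Finset.measurable_restrict Λ)
  have hg : Measurable fun p : HeightFn d k × (Λ → k.E) => patch Λ p.1 p.2 := measurable_patch Λ
  have hgf : ∀ N : Measure (HeightFn d k), (N.map fun φ => (clear Λ φ, Λ.restrict φ)).map
      (fun p : HeightFn d k × (Λ → k.E) => patch Λ p.1 p.2) = N := by
    intro N
    rw [Measure.map_map hg hf]
    have : ((fun p : HeightFn d k × (Λ → k.E) => patch Λ p.1 p.2) ∘
        fun φ => (clear Λ φ, Λ.restrict φ)) = id := by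
      funext φ
      exact patch_restrict_of_eq_off fun x hx => (clear_of_notMem φ hx).symm
    rw [this, Measure.map_id]
  rw [← klDiv_map_eq hf hg (hgf _) (hgf _)]
  have hcomp : ∀ N : Measure (HeightFn d k), (N.map fun φ => (localize S o φ, relHeights Λ o φ)) =
      (blockLaw (S ∪ Λ) o N).map fun φ => (clear Λ φ, Λ.restrict φ) := by
    intro N
    rw [blockLaw, Measure.map_map hf (measurable_localize _ _)]
    refine congrArg (fun f => Measure.map f N) (funext fun φ => Prod.ext (funext fun x => ?_)
      (funext fun x => ?_))
    · simp only [Function.comp_apply]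
      by_cases hx : x ∈ Λ
      · rw [clear_of_mem _ hx, localize_of_notMem (Finset.disjoint_right.1 h hx)]
      · rw [clear_of_notMem _ hx]
        by_cases hS : x ∈ S
        · rw [localize_of_mem hS, localize_of_mem (Finset.mem_union_left _ hS)]
        · rw [localize_of_notMem hS, localize_of_notMem (by simp [hS, hx])]
    · simp only [Function.comp_apply, Finset.restrict]
      rw [localize_of_mem (Finset.mem_union_right _ x.2)]
      rfl
  rw [hcomp, hcomp]

/-- Conditionally on the heights on `S`, a measure preserved by a local Gibbs kernel is a mixture
of the local Gibbs measures. -/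
theorem joint_eq_compProd_mixture {P : Measure (HeightFn d k)} [IsProbabilityMeasure P]
    {S Λ : Finset (Site d)} (hSΛ : Disjoint S Λ) {o : Site d} (hoS : o ∈ S)
    {w : HeightFn d k → ℝ≥0∞} (hw : Measurable w) (hP : gibbs Λ hw ∘ₘ P = P)
    (h0 : ∀ᵐ φ ∂P, φ o = 0) :
    (P.map fun φ => (localize S o φ, relHeights Λ o φ)) = blockLaw S o P ⊗ₘ
      ((gibbs Λ hw ∘ₖ condDistrib id (localize S o) P).map Λ.restrict) := by
  have hR : Measurable (Λ.restrict : HeightFn d k → Λ → k.E) := Finset.measurable_restrict Λ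
  have hr := measurable_localize (k := k) S o
  refine Measure.ext_of_lintegral _ fun f hf => ?_
  have hjoint : (blockLaw S o P) ⊗ₘ condDistrib id (localize S o) P =
      P.map fun φ => (localize S o φ, φ) :=
    compProd_map_condDistrib measurable_id.aemeasurable
  have hin : Measurable fun p : HeightFn d k × HeightFn d k =>
      ∫⁻ φ', f (p.1, Λ.restrict φ') ∂(gibbs Λ hw p.2) := by
    have hF : Measurable fun q : (HeightFn d k × HeightFn d k) × HeightFn d k =>
        f (q.1.1, Λ.restrict q.2) :=
      hf.comp ((measurable_fst.comp measurable_fst).prodMk (hR.comp measurable_snd))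
    exact hF.lintegral_kernel_prod_right' (κ := (gibbs Λ hw).comap Prod.snd measurable_snd)
  have hloc : Measurable fun φ : HeightFn d k => f (localize S o φ, Λ.restrict φ) :=
    hf.comp (hr.prodMk hR)
  calc ∫⁻ p, f p ∂(P.map fun φ => (localize S o φ, relHeights Λ o φ))
      = ∫⁻ φ, f (localize S o φ, relHeights Λ o φ) ∂P :=
        lintegral_map hf (hr.prodMk (measurable_relHeights Λ o))
    _ = ∫⁻ φ, f (localize S o φ, Λ.restrict φ) ∂P := by
        refine lintegral_congr_ae ?_
        filter_upwards [h0] with φ hφ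
        congr 2
        funext x
        simp [relHeights, hφ]
    -- One resampling step is inserted by the invariance of `P`; it leaves the heights on `S`
    -- unchanged.
    _ = ∫⁻ φ, ∫⁻ φ', f (localize S o φ', Λ.restrict φ') ∂(gibbs Λ hw φ) ∂P := by
        conv_lhs => rw [← hP]
        rw [Measure.lintegral_bind (Kernel.measurable _).aemeasurable hloc.aemeasurable]
    _ = ∫⁻ φ, ∫⁻ φ', f (localize S o φ, Λ.restrict φ') ∂(gibbs Λ hw φ) ∂P := by
        refine lintegral_congr fun φ => lintegral_congr_ae ?_
        rw [gibbs_apply]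
        filter_upwards [ae_gibbsLaw_eq_off Λ w φ] with φ' hφ'
        rw [localize_congr hoS fun x hx => hφ' x (Finset.disjoint_left.1 hSΛ hx)]
    _ = ∫⁻ p, ∫⁻ φ', f (p.1, Λ.restrict φ') ∂(gibbs Λ hw p.2)
          ∂(P.map fun φ => (localize S o φ, φ)) :=
        (lintegral_map hin (hr.prodMk measurable_id)).symm
    _ = ∫⁻ x, ∫⁻ φ, ∫⁻ φ', f (x, Λ.restrict φ') ∂(gibbs Λ hw φ)
          ∂(condDistrib id (localize S o) P x) ∂(blockLaw S o P) := by
        rw [← hjoint, Measure.lintegral_compProd hin]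
    _ = _ := by
        rw [Measure.lintegral_compProd hf]
        refine lintegral_congr fun x => ?_
        have hfx : Measurable fun ψ => f (x, ψ) := hf.comp measurable_prodMk_left
        have hfx' : Measurable fun φ : HeightFn d k => f (x, Λ.restrict φ) := hfx.comp hR
        rw [Kernel.map_apply _ hR, lintegral_map hfx hR, Kernel.lintegral_comp _ _ _ hfx']

variable {L : AddSubgroup (Site d)} {Φ : Potential d k} (I : Interaction L Φ)

/-- Local Gibbs measures with boundary conditions that agree near `Λ` are comparable. -/
theorem Interaction.Collar.gibbsLaw_restrict_le (hd : 0 < d) {Λ W : Finset (Site d)}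
    (hcol : I.Collar Λ W) {φ φ' : HeightFn d k} (hφ : φ ∈ I.Good) (hφ' : φ' ∈ I.Good)
    (h : ∀ x ∈ W, x ∉ Λ → φ x = φ' x) :
    (gibbsLaw Λ (weight Φ (meeting Λ Set.univ)) φ).map Λ.restrict ≤
      ENNReal.ofReal (Real.exp (4 * I.extBound W)) •
        (gibbsLaw Λ (weight Φ (meeting Λ Set.univ)) φ').map Λ.restrict := by
  have hR : Measurable (Λ.restrict : HeightFn d k → Λ → k.E) := Finset.measurable_restrict Λ
  have hwm : Measurable (weight Φ (meeting Λ (W : Set (Site d)))) :=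
    I.measurable_weight (isThin_meeting _ _)
  have h1 := fun φ => (hcol.weight_compare I (Set.subset_univ _) φ).1
  have h2 := fun φ => (hcol.weight_compare I (Set.subset_univ _) φ).2
  -- Both laws are compared with the law whose weight counts only sets inside `W`, which is the same
  -- for `φ` and `φ'`. Each comparison costs `2 * I.extBound W`.
  have hle1 := gibbsLaw_le_of_weight_le (I.measurable_fullWeight Λ) hwm h1 h2
    (I.normalizable_of_good hd hφ Λ) (hcol.normalizable I hd hφ)
  have hle2 := gibbsLaw_le_of_weight_le hwm (I.measurable_fullWeight Λ) h2 h1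
    (hcol.normalizable I hd hφ') (I.normalizable_of_good hd hφ' Λ)
  have hweight : ∀ ψ : Λ → k.E, weight Φ (meeting Λ (W : Set (Site d))) (patch Λ φ ψ) =
      weight Φ (meeting Λ (W : Set (Site d))) (patch Λ φ' ψ) := by
    intro ψ
    refine I.weight_congr fun Γ hΓ x hx y hy => ?_
    have hval : ∀ z ∈ Γ, patch Λ φ ψ z = patch Λ φ' ψ z := by
      intro z hz
      by_cases hzΛ : z ∈ Λ
      · rw [patch_of_mem _ _ hzΛ, patch_of_mem _ _ hzΛ]
      · rw [patch_of_notMem _ _ hzΛ, patch_of_notMem _ _ hzΛ, h z (hΓ.1 hz) hzΛ]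
    rw [hval x hx, hval y hy]
  have heq : (gibbsLaw Λ (weight Φ (meeting Λ W)) φ).map Λ.restrict =
      (gibbsLaw Λ (weight Φ (meeting Λ W)) φ').map Λ.restrict := by
    refine Measure.ext_of_lintegral _ fun f hf => ?_
    have hfR : Measurable fun φ : HeightFn d k => f (Λ.restrict φ) := hf.comp hR
    rw [lintegral_map hf hR, lintegral_map hf hR,
      lintegral_gibbsLaw hwm hfR (hcol.normalizable I hd hφ),
      lintegral_gibbsLaw hwm hfR (hcol.normalizable I hd hφ')]
    have hres : ∀ φ (ψ : Λ → k.E), Λ.restrict (patch Λ φ ψ) = ψ := fun φ ψ =>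
      funext fun x => patch_of_mem φ ψ x.2
    simp only [refInt, hweight, hres]
  have hexp : ENNReal.ofReal (Real.exp (4 * I.extBound W)) =
      ENNReal.ofReal (Real.exp (2 * I.extBound W)) *
        ENNReal.ofReal (Real.exp (2 * I.extBound W)) := by
    rw [← ENNReal.ofReal_mul (Real.exp_nonneg _), ← Real.exp_add]
    congr 2; ring
  refine (Measure.map_mono hle1 hR).trans ?_
  rw [Measure.map_smul, heq, hexp, ← smul_smul]
  refine Measure.le_iff.2 fun A hA => ?_
  have h3 := Measure.map_mono hle2 hR A
  rw [Measure.map_smul] at h3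
  simp only [Measure.smul_apply, smul_eq_mul] at h3 ⊢
  gcongr

/-- The mixtures of local Gibbs measures with boundary conditions prescribed by a gradient
measure on `S`. -/
theorem ae_mixture_patch_good (hd : 0 < d) {Λ S W : Finset (Site d)} (hcol : I.Collar Λ W)
    (hWS : W \ Λ ⊆ S) {ν : Measure (HeightFn d k)} [IsProbabilityMeasure ν] {x : HeightFn d k}
    (hS : ∀ᵐ φ ∂ν, ∀ y ∈ S, φ y = x y) (hgood : ∀ᵐ φ ∂ν, φ ∈ I.Good)
    (hgg : ∀ᵐ φ ∂ν, ∀ᵐ φ' ∂(gibbs Λ (I.measurable_fullWeight Λ) φ), φ' ∈ I.Good) :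
    ∀ᵐ ψ ∂((gibbs Λ (I.measurable_fullWeight Λ) ∘ₘ ν).map Λ.restrict),
      ∀ᵐ φ ∂ν, patch Λ φ ψ ∈ I.Good := by
  have hR : Measurable (Λ.restrict : HeightFn d k → Λ → k.E) := Finset.measurable_restrict Λ
  have hprob : IsProbabilityMeasure
      ((gibbs Λ (I.measurable_fullWeight Λ) ∘ₘ ν).map Λ.restrict) :=
    Measure.isProbabilityMeasure_map hR.aemeasurable
  have hset : MeasurableSet {p : HeightFn d k × (Λ → k.E) | patch Λ p.1 p.2 ∈ I.Good} :=
    measurable_patch Λ I.measurableSet_good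
  -- After the exchange of quantifiers the boundary condition `φ` is fixed, and the heights on `Λ`
  -- come from the mixture. Each component of the mixture agrees with `φ` on the collar, so its law
  -- on `Λ` is absolutely continuous with respect to that for `φ`, under which the patched function
  -- is almost surely admissible.
  refine (Measure.ae_ae_comm hset).1 ?_
  filter_upwards [hS, hgood, hgg] with φ h1 h2 h3
  have hset' : MeasurableSet {ψ : Λ → k.E | patch Λ φ ψ ∈ I.Good} :=
    measurable_patch_right Λ φ I.measurableSet_good
  rw [ae_map_iff (p := fun ψ => patch Λ φ ψ ∈ I.Good) hR.aemeasurable hset']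
  have hset'' : MeasurableSet {φ₁ : HeightFn d k | patch Λ φ (Λ.restrict φ₁) ∈ I.Good} :=
    ((measurable_patch_right Λ φ).comp hR) I.measurableSet_good
  refine (Measure.ae_comp_iff (p := fun φ₁ : HeightFn d k => patch Λ φ (Λ.restrict φ₁) ∈ I.Good)
    hset'').2 ?_
  filter_upwards [hS, hgood] with φ' h1' h2'
  rw [gibbs_apply]
  have hle := hcol.gibbsLaw_restrict_le I hd h2' h2 (fun y hy hyΛ => by
    rw [h1 y (hWS (Finset.mem_sdiff.2 ⟨hy, hyΛ⟩)), h1' y (hWS (Finset.mem_sdiff.2 ⟨hy, hyΛ⟩))])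
  have hac := (Measure.absolutelyContinuous_of_le_smul hle).ae_le
  rw [gibbs_apply] at h3
  have h4 : ∀ᵐ ψ ∂((gibbsLaw Λ (weight Φ (meeting Λ Set.univ)) φ).map Λ.restrict),
      patch Λ φ ψ ∈ I.Good := by
    rw [ae_map_iff (p := fun ψ => patch Λ φ ψ ∈ I.Good) hR.aemeasurable hset']
    filter_upwards [h3, ae_gibbsLaw_eq_off Λ _ φ] with φ₃ h5 h6
    rwa [patch_restrict_of_eq_off h6]
  have h5 : ∀ᵐ ψ ∂((gibbsLaw Λ (weight Φ (meeting Λ Set.univ)) φ').map Λ.restrict),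
      patch Λ φ ψ ∈ I.Good := hac h4
  exact (ae_map_iff (p := fun ψ => patch Λ φ ψ ∈ I.Good) hR.aemeasurable hset').1 h5

/-- The conclusion of the approximation: near `Λ`, the conditional laws of a minimizer are close
to mixtures of local Gibbs measures with admissible boundary conditions. -/
theorem IsMinimizer.exists_kernel_approximation {μ : Measure[gradSigma d k] (HeightFn d k)}
    [hprob : IsProbabilityMeasure (lift μ)] (hμ : IsMinimizer L Φ μ) (hd : 0 < d) (hL : L.FiniteIndex) {Λ : Finset (Site d)}
    (F : Finset (Site d)) {o : Site d} (ho : o ∉ Λ) {δ : ℝ} (hδ : 0 < δ) :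
    ∃ S : Finset (Site d), o ∈ S ∧ Disjoint S Λ ∧ F \ Λ ⊆ S ∧
      ∃ ν : Kernel (HeightFn d k) (HeightFn d k), IsMarkovKernel ν ∧
        (∀ᵐ φ ∂(lift μ), ∀ᵐ φ' ∂(ν (localize S o φ)), (∀ y ∈ S, φ' y = φ y - φ o) ∧
          φ' ∈ I.Good ∧ patch Λ φ' (relHeights Λ o φ) ∈ I.Good) ∧
        ∀ D : Set (Λ → k.E), MeasurableSet D →
          ∫⁻ φ, ENNReal.ofReal
            |(condDistrib (relHeights Λ o) (localize S o) (lift μ) (localize S o φ)).real D -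
              ((gibbs Λ (I.measurable_fullWeight Λ) ∘ₘ ν (localize S o φ)).map
                Λ.restrict).real D| ∂(lift μ) ≤ ENNReal.ofReal δ := by
  obtain ⟨s, _, hs⟩ := I.exists_collar_width hL
  have hcol : I.Collar Λ (thicken s Λ) := hs _ _ subset_rfl
  obtain ⟨S, hoS, hSΛ, hFS, P, hPp, hPinv, hPgood, hP0, hne, hle⟩ :=
    -- With `a = 4 / δ` in the estimate below, `2 * (a * (δ ^ 2 / 16) + a⁻¹) = δ`. Adding the collar
    -- of `Λ` to `F` makes `S` contain it.
    hμ.exists_approximation I hd hL (F ∪ thicken s Λ) ho (ε := δ ^ 2 / 16) (by positivity)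
  have hr := measurable_localize (k := k) S o
  have hR : Measurable (Λ.restrict : HeightFn d k → Λ → k.E) := Finset.measurable_restrict Λ
  have hY := measurable_relHeights (k := k) Λ o
  set γ := gibbs Λ (I.measurable_fullWeight Λ) with hγ
  set ν := condDistrib id (localize S o) P with hν
  set M := lift μ with hM
  have hlawM : (M.map fun φ => (localize S o φ, relHeights Λ o φ)) =
      blockLaw S o M ⊗ₘ condDistrib (relHeights Λ o) (localize S o) M :=
    (compProd_map_condDistrib hY.aemeasurable).symm
  have hlawP := joint_eq_compProd_mixture hSΛ hoS (I.measurable_fullWeight Λ) hPinv hP0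
  rw [← klDiv_blockLaw_eq_joint hSΛ] at hne hle
  have hMarkov : IsMarkovKernel ((γ ∘ₖ ν).map (Λ.restrict : HeightFn d k → Λ → k.E)) :=
    Kernel.IsMarkovKernel.map _ hR
  rw [hlawM, hlawP] at hne hle
  rw [klDiv_compProd_eq_add] at hle
  have hne1 : klDiv (blockLaw S o M) (blockLaw S o P) ≠ ∞ := fun h => by
    rw [klDiv_compProd_eq_add, h, top_add] at hne
    exact hne rfl
  -- The marginal divergence on `S` is finite and cancels; what remains is the divergence of the
  -- conditional laws, averaged over `lift μ`.
  have hkl := (ENNReal.add_le_add_iff_left hne1).1 hle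
  have hac := (klDiv_ne_top_iff.1 hne).1
  rw [← hlawM, ← hlawP] at hac
  have hac1 := (klDiv_ne_top_iff.1 hne1).1
  refine ⟨S, hoS, hSΛ, fun x hx => hFS ?_, ν, inferInstance, ?_, fun D hD => ?_⟩
  · rw [Finset.mem_sdiff] at hx ⊢
    exact ⟨Finset.mem_union_left _ hx.1, hx.2⟩
  · have hPgg : ∀ᵐ φ ∂P, ∀ᵐ φ' ∂(γ φ), φ' ∈ I.Good := by
      refine (Measure.ae_comp_iff (p := fun φ => φ ∈ I.Good) I.measurableSet_good).1 ?_
      rwa [hPinv]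
    have hprops : ∀ᵐ x ∂(blockLaw S o P), ∀ᵐ φ ∂(ν x), (∀ y ∈ S, φ y = x y) ∧
        φ ∈ I.Good ∧ ∀ᵐ φ' ∂(γ φ), φ' ∈ I.Good := by
      have hjoint : (blockLaw S o P) ⊗ₘ ν = P.map fun φ => (localize S o φ, φ) :=
        compProd_map_condDistrib measurable_id.aemeasurable
      have : ∀ᵐ p ∂((blockLaw S o P) ⊗ₘ ν), (∀ y ∈ S, p.2 y = p.1 y) ∧
          p.2 ∈ I.Good ∧ ∀ᵐ φ' ∂(γ p.2), φ' ∈ I.Good := by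
        have hm1 : MeasurableSet {p : HeightFn d k × HeightFn d k | ∀ y ∈ S, p.2 y = p.1 y} := by
          have : {p : HeightFn d k × HeightFn d k | ∀ y ∈ S, p.2 y = p.1 y} =
            ⋂ y ∈ S, {p | p.2 y = p.1 y} := by ext; simp
          rw [this]
          exact Finset.measurableSet_biInter S fun y _ => measurableSet_eq_fun
            ((measurable_pi_apply y).comp measurable_snd)
            ((measurable_pi_apply y).comp measurable_fst)
        have hm2 : MeasurableSet {φ : HeightFn d k | ∀ᵐ φ' ∂(γ φ), φ' ∈ I.Good} :=
          measurableSet_eq_fun (γ.measurable_coe I.measurableSet_good.compl) measurable_const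
        have hm : MeasurableSet {p : HeightFn d k × HeightFn d k | (∀ y ∈ S, p.2 y = p.1 y) ∧
            p.2 ∈ I.Good ∧ ∀ᵐ φ' ∂(γ p.2), φ' ∈ I.Good} :=
          hm1.inter ((measurable_snd I.measurableSet_good).inter (measurable_snd hm2))
        have hrid : Measurable fun φ : HeightFn d k => (localize S o φ, φ) :=
          hr.prodMk measurable_id
        rw [hjoint]
        refine (ae_map_iff hrid.aemeasurable hm).2 ?_
        filter_upwards [hP0, hPgood, hPgg] with φ h1 h2 h3
        refine ⟨fun y hy => ?_, h2, h3⟩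
        rw [localize_of_mem hy, h1, sub_zero]
      exact Measure.ae_ae_of_ae_compProd this
    have hpm : MeasurableSet {p : HeightFn d k × (Λ → k.E) |
        ∀ᵐ φ' ∂(ν p.1), patch Λ φ' p.2 ∈ I.Good} := by
      have ht : MeasurableSet {q : (HeightFn d k × (Λ → k.E)) × HeightFn d k |
          patch Λ q.2 q.1.2 ∉ I.Good} :=
        ((measurable_patch Λ).comp (measurable_snd.prodMk (measurable_snd.comp measurable_fst)))
          I.measurableSet_good.compl
      exact measurableSet_eq_fun (Kernel.measurable_kernel_prodMk_left
        (κ := ν.comap Prod.fst measurable_fst) ht) measurable_const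
    have hP1 : ∀ᵐ p ∂(P.map fun φ => (localize S o φ, relHeights Λ o φ)),
        ∀ᵐ φ' ∂(ν p.1), patch Λ φ' p.2 ∈ I.Good := by
      rw [hlawP]
      refine (Measure.ae_compProd_iff hpm).2 ?_
      filter_upwards [hprops] with x hx
      rw [Kernel.map_apply _ hR, Kernel.comp_apply]
      exact ae_mixture_patch_good I hd hcol (fun y hy => hFS (by
        rw [Finset.mem_sdiff] at hy ⊢
        exact ⟨Finset.mem_union_right _ hy.1, hy.2⟩)) (hx.mono fun φ h => h.1)
        (hx.mono fun φ h => h.2.1) (hx.mono fun φ h => h.2.2)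
    -- The almost sure properties hold under `P`. Finite divergence makes the law under the
    -- minimizer absolutely continuous, so they transfer to it.
    filter_upwards [ae_of_ae_map (hr.prodMk hY).aemeasurable (hac.ae_le hP1),
      ae_of_ae_map hr.aemeasurable (hac1.ae_le hprops)] with φ h1 h2
    filter_upwards [h1, h2] with φ' h3 h4
    exact ⟨fun y hy => by rw [h4.1 y hy, localize_of_mem hy], h4.2.1, h3⟩
  · have h := lintegral_abs_sub_le_of_klDiv (a := 4 / δ) (by positivity) (by positivity) hkl
      (MeasurableSet.univ.prod hD)
    have hpre : ∀ x : HeightFn d k, Prod.mk x ⁻¹' ((Set.univ : Set (HeightFn d k)) ×ˢ D) = D := by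
      intro x; ext; simp
    simp only [hpre] at h
    have hmeas : Measurable fun x => ENNReal.ofReal
        |(condDistrib (relHeights Λ o) (localize S o) M x).real D -
          ((γ ∘ₖ ν).map (Λ.restrict : HeightFn d k → Λ → k.E) x).real D| := by
      have hdiff : Measurable fun x =>
          (condDistrib (relHeights Λ o) (localize S o) M x).real D -
            ((γ ∘ₖ ν).map (Λ.restrict : HeightFn d k → Λ → k.E) x).real D :=
        (Kernel.measurable_coe _ hD).ennreal_toReal.sub
          (Kernel.measurable_coe _ hD).ennreal_toReal
      exact ENNReal.measurable_ofReal.comp (continuous_abs.measurable.comp hdiff)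
    rw [blockLaw, lintegral_map hmeas hr] at h
    simp only [Kernel.map_apply _ hR, Kernel.comp_apply] at h
    refine h.trans (ENNReal.ofReal_le_ofReal (le_of_eq ?_))
    field_simp
    ring

end KernelApproximation

/-! ### Setwise convergence, and Lévy's theorem for the heights off a finite set. -/

section Convergence

open ProbabilityTheory
open scoped symmDiff

/-- Setwise convergence on a generating algebra extends to all measurable sets for a dominated
sequence of measures. -/
theorem tendsto_measureReal_of_isSetAlgebra {Y : Type*} [m : MeasurableSpace Y]
    {𝒜 : Set (Set Y)} (h𝒜 : IsSetAlgebra 𝒜) (hgen : m = MeasurableSpace.generateFrom 𝒜)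
    {ρ : ℕ → Measure Y} {κ θ : Measure Y} [∀ n, IsFiniteMeasure (ρ n)] [IsFiniteMeasure κ]
    [IsFiniteMeasure θ] (hle : ∀ n, ρ n ≤ θ)
    (h : ∀ A ∈ 𝒜, Tendsto (fun n => (ρ n).real A) atTop (𝓝 (κ.real A))) {D : Set Y}
    (hD : MeasurableSet D) : Tendsto (fun n => (ρ n).real D) atTop (𝓝 (κ.real D)) := by
  refine Metric.tendsto_atTop.2 fun ε hε => ?_
  -- A set of the algebra approximates `D` under `θ + κ`. Domination by `θ` makes this approximation
  -- uniform along the sequence.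
  obtain ⟨A, hA, hlt⟩ := (Measure.MeasureDense.of_generateFrom_isSetAlgebra_finite
    (μ := θ + κ) h𝒜 hgen).approx D hD (measure_ne_top _ _) (ε / 3) (by positivity)
  have hAm : MeasurableSet A := hgen ▸ MeasurableSpace.measurableSet_generateFrom hA
  have hsmall : ∀ N : Measure Y, N ≤ θ + κ → IsFiniteMeasure N →
      |N.real D - N.real A| < ε / 3 := by
    intro N hN hfin
    refine (abs_measureReal_sub_le_measureReal_symmDiff hD.nullMeasurableSet
      hAm.nullMeasurableSet).trans_lt ?_
    exact (ENNReal.toReal_lt_of_lt_ofReal ((hN _).trans_lt hlt))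
  obtain ⟨n₀, hn₀⟩ := Metric.tendsto_atTop.1 (h A hA) (ε / 3) (by positivity)
  refine ⟨n₀, fun n hn => ?_⟩
  have h1 := hsmall (ρ n) ((hle n).trans (Measure.le_add_right le_rfl)) inferInstance
  have h2 := hsmall κ (Measure.le_add_left le_rfl) inferInstance
  have h3 := hn₀ n hn
  rw [Real.dist_eq] at h3 ⊢
  rw [abs_lt] at *
  constructor <;> linarith [h1.1, h1.2, h2.1, h2.2, h3.1, h3.2]

/-- The means are summable, so the series converges almost surely and its terms tend to zero. -/
theorem ae_tendsto_zero_of_lintegral_le {X : Type*} [MeasurableSpace X] {M : Measure X}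
    {f : ℕ → X → ℝ} (hf : ∀ n, Measurable (f n))
    (h : ∀ n, ∫⁻ x, ENNReal.ofReal |f n x| ∂M ≤ ENNReal.ofReal ((1 / 2) ^ n)) :
    ∀ᵐ x ∂M, Tendsto (fun n => f n x) atTop (𝓝 0) := by
  have hm : ∀ n, Measurable fun x => ENNReal.ofReal |f n x| := fun n =>
    ENNReal.measurable_ofReal.comp (continuous_abs.measurable.comp (hf n))
  have hsum : ∫⁻ x, ∑' n, ENNReal.ofReal |f n x| ∂M ≠ ∞ := by
    rw [lintegral_tsum fun n => (hm n).aemeasurable]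
    refine ne_top_of_le_ne_top ?_ (ENNReal.tsum_le_tsum h)
    rw [← ENNReal.ofReal_tsum_of_nonneg (fun n => by positivity) summable_geometric_two]
    exact ENNReal.ofReal_ne_top
  filter_upwards [ae_lt_top (Measurable.tsum hm) hsum] with x hx
  have h1 := (ENNReal.tendsto_toReal ENNReal.zero_ne_top).comp
    (ENNReal.tendsto_atTop_zero_of_tsum_ne_top hx.ne)
  rw [ENNReal.toReal_zero] at h1
  refine (tendsto_zero_iff_abs_tendsto_zero _).2 (h1.congr fun n => ?_)
  simp [ENNReal.toReal_ofReal (abs_nonneg _)]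

variable {d : ℕ} {k : HeightKind}

theorem extGradSigma_le (Λ : Finset (Site d)) : extGradSigma k Λ ≤ MeasurableSpace.pi :=
  inf_le_right.trans gradSigma_le

theorem comap_localize_le {Λ S : Finset (Site d)} (h : Disjoint S Λ) {o : Site d} (ho : o ∉ Λ) :
    MeasurableSpace.comap (localize (k := k) S o) MeasurableSpace.pi ≤ extGradSigma k Λ := by
  have hcoord : ∀ y, y ∉ Λ → Measurable[extSigma k Λ] fun φ : HeightFn d k => φ y := fun y hy =>
    Measurable.mono (comap_measurable _)
      (le_iSup₂ (f := fun (x : Site d) (_ : x ∉ Λ) =>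
        MeasurableSpace.comap (fun φ : HeightFn d k => φ x) inferInstance) y hy) le_rfl
  refine le_inf ?_ ?_
  · have hm : @Measurable _ _ (extSigma k Λ) MeasurableSpace.pi (localize (k := k) S o) := by
      refine @measurable_pi_lambda _ _ _ (extSigma k Λ) _ _ fun x => ?_
      by_cases hx : x ∈ S
      · simp only [localize_of_mem hx]
        exact (hcoord x (Finset.disjoint_left.1 h hx)).sub (hcoord o ho)
      · simp only [localize_of_notMem hx]
        exact measurable_const
    exact hm.comap_le
  · exact Measurable.comap_le ((isGrad_localize S o).measurable_gradSigma
      (measurable_localize S o))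

/-- Events in `T^∇_Λ` are determined by the recentered heights off `Λ`. -/
theorem exists_eq_preimage_clear_recenter {Λ : Finset (Site d)} {o : Site d}
    {B : Set (HeightFn d k)} (hB : MeasurableSet[extGradSigma k Λ] B) :
    ∃ B' : Set (HeightFn d k), MeasurableSet B' ∧
      B = (fun φ => clear Λ (recenter o φ)) ⁻¹' B' := by
  have hext : extSigma k Λ ≤ MeasurableSpace.comap (clear (k := k) Λ) MeasurableSpace.pi := by
    refine iSup₂_le fun x hx => ?_
    rintro _ ⟨s, hs, rfl⟩
    refine ⟨(fun φ : HeightFn d k => φ x) ⁻¹' s, measurable_pi_apply x hs, ?_⟩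
    ext φ
    simp [clear_of_notMem φ hx]
  obtain ⟨B', hB', hBB'⟩ := hext B hB.1
  refine ⟨B', hB', Set.ext fun φ => ?_⟩
  have h1 : φ ∈ B ↔ recenter o φ ∈ B := by
    rw [recenter_eq_add]
    exact (add_const_mem_iff_of_gradSigma hB.2 φ _).symm
  rw [h1, ← hBB']
  rfl

theorem measurable_clear_recenter {m : MeasurableSpace (HeightFn d k)} {Λ : Finset (Site d)}
    {o : Site d} (h : ∀ x ∉ Λ, Measurable[m] fun φ : HeightFn d k => φ x - φ o) :
    @Measurable _ _ m MeasurableSpace.pi fun φ : HeightFn d k => clear Λ (recenter o φ) := by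
  refine @measurable_pi_lambda _ _ _ m _ _ fun x => ?_
  by_cases hx : x ∈ Λ
  · simp only [clear_of_mem _ hx]
    exact measurable_const
  · simp only [clear_of_notMem _ hx]
    exact h x hx

theorem measurable_comap_localize {S : Finset (Site d)} (o : Site d) {x : Site d} (hx : x ∈ S) :
    Measurable[MeasurableSpace.comap (localize (k := k) S o) MeasurableSpace.pi]
      fun φ : HeightFn d k => φ x - φ o := by
  rintro s hs
  refine ⟨(fun φ : HeightFn d k => φ x) ⁻¹' s, measurable_pi_apply x hs, ?_⟩
  ext φ
  simp [localize_of_mem hx]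

/-- An event in `T^∇_Λ` is a function of the heights off `Λ` relative to `o`, and each of these is
visible from some `S n`. This identifies the limit σ-algebra in Lévy's theorem. -/
theorem extGradSigma_eq_iSup {Λ : Finset (Site d)} {o : Site d} (ho : o ∉ Λ)
    {S : ℕ → Finset (Site d)} (hS : ∀ n, Disjoint (S n) Λ) (hcov : ∀ x ∉ Λ, ∃ n, x ∈ S n) :
    extGradSigma k Λ =
      ⨆ n, MeasurableSpace.comap (localize (k := k) (S n) o) MeasurableSpace.pi := by
  refine le_antisymm (fun B hB => ?_) (iSup_le fun n => comap_localize_le (hS n) ho)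
  obtain ⟨B', hB', rfl⟩ := exists_eq_preimage_clear_recenter (o := o) hB
  refine measurable_clear_recenter (m := ⨆ n,
    MeasurableSpace.comap (localize (k := k) (S n) o) MeasurableSpace.pi) (fun x hx => ?_) hB'
  obtain ⟨n, hn⟩ := hcov x hx
  exact (measurable_comap_localize o hn).mono (le_iSup (fun n =>
    MeasurableSpace.comap (localize (k := k) (S n) o) MeasurableSpace.pi) n) le_rfl

theorem measurable_clear_recenter_extGradSigma {Λ : Finset (Site d)} {o : Site d} (ho : o ∉ Λ) :
    @Measurable _ _ (extGradSigma k Λ) MeasurableSpace.pi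
      fun φ : HeightFn d k => clear Λ (recenter o φ) :=
  measurable_clear_recenter fun _ hx => (measurable_comap_localize o
    (Finset.mem_singleton_self _)).mono
      (comap_localize_le (Finset.disjoint_singleton_left.2 hx) ho) le_rfl

theorem lintegral_lift_of_gradSigma (μ : Measure[gradSigma d k] (HeightFn d k))
    {f : HeightFn d k → ℝ≥0∞} (hf : Measurable[gradSigma d k] f) {B : Set (HeightFn d k)}
    (hB : MeasurableSet[gradSigma d k] B) :
    ∫⁻ φ in B, f φ ∂(lift μ) = ∫⁻ φ in B, f φ ∂μ := by
  conv_rhs => rw [← trim_lift μ]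
  exact (setLIntegral_trim gradSigma_le hf hB).symm

theorem measurableSet_relHeights (Λ : Finset (Site d)) (o : Site d) {D : Set (Λ → k.E)}
    (hD : MeasurableSet D) : MeasurableSet[gradSigma d k] (relHeights (k := k) Λ o ⁻¹' D) :=
  (isGrad_relHeights Λ o).measurable_gradSigma (measurable_relHeights Λ o) hD

namespace IsCondDistrib

variable {Λ : Finset (Site d)} {μ : Measure[gradSigma d k] (HeightFn d k)}
  {κ : HeightFn d k → Measure (HeightFn d k)} (hκ : IsCondDistrib Λ μ κ)
include hκ

theorem ae_eq_condExp [IsProbabilityMeasure (lift μ)] (o : Site d) {D : Set (Λ → k.E)}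
    (hD : MeasurableSet D) :
    (fun φ => ((κ φ).map (relHeights Λ o)).real D) =ᵐ[lift μ]
      (lift μ)⟦relHeights Λ o ⁻¹' D | extGradSigma k Λ⟧ := by
  have hY := measurable_relHeights (k := k) Λ o
  have hA := measurableSet_relHeights (k := k) Λ o hD
  have hm := hκ.measurable _ hA
  have hm' : Measurable fun φ => κ φ (relHeights Λ o ⁻¹' D) := hm.mono (extGradSigma_le Λ) le_rfl
  have heq : (fun φ => ((κ φ).map (relHeights Λ o)).real D) =
      fun φ => (κ φ (relHeights Λ o ⁻¹' D)).toReal := by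
    funext φ
    rw [measureReal_def, Measure.map_apply hY hD]
  have hlt : ∀ φ, κ φ (relHeights Λ o ⁻¹' D) ≤ 1 := fun φ => by
    have := hκ.prob φ
    exact prob_le_one
  rw [heq]
  refine ae_eq_condExp_of_forall_setIntegral_eq (extGradSigma_le Λ)
    ((integrable_const _).indicator (hY hD)) (fun s _ _ => ?_) (fun s hs _ => ?_)
    hm.ennreal_toReal.stronglyMeasurable.aestronglyMeasurable
  · refine Integrable.integrableOn (Integrable.of_bound
      hm'.ennreal_toReal.aestronglyMeasurable 1 (ae_of_all _ fun φ => ?_))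
    rw [Real.norm_eq_abs, abs_of_nonneg ENNReal.toReal_nonneg]
    exact ENNReal.toReal_mono ENNReal.one_ne_top (hlt φ)
  · rw [integral_toReal hm'.aemeasurable (ae_of_all _ fun φ => (hlt φ).trans_lt ENNReal.one_lt_top),
      lintegral_lift_of_gradSigma μ (hm.mono inf_le_right le_rfl) hs.2, hκ.cond _ _ hA hs,
      integral_indicator_const _ (hY hD), measureReal_restrict_apply (hY hD), smul_eq_mul, mul_one,
      measureReal_def, lift_apply μ (hA.inter hs.2)]

/-- The identity holds for every `φ`, not just almost every one, because a function that is
measurable with respect to `F^∇` cannot separate `φ` from its vertical translates. -/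
theorem apply_add_const {A : Set (HeightFn d k)} (hA : MeasurableSet[gradSigma d k] A)
    (φ : HeightFn d k) (c : k.E) : κ (φ + fun _ => c) A = κ φ A := by
  have hset : MeasurableSet[gradSigma d k] {φ' | κ φ' A = κ φ A} :=
    (hκ.measurable A hA).mono inf_le_right le_rfl (measurableSet_singleton (κ φ A))
  exact (add_const_mem_iff_of_gradSigma hset φ c).2 rfl

/-- Lévy's upward theorem for the filtration generated by the heights on `S n` relative to `o`. -/
theorem ae_tendsto_condDistrib [IsProbabilityMeasure (lift μ)] {o : Site d} (ho : o ∉ Λ)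
    {S : ℕ → Finset (Site d)} (hS : ∀ n, Disjoint (S n) Λ) (hoS : ∀ n, o ∈ S n)
    (hmono : Monotone S) (hcov : ∀ x ∉ Λ, ∃ n, x ∈ S n) {D : Set (Λ → k.E)}
    (hD : MeasurableSet D) :
    ∀ᵐ φ ∂(lift μ), Tendsto (fun n => (condDistrib (relHeights Λ o) (localize (S n) o) (lift μ)
      (localize (S n) o φ)).real D) atTop (𝓝 (((κ φ).map (relHeights Λ o)).real D)) := by
  let ℱ : Filtration ℕ (MeasurableSpace.pi : MeasurableSpace (HeightFn d k)) :=
    { seq := fun n => MeasurableSpace.comap (localize (S n) o) MeasurableSpace.pi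
      mono' := by
        intro m n hmn
        have hcomp : localize (k := k) (S m) o = localize (S m) o ∘ localize (S n) o :=
          funext fun φ => (localize_localize (hmono hmn) (hoS n) φ).symm
        change MeasurableSpace.comap (localize (S m) o) MeasurableSpace.pi ≤ _
        rw [hcomp, ← MeasurableSpace.comap_comp]
        exact MeasurableSpace.comap_mono (measurable_localize (S m) o).comap_le
      le' := fun n => (measurable_localize (S n) o).comap_le }
  have hlim := tendsto_ae_condExp (μ := lift μ) (ℱ := ℱ)
    ((relHeights Λ o ⁻¹' D).indicator fun _ => (1 : ℝ))
  have hsup : ⨆ n, ℱ n = extGradSigma k Λ := (extGradSigma_eq_iSup ho hS hcov).symm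
  rw [hsup] at hlim
  have hn : ∀ᵐ φ ∂(lift μ), ∀ n,
      (condDistrib (relHeights Λ o) (localize (S n) o) (lift μ) (localize (S n) o φ)).real D =
        ((lift μ)⟦relHeights Λ o ⁻¹' D | ℱ n⟧) φ :=
    ae_all_iff.2 fun n => condDistrib_ae_eq_condExp (measurable_localize (S n) o)
      (measurable_relHeights Λ o) hD
  filter_upwards [hlim, hn, hκ.ae_eq_condExp o hD] with φ h1 h2 h3
  rw [h3]
  exact h1.congr fun n => (h2 n).symm

end IsCondDistrib

end Convergence

/-! ### Limits of mixtures, and existence of conditional distributions. -/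

section LimitingMixtures

open ProbabilityTheory

variable {d : ℕ} {k : HeightKind} {L : AddSubgroup (Site d)} {Φ : Potential d k}
  (I : Interaction L Φ)

theorem localGibbs_eq_gibbsLaw {Λ : Finset (Site d)} {φ : HeightFn d k}
    (h : Normalizable Λ (weight Φ (meeting Λ Set.univ)) φ)
    (hw : Measurable (weight Φ (meeting Λ (Set.univ : Set (Site d))))) :
    localGibbs Φ Λ φ = gibbsLaw Λ (weight Φ (meeting Λ Set.univ)) φ := by
  have hwt : ∀ φ', EReal.exp (-hamiltonian Φ Λ φ') = weight Φ (meeting Λ Set.univ) φ' := fun φ' =>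
    (weight_meeting Φ Λ Set.univ φ').symm
  have hp := measurable_patch_right (k := k) Λ φ
  refine Measure.ext_of_lintegral _ fun f hf => ?_
  rw [lintegral_gibbsLaw hw hf h]
  simp only [localGibbs, partitionFn, hwt, lintegral_smul_measure, smul_eq_mul]
  have hwp : Measurable fun ψ => weight Φ (meeting Λ Set.univ) (patch Λ φ ψ) := hw.comp hp
  have hfp : Measurable fun ψ => f (patch Λ φ ψ) := hf.comp hp
  rw [lintegral_map hf hp, lintegral_withDensity_eq_lintegral_mul _ hwp hfp]
  rfl

theorem Interaction.localGibbs_eq_of_good (hd : 0 < d) {Λ : Finset (Site d)} {φ : HeightFn d k}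
    (h : φ ∈ I.Good) : localGibbs Φ Λ φ = gibbs Λ (I.measurable_fullWeight Λ) φ := by
  rw [gibbs_apply]
  exact localGibbs_eq_gibbsLaw (I.normalizable_of_good hd h Λ) (I.measurable_fullWeight Λ)

/-- Mixtures of local Gibbs measures, with boundary conditions that exhaust the complement of `Λ`,
converge setwise to elements of the set of limiting local Gibbs measures. -/
theorem Interaction.exists_mem_limitingLocalGibbs (hd : 0 < d) {Λ : Finset (Site d)} {o : Site d}
    (ho : o ∉ Λ) {φ : HeightFn d k} {N : Measure (HeightFn d k)} [IsProbabilityMeasure N]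
    (hN : ∀ᵐ ψ ∂N, ∀ x, x ∉ Λ → ψ x = φ x) {S : ℕ → Finset (Site d)} (hmono : Monotone S)
    (hcov : ∀ x ∉ Λ, ∃ n, x ∈ S n) {ν : ℕ → Measure (HeightFn d k)}
    [∀ n, IsProbabilityMeasure (ν n)]
    (hν : ∀ n, ∀ᵐ φ' ∂(ν n), (∀ y ∈ S n, φ' y = φ y - φ o) ∧ φ' ∈ I.Good ∧
      patch Λ φ' (relHeights Λ o φ) ∈ I.Good)
    (hlim : ∀ D : Set (Λ → k.E), MeasurableSet D →
      Tendsto (fun n => ((gibbs Λ (I.measurable_fullWeight Λ) ∘ₘ ν n).map Λ.restrict).real D) atTop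
        (𝓝 ((N.map (relHeights Λ o)).real D))) :
    ∃ ρ ∈ limitingLocalGibbs Φ Λ φ,
      (ρ : Measure (Λ → k.E)) = N.map (fun ψ => Λ.restrict ψ) := by
  have hR : Measurable (Λ.restrict : HeightFn d k → Λ → k.E) := Finset.measurable_restrict Λ
  have hY := measurable_relHeights (k := k) Λ o
  set γ := gibbs Λ (I.measurable_fullWeight Λ) with hγ
  set c := φ o with hc
  -- The definition of `localGibbsMixtures` prescribes the boundary condition on all of `Δ`,
  -- including `Λ`. So the heights of `φ` are inserted on `Λ`, which the Gibbs kernel ignores, and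
  -- the height of `φ` at `o` is added back.
  let b : HeightFn d k → HeightFn d k := fun φ' =>
    patch Λ φ' (relHeights Λ o φ) + fun _ => c
  have hb : Measurable b := by
    have h : Measurable fun φ' : HeightFn d k => patch Λ φ' (relHeights Λ o φ) :=
      (measurable_patch Λ).comp (measurable_prodMk_right (y := relHeights Λ o φ))
    refine measurable_pi_iff.2 fun x => ?_
    change Measurable fun φ' => patch Λ φ' (relHeights Λ o φ) x + c
    exact ((measurable_pi_apply x).comp h).add measurable_const
  have hadd : Measurable fun ψ : Λ → k.E => ψ + fun _ => c :=
    measurable_pi_iff.2 fun x => (measurable_pi_apply x).add measurable_const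
  have haddΩ : Measurable fun ψ : HeightFn d k => ψ + fun _ => c :=
    measurable_pi_iff.2 fun x => (measurable_pi_apply x).add measurable_const
  have hνb : ∀ n, IsProbabilityMeasure ((ν n).map b) := fun n =>
    Measure.isProbabilityMeasure_map hb.aemeasurable
  let ρ : ℕ → ProbabilityMeasure (Λ → k.E) := fun n =>
    ⟨(γ ∘ₘ (ν n).map b).map Λ.restrict, Measure.isProbabilityMeasure_map hR.aemeasurable⟩
  let ρ' : ProbabilityMeasure (Λ → k.E) :=
    ⟨N.map Λ.restrict, Measure.isProbabilityMeasure_map hR.aemeasurable⟩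
  have hbgood : ∀ n, ∀ᵐ ψ ∂((ν n).map b), ψ ∈ I.Good := by
    intro n
    refine (ae_map_iff (p := fun ψ => ψ ∈ I.Good) hb.aemeasurable I.measurableSet_good).2 ?_
    filter_upwards [hν n] with φ' h
    exact (I.add_const_mem_good _ c).2 h.2.2
  have hρC : ∀ n (C : Set (Λ → k.E)), MeasurableSet C → ((γ ∘ₘ (ν n).map b).map Λ.restrict) C =
      ((γ ∘ₘ ν n).map Λ.restrict) ((fun ψ => ψ + fun _ => c) ⁻¹' C) := by
    intro n C hC
    rw [Measure.map_apply hR hC, Measure.map_apply hR (hadd hC),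
      Measure.bind_apply (hR hC) γ.measurable.aemeasurable,
      Measure.bind_apply (hR (hadd hC)) γ.measurable.aemeasurable,
      lintegral_map (γ.measurable_coe (hR hC)) hb]
    refine lintegral_congr_ae ?_
    filter_upwards [hν n] with φ' h
    have h1 : γ (b φ') = (γ φ').map fun ψ => ψ + fun _ => c := by
      rw [hγ, gibbs_apply, gibbs_apply, gibbsLaw_map_add_const (I.measurable_fullWeight Λ)
        (fun φ c => I.weight_add_const _ φ c) (I.normalizable_of_good hd h.2.1 Λ)]
      refine gibbsLaw_congr fun x hx => ?_
      simp only [b, Pi.add_apply, patch_of_notMem _ _ hx]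
    rw [h1, Measure.map_apply haddΩ (hR hC)]
    rfl
  have hρ'C : ∀ C : Set (Λ → k.E), MeasurableSet C → (N.map Λ.restrict) C =
      (N.map (relHeights Λ o)) ((fun ψ => ψ + fun _ => c) ⁻¹' C) := by
    intro C hC
    rw [Measure.map_apply hR hC, Measure.map_apply hY (hadd hC)]
    refine measure_congr ?_
    filter_upwards [hN] with ψ hψ
    have : Λ.restrict ψ = relHeights Λ o ψ + fun _ => c := by
      funext x
      simp [relHeights, hψ o ho, hc]
    exact congrArg (fun η => η ∈ C) this
  have htend : @Tendsto _ _ ρ atTop (@nhds _ (strongTopology (Λ → k.E)) ρ') := by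
    rw [nhds_induced, tendsto_comap_iff, tendsto_pi_nhds]
    rintro ⟨C, hC⟩
    refine tendsto_subtype_rng.2 ?_
    have h := hlim _ (hadd hC)
    simp only [measureReal_def] at h
    rw [← hρ'C C hC] at h
    exact h.congr fun n => by rw [← hρC n C hC]; rfl
  refine ⟨ρ', Set.mem_iInter₂.2 fun Δ hΔ => ?_, rfl⟩
  let _ : TopologicalSpace (ProbabilityMeasure (Λ → k.E)) := strongTopology (Λ → k.E)
  refine mem_closure_of_tendsto htend ?_
  -- For a given `Δ` only finitely many vertices must be prescribed, so all late terms of the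
  -- sequence belong to the set whose closure is taken.
  have hev : ∀ᶠ n in atTop, ∀ x ∈ Δ, x ∉ Λ → x ∈ S n := by
    refine (Finset.eventually_all Δ).2 fun x _ => ?_
    by_cases hx : x ∈ Λ
    · exact Eventually.of_forall fun n h => absurd hx h
    · obtain ⟨n, hn⟩ := hcov x hx
      filter_upwards [eventually_ge_atTop n] with m hm _ using hmono hm hn
  filter_upwards [hev] with n hn
  refine ⟨(ν n).map b, hνb n, ?_, ?_, ?_⟩
  · filter_upwards [hbgood n] with ψ h using I.admissible_of_good hd h
  · rw [Measure.map_map (Finset.measurable_restrict Δ) hb]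
    have : ((fun ψ : HeightFn d k => Δ.restrict ψ) ∘ b) =ᵐ[ν n] fun _ => Δ.restrict φ := by
      filter_upwards [hν n] with φ' h
      funext x
      simp only [Function.comp_apply, Finset.restrict, b, Pi.add_apply]
      by_cases hx : (x : Site d) ∈ Λ
      · rw [patch_of_mem _ _ hx]
        simp [relHeights, hc]
      · rw [patch_of_notMem _ _ hx, h.1 x (hn x x.2 hx), sub_add_cancel]
    rw [Measure.map_congr this, Measure.map_const, measure_univ, one_smul]
  · refine congrArg (Measure.map Λ.restrict) ?_
    refine Measure.bind_congr_right ?_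
    filter_upwards [hbgood n] with ψ h
    exact (I.localGibbs_eq_of_good hd h).symm

/-- A regular conditional probability distribution given the heights off `Λ` exists. -/
theorem exists_isCondDistrib {μ : Measure[gradSigma d k] (HeightFn d k)}
    (hμ : IsProbabilityMeasure μ) {Λ : Finset (Site d)} {o : Site d} (ho : o ∉ Λ) :
    ∃ κ : HeightFn d k → Measure (HeightFn d k), IsCondDistrib Λ μ κ := by
  have hprob := isProbabilityMeasure_lift μ hμ
  have hY := measurable_relHeights (k := k) Λ o
  have hXe := measurable_clear_recenter_extGradSigma (k := k) ho
  set X : HeightFn d k → HeightFn d k := fun φ => clear Λ (recenter o φ) with hX_def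
  have hX : Measurable X := hXe.mono (extGradSigma_le Λ) le_rfl
  -- The heights on `Λ` relative to `o` are conditioned on the heights off `Λ` relative to `o`; a
  -- sample is then raised by `φ o` and inserted into `φ`.
  let η := condDistrib (relHeights Λ o) X (lift μ)
  have hin : ∀ φ : HeightFn d k, Measurable fun ψ : Λ → k.E => patch Λ φ (ψ + fun _ => φ o) :=
    fun φ => (measurable_patch_right Λ φ).comp
      (measurable_pi_iff.2 fun x => (measurable_pi_apply x).add measurable_const)
  have hval : ∀ A, MeasurableSet[gradSigma d k] A → ∀ φ,
      (η (X φ)).map (fun ψ => patch Λ φ (ψ + fun _ => φ o)) A =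
        η (X φ) {ψ | patch Λ (X φ) ψ ∈ A} := by
    intro A hA φ
    rw [Measure.map_apply (hin φ) (gradSigma_le A hA)]
    congr 1
    ext ψ
    have : patch Λ φ (ψ + fun _ => φ o) = patch Λ (X φ) ψ + fun _ => φ o := by
      funext x
      by_cases hx : x ∈ Λ
      · simp [patch_of_mem _ _ hx]
      · simp [patch_of_notMem _ _ hx, hX_def, clear_of_notMem _ hx, recenter]
    simp only [Set.mem_preimage, Set.mem_ofPred_eq, this]
    exact add_const_mem_iff_of_gradSigma hA _ _
  have hG : ∀ A : Set (HeightFn d k), MeasurableSet A →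
      Measurable fun x => η x {ψ | patch Λ x ψ ∈ A} := fun A hA =>
    Kernel.measurable_kernel_prodMk_left (measurable_patch Λ hA)
  refine ⟨fun φ => (η (X φ)).map fun ψ => patch Λ φ (ψ + fun _ => φ o),
    fun φ => Measure.isProbabilityMeasure_map (hin φ).aemeasurable, fun φ => ?_,
    fun A hA => ?_, fun A B hA hB => ?_⟩
  · refine (ae_map_iff (p := fun ψ => ∀ x, x ∉ Λ → ψ x = φ x) (hin φ).aemeasurable
      (measurableSet_eq_off Λ φ)).2 (ae_of_all _ fun ψ x hx => patch_of_notMem _ _ hx)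
  · simp only [hval A hA]
    exact (hG A (gradSigma_le A hA)).comp hXe
  · simp only [hval A hA]
    have hm := (hG A (gradSigma_le A hA)).comp hXe
    have hBg : MeasurableSet[gradSigma d k] B := hB.2
    refine (lintegral_lift_of_gradSigma μ (hm.mono inf_le_right le_rfl) hBg).symm.trans ?_
    obtain ⟨B', hB', rfl⟩ := exists_eq_preimage_clear_recenter (o := o) hB
    have hC : MeasurableSet {p : HeightFn d k × (Λ → k.E) | p.1 ∈ B' ∧ patch Λ p.1 p.2 ∈ A} :=
      (measurable_fst hB').inter (measurable_patch Λ (gradSigma_le A hA))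
    have hjoint : ((lift μ).map X) ⊗ₘ η = (lift μ).map fun φ => (X φ, relHeights Λ o φ) :=
      compProd_map_condDistrib hY.aemeasurable
    calc ∫⁻ φ in X ⁻¹' B', η (X φ) {ψ | patch Λ (X φ) ψ ∈ A} ∂(lift μ)
        = ∫⁻ x in B', η x {ψ | patch Λ x ψ ∈ A} ∂((lift μ).map X) :=
          (setLIntegral_map hB' (hG A (gradSigma_le A hA)) hX).symm
      _ = (((lift μ).map X) ⊗ₘ η) {p | p.1 ∈ B' ∧ patch Λ p.1 p.2 ∈ A} := by
          rw [Measure.compProd_apply hC, ← lintegral_indicator hB']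
          refine lintegral_congr fun x => ?_
          by_cases hx : x ∈ B'
          · rw [Set.indicator_of_mem hx]
            congr 1
            ext ψ
            simp [hx]
          · rw [Set.indicator_of_notMem hx]
            have : Prod.mk x ⁻¹' {p : HeightFn d k × (Λ → k.E) |
                p.1 ∈ B' ∧ patch Λ p.1 p.2 ∈ A} = ∅ := by ext ψ; simp [hx]
            rw [this, measure_empty]
      _ = μ (A ∩ X ⁻¹' B') := by
          rw [hjoint, Measure.map_apply (hX.prodMk hY) hC, ← lift_apply μ (hA.inter hBg)]
          congr 1
          ext φ
          have : patch Λ (X φ) (relHeights Λ o φ) = recenter o φ := by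
            funext x
            by_cases hx : x ∈ Λ
            · rw [patch_of_mem _ _ hx]; rfl
            · rw [patch_of_notMem _ _ hx, hX_def]
              exact clear_of_notMem _ hx
          have h2 : recenter o φ ∈ A ↔ φ ∈ A := by
            rw [recenter_eq_add]
            exact add_const_mem_iff_of_gradSigma hA _ _
          simp only [Set.mem_preimage, Set.mem_ofPred_eq, this, Set.mem_inter_iff, h2]
          exact and_comm

end LimitingMixtures

/-! ### Conclusion of the proof. -/

section MainTheorem

open ProbabilityTheory

variable {d : ℕ} {k : HeightKind} {L : AddSubgroup (Site d)} {Φ : Potential d k}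
  (I : Interaction L Φ)

/-- Every component of the mixture agrees with `φ` on the collar, so its law on `Λ` is dominated by
a fixed multiple of that for `φ`. This is the uniform domination that upgrades convergence on an
algebra to setwise convergence. -/
theorem Interaction.Collar.mixture_le (hd : 0 < d) {Λ W : Finset (Site d)}
    (hcol : I.Collar Λ W) {φ : HeightFn d k} (hφ : φ ∈ I.Good) {ν : Measure (HeightFn d k)}
    [IsProbabilityMeasure ν]
    (hν : ∀ᵐ φ' ∂ν, φ' ∈ I.Good ∧ ∀ x ∈ W, x ∉ Λ → φ' x = φ x) :
    (gibbs Λ (I.measurable_fullWeight Λ) ∘ₘ ν).map Λ.restrict ≤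
      ENNReal.ofReal (Real.exp (4 * I.extBound W)) •
        (gibbs Λ (I.measurable_fullWeight Λ) φ).map Λ.restrict := by
  have hR : Measurable (Λ.restrict : HeightFn d k → Λ → k.E) := Finset.measurable_restrict Λ
  refine Measure.le_iff.2 fun A hA => ?_
  rw [Measure.map_apply hR hA, Measure.bind_apply (hR hA) (Kernel.measurable _).aemeasurable]
  refine (lintegral_mono_ae (g := fun _ => (ENNReal.ofReal (Real.exp (4 * I.extBound W)) •
    (gibbs Λ (I.measurable_fullWeight Λ) φ).map Λ.restrict) A) ?_).trans (by simp)
  filter_upwards [hν] with φ' h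
  have hle := hcol.gibbsLaw_restrict_le I hd h.1 hφ h.2 A
  rwa [Measure.map_apply hR hA] at hle

theorem eq_map_patch_of_ae_eq_off {Λ : Finset (Site d)} {φ : HeightFn d k}
    {N : Measure (HeightFn d k)} (h : ∀ᵐ ψ ∂N, ∀ x ∉ Λ, ψ x = φ x) :
    (N.map Λ.restrict).map (patch Λ φ) = N := by
  rw [Measure.map_map (measurable_patch_right Λ φ) (Finset.measurable_restrict Λ)]
  have : patch Λ φ ∘ Λ.restrict =ᵐ[N] id := by
    filter_upwards [h] with ψ hψ using patch_restrict_of_eq_off hψ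
  rw [Measure.map_congr this, Measure.map_id]

include I

/-- Approximations by mixtures with error `2 ^ (-n)`, conditioned on increasing sets, converge
almost surely to the same limit as the conditional laws given these sets, namely `κ φ` by Lévy's
theorem. -/
theorem IsMinimizer.ae_exists_mem_limitingLocalGibbs {μ : Measure[gradSigma d k] (HeightFn d k)}
    (hμ : IsMinimizer L Φ μ) (hd : 0 < d) (hL : L.FiniteIndex) {Λ : Finset (Site d)}
    {κ : HeightFn d k → Measure (HeightFn d k)} (hκ : IsCondDistrib Λ μ κ) :
    ∀ᵐ φ ∂μ, ∃ ρ ∈ limitingLocalGibbs Φ Λ φ,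
      (ρ : Measure (Λ → k.E)) = (κ φ).map (fun ψ => Λ.restrict ψ) := by
  have hprob := hμ.isProbabilityMeasure_lift
  obtain ⟨o, ho⟩ := Interaction.exists_notMem hd Λ
  obtain ⟨s, _, hs⟩ := I.exists_collar_width hL
  have hcol : I.Collar Λ (thicken s Λ) := hs _ _ subset_rfl
  have hY := measurable_relHeights (k := k) Λ o
  have hR : Measurable (Λ.restrict : HeightFn d k → Λ → k.E) := Finset.measurable_restrict Λ
  have happ := fun (n : ℕ) (F : Finset (Site d)) =>
    hμ.exists_kernel_approximation I hd hL F ho (δ := (1 / 2) ^ n) (by positivity)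
  choose A hoA hAΛ hFA N hN hNp hNd using happ
  -- Each request includes the set returned before it and a growing neighbourhood of the origin, so
  -- the returned sets increase and exhaust the complement of `Λ`. The initial request is the collar
  -- of `Λ`.
  let T : ℕ → Finset (Site d) := fun n =>
    Nat.rec (thicken s Λ) (fun n F => A n F ∪ thicken (n + 1) {0}) n
  have hT : ∀ n, T (n + 1) = A n (T n) ∪ thicken (n + 1) {0} := fun n => rfl
  let S : ℕ → Finset (Site d) := fun n => A n (T n)
  let ν : ℕ → Kernel (HeightFn d k) (HeightFn d k) := fun n => N n (T n)
  have hνM : ∀ n, IsMarkovKernel (ν n) := fun n => hN n (T n)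
  have hTS : ∀ n, ∀ x ∈ T n, x ∉ Λ → x ∈ S n := fun n x hx hxΛ =>
    hFA n (T n) (Finset.mem_sdiff.2 ⟨hx, hxΛ⟩)
  have hSΛ : ∀ n, Disjoint (S n) Λ := fun n => hAΛ n (T n)
  have hmono : Monotone S := monotone_nat_of_le_succ fun n x hx =>
    hTS (n + 1) x (by rw [hT]; exact Finset.mem_union_left _ hx)
      (Finset.disjoint_left.1 (hSΛ n) hx)
  have hcov : ∀ x ∉ Λ, ∃ n, x ∈ S n := by
    intro x hx
    refine ⟨dist1 0 x + 1, hTS _ x ?_ hx⟩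
    rw [hT]
    refine Finset.mem_union_right _ (mem_thicken.2 ⟨0, Finset.mem_singleton_self 0, fun i => ?_⟩)
    have := abs_sub_le_dist1 0 x i
    push_cast
    linarith
  have hcolS : ∀ n, ∀ x ∈ thicken s Λ, x ∉ Λ → x ∈ S n := fun n x hx hxΛ =>
    hmono (Nat.zero_le n) (hTS 0 x hx hxΛ)
  set γ := gibbs Λ (I.measurable_fullWeight Λ) with hγ
  -- A countable algebra, so that one null set serves all its members.
  let 𝒜 := generateSetAlgebra (MeasurableSpace.countableGeneratingSet (Λ → k.E))
  have h𝒜 : IsSetAlgebra 𝒜 := isSetAlgebra_generateSetAlgebra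
  have hgen : (MeasurableSpace.pi : MeasurableSpace (Λ → k.E)) = MeasurableSpace.generateFrom 𝒜 := by
    rw [generateFrom_generateSetAlgebra_eq, MeasurableSpace.generateFrom_countableGeneratingSet]
  have hcount : 𝒜.Countable :=
    countable_generateSetAlgebra MeasurableSpace.countable_countableGeneratingSet
  have h𝒜m : ∀ D ∈ 𝒜, MeasurableSet D := fun D hD =>
    hgen ▸ MeasurableSpace.measurableSet_generateFrom hD
  have hlim : ∀ D : Set (Λ → k.E), MeasurableSet D → ∀ᵐ φ ∂(lift μ),
      Tendsto (fun n => ((γ ∘ₘ ν n (localize (S n) o φ)).map Λ.restrict).real D) atTop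
        (𝓝 (((κ φ).map (relHeights Λ o)).real D)) := by
    intro D hD
    have hm : ∀ n, Measurable fun φ =>
        (condDistrib (relHeights Λ o) (localize (S n) o) (lift μ) (localize (S n) o φ)).real D -
          ((γ ∘ₘ ν n (localize (S n) o φ)).map Λ.restrict).real D := by
      intro n
      have hr := measurable_localize (k := k) (S n) o
      have h2 : Measurable fun x => ((γ ∘ₖ ν n).map (Λ.restrict : HeightFn d k → Λ → k.E) x) D :=
        Kernel.measurable_coe _ hD
      simp only [Kernel.map_apply _ hR, Kernel.comp_apply] at h2
      exact ((Kernel.measurable_coe _ hD).comp hr).ennreal_toReal.sub (h2.comp hr).ennreal_toReal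
    filter_upwards [ae_tendsto_zero_of_lintegral_le hm fun n => hNd n (T n) D hD,
      hκ.ae_tendsto_condDistrib ho hSΛ (fun n => hoA n (T n)) hmono hcov hD] with φ h1 h2
    simpa using h2.sub h1
  have hall : ∀ᵐ φ ∂μ, φ ∈ I.Good ∧
      (∀ n, ∀ᵐ φ' ∂(ν n (localize (S n) o φ)), (∀ y ∈ S n, φ' y = φ y - φ o) ∧ φ' ∈ I.Good ∧
        patch Λ φ' (relHeights Λ o φ) ∈ I.Good) ∧
      ∀ D ∈ 𝒜, Tendsto (fun n => ((γ ∘ₘ ν n (localize (S n) o φ)).map Λ.restrict).real D) atTop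
        (𝓝 (((κ φ).map (relHeights Λ o)).real D)) := by
    refine ae_of_ae_lift (fun φ c => ?_) ?_
    · have h1 : ∀ n, localize (S n) o (φ + fun _ => c) = localize (S n) o φ := fun n =>
        isGrad_localize (S n) o φ c
      have h2 : relHeights Λ o (φ + fun _ => c) = relHeights Λ o φ := isGrad_relHeights Λ o φ c
      have h3 : ∀ D ∈ 𝒜, ((κ (φ + fun _ => c)).map (relHeights Λ o)).real D =
          ((κ φ).map (relHeights Λ o)).real D := fun D hD => by
        rw [measureReal_def, measureReal_def, Measure.map_apply hY (h𝒜m D hD),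
          Measure.map_apply hY (h𝒜m D hD),
          hκ.apply_add_const (measurableSet_relHeights Λ o (h𝒜m D hD))]
      simp only [I.add_const_mem_good, h1, h2, Pi.add_apply, add_sub_add_right_eq_sub]
      refine and_congr_right fun _ => and_congr_right fun _ => forall₂_congr fun D hD => ?_
      rw [h3 D hD]
    · filter_upwards [hμ.ae_good I hd hL, ae_all_iff.2 fun n => hNp n (T n),
        (ae_ball_iff hcount).2 fun D hD => hlim D (h𝒜m D hD)] with φ h1 h2 h3
      exact ⟨h1, h2, h3⟩
  filter_upwards [hall] with φ hφ
  have hκp := hκ.prob φ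
  have hYp : IsProbabilityMeasure ((κ φ).map (relHeights Λ o)) :=
    Measure.isProbabilityMeasure_map hY.aemeasurable
  have hmp : ∀ n, IsProbabilityMeasure ((γ ∘ₘ ν n (localize (S n) o φ)).map Λ.restrict) :=
    fun n => Measure.isProbabilityMeasure_map hR.aemeasurable
  refine I.exists_mem_limitingLocalGibbs hd ho (hκ.proper φ) hmono hcov hφ.2.1 fun D hD => ?_
  have hθp : IsProbabilityMeasure ((γ (recenter o φ)).map Λ.restrict) :=
    Measure.isProbabilityMeasure_map hR.aemeasurable
  have hθ : IsFiniteMeasure (ENNReal.ofReal (Real.exp (4 * I.extBound (thicken s Λ))) •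
      (γ (recenter o φ)).map Λ.restrict) := Measure.smul_finite _ ENNReal.ofReal_ne_top
  -- The dominating measure belongs to `recenter o φ`, not to `φ`, since the boundary conditions
  -- drawn from `ν n` vanish at `o`.
  refine tendsto_measureReal_of_isSetAlgebra h𝒜 hgen (θ :=
    ENNReal.ofReal (Real.exp (4 * I.extBound (thicken s Λ))) •
      (γ (recenter o φ)).map Λ.restrict) (fun n => ?_) hφ.2.2 hD
  refine hcol.mixture_le I hd ((I.recenter_mem_good o).2 hφ.1) ?_
  filter_upwards [hφ.2.1 n] with φ' h
  exact ⟨h.2.1, fun x hx hxΛ => h.1 x (hcolS n x hx hxΛ)⟩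

/-- At a point of quasilocality the conditional law and the local Gibbs measure have the same
restriction to `Λ`. Both are carried by functions equal to `φ` off `Λ`, so they coincide, and
integrating the conditional law over `μ` gives `μ`. -/
theorem IsMinimizer.isAlmostGibbs {μ : Measure[gradSigma d k] (HeightFn d k)}
    (hμ : IsMinimizer L Φ μ) (hd : 0 < d) (hL : L.FiniteIndex)
    (hq : ∀ᵐ φ ∂μ, IsPointOfQuasilocality Φ φ) : IsAlmostGibbs Φ μ := by
  refine ⟨hq, fun Λ A hA => ?_⟩
  obtain ⟨o, ho⟩ := Interaction.exists_notMem hd Λ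
  obtain ⟨κ, hκ⟩ := exists_isCondDistrib hμ.1.prob ho
  have h := hκ.cond A Set.univ hA (@MeasurableSet.univ _ (extGradSigma k Λ))
  rw [Set.inter_univ, Measure.restrict_univ] at h
  rw [← h]
  refine lintegral_congr_ae ?_
  filter_upwards [hq, hμ.ae_exists_mem_limitingLocalGibbs I hd hL hκ] with φ hφ hρ
  obtain ⟨ρ, hρ, hρκ⟩ := hρ
  have hmem : (ρ : Measure (Λ → k.E)) ∈ (fun ρ : ProbabilityMeasure (Λ → k.E) =>
      (ρ : Measure (Λ → k.E))) '' limitingLocalGibbs Φ Λ φ := ⟨ρ, hρ, rfl⟩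
  rw [hφ.2 Λ, Set.mem_singleton_iff, hρκ] at hmem
  have hoff : ∀ᵐ ψ ∂(localGibbs Φ Λ φ), ∀ x ∉ Λ, ψ x = φ x := by
    rw [I.localGibbs_eq_of_good hd (I.good_of_admissible hφ.1), gibbs_apply]
    exact ae_gibbsLaw_eq_off Λ _ φ
  rw [← eq_map_patch_of_ae_eq_off hoff, ← eq_map_patch_of_ae_eq_off (hκ.proper φ)]
  exact congrArg (fun N => (Measure.map (patch Λ φ) N) A) hmem

end MainTheorem

theorem theorem4p3 (d : ℕ) (hd : 2 ≤ d) (k : HeightKind)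
    (L : AddSubgroup (Site d)) (hL : L.FiniteIndex)
    (Φ : Potential d k) (hΦ : IsStrongPlusWeak L Φ)
    (μ : Measure[gradSigma d k] (HeightFn d k)) (hμ : IsMinimizer L Φ μ) :
    (∀ Λ : Finset (Site d),
      (∃ κ : HeightFn d k → Measure (HeightFn d k), IsCondDistrib Λ μ κ) ∧
      ∀ κ : HeightFn d k → Measure (HeightFn d k), IsCondDistrib Λ μ κ →
        ∀ᵐ φ ∂μ, ∃ ρ ∈ limitingLocalGibbs Φ Λ φ,
          (ρ : Measure (Λ → k.E)) = (κ φ).map (fun ψ => Λ.restrict ψ)) ∧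
    ((∀ᵐ φ ∂μ, IsPointOfQuasilocality Φ φ) → IsAlmostGibbs Φ μ) ∧
    (IsQuasilocal Φ → IsGibbs Φ μ) := by
  obtain ⟨I⟩ := hΦ.nonempty_interaction
  have hd' : 0 < d := by omega
  refine ⟨fun Λ => ⟨?_, fun κ hκ => hμ.ae_exists_mem_limitingLocalGibbs I hd' hL hκ⟩,
    hμ.isAlmostGibbs I hd' hL, fun hq => ⟨hq, hμ.isAlmostGibbs I hd' hL ?_⟩⟩
  · obtain ⟨o, ho⟩ := Interaction.exists_notMem hd' Λ
    exact exists_isCondDistrib hμ.1.prob ho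
  -- Quasilocality speaks of admissible height functions only, and almost every height function is
  -- admissible under a minimizer.
  · have hgood : ∀ᵐ φ ∂μ, φ ∈ I.Good :=
      ae_of_ae_lift (fun φ c => I.add_const_mem_good φ c) (hμ.ae_good I hd' hL)
    filter_upwards [hgood] with φ hφ using hq φ (I.admissible_of_good hd' hφ)
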